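/- **Definitions.** Let $(\Omega,\mu)$ be $[0,1]$ or $[0,\infty)$ with Lebesgue measure, or $\mathbb N=\{1,2,3,\dots\}$ with counting measure, and let $L_0(\mu)$ be the space of real measurable functions on $\Omega$ modulo a.e. equality, with convergence in measure on sets of finite measure. A *Köthe function space* on $\Omega$ is a Banach space $X\subset L_0(\mu)$ that contains $\chi_B$ whenever $\mu(B)<\infty$, such that $\|f\|_X\le\|g\|_X$ whenever $|f|\le|g|$ a.e., and whose unit ball $\{f:\|f\|_X\le 1\}$ is closed in $L_0(\mu)$ (the Fatou property); put $\|f\|_X=\infty$ for $f\notin X$. It is *rearrangement-invariant* (r.i.; a *symmetric sequence space* if $\Omega=\mathbb N$) if $\|f\|_X=\|g\|_X$ whenever $|f|$ and $|g|$ have the same distribution function. For Köthe function spaces $X,Y$ on $\Omega$, $f\in X+Y$ and $t>0$ let $K(t,f)=\inf\{\|x\|_X+t\|y\|_Y: x+y=f\}$. The pair $(X,Y)$ is a *Calderón couple* if for all $f,g\in X+Y$ with $K(t,f)\le K(t,g)$ for all $t>0$ there is a linear operator $T:X+Y\to X+Y$ with $Tg=f$, $\|T\|_X=\sup\{\|Th\|_X:\|h\|_X\le1\}<\infty$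 and $\|T\|_Y<\infty$. It is a *uniform Calderón couple* if there is a constant $C$, independent of $f,g$, such that $T$ can always be chosen with $\max(\|T\|_X,\|T\|_Y)\le C$. Let $J$ be $\{n\in\mathbb Z:n<0\}$, $\mathbb Z$ or $\{n\in\mathbb Z:n\ge0\}$ when $\Omega$ is $[0,1]$, $[0,\infty)$ or $\mathbb N$ respectively, and let $e_n=\chi_{[2^n,2^{n+1})}$ for $n\in J$. For an r.i. space $X$ on $\Omega$ let $E_X$ be the space of sequences on $J$ with norm $\|\xi\|_{E_X}=\|\sum_{n\in J}\xi(n)e_n\|_X$. The space $X$ is *stretchable* if $E=E_X$ has the *right-shift property*: there is a constant $C$ such that, whenever $I$ is an interval of $\mathbb Z$ and $(x_n)_{n\in I}$, $(y_n)_{n\in I}$ are finitely supported sequences on $J$ with $\|y_n\|_E\le\|x_n\|_E=1$ for all $n\in I$, $\operatorname{supp}x_n<\operatorname{supp}y_n$ for all $n\in I$, and $\operatorname{supp}x_m\cup\operatorname{supp}y_m<\operatorname{supp}x_n\cup\operatorname{supp}y_n$ for all $m<n$ in $I$, we have $$\Big\|\sum_{n\in I}\alpha_ny_n\Big\|_E\le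 C\,\Big\|\sum_{n\in I}\alpha_nx_n\Big\|_E$$ for every finitely nonzero family of real scalars $(\alpha_n)_{n\in I}$. (Here $A<B$ means $a<b$ for all $a\in A$, $b\in B$.) **Theorem 5.4.** (1) Let $X$ be an r.i. space on $[0,1]$ or on $[0,\infty)$. Then $(X,L_\infty)$ is a Calderón couple if and only if $X$ is stretchable, and $(X,L_\infty)$ is a uniform Calderón couple if and only if $X$ is stretchable. (2) Let $X$ be a symmetric sequence space. Then $(\ell_\infty,X)$ is a Calderón couple if and only if $X$ is stretchable, and $(\ell_\infty,X)$ is a uniform Calderón couple if and only if $X$ is stretchable. -/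

import Mathlib

open MeasureTheory Filter Topology Set
open scoped ENNReal NNReal

noncomputable section

namespace CalderonCouples

/-! ### Köthe function spaces -/

/-- A (real) Köthe function space over `(Ω, μ)`. It is given by its norm, extended to the space
`L₀(μ) = (Ω →ₘ[μ] ℝ)` of classes of measurable functions by the value `∞` off the space, so that
the space is `{f | nrm f < ∞}`. -/
structure KotheSpace {Ω : Type*} [MeasurableSpace Ω] (μ : Measure Ω) where
  /-- the norm, with value `∞` outside the space -/
  nrm : (Ω →ₘ[μ] ℝ) → ℝ≥0∞
  /-- definiteness -/
  nrm_eq_zero_iff : ∀ f, nrm f = 0 ↔ f = 0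
  /-- homogeneity -/
  nrm_smul : ∀ (c : ℝ) (f : Ω →ₘ[μ] ℝ), nrm (c • f) = ENNReal.ofReal |c| * nrm f
  /-- the triangle inequality -/
  nrm_add_le : ∀ f g, nrm (f + g) ≤ nrm f + nrm g
  /-- completeness: a norm-Cauchy sequence of the space converges in norm to a member of it -/
  complete : ∀ f : ℕ → (Ω →ₘ[μ] ℝ), (∀ n, nrm (f n) < ∞) →
    (∀ ε : ℝ≥0∞, 0 < ε → ∃ N, ∀ m n, N ≤ m → N ≤ n → nrm (f m - f n) < ε) →
    ∃ g, nrm g < ∞ ∧ Tendsto (fun n => nrm (f n - g)) atTop (𝓝 0)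
  /-- characteristic functions of sets of finite measure belong to the space -/
  nrm_indicator_lt_top : ∀ (B : Set Ω) (hB : MeasurableSet B), μ B < ∞ →
    nrm (AEEqFun.mk (B.indicator fun _ => (1 : ℝ)) (aestronglyMeasurable_const.indicator hB)) < ∞
  /-- the norm is a lattice norm -/
  nrm_mono : ∀ f g : Ω →ₘ[μ] ℝ, (∀ᵐ s ∂μ, |f s| ≤ |g s|) → nrm f ≤ nrm g
  /-- the Fatou property: the unit ball is closed in `L₀(μ)`, for convergence in measure on sets
  of finite measure -/
  fatou : ∀ (f : ℕ → (Ω →ₘ[μ] ℝ)) (g : Ω →ₘ[μ] ℝ), (∀ n, nrm (f n) ≤ 1) →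
    (∀ B, MeasurableSet B → μ B < ∞ →
      TendstoInMeasure (μ.restrict B) (fun n s => f n s) atTop (fun s => g s)) →
    nrm g ≤ 1

variable {Ω : Type*} [MeasurableSpace Ω] {μ : Measure Ω}

/-- The underlying vector space of a Köthe function space. -/
def KotheSpace.carrier (X : KotheSpace μ) : Submodule ℝ (Ω →ₘ[μ] ℝ) where
  carrier := {f | X.nrm f < ∞}
  add_mem' := fun hf hg => (X.nrm_add_le _ _).trans_lt (ENNReal.add_lt_top.2 ⟨hf, hg⟩)
  zero_mem' := by simp [(X.nrm_eq_zero_iff 0).2 rfl]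
  smul_mem' := fun c f hf => by
    simp only [Set.mem_ofPred_eq, X.nrm_smul]
    exact ENNReal.mul_lt_top ENNReal.ofReal_lt_top hf

/-- `X` is rearrangement-invariant (symmetric, for counting measure): functions whose absolute
values have the same distribution, i.e. with the same decreasing rearrangement, have the same
norm. -/
def KotheSpace.IsRearrangementInvariant (X : KotheSpace μ) : Prop :=
  ∀ f g : Ω →ₘ[μ] ℝ, (∀ r : ℝ, 0 ≤ r → μ {s | r < |f s|} = μ {s | r < |g s|}) → X.nrm f = X.nrm g

/-- The space `L_∞(μ)` with the essential supremum norm; it is `ℓ_∞` for counting measure. -/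
def linfty (μ : Measure Ω) [SigmaFinite μ] : KotheSpace μ where
  nrm f := eLpNorm f ∞ μ
  nrm_eq_zero_iff f := by
    rw [eLpNorm_eq_zero_iff f.aestronglyMeasurable (by simp)]
    constructor
    · intro h
      exact AEEqFun.ext (h.trans AEEqFun.coeFn_zero.symm)
    · rintro rfl
      exact AEEqFun.coeFn_zero
  nrm_smul c f := by
    rw [eLpNorm_congr_ae (AEEqFun.coeFn_smul c f), eLpNorm_const_smul, Real.enorm_eq_ofReal_abs]
  nrm_add_le f g := by
    rw [eLpNorm_congr_ae (AEEqFun.coeFn_add f g)]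
    exact eLpNorm_add_le f.aestronglyMeasurable g.aestronglyMeasurable le_top
  complete f hf hc := by
    have hpos : ∀ k : ℕ, (0 : ℝ≥0∞) < (2⁻¹ : ℝ≥0∞) ^ k := fun k => ENNReal.pow_pos (by simp) k
    choose N hN using fun k : ℕ => hc _ (hpos k)
    -- a subsequence that is Cauchy at a summable rate
    let M : ℕ → ℕ := fun k => ∑ j ∈ Finset.range (k + 1), N j
    have hMN : ∀ k n, k ≤ n → N k ≤ M n := fun k n hkn =>
      Finset.single_le_sum (f := N) (fun _ _ => Nat.zero_le _)
        (Finset.mem_range.2 (Nat.lt_succ_of_le hkn))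
    obtain ⟨g, hg, hlim⟩ := Lp.cauchy_complete_eLpNorm (p := ∞) (μ := μ) le_top
      (f := fun k => (f (M k) : Ω → ℝ)) (fun k => ⟨(f (M k)).aestronglyMeasurable, hf _⟩)
      (B := fun k => (2⁻¹ : ℝ≥0∞) ^ k)
      (by rw [ENNReal.tsum_geometric]; simp)
      (fun k n m hn hm => by
        rw [← eLpNorm_congr_ae (AEEqFun.coeFn_sub (f (M n)) (f (M m)))]
        exact hN k _ _ (hMN k n hn) (hMN k m hm))
    let G : Ω →ₘ[μ] ℝ := AEEqFun.mk g hg.1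
    have hG : (G : Ω → ℝ) =ᵐ[μ] g := AEEqFun.coeFn_mk g hg.1
    have hsub : ∀ n, eLpNorm ((f n - G : Ω →ₘ[μ] ℝ) : Ω → ℝ) ∞ μ = eLpNorm ((f n : Ω → ℝ) - g) ∞ μ := fun n =>
      eLpNorm_congr_ae ((AEEqFun.coeFn_sub (f n) G).trans ((EventuallyEq.refl _ _).sub hG))
    refine ⟨G, by rw [eLpNorm_congr_ae hG]; exact hg.2, ?_⟩
    rw [ENNReal.tendsto_atTop_zero]
    intro ε hε
    rw [ENNReal.tendsto_atTop_zero] at hlim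
    have hε2 : 0 < ε / 2 := ENNReal.half_pos hε.ne'
    obtain ⟨K, hK⟩ := hlim (ε / 2) hε2
    obtain ⟨L, hL⟩ := hc (ε / 2) hε2
    obtain ⟨k, hk⟩ : ∃ k : ℕ, (2⁻¹ : ℝ≥0∞) ^ k < ε / 2 :=
      ENNReal.exists_inv_two_pow_lt hε2.ne'
    refine ⟨N k, fun n hn => ?_⟩
    rw [hsub]
    have h1 := hN k n (M (max K k)) hn (hMN k _ (le_max_right _ _))
    have h2 := hK (max K k) (le_max_left _ _)
    rw [eLpNorm_congr_ae (AEEqFun.coeFn_sub (f n) (f (M (max K k))))] at h1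
    have h3 : (f n : Ω → ℝ) - g =
        ((f n : Ω → ℝ) - f (M (max K k))) + ((f (M (max K k)) : Ω → ℝ) - g) := by
      ext s; simp
    rw [h3]
    refine (eLpNorm_add_le ((f n).aestronglyMeasurable.sub (f _).aestronglyMeasurable)
      ((f _).aestronglyMeasurable.sub hg.1) le_top).trans ?_
    calc _ ≤ ε / 2 + ε / 2 := add_le_add (h1.le.trans hk.le) h2
      _ = ε := ENNReal.add_halves ε
  nrm_indicator_lt_top B hB _ := by
    rw [eLpNorm_congr_ae (AEEqFun.coeFn_mk _ _)]
    refine lt_of_le_of_lt (eLpNorm_mono (g := fun _ => (1 : ℝ)) fun s => ?_)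
      (memLp_top_const (1 : ℝ)).2
    by_cases hs : s ∈ B <;> simp [hs]
  nrm_mono f g h := by
    refine eLpNorm_mono_ae ?_
    filter_upwards [h] with s hs
    simpa using hs
  fatou f g hf hlim := by
    have key : ∀ n, ∀ᵐ s ∂μ, ‖f n s‖ₑ ≤ 1 := fun n => by
      filter_upwards [ae_le_eLpNormEssSup (f := fun s => f n s) (μ := μ)] with s hs
      exact hs.trans (by simpa [eLpNorm_exponent_top] using hf n)
    rw [eLpNorm_exponent_top]
    refine eLpNormEssSup_le_of_ae_enorm_bound ?_
    refine ae_of_forall_measure_lt_top_ae_restrict _ fun B hB hμB => ?_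
    obtain ⟨ns, -, hns⟩ := (hlim B hB hμB).exists_seq_tendsto_ae
    filter_upwards [hns, ae_restrict_of_ae (ae_all_iff.2 key)] with s hs hb
    exact le_of_tendsto hs.enorm (Eventually.of_forall fun i => hb (ns i))

/-! ### Calderón couples -/

/-- The space `X + Y`. -/
abbrev sumSpace (X Y : KotheSpace μ) : Submodule ℝ (Ω →ₘ[μ] ℝ) := X.carrier ⊔ Y.carrier

/-- Peetre's functional `K(t, f; X, Y) = inf {‖x‖_X + t ‖y‖_Y : x + y = f}`. -/
def kFunctional (X Y : KotheSpace μ) (t : ℝ≥0) (f : Ω →ₘ[μ] ℝ) : ℝ≥0∞ :=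
  ⨅ (x : Ω →ₘ[μ] ℝ) (y : Ω →ₘ[μ] ℝ) (_ : x + y = f), X.nrm x + t * Y.nrm y

/-- `‖T‖_X = sup {‖T f‖_X : ‖f‖_X ≤ 1}`, for an operator `T` on a vector space `V` of functions
(in use, one that contains `X`). -/
def opNorm (X : KotheSpace μ) {V : Submodule ℝ (Ω →ₘ[μ] ℝ)} (T : V →ₗ[ℝ] V) : ℝ≥0∞ :=
  ⨆ (f : V) (_ : X.nrm (f : Ω →ₘ[μ] ℝ) ≤ 1), X.nrm (T f : Ω →ₘ[μ] ℝ)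

/-- `(X, Y)` is a Calderón couple. -/
def IsCalderonCouple (X Y : KotheSpace μ) : Prop :=
  ∀ f g : sumSpace X Y,
    (∀ t : ℝ≥0, 0 < t → kFunctional X Y t (f : Ω →ₘ[μ] ℝ) ≤ kFunctional X Y t (g : Ω →ₘ[μ] ℝ)) →
    ∃ T : sumSpace X Y →ₗ[ℝ] sumSpace X Y, opNorm X T < ∞ ∧ opNorm Y T < ∞ ∧ T g = f

/-- `(X, Y)` is a uniform Calderón couple: the norms of the operators have a common bound. -/
def IsUniformCalderonCouple (X Y : KotheSpace μ) : Prop :=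
  ∃ C : ℝ≥0, ∀ f g : sumSpace X Y,
    (∀ t : ℝ≥0, 0 < t → kFunctional X Y t (f : Ω →ₘ[μ] ℝ) ≤ kFunctional X Y t (g : Ω →ₘ[μ] ℝ)) →
    ∃ T : sumSpace X Y →ₗ[ℝ] sumSpace X Y, opNorm X T ≤ C ∧ opNorm Y T ≤ C ∧ T g = f

/-! ### The right-shift property -/

/-- `A < B` for sets of indices: each element of `A` is smaller than each element of `B`. -/
def SetLT {J : Type*} [LT J] (A B : Set J) : Prop := ∀ a ∈ A, ∀ b ∈ B, a < b

/-- The pair of sequences `(xₙ, yₙ)`, `n ∈ I`, of finitely supported vectors is interlaced: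
`supp xₘ < supp yₘ < supp xₙ < supp yₙ` for `m < n`. All pairs `m < n` are compared, and not only
consecutive ones, because some `yₙ` may be zero, and `<` is not transitive through `∅`. -/
structure IsInterlaced {J : Type*} [LinearOrder J] (I : Set ℤ) (x y : ℤ → J → ℝ) : Prop where
  finite_left : ∀ n ∈ I, (Function.support (x n)).Finite
  finite_right : ∀ n ∈ I, (Function.support (y n)).Finite
  lt : ∀ n ∈ I, SetLT (Function.support (x n)) (Function.support (y n))
  lt_of_lt : ∀ m ∈ I, ∀ n ∈ I, m < n →
    SetLT (Function.support (x m) ∪ Function.support (y m))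
      (Function.support (x n) ∪ Function.support (y n))

/-- The right-shift property (RSP) of a norm `E` (with value `∞` off the space) on sequences
indexed by `J`; `I` runs over the intervals of `ℤ`. -/
def HasRSP {J : Type*} [LinearOrder J] (E : (J → ℝ) → ℝ≥0∞) : Prop :=
  ∃ C : ℝ≥0, ∀ (I : Set ℤ) (x y : ℤ → J → ℝ), I.OrdConnected → IsInterlaced I x y →
    (∀ n ∈ I, E (x n) = 1 ∧ E (y n) ≤ 1) →
    ∀ α : ℤ →₀ ℝ, (α.support : Set ℤ) ⊆ I →
      E (∑ n ∈ α.support, α n • y n) ≤ C * E (∑ n ∈ α.support, α n • x n)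

/-! ### The dyadic sequence space of a space -/

/-- The dyadic block `[2ᵏ, 2ᵏ⁺¹)`, pulled back to `Ω` along a position function `c : Ω → ℝ`. -/
def dyadicBlock {Ω : Type*} (c : Ω → ℝ) (k : ℤ) : Set Ω := c ⁻¹' Ico ((2 : ℝ) ^ k) ((2 : ℝ) ^ (k + 1))

/-- The function `∑ₖ ξ(k) eₖ` on `Ω`, where `eₖ` is the characteristic function of the `k`-th
dyadic block; at each point at most one term is not zero. -/
def dyadicStep {Ω : Type*} (c : Ω → ℝ) {J : Set ℤ} (ξ : J → ℝ) : Ω → ℝ :=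
  fun s => ∑' k : J, (dyadicBlock c k).indicator (fun _ => ξ k) s

theorem dyadicBlock_unique {Ω : Type*} (c : Ω → ℝ) {k l : ℤ} {s : Ω} (hk : s ∈ dyadicBlock c k)
    (hl : s ∈ dyadicBlock c l) : k = l := by
  have h1 : (2 : ℝ) ^ k < (2 : ℝ) ^ (l + 1) := hk.1.trans_lt hl.2
  have h2 : (2 : ℝ) ^ l < (2 : ℝ) ^ (k + 1) := hl.1.trans_lt hk.2
  rw [zpow_lt_zpow_iff_right₀ one_lt_two] at h1 h2
  omega

theorem measurable_dyadicStep (c : Ω → ℝ) (hc : Measurable c) {J : Set ℤ} (ξ : J → ℝ) :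
    Measurable (dyadicStep c ξ) := by
  refine measurable_of_tendsto_metrizable' (atTop : Filter (Finset J))
    (f := fun (F : Finset J) s => ∑ k ∈ F, (dyadicBlock c k).indicator (fun _ => ξ k) s)
    (fun F => ?_) ?_
  · exact Finset.measurable_fun_sum F fun k _ =>
      measurable_const.indicator (hc measurableSet_Ico)
  · refine tendsto_pi_nhds.2 fun s => ?_
    have hfin : (fun k : J => (dyadicBlock c k).indicator (fun _ => ξ k) s).support.Finite := by
      refine Set.Subsingleton.finite fun k hk l hl => ?_
      exact Subtype.ext (dyadicBlock_unique c (mem_of_indicator_ne_zero hk)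
        (mem_of_indicator_ne_zero hl))
    have hsum : HasSum (fun k : J => (dyadicBlock c k).indicator (fun _ => ξ k) s)
        (dyadicStep c ξ s) := (summable_of_hasFiniteSupport hfin).hasSum
    exact hsum

/-- The norm of the sequence space `E_X` on `J`: `‖ξ‖_{E_X} = ‖∑ₖ ξ(k) eₖ‖_X`. -/
def dyadicNorm (X : KotheSpace μ) (c : Ω → ℝ) (hc : Measurable c) (J : Set ℤ) (ξ : J → ℝ) : ℝ≥0∞ :=
  X.nrm (AEEqFun.mk (dyadicStep c ξ) (measurable_dyadicStep c hc ξ).aestronglyMeasurable)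

/-! ### The three underlying measure spaces -/

/-- Lebesgue measure on `[0, 1]`. -/
abbrev unitMeasure : Measure ℝ := volume.restrict (Icc 0 1)

/-- Lebesgue measure on `[0, ∞)`. -/
abbrev halfLineMeasure : Measure ℝ := volume.restrict (Ici 0)

/-- Counting measure on the positions of a sequence. The position of the entry with index
`i : ℕ` is `i + 1`, so that the positions are `1, 2, 3, …`. -/
abbrev seqMeasure : Measure ℕ := Measure.count

/-- A space on `[0, 1]` is stretchable if `E_X`, a sequence space on the negative integers, has the
right-shift property. -/
def StretchableUnit (X : KotheSpace unitMeasure) : Prop :=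
  HasRSP (dyadicNorm X id measurable_id (Iio 0))

/-- A space on `[0, ∞)` is stretchable if `E_X`, a sequence space on `ℤ`, has the right-shift
property. -/
def StretchableHalfLine (X : KotheSpace halfLineMeasure) : Prop :=
  HasRSP (dyadicNorm X id measurable_id univ)

/-- A sequence space is stretchable if `E_X`, a sequence space on the nonnegative integers, has the
right-shift property. -/
def StretchableSeq (X : KotheSpace seqMeasure) : Prop :=
  HasRSP (dyadicNorm X (fun i => (i : ℝ) + 1) (measurable_of_countable _) (Ici 0))

end CalderonCouples

end

open CalderonCouples

noncomputable section

namespace CalderonCouples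

/-! ### The norm of a function -/

section FunctionNorm

variable {Ω : Type*} [MeasurableSpace Ω] {μ : Measure Ω} (X : KotheSpace μ)

/-! The three measure spaces enter only through `DyadicModel`: an integer-valued function `κ`
divides the space into blocks of measure `2 ^ k`, `k ∈ J`, and there are enough subsets of
prescribed measure and enough equipartitions. Rearrangement invariance then gives two tools. A step
function may be moved to other disjoint sets of comparable measure at the cost of a factor 2
(`N_step_le_two`), and averaging over disjoint sets does not increase the norm (`N_step_avg_le`).
Below, `E` is the sequence space with norm `X.NE κ`, and `e_n`, `T_n` are the norms of the
characteristic functions of the `n`-th block and of all blocks up to `n`; one has `T_n ≤ 2 e_n`.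

The functional `K(T_n, f)` is equivalent to the norm in `E` of the sequence of levels `f^*(2 ^ k)`,
`k ≤ n` (`NE_level_le`, `kFunctional_le_NE`). Domination of `f` by `g` in the sense of the
`K`-functional therefore says that the initial segments of the levels `b` of `f` are dominated, up
to the factor 16, by those of the levels `a` of `g`.

Sufficiency. Cut `J` into consecutive blocks such that the norm of `a` up to any index of a block is
controlled by its norm on the preceding block (`exists_division`). The Hahn-Banach theorem gives
functionals `c_j` with `c_j(g) = 1`, controlled by averages of `|h|` over sets that belong to the
preceding block (`exists_coef`). The operator that multiplies the part of `f` with levels in block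
`j` by `c_j(h)` sends `g` to that part of `f`. Its boundedness on `L_∞` is direct. On `X`, each
piece is dominated by a piece of the averages of `h` that lies to its left, and the right-shift
property, applied to even and to odd `j` separately, adds up these estimates (`reaches_levelSets`).
What remains of `f`, below all its levels, is reached by a rank one operator built on the limit of
`K(t, h) / t` (`reaches_levelRest`).

Necessity. It is enough to treat chains, that is pairs `x_i`, `y_i` in widely separated intervals
(`rightShift_of_chain`). Choose coefficients `c_i` along a chain so that, seen from the interval of
`i`, earlier terms are negligible in `X` and later ones in `L_∞`, by a factor `1 / Λ_i`
(`IsChain.exists_coefs`). Then the `K`-functional of the glued sequence of the `c_i x_i / ‖x_i‖`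
dominates that of the `c_i y_i / (6 ‖x_i‖)` (`kFunctional_glue_le`), and the Calderón property gives
an operator `S` between them. On the interval of `i`, `6 S x_i` equals `y_i` up to an error of
relative size `1 / Λ_i`. The restrictions of the `S x_i` form the diagonal of a matrix; averaging
over signs bounds their sum by `‖S‖ ‖∑ x_i‖` (`IsChain.exists_remainder`).

The errors are small one by one, but their sum has to be controlled too. If the right-shift property
fails, there are finite chains with gaps measured by `k + 2` on which it fails for the constant `k`,
with `y` optimal up to a factor 2. Placed outside each other's range, they form one infinite chain,
and a single operator, with constant `C`, serves all of them. For `k ≥ 4 C` the errors multiplied by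
4 compete with the `y_i`, so the norm of their sum is at most half of `‖∑ y_i‖`; absorbing it gives
`‖∑ y_i‖ ≤ 2 C ‖∑ x_i‖`, a contradiction. No uniformity of the couple is used here, while the
sufficiency part gives a uniform bound; hence both equivalences. -/

open Classical in
/-- The norm of a function, with value `∞` for functions that are not measurable. -/
def KotheSpace.N (u : Ω → ℝ) : ℝ≥0∞ :=
  if h : AEStronglyMeasurable u μ then X.nrm (AEEqFun.mk u h) else ∞

variable {X}

theorem N_mk {u : Ω → ℝ} (h : AEStronglyMeasurable u μ) : X.N u = X.nrm (AEEqFun.mk u h) := by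
  simp [KotheSpace.N, h]

theorem N_coe (f : Ω →ₘ[μ] ℝ) : X.N f = X.nrm f := by
  rw [N_mk f.aestronglyMeasurable, AEEqFun.mk_coeFn]

theorem aesm_of_N_lt_top {u : Ω → ℝ} (h : X.N u < ∞) : AEStronglyMeasurable u μ := by
  by_contra h'
  simp [KotheSpace.N, h'] at h

theorem N_mono {u v : Ω → ℝ} (hu : AEStronglyMeasurable u μ) (h : ∀ᵐ s ∂μ, |u s| ≤ |v s|) :
    X.N u ≤ X.N v := by
  by_cases hv : AEStronglyMeasurable v μ
  · rw [N_mk hu, N_mk hv]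
    refine X.nrm_mono _ _ ?_
    filter_upwards [h, AEEqFun.coeFn_mk u hu, AEEqFun.coeFn_mk v hv] with s h1 h2 h3
    rwa [h2, h3]
  · simp [KotheSpace.N, hv]

theorem N_congr {u v : Ω → ℝ} (h : u =ᵐ[μ] v) : X.N u = X.N v := by
  by_cases hu : AEStronglyMeasurable u μ
  · have hv := hu.congr h
    rw [N_mk hu, N_mk hv, AEEqFun.mk_eq_mk.2 h]
  · have hv : ¬ AEStronglyMeasurable v μ := fun hv => hu (hv.congr h.symm)
    simp [KotheSpace.N, hu, hv]

theorem N_zero : X.N (fun _ => 0) = 0 := by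
  rw [N_mk aestronglyMeasurable_const]
  exact (X.nrm_eq_zero_iff _).2 rfl

theorem N_eq_zero {u : Ω → ℝ} (h : X.N u = 0) : u =ᵐ[μ] 0 := by
  have hu : AEStronglyMeasurable u μ := aesm_of_N_lt_top (X := X) (by simp [h])
  rw [N_mk hu, X.nrm_eq_zero_iff] at h
  exact AEEqFun.mk_eq_mk.1 (h.trans AEEqFun.zero_def)

theorem N_add_le (u v : Ω → ℝ) : X.N (fun s => u s + v s) ≤ X.N u + X.N v := by
  by_cases hu : AEStronglyMeasurable u μ
  · by_cases hv : AEStronglyMeasurable v μ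
    · rw [N_mk hu, N_mk hv, N_mk (u := fun s => u s + v s) (hu.add hv)]
      exact X.nrm_add_le _ _
    · simp [KotheSpace.N, hv]
  · simp [KotheSpace.N, hu]

theorem N_const_mul {u : Ω → ℝ} (hu : AEStronglyMeasurable u μ) (c : ℝ) :
    X.N (fun s => c * u s) = ENNReal.ofReal |c| * X.N u := by
  rw [N_mk hu, N_mk (hu.const_mul c), ← X.nrm_smul]
  rfl

theorem N_sum_le {ι : Type*} (F : Finset ι) (u : ι → Ω → ℝ) :
    X.N (fun s => ∑ i ∈ F, u i s) ≤ ∑ i ∈ F, X.N (u i) := by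
  classical
  induction F using Finset.induction_on with
  | empty => simp [N_zero]
  | insert a F ha ih =>
    simp only [Finset.sum_insert ha]
    exact (N_add_le _ _).trans (by gcongr)

theorem N_abs {u : Ω → ℝ} (hu : AEStronglyMeasurable u μ) : X.N (fun s => |u s|) = X.N u :=
  le_antisymm (N_mono (by simpa using hu.norm) (by simp)) (N_mono hu (by simp))

/-- The axiom concerns only the unit ball and convergence in measure. Scaling by a real `E > C`
reduces to the unit ball, also when `C` is 0, and convergence almost everywhere gives convergence in
measure on sets of finite measure. -/
theorem N_fatou {u : ℕ → Ω → ℝ} {v : Ω → ℝ} {C : ℝ≥0∞} (hu : ∀ n, Measurable (u n))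
    (hv : Measurable v) (hC : ∀ n, X.N (u n) ≤ C)
    (hlim : ∀ᵐ s ∂μ, Tendsto (fun n => u n s) atTop (𝓝 (v s))) : X.N v ≤ C := by
  refine le_of_forall_gt fun D hD => ?_
  obtain ⟨E, hE, hED⟩ := ENNReal.lt_iff_exists_nnreal_btwn.1 hD
  refine lt_of_le_of_lt ?_ hED
  have hE0 : (0 : ℝ) < E := by
    have : (0 : ℝ≥0∞) < E := (zero_le).trans_lt hE
    exact_mod_cast this
  have huE : ∀ n, AEStronglyMeasurable (fun s => (E : ℝ)⁻¹ * u n s) μ := fun n =>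
    ((hu n).const_mul _).aestronglyMeasurable
  have hvE : AEStronglyMeasurable (fun s => (E : ℝ)⁻¹ * v s) μ :=
    (hv.const_mul _).aestronglyMeasurable
  have hofE : ENNReal.ofReal |(E : ℝ)⁻¹| = (E : ℝ≥0∞)⁻¹ := by
    rw [abs_of_pos (inv_pos.2 hE0), ENNReal.ofReal_inv_of_pos hE0, ENNReal.ofReal_coe_nnreal]
  have hE0' : (E : ℝ≥0∞) ≠ 0 := by
    have : (E : ℝ) ≠ 0 := hE0.ne'
    exact_mod_cast this
  have key := X.fatou (fun n => AEEqFun.mk _ (huE n)) (AEEqFun.mk _ hvE) (fun n => by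
    rw [← N_mk, N_const_mul (hu n).aestronglyMeasurable, hofE]
    calc (E : ℝ≥0∞)⁻¹ * X.N (u n) ≤ (E : ℝ≥0∞)⁻¹ * E := by
          gcongr; exact (hC n).trans hE.le
      _ = 1 := ENNReal.inv_mul_cancel hE0' ENNReal.coe_ne_top) (fun B hB hμB => by
    have : IsFiniteMeasure (μ.restrict B) := ⟨by simpa using hμB⟩
    refine tendstoInMeasure_of_tendsto_ae (fun n => ?_) ?_
    · exact (AEEqFun.aestronglyMeasurable _).mono_measure Measure.restrict_le_self
    · have h1 : ∀ᵐ s ∂μ, ∀ n, (AEEqFun.mk _ (huE n) : Ω →ₘ[μ] ℝ) s = (E : ℝ)⁻¹ * u n s :=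
        ae_all_iff.2 fun n => AEEqFun.coeFn_mk _ (huE n)
      refine ae_restrict_of_ae ?_
      filter_upwards [h1, AEEqFun.coeFn_mk _ hvE, hlim] with s h1 h2 h3
      simp only [h1, h2]
      exact h3.const_mul _)
  rw [← N_mk, N_const_mul hv.aestronglyMeasurable, hofE] at key
  calc X.N v = E * ((E : ℝ≥0∞)⁻¹ * X.N v) := by
        rw [← mul_assoc, ENNReal.mul_inv_cancel hE0' ENNReal.coe_ne_top, one_mul]
    _ ≤ E * 1 := by gcongr
    _ = E := mul_one _

theorem N_indicator_lt_top {B : Set Ω} (hB : MeasurableSet B) (h : μ B < ∞) :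
    X.N (B.indicator fun _ => (1 : ℝ)) < ∞ := by
  rw [N_mk (aestronglyMeasurable_const.indicator hB)]
  exact X.nrm_indicator_lt_top B hB h

theorem N_indicator_pos {B : Set Ω} (h : μ B ≠ 0) :
    0 < X.N (B.indicator fun _ => (1 : ℝ)) := by
  rw [pos_iff_ne_zero]
  intro h0
  refine h (measure_mono_null (fun s hs => ?_) (N_eq_zero h0))
  simp [hs]

theorem N_ri (hX : X.IsRearrangementInvariant) {u v : Ω → ℝ} (hu : AEStronglyMeasurable u μ)
    (hv : AEStronglyMeasurable v μ)
    (h : ∀ r : ℝ, 0 ≤ r → μ {s | r < |u s|} = μ {s | r < |v s|}) : X.N u = X.N v := by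
  rw [N_mk hu, N_mk hv]
  refine hX _ _ fun r hr => ?_
  have e1 : μ {s | r < |(AEEqFun.mk u hu : Ω →ₘ[μ] ℝ) s|} = μ {s | r < |u s|} := by
    refine measure_congr (eventuallyEq_set.2 ?_)
    filter_upwards [AEEqFun.coeFn_mk u hu] with s h1
    rw [h1]
  have e2 : μ {s | r < |(AEEqFun.mk v hv : Ω →ₘ[μ] ℝ) s|} = μ {s | r < |v s|} := by
    refine measure_congr (eventuallyEq_set.2 ?_)
    filter_upwards [AEEqFun.coeFn_mk v hv] with s h1
    rw [h1]
  rw [e1, e2, h r hr]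

/-- The norm in `L_∞`. -/
theorem N_linfty [SigmaFinite μ] {u : Ω → ℝ} (hu : AEStronglyMeasurable u μ) :
    (linfty μ).N u = eLpNorm u ∞ μ := by
  rw [N_mk hu]
  change eLpNorm (AEEqFun.mk u hu : Ω →ₘ[μ] ℝ) ∞ μ = _
  exact eLpNorm_congr_ae (AEEqFun.coeFn_mk u hu)

theorem N_linfty_le [SigmaFinite μ] {u : Ω → ℝ} (hu : AEStronglyMeasurable u μ) {C : ℝ≥0∞}
    (h : ∀ᵐ s ∂μ, ENNReal.ofReal |u s| ≤ C) : (linfty μ).N u ≤ C := by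
  rw [N_linfty hu, eLpNorm_exponent_top]
  refine eLpNormEssSup_le_of_ae_enorm_bound ?_
  filter_upwards [h] with s hs
  rwa [Real.enorm_eq_ofReal_abs]

theorem ae_le_N_linfty [SigmaFinite μ] (u : Ω → ℝ) :
    ∀ᵐ s ∂μ, ENNReal.ofReal |u s| ≤ (linfty μ).N u := by
  by_cases hu : AEStronglyMeasurable u μ
  · rw [N_linfty hu, eLpNorm_exponent_top]
    filter_upwards [ae_le_eLpNormEssSup (f := u) (μ := μ)] with s hs
    rwa [← Real.enorm_eq_ofReal_abs]
  · simp [KotheSpace.N, hu]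

end FunctionNorm

/-! ### Step functions over disjoint families of sets -/

section Step

variable {Ω : Type*} [MeasurableSpace Ω] {μ : Measure Ω} {X : KotheSpace μ} {ι : Type*}

/-- The function `∑ i ∈ F, ξ i • 1_{A i}`. -/
def step (F : Finset ι) (ξ : ι → ℝ) (A : ι → Set Ω) : Ω → ℝ :=
  fun s => ∑ i ∈ F, (A i).indicator (fun _ => ξ i) s

theorem measurable_step {F : Finset ι} {ξ : ι → ℝ} {A : ι → Set Ω}
    (hA : ∀ i ∈ F, MeasurableSet (A i)) : Measurable (step F ξ A) :=
  Finset.measurable_fun_sum F fun i hi => measurable_const.indicator (hA i hi)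

omit [MeasurableSpace Ω] in
theorem step_of_mem {F : Finset ι} {ξ : ι → ℝ} {A : ι → Set Ω}
    (hd : (F : Set ι).PairwiseDisjoint A) {i : ι} (hi : i ∈ F) {s : Ω} (hs : s ∈ A i) :
    step F ξ A s = ξ i := by
  classical
  rw [step, Finset.sum_eq_single_of_mem i hi]
  · simp [hs]
  · intro j hj hji
    have : s ∉ A j := fun hsj => (Set.disjoint_left.1 (hd hj hi hji)) hsj hs
    simp [this]

omit [MeasurableSpace Ω] in
theorem step_of_notMem {F : Finset ι} {ξ : ι → ℝ} {A : ι → Set Ω} {s : Ω}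
    (hs : ∀ i ∈ F, s ∉ A i) : step F ξ A s = 0 :=
  Finset.sum_eq_zero fun i hi => by simp [hs i hi]

omit [MeasurableSpace Ω] in
theorem abs_step_le {F : Finset ι} {ξ : ι → ℝ} {A : ι → Set Ω}
    (hd : (F : Set ι).PairwiseDisjoint A) {v : Ω → ℝ} (h : ∀ i ∈ F, ∀ s ∈ A i, |ξ i| ≤ |v s|)
    (s : Ω) : |step F ξ A s| ≤ |v s| := by
  by_cases hs : ∃ i ∈ F, s ∈ A i
  · obtain ⟨i, hi, hsi⟩ := hs
    rw [step_of_mem hd hi hsi]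
    exact h i hi s hsi
  · push Not at hs
    rw [step_of_notMem hs]
    simp

/-- Since `v` vanishes on the blocks and `r ≥ 0`, the superlevel set is the disjoint union of some
blocks and a superlevel set of `v`. The distribution thus depends on the blocks only through their
measures. -/
theorem measure_lt_abs_step_add {F : Finset ι} {ξ : ι → ℝ} {A : ι → Set Ω} {v : Ω → ℝ}
    (hA : ∀ i ∈ F, MeasurableSet (A i)) (hd : (F : Set ι).PairwiseDisjoint A)
    (hv : Measurable v) (hvA : ∀ i ∈ F, ∀ s ∈ A i, v s = 0) {r : ℝ} (hr : 0 ≤ r) :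
    μ {s | r < |step F ξ A s + v s|} =
      ∑ i ∈ F.filter (fun i => r < |ξ i|), μ (A i) + μ {s | r < |v s|} := by
  classical
  have hset : {s | r < |step F ξ A s + v s|} =
      (⋃ i ∈ F.filter (fun i => r < |ξ i|), A i) ∪ {s | r < |v s|} := by
    ext s
    simp only [mem_ofPred_eq, mem_union, mem_iUnion, Finset.mem_filter, exists_prop]
    by_cases hs : ∃ i ∈ F, s ∈ A i
    · obtain ⟨i, hi, hsi⟩ := hs
      rw [step_of_mem hd hi hsi, hvA i hi s hsi]
      constructor
      · intro h
        exact Or.inl ⟨i, ⟨hi, by simpa using h⟩, hsi⟩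
      · rintro (⟨j, ⟨hj, hlt⟩, hsj⟩ | h)
        · obtain rfl : i = j := by
            by_contra hne
            exact Set.disjoint_left.1 (hd hi hj hne) hsi hsj
          simpa using hlt
        · rw [abs_zero] at h
          exact absurd h (not_lt.2 hr)
    · push Not at hs
      rw [step_of_notMem hs, zero_add]
      constructor
      · exact Or.inr
      · rintro (⟨j, ⟨hj, -⟩, hsj⟩ | h)
        · exact absurd hsj (hs j hj)
        · exact h
  rw [hset, measure_union _ (measurableSet_lt measurable_const hv.abs), measure_biUnion_finset]
  · exact hd.subset fun i hi => (Finset.mem_filter.1 hi).1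
  · exact fun i hi => hA i (Finset.mem_filter.1 hi).1
  · rw [Set.disjoint_left]
    simp only [mem_iUnion, Finset.mem_filter, exists_prop, mem_ofPred_eq]
    rintro s ⟨i, ⟨hi, -⟩, hsi⟩ h
    rw [hvA i hi s hsi, abs_zero] at h
    exact absurd h (not_lt.2 hr)

/-- Step functions with blocks of equal measure, and equal remainders off these blocks, have equal
norms. -/
theorem N_step_add_eq (hX : X.IsRearrangementInvariant) {F : Finset ι} {ξ : ι → ℝ}
    {A B : ι → Set Ω} {v : Ω → ℝ}
    (hA : ∀ i ∈ F, MeasurableSet (A i)) (hdA : (F : Set ι).PairwiseDisjoint A)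
    (hB : ∀ i ∈ F, MeasurableSet (B i)) (hdB : (F : Set ι).PairwiseDisjoint B)
    (hv : Measurable v) (hvA : ∀ i ∈ F, ∀ s ∈ A i, v s = 0) (hvB : ∀ i ∈ F, ∀ s ∈ B i, v s = 0)
    (hAB : ∀ i ∈ F, μ (A i) = μ (B i)) :
    X.N (fun s => step F ξ A s + v s) = X.N (fun s => step F ξ B s + v s) := by
  refine N_ri hX ((measurable_step hA).add hv).aestronglyMeasurable
    ((measurable_step hB).add hv).aestronglyMeasurable fun r hr => ?_
  rw [measure_lt_abs_step_add hA hdA hv hvA hr, measure_lt_abs_step_add hB hdB hv hvB hr]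
  congr 1
  exact Finset.sum_congr rfl fun i hi => hAB i (Finset.mem_filter.1 hi).1

theorem N_step_eq (hX : X.IsRearrangementInvariant) {F : Finset ι} {ξ : ι → ℝ}
    {A B : ι → Set Ω}
    (hA : ∀ i ∈ F, MeasurableSet (A i)) (hdA : (F : Set ι).PairwiseDisjoint A)
    (hB : ∀ i ∈ F, MeasurableSet (B i)) (hdB : (F : Set ι).PairwiseDisjoint B)
    (hAB : ∀ i ∈ F, μ (A i) = μ (B i)) :
    X.N (step F ξ A) = X.N (step F ξ B) := by
  simpa using N_step_add_eq (X := X) hX (ξ := ξ) (v := fun _ => 0) hA hdA hB hdB measurable_const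
    (fun _ _ _ _ => rfl) (fun _ _ _ _ => rfl) hAB

end Step

/-! ### Measure spaces with a dyadic decomposition -/

/-- A measure space divided by `κ` into blocks `{κ = k}` of measure `2ᵏ`, `k ∈ J`, with the
properties that the three underlying spaces share. -/
structure DyadicModel {Ω : Type*} [MeasurableSpace Ω] (μ : Measure Ω) (κ : Ω → ℤ) (J : Set ℤ) :
    Prop where
  measurable : Measurable κ
  ordConnected : J.OrdConnected
  nonempty : J.Nonempty
  block : ∀ k ∈ J, μ (κ ⁻¹' {k}) = 2 ^ k
  null : ∀ k ∉ J, μ (κ ⁻¹' {k}) = 0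
  lt_le : ∀ k ∈ J, μ {s | κ s < k} ≤ 2 ^ k
  two_pow_le : ∀ k ∈ J, (2 : ℝ≥0∞) ^ k ≤ μ univ
  -- Immediate for Lebesgue measure, where `J` is unbounded below; for counting measure it says that
  -- a set of measure less than 1 is null.
  small : ∀ A, MeasurableSet A → (∀ k ∈ J, μ A < 2 ^ k) → μ A = 0
  -- The prescribed measure is that of a set `F`, so that only attainable values are asked for when
  -- measures are integers.
  split : ∀ A B F : Set Ω, MeasurableSet A → MeasurableSet B → MeasurableSet F → A ⊆ B →
    μ A ≤ μ F → μ F ≤ μ B → μ F < ∞ → ∃ C, MeasurableSet C ∧ A ⊆ C ∧ C ⊆ B ∧ μ C = μ F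
  -- A lower sum over parts of equal measure approximates the integral: the parts are points for
  -- counting measure, and slices of `G` by the size of `w` for Lebesgue measure.
  equi : ∀ (G : Set Ω) (w : Ω → ℝ) (L ε : ℝ), MeasurableSet G → μ G < ∞ → Measurable w →
    (∀ s, 0 ≤ w s) → (∀ s, w s ≤ L) → 0 < ε →
    ∃ (n : ℕ) (P : Fin (n + 1) → Set Ω) (c : Fin (n + 1) → ℝ), (∀ l, MeasurableSet (P l)) ∧
      Pairwise (fun l l' => Disjoint (P l) (P l')) ∧ ⋃ l, P l = G ∧ (∀ l l', μ (P l) = μ (P l')) ∧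
      (∀ l, 0 ≤ c l) ∧ (∀ l, ∀ s ∈ P l, c l ≤ w s) ∧
      ∫ s in G, w s ∂μ ≤ ∑ l, c l * (μ (P l)).toReal + ε

section Dyadic

variable {Ω : Type*} [MeasurableSpace Ω] {μ : Measure Ω} {X : KotheSpace μ} {ι : Type*}
  {κ : Ω → ℤ} {J : Set ℤ}

/-- Enlarging the blocks of a step function, in measure, enlarges its norm. -/
theorem N_step_le (M : DyadicModel μ κ J) (hX : X.IsRearrangementInvariant) {F : Finset ι}
    {ξ : ι → ℝ} {A B : ι → Set Ω}
    (hA : ∀ i ∈ F, MeasurableSet (A i)) (hdA : (F : Set ι).PairwiseDisjoint A)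
    (hB : ∀ i ∈ F, MeasurableSet (B i)) (hdB : (F : Set ι).PairwiseDisjoint B)
    (hAB : ∀ i ∈ F, μ (A i) ≤ μ (B i)) (hfin : ∀ i ∈ F, μ (A i) < ∞) :
    X.N (step F ξ A) ≤ X.N (step F ξ B) := by
  have h : ∀ i, ∃ C, i ∈ F → MeasurableSet C ∧ C ⊆ B i ∧ μ C = μ (A i) := fun i => by
    by_cases hi : i ∈ F
    · obtain ⟨C, h1, -, h2, h3⟩ := M.split ∅ (B i) (A i) MeasurableSet.empty (hB i hi) (hA i hi)
        (empty_subset _) (by simp) (hAB i hi) (hfin i hi)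
      exact ⟨C, fun _ => ⟨h1, h2, h3⟩⟩
    · exact ⟨∅, fun h => absurd h hi⟩
  choose C hC using h
  have hdC : (F : Set ι).PairwiseDisjoint C := fun i hi j hj hij =>
    (hdB hi hj hij).mono (hC i hi).2.1 (hC j hj).2.1
  rw [N_step_eq hX hA hdA (fun i hi => (hC i hi).1) hdC fun i hi => (hC i hi).2.2.symm]
  refine N_mono (measurable_step fun i hi => (hC i hi).1).aestronglyMeasurable
    (Eventually.of_forall (abs_step_le hdC fun i hi s hs => ?_))
  rw [step_of_mem hdB hi ((hC i hi).2.1 hs)]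

/-- Each `A i` is cut into two sets of measure at most `μ (B i)`. The two step functions are bounded
by enlarging blocks, and the triangle inequality costs the factor 2. -/
theorem N_step_le_two (M : DyadicModel μ κ J) (hX : X.IsRearrangementInvariant) {F : Finset ι}
    {ξ : ι → ℝ} {A B : ι → Set Ω}
    (hA : ∀ i ∈ F, MeasurableSet (A i)) (hdA : (F : Set ι).PairwiseDisjoint A)
    (hB : ∀ i ∈ F, MeasurableSet (B i)) (hdB : (F : Set ι).PairwiseDisjoint B)
    (hAB : ∀ i ∈ F, μ (A i) ≤ 2 * μ (B i)) (hfin : ∀ i ∈ F, μ (B i) < ∞) :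
    X.N (step F ξ A) ≤ 2 * X.N (step F ξ B) := by
  have h : ∀ i, ∃ C, i ∈ F → MeasurableSet C ∧ C ⊆ A i ∧ μ C ≤ μ (B i) ∧ μ (A i \ C) ≤ μ (B i) :=
      fun i => by
    by_cases hi : i ∈ F
    · rcases le_total (μ (A i)) (μ (B i)) with h | h
      · exact ⟨A i, fun _ => ⟨hA i hi, Subset.rfl, h, by simp⟩⟩
      · obtain ⟨C, h1, -, h2, h3⟩ := M.split ∅ (A i) (B i) MeasurableSet.empty (hA i hi) (hB i hi)
          (empty_subset _) (by simp) h (hfin i hi)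
        refine ⟨C, fun _ => ⟨h1, h2, h3.le, ?_⟩⟩
        rw [measure_sdiff h2 h1.nullMeasurableSet (by rw [h3]; exact (hfin i hi).ne), h3]
        rw [tsub_le_iff_right, ← two_mul]
        exact hAB i hi
    · exact ⟨∅, fun h => absurd h hi⟩
  choose C hC using h
  have hdC : (F : Set ι).PairwiseDisjoint C := fun i hi j hj hij =>
    (hdA hi hj hij).mono (hC i hi).2.1 (hC j hj).2.1
  have hdD : (F : Set ι).PairwiseDisjoint (fun i => A i \ C i) := fun i hi j hj hij =>
    (hdA hi hj hij).mono sdiff_subset sdiff_subset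
  have e : step F ξ A = fun s => step F ξ C s + step F ξ (fun i => A i \ C i) s := by
    funext s
    rw [step, step, step, ← Finset.sum_add_distrib]
    refine Finset.sum_congr rfl fun i hi => ?_
    by_cases h1 : s ∈ C i
    · have : s ∈ A i := (hC i hi).2.1 h1
      simp [h1, this]
    · by_cases h2 : s ∈ A i <;> simp [h1, h2]
  rw [e, two_mul]
  refine (N_add_le _ _).trans (add_le_add ?_ ?_)
  · exact N_step_le M hX (fun i hi => (hC i hi).1) hdC hB hdB (fun i hi => (hC i hi).2.2.1)
      fun i hi => (hC i hi).2.2.1.trans_lt (hfin i hi)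
  · exact N_step_le M hX (fun i hi => (hA i hi).diff (hC i hi).1) hdD hB hdB
      (fun i hi => (hC i hi).2.2.2) fun i hi => (hC i hi).2.2.2.trans_lt (hfin i hi)

omit [MeasurableSpace Ω] in
theorem step_unit (A : Set Ω) :
    step {()} (fun _ => 1) (fun _ => A) = A.indicator fun _ => 1 := by
  funext s
  simp [step]

theorem N_set_le (M : DyadicModel μ κ J) (hX : X.IsRearrangementInvariant) {A B : Set Ω}
    (hA : MeasurableSet A) (hB : MeasurableSet B) (h : μ A ≤ μ B) (hfin : μ A < ∞) :
    X.N (A.indicator fun _ => 1) ≤ X.N (B.indicator fun _ => 1) := by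
  have := N_step_le (X := X) (ι := Unit) (F := {()}) (ξ := fun _ => 1) (A := fun _ => A)
    (B := fun _ => B) M hX (fun _ _ => hA) (by simp) (fun _ _ => hB) (by simp) (fun _ _ => h)
    (fun _ _ => hfin)
  simpa only [step_unit] using this

theorem N_set_le_two (M : DyadicModel μ κ J) (hX : X.IsRearrangementInvariant) {A B : Set Ω}
    (hA : MeasurableSet A) (hB : MeasurableSet B) (h : μ A ≤ 2 * μ B) (hfin : μ B < ∞) :
    X.N (A.indicator fun _ => 1) ≤ 2 * X.N (B.indicator fun _ => 1) := by
  have := N_step_le_two (X := X) (ι := Unit) (F := {()}) (ξ := fun _ => 1) (A := fun _ => A)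
    (B := fun _ => B) M hX (fun _ _ => hA) (by simp) (fun _ _ => hB) (by simp) (fun _ _ => h)
    (fun _ _ => hfin)
  simpa only [step_unit] using this

variable (X κ) in
/-- The norm of the characteristic function of a block. -/
def KotheSpace.e (k : ℤ) : ℝ≥0∞ := X.N ((κ ⁻¹' {k}).indicator fun _ => 1)

variable (X κ) in
/-- The norm of the characteristic function of the first blocks. -/
def KotheSpace.T (k : ℤ) : ℝ≥0∞ := X.N ((κ ⁻¹' Iic k).indicator fun _ => 1)

variable (X κ) in
/-- The norm of the sequence space. -/
def KotheSpace.NE (ξ : ℤ → ℝ) : ℝ≥0∞ := X.N (fun s => ξ (κ s))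

theorem two_zpow_lt_top (k : ℤ) : (2 : ℝ≥0∞) ^ k < ∞ :=
  ENNReal.zpow_lt_top (by simp) (by simp) k

theorem two_zpow_pos (k : ℤ) : 0 < (2 : ℝ≥0∞) ^ k :=
  ENNReal.zpow_pos (by simp) (by simp) k

theorem two_zpow_succ (k : ℤ) : (2 : ℝ≥0∞) ^ (k + 1) = 2 * 2 ^ k := by
  rw [ENNReal.zpow_add (by simp) (by simp), zpow_one, mul_comm]

namespace DyadicModel

variable (M : DyadicModel μ κ J)

include M

theorem ms_pre (A : Set ℤ) : MeasurableSet (κ ⁻¹' A) := M.measurable (MeasurableSet.of_discrete)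

theorem measurable_comp (ξ : ℤ → ℝ) : Measurable (fun s => ξ (κ s)) :=
  (measurable_of_countable ξ).comp M.measurable

theorem aesm_comp (ξ : ℤ → ℝ) : AEStronglyMeasurable (fun s => ξ (κ s)) μ :=
  (M.measurable_comp ξ).aestronglyMeasurable

theorem ae_mem : ∀ᵐ s ∂μ, κ s ∈ J := by
  have h : {s | ¬ κ s ∈ J} = ⋃ k ∈ Jᶜ, κ ⁻¹' {k} := by
    ext s; simp
  rw [ae_iff, h, measure_biUnion_null_iff (to_countable _)]
  exact M.null

theorem block_lt_top (k : ℤ) : μ (κ ⁻¹' {k}) < ∞ := by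
  by_cases hk : k ∈ J
  · rw [M.block k hk]
    exact two_zpow_lt_top k
  · simp [M.null k hk]

theorem Iic_le {k : ℤ} (hk : k ∈ J) : μ (κ ⁻¹' Iic k) ≤ 2 * 2 ^ k := by
  have : κ ⁻¹' Iic k = {s | κ s < k} ∪ κ ⁻¹' {k} := by
    ext s
    simp [le_iff_lt_or_eq]
  rw [this, two_mul]
  exact (measure_union_le _ _).trans (add_le_add (M.lt_le k hk) (M.block k hk).le)

theorem Iic_lt_top {k : ℤ} (hk : k ∈ J) : μ (κ ⁻¹' Iic k) < ∞ :=
  (M.Iic_le hk).trans_lt (ENNReal.mul_lt_top (by simp) (two_zpow_lt_top k))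

theorem T_mono : Monotone (X.T κ) := fun a b hab => by
  refine N_mono (aestronglyMeasurable_const.indicator (M.ms_pre _))
    (Eventually.of_forall fun s => ?_)
  by_cases h : κ s ≤ a
  · simp [indicator, h, h.trans hab]
  · simp [indicator, h]

theorem e_le_T (k : ℤ) : X.e κ k ≤ X.T κ k := by
  refine N_mono (aestronglyMeasurable_const.indicator (M.ms_pre _))
    (Eventually.of_forall fun s => ?_)
  by_cases h : κ s = k <;> simp [indicator, h]

theorem e_lt_top (k : ℤ) : X.e κ k < ∞ := N_indicator_lt_top (M.ms_pre _) (M.block_lt_top k)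

theorem e_pos {k : ℤ} (hk : k ∈ J) : 0 < X.e κ k :=
  N_indicator_pos (by rw [M.block k hk]; exact (two_zpow_pos k).ne')

theorem T_lt_top {k : ℤ} (hk : k ∈ J) : X.T κ k < ∞ :=
  N_indicator_lt_top (M.ms_pre _) (M.Iic_lt_top hk)

theorem T_pos {k : ℤ} (hk : k ∈ J) : 0 < X.T κ k := (M.e_pos hk).trans_le (M.e_le_T k)

/-- The blocks before `k` together have measure at most `2 ^ k`, like block `k` itself. -/
theorem T_le_two_e (hX : X.IsRearrangementInvariant) {k : ℤ} (hk : k ∈ J) :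
    X.T κ k ≤ 2 * X.e κ k := by
  refine N_set_le_two M hX (M.ms_pre _) (M.ms_pre _) ?_ (M.block_lt_top k)
  rw [M.block k hk]
  exact M.Iic_le hk

theorem e_succ_le (hX : X.IsRearrangementInvariant) {k : ℤ} (hk : k ∈ J) (hk' : k + 1 ∈ J) :
    X.e κ (k + 1) ≤ 2 * X.e κ k := by
  refine N_set_le_two M hX (M.ms_pre _) (M.ms_pre _) ?_ (M.block_lt_top k)
  rw [M.block k hk, M.block _ hk', two_zpow_succ]

theorem NE_mono {ξ η : ℤ → ℝ} (h : ∀ k ∈ J, |ξ k| ≤ |η k|) : X.NE κ ξ ≤ X.NE κ η := by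
  refine N_mono (M.aesm_comp ξ) ?_
  filter_upwards [M.ae_mem] with s hs using h _ hs

theorem NE_congr {ξ η : ℤ → ℝ} (h : ∀ k ∈ J, ξ k = η k) : X.NE κ ξ = X.NE κ η :=
  le_antisymm (M.NE_mono fun k hk => by rw [h k hk]) (M.NE_mono fun k hk => by rw [h k hk])

omit M in
theorem NE_add_le (ξ η : ℤ → ℝ) : X.NE κ (fun k => ξ k + η k) ≤ X.NE κ ξ + X.NE κ η :=
  N_add_le _ _

omit M in
theorem NE_sum_le {ι : Type*} (F : Finset ι) (ξ : ι → ℤ → ℝ) :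
    X.NE κ (fun k => ∑ i ∈ F, ξ i k) ≤ ∑ i ∈ F, X.NE κ (ξ i) :=
  N_sum_le F fun i s => ξ i (κ s)

omit M in
theorem NE_zero : X.NE κ (fun _ => 0) = 0 := N_zero

theorem NE_const_mul (c : ℝ) (ξ : ℤ → ℝ) :
    X.NE κ (fun k => c * ξ k) = ENNReal.ofReal |c| * X.NE κ ξ :=
  N_const_mul (M.aesm_comp ξ) c

theorem NE_coord (ξ : ℤ → ℝ) (k : ℤ) : ENNReal.ofReal |ξ k| * X.e κ k ≤ X.NE κ ξ := by
  rw [KotheSpace.e, ← N_const_mul (aestronglyMeasurable_const.indicator (M.ms_pre _))]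
  refine N_mono ((aestronglyMeasurable_const.indicator (M.ms_pre _)).const_mul _)
    (Eventually.of_forall fun s => ?_)
  by_cases h : κ s = k <;> simp [indicator, h]

theorem NE_eq_zero {ξ : ℤ → ℝ} (h : X.NE κ ξ = 0) {k : ℤ} (hk : k ∈ J) : ξ k = 0 := by
  have h1 := M.NE_coord (X := X) ξ k
  rw [h, nonpos_iff_eq_zero, mul_eq_zero] at h1
  rcases h1 with h1 | h1
  · simpa using h1
  · exact absurd h1 (M.e_pos hk).ne'

theorem NE_le_mul_T {ξ : ℤ → ℝ} {c : ℝ} (n : ℤ) (hc : 0 ≤ c) (h : ∀ k ∈ J, |ξ k| ≤ c)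
    (hn : ∀ k ∈ J, n < k → ξ k = 0) : X.NE κ ξ ≤ ENNReal.ofReal c * X.T κ n := by
  rw [KotheSpace.T, ← abs_of_nonneg hc,
    ← N_const_mul (aestronglyMeasurable_const.indicator (M.ms_pre _))]
  refine N_mono (M.aesm_comp ξ) ?_
  filter_upwards [M.ae_mem] with s hs
  by_cases hk : κ s ≤ n
  · simpa [indicator, hk, abs_of_nonneg hc] using h _ hs
  · rw [hn _ hs (not_le.1 hk), abs_zero]
    exact abs_nonneg _

omit M in
theorem NE_eq_step {ξ : ℤ → ℝ} {F : Finset ℤ} (h : ∀ k ∉ F, ξ k = 0) :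
    X.NE κ ξ = X.N (step F ξ (fun k => κ ⁻¹' {k})) := by
  refine congrArg X.N (funext fun s => ?_)
  have hd : (F : Set ℤ).PairwiseDisjoint (fun k => κ ⁻¹' {k}) := fun i _ j _ hij =>
    Disjoint.preimage κ (by simpa using hij)
  by_cases hs : κ s ∈ F
  · rw [step_of_mem hd hs (by simp)]
  · rw [step_of_notMem, h _ hs]
    intro i hi hsi
    exact hs (by rw [show κ s = i from hsi]; exact hi)

theorem NE_lt_top {ξ : ℤ → ℝ} (h : ξ.support.Finite) : X.NE κ ξ < ∞ := by
  have e : ξ = fun k => ∑ i ∈ h.toFinset, ξ i * (({i} : Set ℤ).indicator (fun _ => 1) k) := by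
    funext k
    by_cases hk : k ∈ h.toFinset
    · rw [Finset.sum_eq_single_of_mem k hk]
      · simp
      · intro j _ hj
        simp [Ne.symm hj]
    · rw [Finset.sum_eq_zero]
      · simpa using hk
      · intro j hj
        have : k ≠ j := fun h => hk (h ▸ hj)
        simp [this]
  rw [e]
  refine (NE_sum_le _ _).trans_lt (ENNReal.sum_lt_top.2 fun i _ => ?_)
  rw [M.NE_const_mul]
  exact ENNReal.mul_lt_top ENNReal.ofReal_lt_top (M.e_lt_top i)

/-- Passage from finitely supported sequences to all sequences; finitely supported sequences need
not be dense, and the Fatou property replaces density. -/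
theorem NE_fatou {ξ : ℤ → ℝ} {C : ℝ≥0∞}
    (h : ∀ n : ℕ, X.NE κ ((Icc (-n : ℤ) n).indicator ξ) ≤ C) : X.NE κ ξ ≤ C := by
  refine N_fatou (fun n => M.measurable_comp _) (M.measurable_comp ξ) h
    (Eventually.of_forall fun s => ?_)
  refine tendsto_const_nhds.congr' ?_
  filter_upwards [eventually_ge_atTop (κ s).natAbs] with n hn
  rw [indicator_of_mem]
  simp only [mem_Icc]
  omega

end DyadicModel

end Dyadic

/-! ### Averaging operators -/

section Averaging

variable {Ω : Type*} [MeasurableSpace Ω] {μ : Measure Ω} {X : KotheSpace μ} {ι : Type*}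
  {κ : Ω → ℤ} {J : Set ℤ}

/-- Averaging a function over the cyclic shifts of a partition of `G` in parts of equal measure. -/
theorem N_mean_le (hX : X.IsRearrangementInvariant) {n : ℕ}
    {G : Set Ω} {P : Fin (n + 1) → Set Ω} {c : Fin (n + 1) → ℝ} {v : Ω → ℝ}
    (hP : ∀ l, MeasurableSet (P l)) (hd : Pairwise (fun l l' => Disjoint (P l) (P l')))
    (hG : ⋃ l, P l = G) (heq : ∀ l l', μ (P l) = μ (P l')) (hv : Measurable v)
    (hvG : ∀ s ∈ G, v s = 0) :
    X.N (fun s => G.indicator (fun _ => (∑ l, c l) / (n + 1)) s + v s) ≤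
      X.N (fun s => step Finset.univ c P s + v s) := by
  have hvP : ∀ l, ∀ s ∈ P l, v s = 0 := fun l s hs => hvG s (hG ▸ mem_iUnion.2 ⟨l, hs⟩)
  have hdP : ((Finset.univ : Finset (Fin (n + 1))) : Set (Fin (n + 1))).PairwiseDisjoint P :=
    fun i _ j _ hij => hd hij
  have hGm : MeasurableSet G := hG ▸ MeasurableSet.iUnion hP
  -- `u t` carries the values `c` shifted cyclically by `t`. All shifts have the same norm, and
  -- their sum is constant on `G`.
  let u : Fin (n + 1) → Ω → ℝ := fun t s => step Finset.univ (fun l => c (l + t)) P s + v s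
  have hu : ∀ t, X.N (u t) = X.N (fun s => step Finset.univ c P s + v s) := fun t => by
    have e : step Finset.univ (fun l => c (l + t)) P =
        step Finset.univ c (fun l => P (l - t)) := by
      funext s
      rw [step, step, ← Equiv.sum_comp (Equiv.addRight t)
        (fun l => (P (l - t)).indicator (fun _ => c l) s)]
      simp
    simp only [u, e]
    refine N_step_add_eq hX (fun l _ => hP _) (fun i _ j _ hij => hd (by simpa using hij))
      (fun l _ => hP _) hdP hv (fun l _ => hvP _) (fun l _ => hvP l) fun l _ => heq _ _
  have hsum : (fun s => ∑ t, u t s) = fun s => ((n : ℝ) + 1) *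
      (G.indicator (fun _ => (∑ l, c l) / (n + 1)) s + v s) := by
    funext s
    have hn : (n : ℝ) + 1 ≠ 0 := by positivity
    by_cases hs : s ∈ G
    · obtain ⟨l, hl⟩ := mem_iUnion.1 (hG.symm ▸ hs)
      simp only [u, hvG s hs, add_zero, indicator_of_mem hs,
        step_of_mem hdP (Finset.mem_univ l) hl]
      rw [show ∑ t, c (l + t) = ∑ t, c t from Equiv.sum_comp (Equiv.addLeft l) c]
      field_simp
    · have h0 : ∀ i ∈ Finset.univ, s ∉ P i := fun i _ hi => hs (hG ▸ mem_iUnion.2 ⟨i, hi⟩)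
      simp only [u, step_of_notMem h0, indicator_of_notMem hs]
      simp
  have key := N_sum_le (X := X) Finset.univ u
  simp only [hu] at key
  rw [hsum, N_const_mul (u := fun s => G.indicator (fun _ => (∑ l, c l) / ((n : ℝ) + 1)) s + v s)
    (((measurable_const.indicator hGm).add hv).aestronglyMeasurable)] at key
  have hn : ENNReal.ofReal |(n : ℝ) + 1| = (n + 1 : ℕ) := by
    rw [abs_of_nonneg (by positivity)]
    rw [← ENNReal.ofReal_natCast]
    push_cast
    rfl
  rw [hn, Finset.sum_const, Finset.card_univ, Fintype.card_fin, nsmul_eq_mul] at key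
  exact (ENNReal.mul_le_mul_iff_right (by simp) (by simp)).1 key

namespace DyadicModel

variable (M : DyadicModel μ κ J)

include M

/-- An equipartition of `G` gives a step function below `w` whose cyclic mean is the average of `w`
up to an error that tends to 0; the Fatou property removes the error. -/
theorem N_avg_le_of_bounded (hX : X.IsRearrangementInvariant) {G : Set Ω} {w : Ω → ℝ} {L : ℝ}
    (hG : MeasurableSet G) (hGfin : μ G < ∞) (hGpos : μ G ≠ 0) (hw : Measurable w)
    (h0 : ∀ s, 0 ≤ w s) (hL : ∀ s, w s ≤ L) :
    X.N (fun s => G.indicator (fun _ => (∫ s in G, w s ∂μ) / (μ G).toReal) s +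
      Gᶜ.indicator w s) ≤ X.N w := by
  set m := (μ G).toReal with hm
  have hmpos : 0 < m := ENNReal.toReal_pos hGpos hGfin.ne
  set a := (∫ s in G, w s ∂μ) / m
  have ha : 0 ≤ a := div_nonneg (integral_nonneg h0) hmpos.le
  have hv : Measurable (Gᶜ.indicator w) := hw.indicator hG.compl
  refine N_fatou (u := fun i s => G.indicator (fun _ => max 0 (a - (1 / ((i : ℝ) + 1)) / m)) s +
      Gᶜ.indicator w s) (fun i => (measurable_const.indicator hG).add hv)
    ((measurable_const.indicator hG).add hv) (fun i => ?_) (Eventually.of_forall fun s => ?_)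
  · obtain ⟨n, P, c, hP, hd, hPG, heq, hc0, hcw, hint⟩ :=
      M.equi G w L (1 / ((i : ℝ) + 1)) hG hGfin hw h0 hL (by positivity)
    have hmeas : ∀ l, (μ (P l)).toReal = m / (n + 1) := fun l => by
      have : μ G = (n + 1 : ℕ) * μ (P l) := by
        rw [← hPG, measure_iUnion hd hP, tsum_fintype, Finset.sum_congr rfl fun l' _ => heq l' l]
        simp
      rw [hm, this, ENNReal.toReal_mul, ENNReal.toReal_natCast]
      push_cast
      field_simp
    have hdP : ((Finset.univ : Finset (Fin (n + 1))) : Set (Fin (n + 1))).PairwiseDisjoint P :=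
      fun i _ j _ hij => hd hij
    have hmean : a - (1 / ((i : ℝ) + 1)) / m ≤ (∑ l, c l) / (n + 1) := by
      simp only [hmeas, ← Finset.sum_mul] at hint
      rw [← sub_div, div_le_iff₀ hmpos]
      calc _ ≤ (∑ l, c l) * (m / (n + 1)) := by linarith
        _ = _ := by ring
    have hmean0 : 0 ≤ (∑ l, c l) / ((n : ℝ) + 1) :=
      div_nonneg (Finset.sum_nonneg fun l _ => hc0 l) (by positivity)
    calc _ ≤ X.N (fun s => G.indicator (fun _ => (∑ l, c l) / ((n : ℝ) + 1)) s +
            Gᶜ.indicator w s) := by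
          refine N_mono ((measurable_const.indicator hG).add hv).aestronglyMeasurable
            (Eventually.of_forall fun s => ?_)
          by_cases hs : s ∈ G
          · simp only [indicator_of_mem hs, indicator_of_notMem (show s ∉ Gᶜ by simpa using hs),
              add_zero]
            rw [abs_of_nonneg (le_max_left _ _), abs_of_nonneg hmean0]
            exact max_le hmean0 hmean
          · simp [hs]
      _ ≤ _ := N_mean_le hX hP hd hPG heq hv fun s hs => by simp [hs]
      _ ≤ _ := by
          refine N_mono ((measurable_step fun l _ => hP l).add hv).aestronglyMeasurable
            (Eventually.of_forall fun s => ?_)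
          by_cases hs : s ∈ G
          · obtain ⟨l, hl⟩ := mem_iUnion.1 (hPG.symm ▸ hs)
            rw [step_of_mem hdP (Finset.mem_univ l) hl]
            simp only [indicator_of_notMem (show s ∉ Gᶜ by simpa using hs), add_zero]
            rw [abs_of_nonneg (hc0 l), abs_of_nonneg (h0 s)]
            exact hcw l s hl
          · rw [step_of_notMem fun l _ hl => hs (hPG ▸ mem_iUnion.2 ⟨l, hl⟩)]
            simp [hs]
  · refine Tendsto.add ?_ tendsto_const_nhds
    by_cases hs : s ∈ G
    · simp only [indicator_of_mem hs]
      have h1 : Tendsto (fun i : ℕ => max 0 (a - (1 / ((i : ℝ) + 1)) / m)) atTop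
          (𝓝 (max 0 (a - 0 / m))) :=
        tendsto_const_nhds.max (tendsto_const_nhds.sub
          ((tendsto_one_div_add_atTop_nhds_zero_nat).div_const m))
      simpa [max_eq_right ha] using h1
    · simp [hs]

/-- By the averaging inequality for bounded functions, the averages over `G` of the truncations of
`|w|` are at most the quotient of the norms of `w` and of the characteristic function of `G`.
Monotone convergence then bounds the integral of `|w|`. -/
theorem integrableOn_of_N_lt_top (hX : X.IsRearrangementInvariant) {G : Set Ω} {w : Ω → ℝ}
    (hG : MeasurableSet G) (hGfin : μ G < ∞) (hw : Measurable w)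
    (hN : X.N w < ∞) : IntegrableOn w G μ := by
  by_cases hGpos : μ G = 0
  · rw [IntegrableOn, Measure.restrict_eq_zero.2 hGpos]
    exact integrable_zero_measure
  have hmpos : 0 < (μ G).toReal := ENNReal.toReal_pos hGpos hGfin.ne
  have hpos : 0 < X.N (G.indicator fun _ => (1 : ℝ)) := N_indicator_pos hGpos
  let wL : ℕ → Ω → ℝ := fun L s => min |w s| L
  have hwL : ∀ L, Measurable (wL L) := fun L => hw.abs.min measurable_const
  have h0 : ∀ L s, 0 ≤ wL L s := fun L s => le_min (abs_nonneg _) (Nat.cast_nonneg _)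
  have hb : ∀ L, ENNReal.ofReal (∫ s in G, wL L s ∂μ) ≤
      X.N w / X.N (G.indicator fun _ => (1 : ℝ)) * ENNReal.ofReal (μ G).toReal := fun L => by
    have h1 : X.N (G.indicator (fun _ => (∫ s in G, wL L s ∂μ) / (μ G).toReal)) ≤ X.N w := by
      refine le_trans ?_ ((M.N_avg_le_of_bounded hX hG hGfin hGpos (hwL L) (h0 L)
        (fun s => min_le_right _ _)).trans (N_mono (hwL L).aestronglyMeasurable
          (Eventually.of_forall fun s => ?_)))
      · refine N_mono (aestronglyMeasurable_const.indicator hG) (Eventually.of_forall fun s => ?_)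
        by_cases hs : s ∈ G <;> simp [hs]
      · rw [abs_of_nonneg (h0 L s)]
        exact min_le_left _ _
    have e : (G.indicator (fun _ => (∫ s in G, wL L s ∂μ) / (μ G).toReal)) =
        fun s => ((∫ s in G, wL L s ∂μ) / (μ G).toReal) * G.indicator (fun _ => (1 : ℝ)) s := by
      funext s
      by_cases hs : s ∈ G <;> simp [hs]
    rw [e, N_const_mul (aestronglyMeasurable_const.indicator hG),
      abs_of_nonneg (div_nonneg (integral_nonneg (h0 L)) hmpos.le)] at h1
    have h2 : ENNReal.ofReal ((∫ s in G, wL L s ∂μ) / (μ G).toReal) ≤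
        X.N w / X.N (G.indicator fun _ => (1 : ℝ)) :=
      (ENNReal.le_div_iff_mul_le (Or.inl hpos.ne') (Or.inl (N_indicator_lt_top hG hGfin).ne)).2 h1
    calc ENNReal.ofReal (∫ s in G, wL L s ∂μ)
        = ENNReal.ofReal ((∫ s in G, wL L s ∂μ) / (μ G).toReal) * ENNReal.ofReal (μ G).toReal := by
          rw [← ENNReal.ofReal_mul (div_nonneg (integral_nonneg (h0 L)) hmpos.le),
            div_mul_cancel₀ _ hmpos.ne']
      _ ≤ _ := by gcongr
  refine ⟨hw.aestronglyMeasurable, ?_⟩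
  have hlim : Tendsto (fun L : ℕ => ∫⁻ s in G, ENNReal.ofReal (wL L s) ∂μ) atTop
      (𝓝 (∫⁻ s in G, ‖w s‖ₑ ∂μ)) := by
    refine lintegral_tendsto_of_tendsto_of_monotone
      (fun L => (hwL L).ennreal_ofReal.aemeasurable) (Eventually.of_forall fun s L L' h => ?_)
      (Eventually.of_forall fun s => ?_)
    · exact ENNReal.ofReal_le_ofReal (min_le_min le_rfl (by exact_mod_cast h))
    · refine tendsto_const_nhds.congr' ?_
      filter_upwards [eventually_ge_atTop ⌈|w s|⌉₊] with L hL
      rw [Real.enorm_eq_ofReal_abs]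
      simp only [wL]
      rw [min_eq_left ((Nat.le_ceil _).trans (by exact_mod_cast hL))]
  refine lt_of_le_of_lt (le_of_tendsto hlim (Eventually.of_forall fun L => ?_))
    (b := X.N w / X.N (G.indicator fun _ => (1 : ℝ)) * ENNReal.ofReal (μ G).toReal) ?_
  · rw [← ofReal_integral_eq_lintegral_ofReal _ (Eventually.of_forall (h0 L))]
    · exact hb L
    · have : IsFiniteMeasure (μ.restrict G) := ⟨by simpa using hGfin⟩
      refine Integrable.of_bound (hwL L).aestronglyMeasurable (L : ℝ) (Eventually.of_forall fun s => ?_)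
      rw [Real.norm_of_nonneg (h0 L s)]
      exact min_le_right _ _
  · exact ENNReal.mul_lt_top (ENNReal.div_lt_top hN.ne hpos.ne') ENNReal.ofReal_lt_top

theorem N_avg_le (hX : X.IsRearrangementInvariant) {G : Set Ω} {w : Ω → ℝ}
    (hG : MeasurableSet G) (hGfin : μ G < ∞) (hGpos : μ G ≠ 0) (hw : Measurable w)
    (h0 : ∀ s, 0 ≤ w s) :
    X.N (fun s => G.indicator (fun _ => (∫ s in G, w s ∂μ) / (μ G).toReal) s +
      Gᶜ.indicator w s) ≤ X.N w := by
  rcases eq_or_ne (X.N w) ∞ with hN | hN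
  · rw [hN]
    exact le_top
  have hint := M.integrableOn_of_N_lt_top hX hG hGfin hw hN.lt_top
  let wL : ℕ → Ω → ℝ := fun L s => min (w s) L
  have hwL : ∀ L, Measurable (wL L) := fun L => hw.min measurable_const
  have hL0 : ∀ L s, 0 ≤ wL L s := fun L s => le_min (h0 s) (Nat.cast_nonneg _)
  have hev : ∀ s, Tendsto (fun L => wL L s) atTop (𝓝 (w s)) := fun s => by
    refine tendsto_const_nhds.congr' ?_
    filter_upwards [eventually_ge_atTop ⌈w s⌉₊] with L hL
    exact (min_eq_left ((Nat.le_ceil _).trans (by exact_mod_cast hL))).symm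
  refine N_fatou (u := fun L s => G.indicator (fun _ => (∫ s in G, wL L s ∂μ) / (μ G).toReal) s +
      Gᶜ.indicator (wL L) s) (fun L => (measurable_const.indicator hG).add
        ((hwL L).indicator hG.compl)) ((measurable_const.indicator hG).add
        (hw.indicator hG.compl)) (fun L => ?_) (Eventually.of_forall fun s => ?_)
  · refine (M.N_avg_le_of_bounded hX hG hGfin hGpos (hwL L) (hL0 L)
      (fun s => min_le_right _ _)).trans (N_mono (hwL L).aestronglyMeasurable
        (Eventually.of_forall fun s => ?_))
    rw [abs_of_nonneg (hL0 L s), abs_of_nonneg (h0 s)]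
    exact min_le_left _ _
  · by_cases hs : s ∈ G
    · simp only [indicator_of_mem hs, indicator_of_notMem (show s ∉ Gᶜ by simpa using hs)]
      refine Tendsto.add (Tendsto.div_const ?_ _) tendsto_const_nhds
      refine tendsto_integral_of_dominated_convergence w
        (fun L => (hwL L).aestronglyMeasurable) hint
        (fun L => Eventually.of_forall fun s => ?_) (Eventually.of_forall hev)
      rw [Real.norm_of_nonneg (hL0 L s)]
      exact min_le_left _ _
    · simpa [hs] using hev s

/-- Averaging over finitely many disjoint sets does not increase the norm. -/
theorem N_step_avg_le (hX : X.IsRearrangementInvariant) {F : Finset ι} {G : ι → Set Ω} {w : Ω → ℝ}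
    (hG : ∀ i ∈ F, MeasurableSet (G i)) (hd : (F : Set ι).PairwiseDisjoint G)
    (hGfin : ∀ i ∈ F, μ (G i) < ∞) (hGpos : ∀ i ∈ F, μ (G i) ≠ 0) (hw : Measurable w) :
    X.N (step F (fun i => (∫ s in G i, |w s| ∂μ) / (μ (G i)).toReal) G) ≤ X.N w := by
  classical
  set a : ι → ℝ := fun i => (∫ s in G i, |w s| ∂μ) / (μ (G i)).toReal with ha
  have ha0 : ∀ i, 0 ≤ a i := fun i =>
    div_nonneg (integral_nonneg fun _ => abs_nonneg _) ENNReal.toReal_nonneg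
  have hst0 : ∀ (F : Finset ι) s, 0 ≤ step F a G s := fun F s =>
    Finset.sum_nonneg fun i _ => indicator_nonneg (fun _ _ => ha0 i) s
  -- One set is averaged at a time: the function is already averaged on the sets of `F'` and is
  -- still `|w|` elsewhere.
  suffices h : ∀ F' ⊆ F, X.N (fun s => step F' a G s +
      (⋃ i ∈ F', G i)ᶜ.indicator (fun s => |w s|) s) ≤ X.N w by
    refine le_trans (N_mono (measurable_step hG).aestronglyMeasurable
      (Eventually.of_forall fun s => ?_)) (h F Subset.rfl)
    have h1 : 0 ≤ (⋃ i ∈ F, G i)ᶜ.indicator (fun s => |w s|) s :=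
      indicator_nonneg (fun _ _ => abs_nonneg _) s
    rw [abs_of_nonneg (hst0 F s), abs_of_nonneg (add_nonneg (hst0 F s) h1)]
    linarith
  intro F'
  induction F' using Finset.induction_on with
  | empty =>
    intro _
    simp only [Finset.notMem_empty, iUnion_of_empty, iUnion_empty, compl_empty, indicator_univ,
      step, Finset.sum_empty, zero_add]
    exact (N_abs hw.aestronglyMeasurable).le
  | insert j F' hj ih =>
    intro hF
    have hjF : j ∈ F := hF (Finset.mem_insert_self _ _)
    have hF' : F' ⊆ F := (Finset.subset_insert _ _).trans hF
    set w' : Ω → ℝ := fun s => step F' a G s + (⋃ i ∈ F', G i)ᶜ.indicator (fun s => |w s|) s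
    have hw' : Measurable w' := (measurable_step fun i hi => hG i (hF' hi)).add
      (hw.abs.indicator (Finset.measurableSet_biUnion _ fun i hi => hG i (hF' hi)).compl)
    have h0' : ∀ s, 0 ≤ w' s := fun s =>
      add_nonneg (hst0 F' s) (indicator_nonneg (fun _ _ => abs_nonneg _) s)
    have hnot : ∀ s ∈ G j, ∀ i ∈ F', s ∉ G i := fun s hs i hi hsi =>
      Set.disjoint_left.1 (hd (hF' hi) hjF fun h => hj (h ▸ hi)) hsi hs
    have hwj : ∀ s ∈ G j, w' s = |w s| := fun s hs => by
      have : s ∈ (⋃ i ∈ F', G i)ᶜ := by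
        simpa using hnot s hs
      simp only [w', step_of_notMem (hnot s hs), zero_add, indicator_of_mem this]
    have hint : ∫ s in G j, w' s ∂μ = ∫ s in G j, |w s| ∂μ :=
      setIntegral_congr_fun (hG j hjF) hwj
    refine le_trans (le_of_eq (congrArg X.N (funext fun s => ?_)))
      ((M.N_avg_le hX (hG j hjF) (hGfin j hjF) (hGpos j hjF) hw' h0').trans (ih hF'))
    rw [hint]
    change _ = (G j).indicator (fun _ => a j) s + _
    by_cases hs : s ∈ G j
    · have h2 : s ∉ (⋃ i ∈ insert j F', G i)ᶜ := by
        simp [hs]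
      simp only [indicator_of_mem hs, indicator_of_notMem h2,
        indicator_of_notMem (show s ∉ (G j)ᶜ by simpa using hs), step,
        Finset.sum_insert hj, add_zero]
      rw [← step, step_of_notMem (hnot s hs), add_zero]
    · have h2 : s ∈ (⋃ i ∈ insert j F', G i)ᶜ ↔ s ∈ (⋃ i ∈ F', G i)ᶜ := by
        simp [hs]
      simp only [indicator_of_notMem hs, indicator_of_mem (show s ∈ (G j)ᶜ from hs), w', step,
        Finset.sum_insert hj, zero_add]
      congr 1
      by_cases h3 : s ∈ (⋃ i ∈ F', G i)ᶜ
      · rw [indicator_of_mem h3, indicator_of_mem (h2.2 h3)]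
      · rw [indicator_of_notMem h3, indicator_of_notMem (fun h => h3 (h2.1 h))]

end DyadicModel

end Averaging

/-! ### Dyadic level sets of a function -/

/-- Recursion from `n₀` in both directions. Steps up and steps down need different information,
hence two invariants, which both hold at `n₀`. -/
theorem exists_int_seq {α : Type*} (R : α → α → Prop) (Pu Pd : ℤ → α → Prop) (n₀ : ℤ) (a₀ : α)
    (hu₀ : Pu n₀ a₀) (hd₀ : Pd n₀ a₀)
    (hu : ∀ k, n₀ ≤ k → ∀ a, Pu k a → ∃ b, Pu (k + 1) b ∧ R a b)
    (hd : ∀ k, k ≤ n₀ → ∀ a, Pd k a → ∃ b, Pd (k - 1) b ∧ R b a) :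
    ∃ H : ℤ → α, (∀ k, n₀ ≤ k → Pu k (H k)) ∧ (∀ k, k ≤ n₀ → Pd k (H k)) ∧
      ∀ k, R (H k) (H (k + 1)) := by
  classical
  have e1 : ∀ (n : ℕ), n₀ + (n : ℤ) + 1 = n₀ + ((n + 1 : ℕ) : ℤ) := fun n => by push_cast; ring
  have e2 : ∀ (n : ℕ), n₀ - (n : ℤ) - 1 = n₀ - ((n + 1 : ℕ) : ℤ) := fun n => by push_cast; ring
  have hu' : ∀ (n : ℕ) (a : α), Pu (n₀ + n) a → ∃ b, Pu (n₀ + (n + 1 : ℕ)) b ∧ R a b :=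
    fun n a ha => by rw [← e1]; exact hu _ (by omega) a ha
  have hd' : ∀ (n : ℕ) (a : α), Pd (n₀ - n) a → ∃ b, Pd (n₀ - (n + 1 : ℕ)) b ∧ R b a :=
    fun n a ha => by rw [← e2]; exact hd _ (by omega) a ha
  choose! fu hfu hfuR using hu'
  choose! fd hfd hfdR using hd'
  let U : ℕ → α := fun n => Nat.rec a₀ (fun n a => fu n a) n
  let D : ℕ → α := fun n => Nat.rec a₀ (fun n a => fd n a) n
  have hU : ∀ n : ℕ, Pu (n₀ + n) (U n) := fun n => by
    induction n with
    | zero => simpa [U] using hu₀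
    | succ n ih => exact hfu n _ ih
  have hD : ∀ n : ℕ, Pd (n₀ - n) (D n) := fun n => by
    induction n with
    | zero => simpa [D] using hd₀
    | succ n ih => exact hfd n _ ih
  refine ⟨fun k => if n₀ ≤ k then U (k - n₀).toNat else D (n₀ - k).toNat, fun k hk => ?_,
    fun k hk => ?_, fun k => ?_⟩ <;> beta_reduce
  · rw [if_pos hk]
    have := hU (k - n₀).toNat
    rwa [show n₀ + ((k - n₀).toNat : ℤ) = k by omega] at this
  · rcases hk.lt_or_eq with h | rfl
    · rw [if_neg (not_le.2 h)]
      have := hD (n₀ - k).toNat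
      rwa [show n₀ - ((n₀ - k).toNat : ℤ) = k by omega] at this
    · simpa [U] using hd₀
  · rcases lt_trichotomy (k + 1) n₀ with h | h | h
    · rw [if_neg (by omega), if_neg (by omega),
        show (n₀ - k).toNat = (n₀ - (k + 1)).toNat + 1 by omega]
      exact hfdR _ _ (hD _)
    · rw [if_neg (by omega), if_pos (by omega), show (n₀ - k).toNat = 0 + 1 by omega,
        show (k + 1 - n₀).toNat = 0 by omega]
      exact hfdR 0 _ (hD 0)
    · rw [if_pos (by omega), if_pos (by omega),
        show (k + 1 - n₀).toNat = (k - n₀).toNat + 1 by omega]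
      exact hfuR _ _ (hU _)

section Levels

variable {Ω : Type*} [MeasurableSpace Ω] {μ : Measure Ω} {κ : Ω → ℤ} {J : Set ℤ}

variable (μ) in
/-- The level `w^*(2ᵏ)` of a function: the smallest that is exceeded on a set of measure less than
`2ᵏ`. -/
def level (w : Ω → ℝ) (k : ℤ) : ℝ := sInf {r | 0 ≤ r ∧ μ {s | r < |w s|} < 2 ^ k}

variable (μ J) in
/-- All levels of the function are finite. -/
def HasLevels (w : Ω → ℝ) : Prop := ∀ k ∈ J, ∃ r, 0 ≤ r ∧ μ {s | r < |w s|} < 2 ^ k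

theorem level_nonneg (w : Ω → ℝ) (k : ℤ) : 0 ≤ level μ w k := Real.sInf_nonneg fun _ h => h.1

theorem level_le {w : Ω → ℝ} {k : ℤ} {r : ℝ} (hr : 0 ≤ r) (h : μ {s | r < |w s|} < 2 ^ k) :
    level μ w k ≤ r :=
  csInf_le (s := {r | 0 ≤ r ∧ μ {s | r < |w s|} < 2 ^ k}) ⟨0, fun _ h => h.1⟩ ⟨hr, h⟩

theorem two_pow_le_of_lt_level {w : Ω → ℝ} {k : ℤ} {r : ℝ} (hr : 0 ≤ r) (h : r < level μ w k) :
    2 ^ k ≤ μ {s | r < |w s|} := by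
  by_contra hlt
  exact absurd (level_le hr (not_le.1 hlt)) (not_le.2 h)

theorem HasLevels.lt_of_level_lt {w : Ω → ℝ} (hw : HasLevels μ J w) {k : ℤ} (hk : k ∈ J) {r : ℝ}
    (h : level μ w k < r) : μ {s | r < |w s|} < 2 ^ k := by
  obtain ⟨q, ⟨-, hq⟩, hqr⟩ := exists_lt_of_csInf_lt (hw k hk) h
  exact (measure_mono fun s (hs : r < _) => hqr.trans hs).trans_lt hq

theorem measurableSet_lt_abs {w : Ω → ℝ} (hwm : Measurable w) (r : ℝ) :
    MeasurableSet {s | r < |w s|} := measurableSet_lt measurable_const hwm.abs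

omit [MeasurableSpace Ω] in
theorem lt_abs_eq_iUnion (w : Ω → ℝ) (r : ℝ) :
    {s | r < |w s|} = ⋃ i : ℕ, {s | r + 1 / ((i : ℝ) + 1) < |w s|} := by
  ext s
  simp only [mem_ofPred_eq, mem_iUnion]
  constructor
  · intro h
    obtain ⟨i, hi⟩ := exists_nat_one_div_lt (sub_pos.2 h)
    exact ⟨i, by linarith⟩
  · rintro ⟨i, hi⟩
    have : (0 : ℝ) < 1 / ((i : ℝ) + 1) := by positivity
    linarith

theorem HasLevels.measure_le {w : Ω → ℝ} (hw : HasLevels μ J w) {k : ℤ} (hk : k ∈ J) :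
    μ {s | level μ w k < |w s|} ≤ 2 ^ k := by
  rw [lt_abs_eq_iUnion, Monotone.measure_iUnion]
  · refine iSup_le fun i => (hw.lt_of_level_lt hk ?_).le
    have : (0 : ℝ) < 1 / ((i : ℝ) + 1) := by positivity
    linarith
  · intro i j hij s hs
    have : 1 / ((j : ℝ) + 1) ≤ 1 / ((i : ℝ) + 1) := by
      gcongr
    simp only [mem_ofPred_eq] at hs ⊢
    linarith

theorem HasLevels.antitone {w : Ω → ℝ} (hw : HasLevels μ J w) {k l : ℤ} (hk : k ∈ J)
    (hkl : k ≤ l) : level μ w l ≤ level μ w k := by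
  refine le_csInf (hw k hk) fun r hr => level_le hr.1 (hr.2.trans_le ?_)
  exact ENNReal.zpow_le_of_le (by simp) hkl

variable (M : DyadicModel μ κ J)

include M

/-- Half of the level replaces the level because, on a space of infinite measure, the level need not
be attained: for `w s = s / (1 + s)` on the half-line all levels are 1, and `w < 1` everywhere. -/
theorem DyadicModel.two_pow_le_half (w : Ω → ℝ) {k : ℤ} (hk : k ∈ J) :
    2 ^ k ≤ μ {s | level μ w k / 2 ≤ |w s|} := by
  rcases (level_nonneg (μ := μ) w k).eq_or_lt with h | h
  · rw [← h, zero_div]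
    have : {s | 0 ≤ |w s|} = univ := by ext; simp
    rw [this]
    exact M.two_pow_le k hk
  · refine (two_pow_le_of_lt_level (w := w) (r := level μ w k / 2) (by positivity)
      (half_lt_self h)).trans ?_
    exact measure_mono fun s (hs : level μ w k / 2 < |w s|) =>
      show level μ w k / 2 ≤ |w s| from hs.le

theorem DyadicModel.exists_between {A B : Set Ω} (hA : MeasurableSet A) (hB : MeasurableSet B)
    (hAB : A ⊆ B) {k : ℤ} (hk : k ∈ J) (h1 : μ A ≤ 2 ^ k) (h2 : 2 ^ k ≤ μ B) :
    ∃ C, MeasurableSet C ∧ A ⊆ C ∧ C ⊆ B ∧ μ C = 2 ^ k := by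
  rw [← M.block k hk] at h1 h2 ⊢
  exact M.split A B (κ ⁻¹' {k}) hA hB (M.ms_pre _) hAB h1 h2 (M.block_lt_top k)

theorem DyadicModel.exists_nested {w : Ω → ℝ} (hwm : Measurable w) (hw : HasLevels μ J w) :
    ∃ H : ℤ → Set Ω, (∀ k, MeasurableSet (H k)) ∧ Monotone H ∧
      ∀ k ∈ J, μ (H k) = 2 ^ k ∧ ∀ s ∈ H k, level μ w k / 2 ≤ |w s| := by
  obtain ⟨n₀, hn₀⟩ := M.nonempty
  have hle : ∀ k, {s | level μ w k < |w s|} ⊆ {s | level μ w k / 2 ≤ |w s|} := fun k s hs => by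
    have := level_nonneg (μ := μ) w k
    simp only [mem_ofPred_eq] at hs ⊢
    linarith
  have hmU : ∀ k, MeasurableSet {s | level μ w k / 2 ≤ |w s|} := fun k =>
    measurableSet_le measurable_const hwm.abs
  obtain ⟨A₀, hA₀, h1, h2, h3⟩ := M.exists_between (measurableSet_lt_abs hwm _) (hmU n₀) (hle n₀)
    hn₀ (hw.measure_le hn₀) (M.two_pow_le_half w hn₀)
  let Pu : ℤ → Set Ω → Prop := fun k A => MeasurableSet A ∧ (k ∈ J → μ A = 2 ^ k ∧ A ⊆ {s | level μ w k / 2 ≤ |w s|})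
  -- On the way down the set must also contain all points above the level, which leaves enough room
  -- for the next, smaller set. On the way up only the lower bound on `|w|` matters.
  let Pd : ℤ → Set Ω → Prop := fun k A => MeasurableSet A ∧ (k ∈ J → μ A = 2 ^ k ∧
    A ⊆ {s | level μ w k / 2 ≤ |w s|} ∧ {s | level μ w k < |w s|} ⊆ A)
  have hup : ∀ k, n₀ ≤ k → ∀ A, Pu k A → ∃ B, Pu (k + 1) B ∧ A ⊆ B := by
    rintro k hk A ⟨hA, hAk⟩
    by_cases hk1 : k + 1 ∈ J
    · have hkJ : k ∈ J := M.ordConnected.out hn₀ hk1 ⟨hk, by omega⟩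
      obtain ⟨h1, h2⟩ := hAk hkJ
      have hanti := hw.antitone hkJ (show k ≤ k + 1 by omega)
      obtain ⟨C, hC, hAC, hCB, hCm⟩ := M.exists_between hA (hmU (k + 1)) (fun s hs => by
        have : level μ w k / 2 ≤ |w s| := h2 hs
        simp only [mem_ofPred_eq]
        linarith) hk1 (by
          rw [h1]
          exact ENNReal.zpow_le_of_le (by simp) (by omega)) (M.two_pow_le_half w hk1)
      exact ⟨C, ⟨hC, fun _ => ⟨hCm, hCB⟩⟩, hAC⟩
    · exact ⟨A, ⟨hA, fun h => absurd h hk1⟩, Subset.rfl⟩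
  have hdown : ∀ k, k ≤ n₀ → ∀ A, Pd k A → ∃ B, Pd (k - 1) B ∧ B ⊆ A := by
    rintro k hk A ⟨hA, hAk⟩
    by_cases hk1 : k - 1 ∈ J
    · have hkJ : k ∈ J := M.ordConnected.out hk1 hn₀ ⟨by omega, hk⟩
      obtain ⟨h1, h2, h3⟩ := hAk hkJ
      have hanti := hw.antitone hk1 (show k - 1 ≤ k by omega)
      obtain ⟨C, hC, hAC, hCB, hCm⟩ := M.exists_between (measurableSet_lt_abs hwm _)
        (hA.inter (hmU (k - 1))) (fun s hs => ⟨h3 (lt_of_le_of_lt hanti hs), hle _ hs⟩) hk1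
        (hw.measure_le hk1) (by
          rcases hanti.eq_or_lt with h | h
          · rw [inter_eq_left.2 (h ▸ h2), h1]
            exact ENNReal.zpow_le_of_le (by simp) (by omega)
          -- The maximum lies strictly below level `k - 1`, so it is exceeded on a set of measure at
          -- least `2 ^ (k - 1)`; the two terms of the maximum place this set in `A` and above half
          -- of level `k - 1`.
          · refine (two_pow_le_of_lt_level (w := w) (r := max (level μ w k)
              (level μ w (k - 1) / 2)) (le_max_of_le_left (level_nonneg _ _)) ?_).trans
              (measure_mono fun s
                (hs : max (level μ w k) (level μ w (k - 1) / 2) < |w s|) =>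
                ⟨h3 ((le_max_left _ _).trans_lt hs), ((le_max_right _ _).trans_lt hs).le⟩)
            refine max_lt h ?_
            have := level_nonneg (μ := μ) w k
            linarith)
      exact ⟨C, ⟨hC, fun _ => ⟨hCm, fun s hs => (hCB hs).2, hAC⟩⟩, fun s hs => (hCB hs).1⟩
    · exact ⟨A, ⟨hA, fun h => absurd h hk1⟩, Subset.rfl⟩
  obtain ⟨H, hu, hd, hR⟩ := exists_int_seq (fun A B : Set Ω => A ⊆ B) Pu Pd n₀ A₀
    ⟨hA₀, fun _ => ⟨h3, h2⟩⟩ ⟨hA₀, fun _ => ⟨h3, h2, h1⟩⟩ hup hdown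
  refine ⟨H, fun k => ?_, monotone_int_of_le_succ hR, fun k hk => ?_⟩
  · rcases le_total n₀ k with h | h
    · exact (hu k h).1
    · exact (hd k h).1
  · rcases le_total n₀ k with h | h
    · exact ⟨((hu k h).2 hk).1, fun s hs => ((hu k h).2 hk).2 hs⟩
    · exact ⟨((hd k h).2 hk).1, fun s hs => ((hd k h).2 hk).2.1 hs⟩

/-- Disjoint sets of measure about `2ᵏ` on which the function is at least half its level. -/
theorem DyadicModel.exists_blocks {w : Ω → ℝ} (hwm : Measurable w) (hw : HasLevels μ J w) :
    ∃ G H : ℤ → Set Ω, (∀ k, MeasurableSet (G k)) ∧ (∀ k, MeasurableSet (H k)) ∧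
      J.PairwiseDisjoint G ∧ (∀ k ∈ J, ∀ l, k ≤ l → G k ⊆ H l) ∧
      ∀ k ∈ J, μ (H k) = 2 ^ k ∧ μ (G k) ≤ 2 ^ k ∧ 2 ^ k ≤ 2 * μ (G k) ∧
        ∀ s ∈ G k, level μ w k / 2 ≤ |w s| := by
  classical
  obtain ⟨H, hH, hmono, hHk⟩ := M.exists_nested hwm hw
  -- Differences of consecutive nested sets have measure `2 ^ (k - 1)`, half of that of the block;
  -- at a least element of `J` the whole set is kept.
  refine ⟨fun k => if k - 1 ∈ J then H k \ H (k - 1) else H k, H, fun k => ?_, hH, ?_,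
    fun k hk l hkl => ?_, fun k hk => ⟨(hHk k hk).1, ?_, ?_, ?_⟩⟩
  · dsimp only
    split_ifs
    · exact (hH k).diff (hH _)
    · exact hH k
  · have key : ∀ k ∈ J, ∀ l ∈ J, k < l →
        Disjoint (if k - 1 ∈ J then H k \ H (k - 1) else H k)
        (if l - 1 ∈ J then H l \ H (l - 1) else H l) := fun k hk l hl hkl => by
      have : l - 1 ∈ J := M.ordConnected.out hk hl ⟨by omega, by omega⟩
      rw [if_pos this]
      refine Disjoint.mono_left (b := H k) ?_ ?_
      · split_ifs
        · exact sdiff_subset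
        · exact Subset.rfl
      · exact disjoint_sdiff_right.mono_left (hmono (by omega))
    intro k hk l hl hkl
    rcases hkl.lt_or_gt with h | h
    · exact key k hk l hl h
    · exact (key l hl k hk h).symm
  · dsimp only
    refine Subset.trans ?_ (hmono hkl)
    split_ifs
    · exact sdiff_subset
    · exact Subset.rfl
  · dsimp only
    rw [← (hHk k hk).1]
    refine measure_mono ?_
    split_ifs
    · exact sdiff_subset
    · exact Subset.rfl
  · dsimp only
    split_ifs with h
    · have h1 := (hHk _ h).1
      have h2 := (hHk k hk).1
      have h3 : (2 : ℝ≥0∞) ^ k = 2 * 2 ^ (k - 1) := by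
        rw [← two_zpow_succ, sub_add_cancel]
      rw [measure_sdiff (hmono (by omega)) (hH _).nullMeasurableSet
        (by rw [h1]; exact (two_zpow_lt_top _).ne), h1, h2, h3, two_mul ((2 : ℝ≥0∞) ^ (k - 1)),
        ENNReal.add_sub_cancel_right (two_zpow_lt_top _).ne, two_mul]
    · rw [(hHk k hk).1, two_mul]
      exact le_self_add
  · intro s hs
    refine (hHk k hk).2 s ?_
    dsimp only at hs
    split_ifs at hs
    · exact hs.1
    · exact hs

/-- The set where the function lies between two consecutive levels. -/
def levelSet (μ : Measure Ω) (J : Set ℤ) (w : Ω → ℝ) (k : ℤ) : Set Ω :=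
  {s | k ∈ J ∧ k + 1 ∈ J ∧ |w s| ≤ level μ w k ∧ level μ w (k + 1) < |w s|}

/-- The set where the function lies below all levels. -/
def levelRest (μ : Measure Ω) (J : Set ℤ) (w : Ω → ℝ) : Set Ω :=
  {s | ∀ k ∈ J, |w s| ≤ level μ w k}

omit M in
theorem measurableSet_levelSet {w : Ω → ℝ} (hwm : Measurable w) (k : ℤ) :
    MeasurableSet (levelSet μ J w k) := by
  by_cases h : k ∈ J ∧ k + 1 ∈ J
  · have : levelSet μ J w k = {s | |w s| ≤ level μ w k} ∩ {s | level μ w (k + 1) < |w s|} := by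
      ext s; simp [levelSet, h]
    rw [this]
    exact (measurableSet_le hwm.abs measurable_const).inter (measurableSet_lt_abs hwm _)
  · have : levelSet μ J w k = ∅ := by
      ext s
      simp only [levelSet, mem_ofPred_eq, mem_empty_iff_false, iff_false]
      exact fun h' => h ⟨h'.1, h'.2.1⟩
    rw [this]
    exact MeasurableSet.empty

omit M in
theorem measurableSet_levelRest {w : Ω → ℝ} (hwm : Measurable w) :
    MeasurableSet (levelRest μ J w) := by
  have : levelRest μ J w = ⋂ k ∈ J, {s | |w s| ≤ level μ w k} := by
    ext s; simp [levelRest]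
  rw [this]
  exact MeasurableSet.biInter (to_countable _) fun k _ => measurableSet_le hwm.abs measurable_const

omit M in
theorem HasLevels.lt_of_mem {w : Ω → ℝ} (hw : HasLevels μ J w) {k n : ℤ} (hn : n ∈ J) {s : Ω}
    (hs : s ∈ levelSet μ J w k) (h : level μ w n < |w s|) : k < n := by
  by_contra hkn
  exact absurd (hs.2.2.1.trans (hw.antitone hn (not_lt.1 hkn))) (not_le.2 h)

omit M in
theorem HasLevels.disjoint {w : Ω → ℝ} (hw : HasLevels μ J w) {k l : ℤ} {s : Ω}
    (hs : s ∈ levelSet μ J w k) (hs' : s ∈ levelSet μ J w l) : k = l := by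
  have h1 := hw.lt_of_mem hs'.2.1 hs hs'.2.2.2
  have h2 := hw.lt_of_mem hs.2.1 hs' hs.2.2.2
  omega

omit M in
theorem HasLevels.levelSet_le {w : Ω → ℝ} (hw : HasLevels μ J w) (k : ℤ) :
    μ (levelSet μ J w k) ≤ 2 * 2 ^ k := by
  by_cases h : k + 1 ∈ J
  · rw [← two_zpow_succ]
    exact (measure_mono fun s hs => hs.2.2.2).trans (hw.measure_le h)
  · have : levelSet μ J w k = ∅ := by
      ext s
      simp only [levelSet, mem_ofPred_eq, mem_empty_iff_false, iff_false]
      exact fun h' => h h'.2.1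
    simp [this]

/-- The set where `|w|` exceeds every level has measure at most `2 ^ j` for each `j ∈ J`, which is
less than `2 ^ k` if `j < k`. At a least index of `J`, the strict inequality holds slightly above
the level, and such sets are already null. -/
theorem DyadicModel.ae_exists_le {w : Ω → ℝ} (hwm : Measurable w) (hw : HasLevels μ J w) :
    ∀ᵐ s ∂μ, ∃ k ∈ J, |w s| ≤ level μ w k := by
  have hA : {s | ¬ ∃ k ∈ J, |w s| ≤ level μ w k} = ⋂ k ∈ J, {s | level μ w k < |w s|} := by
    ext s; simp
  have hAm : MeasurableSet (⋂ k ∈ J, {s | level μ w k < |w s|}) :=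
    MeasurableSet.biInter (to_countable _) fun k _ => measurableSet_lt_abs hwm _
  rw [ae_iff, hA]
  refine M.small _ hAm fun k hk => ?_
  by_cases hj : ∃ j ∈ J, j < k
  · obtain ⟨j, hj, hjk⟩ := hj
    calc _ ≤ μ {s | level μ w j < |w s|} := measure_mono (iInter₂_subset j hj)
      _ ≤ 2 ^ j := hw.measure_le hj
      _ < 2 * 2 ^ j := by
          rw [two_mul]
          exact ENNReal.lt_add_right (two_zpow_lt_top _).ne (two_zpow_pos _).ne'
      _ = 2 ^ (j + 1) := (two_zpow_succ j).symm
      _ ≤ 2 ^ k := ENNReal.zpow_le_of_le (by simp) (by omega)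
  · push Not at hj
    refine lt_of_le_of_lt (b := 0) ?_ (two_zpow_pos k)
    calc _ ≤ μ {s | level μ w k < |w s|} := measure_mono (iInter₂_subset k hk)
      _ = 0 := by
          rw [lt_abs_eq_iUnion, measure_iUnion_null_iff]
          refine fun i => M.small _ (measurableSet_lt_abs hwm _) fun j hj' => ?_
          refine (hw.lt_of_level_lt hk ?_).trans_le (ENNReal.zpow_le_of_le (by simp) (hj j hj'))
          have : (0 : ℝ) < 1 / ((i : ℝ) + 1) := by positivity
          linarith
      _ ≤ 0 := le_rfl

/-- Start from a level that bounds `|w s|`. Either all later levels bound it, or at the first that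
does not, the point lies in the level set just before. -/
theorem DyadicModel.ae_mem_levelSet {w : Ω → ℝ} (hwm : Measurable w) (hw : HasLevels μ J w) :
    ∀ᵐ s ∂μ, s ∈ levelRest μ J w ∨ ∃ k, s ∈ levelSet μ J w k := by
  filter_upwards [M.ae_exists_le hwm hw] with s ⟨k, hk, hks⟩
  by_contra hcon
  push Not at hcon
  obtain ⟨h1, h2⟩ := hcon
  refine h1 fun n hn => ?_
  rcases le_total n k with h | h
  · exact hks.trans (hw.antitone hn h)
  · have : ∀ n, k ≤ n → n ∈ J → |w s| ≤ level μ w n := fun n h => by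
      induction n, h using Int.leInduction with
      | base => exact fun _ => hks
      | succ n hkn ih =>
        intro hn1
        have hn : n ∈ J := M.ordConnected.out hk hn1 ⟨hkn, by omega⟩
        by_contra hlt
        exact h2 n ⟨hn, hn1, ih hn, not_le.1 hlt⟩
    exact this n h hn

end Levels

/-! ### The functional `K(t, f; X, L_∞)` -/

section KFunctional

variable {Ω : Type*} [MeasurableSpace Ω] {μ : Measure Ω} [SigmaFinite μ] {X : KotheSpace μ}
  {κ : Ω → ℤ} {J : Set ℤ}

omit [SigmaFinite μ] in
theorem N_indicator_le {A : Set Ω} (u : Ω → ℝ) (hA : MeasurableSet A)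
    (hu : AEStronglyMeasurable u μ) : X.N (A.indicator u) ≤ X.N u :=
  N_mono (hu.indicator hA) (Eventually.of_forall fun s => by
    by_cases hs : s ∈ A <;> simp [hs])

theorem N_indicator_le_linfty {A : Set Ω} (u : Ω → ℝ) (hA : MeasurableSet A)
    (hu : AEStronglyMeasurable u μ) (hfin : (linfty μ).N u ≠ ∞) :
    X.N (A.indicator u) ≤ (linfty μ).N u * X.N (A.indicator fun _ => 1) := by
  rw [← ENNReal.ofReal_toReal hfin, ← abs_of_nonneg (ENNReal.toReal_nonneg (a := (linfty μ).N u)),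
    ← N_const_mul (aestronglyMeasurable_const.indicator hA)]
  refine N_mono (hu.indicator hA) ?_
  filter_upwards [ae_le_N_linfty (μ := μ) u] with s hs
  by_cases h : s ∈ A
  · simp only [indicator_of_mem h, mul_one]
    rw [abs_of_nonneg ENNReal.toReal_nonneg]
    exact (ENNReal.ofReal_le_iff_le_toReal hfin).1 hs
  · simp [h]

/-- In a decomposition `f = x + y`, the part of `y` on `A` has norm at most `‖y‖_∞ ‖χ_A‖ ≤ s t
‖y‖_∞`. All lower estimates of the `K`-functional come from this. -/
theorem N_indicator_le_kFunctional {A : Set Ω} (hA : MeasurableSet A) {s t : ℝ≥0}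
    (hs : 1 ≤ s) (ht : 0 < t) (h : X.N (A.indicator fun _ => (1 : ℝ)) ≤ s * t) (f : Ω →ₘ[μ] ℝ) :
    X.N (A.indicator f) ≤ s * kFunctional X (linfty μ) t f := by
  have hs0 : (s : ℝ≥0∞) ≠ 0 := by
    have := (zero_lt_one.trans_le hs).ne'
    exact_mod_cast this
  have hs1 : (1 : ℝ≥0∞) ≤ s := by exact_mod_cast hs
  simp only [kFunctional, ENNReal.mul_iInf_of_ne hs0 ENNReal.coe_ne_top]
  refine le_iInf fun x => le_iInf fun y => le_iInf fun hxy => ?_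
  by_cases hy : (linfty μ).nrm y = ∞
  · have ht0 : (t : ℝ≥0∞) ≠ 0 := by exact_mod_cast ht.ne'
    rw [hy, ENNReal.mul_top ht0, add_top, ENNReal.mul_top hs0]
    exact le_top
  have e : A.indicator f =ᵐ[μ] fun a => A.indicator x a + A.indicator y a := by
    rw [← hxy]
    filter_upwards [AEEqFun.coeFn_add x y] with a ha
    by_cases h : a ∈ A <;> simp [h, ha]
  rw [N_congr e]
  refine (N_add_le _ _).trans ?_
  rw [mul_add]
  refine add_le_add ?_ ?_
  · refine (N_indicator_le _ hA x.aestronglyMeasurable).trans ?_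
    rw [N_coe]
    exact le_mul_of_one_le_left zero_le hs1
  · refine (N_indicator_le_linfty _ hA y.aestronglyMeasurable (by rwa [N_coe])).trans ?_
    rw [N_coe]
    calc _ ≤ (linfty μ).nrm y * (s * t) := by gcongr
      _ = _ := by ring

theorem kFunctional_le {t : ℝ≥0} {f : Ω →ₘ[μ] ℝ} {u v : Ω → ℝ} (hu : AEStronglyMeasurable u μ)
    (hv : AEStronglyMeasurable v μ) (h : f =ᵐ[μ] fun s => u s + v s) :
    kFunctional X (linfty μ) t f ≤ X.N u + t * (linfty μ).N v := by
  have e : AEEqFun.mk u hu + AEEqFun.mk v hv = f := by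
    refine AEEqFun.ext ?_
    filter_upwards [AEEqFun.coeFn_add (AEEqFun.mk u hu) (AEEqFun.mk v hv), h,
      AEEqFun.coeFn_mk u hu, AEEqFun.coeFn_mk v hv] with s h1 h2 h3 h4
    rw [h1, h2, Pi.add_apply, h3, h4]
  rw [N_mk hu, N_mk hv]
  exact iInf₂_le_of_le _ _ (iInf_le _ e)

theorem kFunctional_lt_top {t : ℝ≥0} {f : Ω →ₘ[μ] ℝ} (hf : f ∈ sumSpace X (linfty μ)) :
    kFunctional X (linfty μ) t f < ∞ := by
  obtain ⟨x, hx, y, hy, rfl⟩ := Submodule.mem_sup.1 hf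
  refine lt_of_le_of_lt (iInf₂_le_of_le x y (iInf_le _ rfl)) (ENNReal.add_lt_top.2 ⟨hx, ?_⟩)
  exact ENNReal.mul_lt_top ENNReal.coe_lt_top hy

theorem kFunctional_add_le (t : ℝ≥0) (f g : Ω →ₘ[μ] ℝ) :
    kFunctional X (linfty μ) t (f + g) ≤
      kFunctional X (linfty μ) t f + kFunctional X (linfty μ) t g := by
  simp only [kFunctional, ENNReal.iInf_add, ENNReal.add_iInf]
  refine le_iInf fun x => le_iInf fun y => le_iInf fun hxy => ?_
  refine le_iInf fun x' => le_iInf fun y' => le_iInf fun hxy' => ?_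
  refine (iInf₂_le_of_le (x + x') (y + y') (iInf_le _ ?_)).trans ?_
  · rw [← hxy, ← hxy']
    abel
  · calc _ ≤ (X.nrm x + X.nrm x') + t * ((linfty μ).nrm y + (linfty μ).nrm y') := by
          gcongr
          · exact X.nrm_add_le _ _
          · exact (linfty μ).nrm_add_le _ _
      _ = _ := by ring

theorem kFunctional_smul_le (t : ℝ≥0) {c : ℝ} (hc : c ≠ 0) (f : Ω →ₘ[μ] ℝ) :
    kFunctional X (linfty μ) t (c • f) ≤ ENNReal.ofReal |c| * kFunctional X (linfty μ) t f := by
  have h0 : ENNReal.ofReal |c| ≠ 0 := by simpa using hc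
  simp only [kFunctional, ENNReal.mul_iInf_of_ne h0 ENNReal.ofReal_ne_top]
  refine le_iInf fun x => le_iInf fun y => le_iInf fun hxy => ?_
  refine (iInf₂_le_of_le (c • x) (c • y) (iInf_le _ ?_)).trans ?_
  · rw [← hxy, smul_add]
  · rw [X.nrm_smul, (linfty μ).nrm_smul]
    exact le_of_eq (by ring)

theorem kFunctional_le_nrm (t : ℝ≥0) (f : Ω →ₘ[μ] ℝ) :
    kFunctional X (linfty μ) t f ≤ X.nrm f := by
  refine (iInf₂_le_of_le f 0 (iInf_le _ (add_zero f))).trans ?_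
  rw [((linfty μ).nrm_eq_zero_iff 0).2 rfl]
  simp

theorem kFunctional_le_linfty (t : ℝ≥0) (f : Ω →ₘ[μ] ℝ) :
    kFunctional X (linfty μ) t f ≤ t * (linfty μ).nrm f := by
  refine (iInf₂_le_of_le 0 f (iInf_le _ (zero_add f))).trans ?_
  rw [(X.nrm_eq_zero_iff 0).2 rfl]
  simp

/-- That is, `K(t, f) / t` decreases, which makes its limit for large `t` a meaningful seminorm. -/
theorem kFunctional_le_div_mul {s t : ℝ≥0} (hs : 0 < s) (hst : s ≤ t) (f : Ω →ₘ[μ] ℝ) :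
    s * kFunctional X (linfty μ) t f ≤ t * kFunctional X (linfty μ) s f := by
  have hs0 : (s : ℝ≥0∞) ≠ 0 := by exact_mod_cast hs.ne'
  have ht0 : (t : ℝ≥0∞) ≠ 0 := by exact_mod_cast (hs.trans_le hst).ne'
  simp only [kFunctional, ENNReal.mul_iInf_of_ne ht0 ENNReal.coe_ne_top]
  refine le_iInf fun x => le_iInf fun y => le_iInf fun hxy => ?_
  refine (mul_le_mul_right (iInf₂_le_of_le x y (iInf_le _ hxy)) _).trans ?_
  rw [mul_add, mul_add, mul_left_comm (s : ℝ≥0∞)]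
  gcongr

omit [SigmaFinite μ] in
-- Otherwise `|x| > n` on a set at least as large as block `k`, for every `n`, and `n e_k ≤ ‖x‖` for
-- all `n`.
theorem DyadicModel.measure_lt_two_pow (M : DyadicModel μ κ J) (hX : X.IsRearrangementInvariant)
    {x : Ω →ₘ[μ] ℝ} (hx : X.nrm x < ∞) {k : ℤ} (hk : k ∈ J) :
    ∃ r : ℝ, 0 ≤ r ∧ μ {s | r < |x s|} < 2 ^ k := by
  by_contra! hcon
  have hxm : Measurable x := x.measurable
  have h : ∀ n : ℕ, (n : ℝ≥0∞) * X.e κ k ≤ X.nrm x := fun n => by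
    have h1 : X.e κ k ≤ X.N ({s | (n : ℝ) < |x s|}.indicator fun _ => 1) :=
      N_set_le M hX (M.ms_pre _) (measurableSet_lt_abs hxm _)
        (by rw [M.block k hk]; exact hcon n n.cast_nonneg) (M.block_lt_top k)
    calc (n : ℝ≥0∞) * X.e κ k ≤ n * X.N ({s | (n : ℝ) < |x s|}.indicator fun _ => 1) := by
          gcongr
      _ = X.N (fun s => (n : ℝ) * {s | (n : ℝ) < |x s|}.indicator (fun _ => 1) s) := by
          rw [N_const_mul (aestronglyMeasurable_const.indicator (measurableSet_lt_abs hxm _))]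
          simp
      _ ≤ X.N x := by
          refine N_mono ((aestronglyMeasurable_const.indicator
            (measurableSet_lt_abs hxm _)).const_mul _) (Eventually.of_forall fun s => ?_)
          by_cases hs : (n : ℝ) < |x s|
          · simp only [indicator, mem_ofPred_eq, hs, if_true, mul_one, Nat.abs_cast]
            exact hs.le
          · simp [indicator, hs]
      _ = X.nrm x := N_coe x
  have h0 : X.e κ k ≠ 0 := (M.e_pos hk).ne'
  obtain ⟨n, hn⟩ := ENNReal.exists_nat_mul_gt h0 hx.ne
  exact absurd (h n) (not_le.2 hn)

theorem DyadicModel.hasLevels (M : DyadicModel μ κ J) (hX : X.IsRearrangementInvariant)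
    {f : Ω →ₘ[μ] ℝ} (hf : f ∈ sumSpace X (linfty μ)) : HasLevels μ J f := by
  intro k hk
  obtain ⟨x, hx, y, hy, rfl⟩ := Submodule.mem_sup.1 hf
  obtain ⟨r, hr, hxr⟩ := M.measure_lt_two_pow hX hx hk
  have hy' : (linfty μ).N y ≠ ∞ := by
    rw [N_coe]; exact ne_of_lt hy
  refine ⟨r + ((linfty μ).N y).toReal, add_nonneg hr ENNReal.toReal_nonneg,
    lt_of_le_of_lt (measure_mono_ae ?_) hxr⟩
  filter_upwards [ae_le_N_linfty (μ := μ) y, AEEqFun.coeFn_add x y] with s h1 h2 h3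
  rw [ENNReal.ofReal_le_iff_le_toReal hy'] at h1
  change r + ((linfty μ).N y).toReal < |(x + y : Ω →ₘ[μ] ℝ) s| at h3
  change r < |x s|
  rw [h2, Pi.add_apply] at h3
  have := abs_add_le (x s) (y s)
  linarith

omit [SigmaFinite μ] in
/-- Domination of a function by a sequence along the level sets of another function. -/
theorem DyadicModel.N_le_two_NE (M : DyadicModel μ κ J) (hX : X.IsRearrangementInvariant)
    {w : Ω → ℝ} (hwm : Measurable w) (hw : HasLevels μ J w) {u : Ω → ℝ} (hu : Measurable u)
    {ξ : ℤ → ℝ} (h : ∀ k, ∀ s ∈ levelSet μ J w k, |u s| ≤ |ξ k|)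
    (h0 : ∀ᵐ s ∂μ, (∀ k, s ∉ levelSet μ J w k) → u s = 0) : X.N u ≤ 2 * X.NE κ ξ := by
  have hdis : ∀ F : Finset ℤ, (F : Set ℤ).PairwiseDisjoint (levelSet μ J w) :=
    fun F k _ l _ hkl => Set.disjoint_left.2 fun s hs hs' => hkl (hw.disjoint hs hs')
  have hmU : ∀ i : ℕ, MeasurableSet (⋃ k ∈ Finset.Icc (-i : ℤ) i, levelSet μ J w k) := fun i =>
    Finset.measurableSet_biUnion _ fun k _ => measurableSet_levelSet hwm k
  refine N_fatou (u := fun (i : ℕ) => (⋃ k ∈ Finset.Icc (-i : ℤ) i, levelSet μ J w k).indicator u)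
    (fun i => hu.indicator (hmU i)) hu (fun i => ?_) ?_
  · have hd2 : ((Finset.Icc (-i : ℤ) i : Finset ℤ) : Set ℤ).PairwiseDisjoint
        (fun k => κ ⁻¹' {k}) := fun i _ j _ hij => Disjoint.preimage κ (by simpa using hij)
    calc _ ≤ X.N (step (Finset.Icc (-i : ℤ) i) ξ (levelSet μ J w)) := by
          refine N_mono (hu.indicator (hmU i)).aestronglyMeasurable
            (Eventually.of_forall fun s => ?_)
          by_cases hs : ∃ k ∈ Finset.Icc (-i : ℤ) i, s ∈ levelSet μ J w k
          · obtain ⟨k, hk, hsk⟩ := hs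
            rw [step_of_mem (hdis _) hk hsk, indicator_of_mem (mem_iUnion₂.2 ⟨k, hk, hsk⟩)]
            exact h k s hsk
          · rw [indicator_of_notMem (by simpa using hs), abs_zero]
            exact abs_nonneg _
      _ ≤ 2 * X.N (step (Finset.Icc (-i : ℤ) i) ξ (fun k => κ ⁻¹' {k})) := by
          refine N_step_le_two M hX (fun k _ => measurableSet_levelSet hwm k) (hdis _)
            (fun k _ => M.ms_pre _) hd2 (fun k _ => ?_) (fun k _ => M.block_lt_top k)
          by_cases hk : k ∈ J
          · rw [M.block k hk]
            exact hw.levelSet_le k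
          · have : levelSet μ J w k = ∅ := by
              ext s
              simp only [levelSet, mem_ofPred_eq, mem_empty_iff_false, iff_false]
              exact fun h' => hk h'.1
            simp [this]
      _ = 2 * X.NE κ ((Icc (-i : ℤ) i).indicator ξ) := by
          rw [DyadicModel.NE_eq_step (F := Finset.Icc (-i : ℤ) i)
            (ξ := (Icc (-i : ℤ) i).indicator ξ)]
          · congr 2
            refine funext fun s => Finset.sum_congr rfl fun k hk => ?_
            rw [indicator_of_mem (s := Icc (-i : ℤ) i) (by simpa using hk)]
          · intro k hk
            exact indicator_of_notMem (by simpa using hk) _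
      _ ≤ 2 * X.NE κ ξ := by
          gcongr
          refine M.NE_mono fun k _ => ?_
          by_cases hk : k ∈ Icc (-i : ℤ) i
          · rw [indicator_of_mem hk]
          · rw [indicator_of_notMem hk, abs_zero]
            exact abs_nonneg _
  · filter_upwards [h0] with s hs
    by_cases hk : ∃ k, s ∈ levelSet μ J w k
    · obtain ⟨k, hk⟩ := hk
      refine tendsto_const_nhds.congr' ?_
      filter_upwards [eventually_ge_atTop k.natAbs] with n hn
      rw [indicator_of_mem]
      refine mem_iUnion₂.2 ⟨k, ?_, hk⟩
      rw [Finset.mem_Icc]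
      omega
    · push Not at hk
      have hs0 := hs hk
      refine tendsto_const_nhds.congr fun n => ?_
      by_cases hn : s ∈ ⋃ k ∈ Finset.Icc (-n : ℤ) n, levelSet μ J w k
      · rw [indicator_of_mem hn]
      · rw [indicator_of_notMem hn, hs0]

omit [SigmaFinite μ] in
/-- Domination of a sequence by a function along a disjoint family of sets. -/
theorem DyadicModel.NE_le_two_N (M : DyadicModel μ κ J) (hX : X.IsRearrangementInvariant)
    {G : ℤ → Set Ω} (hG : ∀ k, MeasurableSet (G k)) (hd : J.PairwiseDisjoint G)
    (hμG : ∀ k ∈ J, 2 ^ k ≤ 2 * μ (G k)) (hfin : ∀ k ∈ J, μ (G k) < ∞) {v : Ω → ℝ} {ξ : ℤ → ℝ}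
    (h : ∀ k ∈ J, ∀ s ∈ G k, |ξ k| ≤ |v s|) : X.NE κ ξ ≤ 2 * X.N v := by
  classical
  refine M.NE_fatou fun n => ?_
  set F : Finset ℤ := (Finset.Icc (-n : ℤ) n).filter (· ∈ J) with hF
  have hFJ : ∀ k ∈ F, k ∈ J := fun k hk => (Finset.mem_filter.1 hk).2
  have hdF : (F : Set ℤ).PairwiseDisjoint G := hd.subset hFJ
  have e : X.NE κ ((Icc (-n : ℤ) n).indicator ξ) = X.N (step F ξ fun k => κ ⁻¹' {k}) := by
    rw [M.NE_congr (η := (F : Set ℤ).indicator ξ), DyadicModel.NE_eq_step (F := F)]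
    · refine congrArg X.N (funext fun s => Finset.sum_congr rfl fun k hk => ?_)
      rw [indicator_of_mem (s := (F : Set ℤ)) hk]
    · intro k hk
      exact indicator_of_notMem (by simpa using hk) _
    · intro k hk
      by_cases hk' : k ∈ Icc (-n : ℤ) n
      · rw [indicator_of_mem hk', indicator_of_mem]
        simp only [hF, Finset.coe_filter, Finset.mem_Icc]
        exact ⟨hk', hk⟩
      · rw [indicator_of_notMem hk', indicator_of_notMem]
        simp only [hF, Finset.coe_filter, Finset.mem_Icc]
        exact fun h => hk' h.1
  rw [e]
  refine (N_step_le_two M hX (B := G) (fun k _ => M.ms_pre _)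
    (fun i _ j _ hij => Disjoint.preimage κ (by simpa using hij)) (fun k _ => hG k) hdF
    (fun k hk => ?_) (fun k hk => hfin k (hFJ k hk))).trans ?_
  · rw [M.block k (hFJ k hk)]
    exact hμG k (hFJ k hk)
  · gcongr
    exact N_mono (measurable_step fun k _ => hG k).aestronglyMeasurable
      (Eventually.of_forall (abs_step_le hdF fun k hk s hs => h k (hFJ k hk) s hs))

/-- The norms of the initial segments of the sequence of levels are bounded by the
`K`-functional. -/
theorem DyadicModel.NE_level_le (M : DyadicModel μ κ J) (hX : X.IsRearrangementInvariant)
    {f : Ω →ₘ[μ] ℝ} (hf : f ∈ sumSpace X (linfty μ)) {n : ℤ} (hn : n ∈ J) {t : ℝ≥0} (ht : 0 < t)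
    (hT : X.e κ n ≤ t) :
    X.NE κ ((Iic n).indicator (level μ f)) ≤ 4 * kFunctional X (linfty μ) t f := by
  have hfm : Measurable f := f.measurable
  obtain ⟨G, H, hG, hH, hd, hGH, hGk⟩ := M.exists_blocks hfm (M.hasLevels hX hf)
  have hHm : Measurable ((H n).indicator f) := hfm.indicator (hH n)
  -- Two factors 2: `G k` may have only half the measure of block `k`, and `|f|` may be only half of
  -- the level there.
  have h1 : X.NE κ ((Iic n).indicator (level μ f)) ≤
      2 * X.N (fun s => 2 * (H n).indicator f s) := by
    refine M.NE_le_two_N hX hG hd (fun k hk => (hGk k hk).2.2.1)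
      (fun k hk => (hGk k hk).2.1.trans_lt (two_zpow_lt_top k)) fun k hk s hs => ?_
    by_cases hkn : k ≤ n
    · rw [indicator_of_mem (show k ∈ Iic n from hkn), indicator_of_mem (hGH k hk n hkn hs), abs_mul,
        abs_of_nonneg (level_nonneg _ _), abs_two]
      have := (hGk k hk).2.2.2 s hs
      linarith
    · rw [indicator_of_notMem (show k ∉ Iic n from hkn), abs_zero]
      exact abs_nonneg _
  refine h1.trans ?_
  rw [N_const_mul hHm.aestronglyMeasurable, abs_two, ENNReal.ofReal_ofNat, ← mul_assoc]
  have h2 : X.N ((H n).indicator f) ≤ (1 : ℝ≥0) * kFunctional X (linfty μ) t f := by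
    refine N_indicator_le_kFunctional (hH n) le_rfl ht ?_ f
    rw [ENNReal.coe_one, one_mul]
    refine le_trans ?_ hT
    exact N_set_le M hX (hH n) (M.ms_pre _) (by rw [(hGk n hn).1, M.block n hn])
      (by rw [(hGk n hn).1]; exact two_zpow_lt_top n)
  rw [ENNReal.coe_one, one_mul] at h2
  calc _ ≤ 2 * 2 * kFunctional X (linfty μ) t f := by gcongr
    _ = _ := by norm_num

omit [SigmaFinite μ] in
theorem DyadicModel.level_mul_T_le (M : DyadicModel μ κ J) (hX : X.IsRearrangementInvariant)
    {w : Ω → ℝ} {n : ℤ} (hn : n ∈ J) :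
    ENNReal.ofReal (level μ w n) * X.T κ n ≤ 2 * X.NE κ ((Iic n).indicator (level μ w)) := by
  have h := M.NE_coord (X := X) ((Iic n).indicator (level μ w)) n
  rw [indicator_of_mem (by simp), abs_of_nonneg (level_nonneg _ _)] at h
  calc _ ≤ ENNReal.ofReal (level μ w n) * (2 * X.e κ n) := by
        gcongr
        exact M.T_le_two_e hX hn
    _ = 2 * (ENNReal.ofReal (level μ w n) * X.e κ n) := by ring
    _ ≤ _ := by gcongr

/-- The `K`-functional is bounded by the norm of an initial segment of the sequence of levels. -/
theorem DyadicModel.kFunctional_le_NE (M : DyadicModel μ κ J) (hX : X.IsRearrangementInvariant)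
    {f : Ω →ₘ[μ] ℝ} (hf : f ∈ sumSpace X (linfty μ)) {n : ℤ} (hn : n ∈ J) {t : ℝ≥0}
    (hT : t ≤ X.T κ n) :
    kFunctional X (linfty μ) t f ≤ 4 * X.NE κ ((Iic n).indicator (level μ f)) := by
  have hfm : Measurable f := f.measurable
  have hw := M.hasLevels hX hf
  -- The near-optimal decomposition: `f` on the set where it exceeds its `n`-th level is put in `X`,
  -- the rest is bounded by that level.
  set A : Set Ω := {s | level μ f n < |f s|}
  have hA : MeasurableSet A := measurableSet_lt_abs hfm _
  have hu : Measurable (A.indicator f) := hfm.indicator hA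
  have hv : Measurable (Aᶜ.indicator f) := hfm.indicator hA.compl
  refine (kFunctional_le hu.aestronglyMeasurable hv.aestronglyMeasurable
    (Eventually.of_forall fun s => ?_)).trans ?_
  · by_cases hs : s ∈ A
    · simp [hs]
    · simp [hs]
  have h1 : X.N (A.indicator f) ≤ 2 * X.NE κ ((Iic n).indicator (level μ f)) := by
    refine M.N_le_two_NE hX hfm hw hu (fun k s hs => ?_) ?_
    · by_cases hsA : s ∈ A
      · have hkn : k < n := hw.lt_of_mem hn hs hsA
        rw [indicator_of_mem hsA, indicator_of_mem (show k ∈ Iic n from hkn.le),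
          abs_of_nonneg (level_nonneg _ _)]
        exact hs.2.2.1
      · rw [indicator_of_notMem hsA, abs_zero]
        exact abs_nonneg _
    · filter_upwards [M.ae_mem_levelSet hfm hw] with s hs hk
      rcases hs with hs | ⟨k, hk'⟩
      · refine indicator_of_notMem (fun hsA => ?_) _
        exact absurd (hs n hn) (not_le.2 hsA)
      · exact absurd hk' (hk k)
  have h2 : (linfty μ).N (Aᶜ.indicator f) ≤ ENNReal.ofReal (level μ f n) := by
    refine N_linfty_le hv.aestronglyMeasurable (Eventually.of_forall fun s => ?_)
    refine ENNReal.ofReal_le_ofReal ?_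
    by_cases hs : s ∈ A
    · simpa [hs] using level_nonneg _ _
    · rw [indicator_of_mem (show s ∈ Aᶜ from hs)]
      exact not_lt.1 hs
  calc _ ≤ 2 * X.NE κ ((Iic n).indicator (level μ f)) +
        X.T κ n * ENNReal.ofReal (level μ f n) := by gcongr
    _ ≤ 2 * X.NE κ ((Iic n).indicator (level μ f)) +
        2 * X.NE κ ((Iic n).indicator (level μ f)) := by
        refine add_le_add le_rfl ?_
        rw [mul_comm]
        exact M.level_mul_T_le hX hn
    _ = _ := by ring

end KFunctional

/-! ### Construction of operators -/

section Operators

/-- The Hahn-Banach theorem for a seminorm. -/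
theorem exists_functional {E : Type*} [AddCommGroup E] [Module ℝ E] (q : E → ℝ)
    (hadd : ∀ x y, q (x + y) ≤ q x + q y) (hsmul : ∀ (c : ℝ) x, q (c • x) = |c| * q x) (g : E) :
    ∃ φ : E →ₗ[ℝ] ℝ, φ g = q g ∧ ∀ x, |φ x| ≤ q x := by
  have q0 : q 0 = 0 := by simpa using hsmul 0 0
  have hneg : ∀ x, q (-x) = q x := fun x => by simpa using hsmul (-1) x
  have hpos : ∀ x, 0 ≤ q x := fun x => by
    have := hadd x (-x)
    rw [add_neg_cancel, q0, hneg] at this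
    linarith
  have key : ∃ φ : E →ₗ[ℝ] ℝ, φ g = q g ∧ ∀ x, φ x ≤ q x := by
    by_cases hg : g = 0
    · exact ⟨0, by simp [hg, q0], fun x => by simpa using hpos x⟩
    · obtain ⟨φ, h1, h2⟩ := exists_extension_of_le_sublinear
        (LinearPMap.mkSpanSingleton (K := ℝ) g (q g) hg) q
        (fun c hc x => by rw [hsmul, abs_of_pos hc]) hadd (by
          rintro ⟨x, hx⟩
          obtain ⟨c, rfl⟩ := Submodule.mem_span_singleton.1 hx
          have h4 : (LinearPMap.mkSpanSingleton (K := ℝ) g (q g) hg : E →ₗ.[ℝ] ℝ) ⟨c • g, hx⟩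
              = c • q g := LinearPMap.mkSpanSingleton'_apply _ _ _ c _
          rw [h4, hsmul, smul_eq_mul]
          exact mul_le_mul_of_nonneg_right (le_abs_self c) (hpos g))
      refine ⟨φ, ?_, h2⟩
      have := h1 ⟨g, Submodule.mem_span_singleton_self g⟩
      simp only at this
      rw [this]
      exact LinearPMap.mkSpanSingleton_apply ℝ ℝ hg (q g)
  obtain ⟨φ, h1, h2⟩ := key
  refine ⟨φ, h1, fun x => abs_le.2 ⟨?_, h2 x⟩⟩
  have := h2 (-x)
  rw [map_neg, hneg] at this
  linarith

variable {Ω : Type*} [MeasurableSpace Ω] {μ : Measure Ω} {X Y : KotheSpace μ}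

theorem opNorm_le {V : Submodule ℝ (Ω →ₘ[μ] ℝ)} {T : V →ₗ[ℝ] V} {C : ℝ≥0∞}
    (h : ∀ f : V, X.nrm (T f : Ω →ₘ[μ] ℝ) ≤ C * X.nrm (f : Ω →ₘ[μ] ℝ)) : opNorm X T ≤ C := by
  refine iSup₂_le fun f hf => (h f).trans ?_
  calc C * X.nrm (f : Ω →ₘ[μ] ℝ) ≤ C * 1 := by gcongr
    _ = C := mul_one C

theorem nrm_map_le {V : Submodule ℝ (Ω →ₘ[μ] ℝ)} {T : V →ₗ[ℝ] V} {C : ℝ≥0∞}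
    (h : opNorm X T ≤ C) {f : V} (hf : X.nrm (f : Ω →ₘ[μ] ℝ) < ∞) :
    X.nrm (T f : Ω →ₘ[μ] ℝ) ≤ C * X.nrm (f : Ω →ₘ[μ] ℝ) := by
  by_cases h0 : X.nrm (f : Ω →ₘ[μ] ℝ) = 0
  · have : f = 0 := Subtype.ext ((X.nrm_eq_zero_iff _).1 h0)
    rw [this, map_zero]
    simp [(X.nrm_eq_zero_iff 0).2 rfl]
  · set r := (X.nrm (f : Ω →ₘ[μ] ℝ)).toReal with hr
    have hrpos : 0 < r := ENNReal.toReal_pos h0 hf.ne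
    have hrf : X.nrm (f : Ω →ₘ[μ] ℝ) = ENNReal.ofReal r := (ENNReal.ofReal_toReal hf.ne).symm
    have h1 : X.nrm ((r⁻¹ • f : V) : Ω →ₘ[μ] ℝ) ≤ 1 := by
      rw [Submodule.coe_smul, X.nrm_smul, hrf, abs_of_pos (inv_pos.2 hrpos),
        ← ENNReal.ofReal_mul (inv_pos.2 hrpos).le, inv_mul_cancel₀ hrpos.ne', ENNReal.ofReal_one]
    have h2 : X.nrm (T (r⁻¹ • f) : Ω →ₘ[μ] ℝ) ≤ C :=
      (le_iSup₂ (f := fun (f : V) (_ : X.nrm (f : Ω →ₘ[μ] ℝ) ≤ 1) => X.nrm (T f : Ω →ₘ[μ] ℝ))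
        (r⁻¹ • f) h1).trans h
    rw [map_smul, Submodule.coe_smul, X.nrm_smul, abs_of_pos (inv_pos.2 hrpos),
      ENNReal.ofReal_inv_of_pos hrpos, ← hrf, mul_comm, ← div_eq_mul_inv,
      ENNReal.div_le_iff h0 hf.ne] at h2
    exact h2

/-- There is an operator that maps `g` to `u`, with norms at most `C` on both spaces. -/
def Reaches (X Y : KotheSpace μ) (C : ℝ≥0∞) (g : sumSpace X Y) (u : Ω → ℝ) : Prop :=
  ∃ T : sumSpace X Y →ₗ[ℝ] sumSpace X Y, opNorm X T ≤ C ∧ opNorm Y T ≤ C ∧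
    ((T g : Ω →ₘ[μ] ℝ) : Ω → ℝ) =ᵐ[μ] u

theorem opNorm_add_le {V : Submodule ℝ (Ω →ₘ[μ] ℝ)} (S T : V →ₗ[ℝ] V) :
    opNorm X (S + T) ≤ opNorm X S + opNorm X T := by
  refine iSup₂_le fun f hf => ?_
  rw [LinearMap.add_apply, Submodule.coe_add]
  refine (X.nrm_add_le _ _).trans (add_le_add ?_ ?_)
  · exact le_iSup₂ (f := fun (f : V) (_ : X.nrm (f : Ω →ₘ[μ] ℝ) ≤ 1) => X.nrm (S f : Ω →ₘ[μ] ℝ))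
      f hf
  · exact le_iSup₂ (f := fun (f : V) (_ : X.nrm (f : Ω →ₘ[μ] ℝ) ≤ 1) => X.nrm (T f : Ω →ₘ[μ] ℝ))
      f hf

theorem Reaches.add {C D : ℝ≥0∞} {g : sumSpace X Y} {u v : Ω → ℝ} (hu : Reaches X Y C g u)
    (hv : Reaches X Y D g v) : Reaches X Y (C + D) g (fun s => u s + v s) := by
  obtain ⟨S, h1, h2, h3⟩ := hu
  obtain ⟨T, h4, h5, h6⟩ := hv
  refine ⟨S + T, (opNorm_add_le S T).trans (add_le_add h1 h4),
    (opNorm_add_le S T).trans (add_le_add h2 h5), ?_⟩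
  rw [LinearMap.add_apply, Submodule.coe_add]
  filter_upwards [AEEqFun.coeFn_add (S g : Ω →ₘ[μ] ℝ) (T g : Ω →ₘ[μ] ℝ), h3, h6] with s a b c
  rw [a, Pi.add_apply, b, c]

theorem Reaches.congr {C : ℝ≥0∞} {g : sumSpace X Y} {u v : Ω → ℝ} (hu : Reaches X Y C g u)
    (h : u =ᵐ[μ] v) : Reaches X Y C g v := by
  obtain ⟨S, h1, h2, h3⟩ := hu
  exact ⟨S, h1, h2, h3.trans h⟩

theorem Reaches.mono {C D : ℝ≥0∞} {g : sumSpace X Y} {u : Ω → ℝ} (hu : Reaches X Y C g u)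
    (h : C ≤ D) : Reaches X Y D g u := by
  obtain ⟨S, h1, h2, h3⟩ := hu
  exact ⟨S, h1.trans h, h2.trans h, h3⟩

theorem Reaches.zero {C : ℝ≥0∞} {g : sumSpace X Y} : Reaches X Y C g (fun _ => 0) := by
  refine ⟨0, ?_, ?_, ?_⟩
  · refine opNorm_le fun f => ?_
    rw [LinearMap.zero_apply, Submodule.coe_zero, (X.nrm_eq_zero_iff 0).2 rfl]
    exact zero_le
  · refine opNorm_le fun f => ?_
    rw [LinearMap.zero_apply, Submodule.coe_zero, (Y.nrm_eq_zero_iff 0).2 rfl]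
    exact zero_le
  · exact AEEqFun.coeFn_zero

/-- Operators `h ↦ ∑ⱼ cⱼ(h) 1_{ℓ = j} f`, with linear functionals `cⱼ`. -/
theorem reaches_of_coef {ι : Type*} [Countable ι] [MeasurableSpace ι] [DiscreteMeasurableSpace ι]
    {ℓ : Ω → ι} (hℓ : Measurable ℓ) {f : Ω → ℝ} (hf : Measurable f)
    (c : sumSpace X Y →ₗ[ℝ] (ι → ℝ)) {C : ℝ≥0∞} (hC : C ≠ ∞)
    (hX : ∀ h : sumSpace X Y, X.nrm (h : Ω →ₘ[μ] ℝ) < ∞ →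
      X.N (fun s => c h (ℓ s) * f s) ≤ C * X.nrm (h : Ω →ₘ[μ] ℝ))
    (hY : ∀ h : sumSpace X Y, Y.nrm (h : Ω →ₘ[μ] ℝ) < ∞ →
      Y.N (fun s => c h (ℓ s) * f s) ≤ C * Y.nrm (h : Ω →ₘ[μ] ℝ)) (g : sumSpace X Y) :
    Reaches X Y C g (fun s => c g (ℓ s) * f s) := by
  -- If `C = 0`, the product of `C` with an infinite norm is 0, and the estimate at the end would
  -- not be automatic for functions outside the space.
  by_cases hC0 : C = 0
  · subst hC0
    obtain ⟨x, hx, y, hy, hxy⟩ := Submodule.mem_sup.1 g.2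
    let x' : sumSpace X Y := ⟨x, Submodule.mem_sup_left hx⟩
    let y' : sumSpace X Y := ⟨y, Submodule.mem_sup_right hy⟩
    have hg : g = x' + y' := Subtype.ext hxy.symm
    have h1 := hX x' hx
    have h2 := hY y' hy
    rw [zero_mul, nonpos_iff_eq_zero] at h1 h2
    refine Reaches.zero.congr ?_
    filter_upwards [N_eq_zero h1, N_eq_zero h2] with s a b
    rw [hg, map_add, Pi.add_apply, add_mul, a, b]
    simp
  have hm : ∀ h : sumSpace X Y, AEStronglyMeasurable (fun s => c h (ℓ s) * f s) μ := fun h =>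
    (((measurable_of_countable (c h)).comp hℓ).mul hf).aestronglyMeasurable
  let T₀ : sumSpace X Y →ₗ[ℝ] (Ω →ₘ[μ] ℝ) :=
    { toFun := fun h => AEEqFun.mk _ (hm h)
      map_add' := fun h k => by
        refine AEEqFun.ext ?_
        filter_upwards [AEEqFun.coeFn_mk _ (hm (h + k)), AEEqFun.coeFn_mk _ (hm h),
          AEEqFun.coeFn_mk _ (hm k),
          AEEqFun.coeFn_add (AEEqFun.mk _ (hm h)) (AEEqFun.mk _ (hm k))] with s h1 h2 h3 h4
        rw [h1, h4, Pi.add_apply, h2, h3, map_add, Pi.add_apply, add_mul]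
      map_smul' := fun a h => by
        refine AEEqFun.ext ?_
        filter_upwards [AEEqFun.coeFn_mk _ (hm (a • h)), AEEqFun.coeFn_mk _ (hm h),
          AEEqFun.coeFn_smul a (AEEqFun.mk _ (hm h))] with s h1 h2 h3
        rw [h1, RingHom.id_apply, h3, Pi.smul_apply, h2, map_smul, Pi.smul_apply, smul_eq_mul,
          smul_eq_mul, mul_assoc] }
  have hT₀ : ∀ h, (T₀ h : Ω → ℝ) =ᵐ[μ] fun s => c h (ℓ s) * f s := fun h =>
    AEEqFun.coeFn_mk _ (hm h)
  have hTX : ∀ h : sumSpace X Y, X.nrm (h : Ω →ₘ[μ] ℝ) < ∞ →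
      X.nrm (T₀ h) ≤ C * X.nrm (h : Ω →ₘ[μ] ℝ) := fun h hh => by
    rw [← N_coe, N_congr (hT₀ h)]
    exact hX h hh
  have hTY : ∀ h : sumSpace X Y, Y.nrm (h : Ω →ₘ[μ] ℝ) < ∞ →
      Y.nrm (T₀ h) ≤ C * Y.nrm (h : Ω →ₘ[μ] ℝ) := fun h hh => by
    rw [← N_coe, N_congr (hT₀ h)]
    exact hY h hh
  have hmem : ∀ h, T₀ h ∈ sumSpace X Y := fun h => by
    obtain ⟨x, hx, y, hy, hxy⟩ := Submodule.mem_sup.1 h.2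
    let x' : sumSpace X Y := ⟨x, Submodule.mem_sup_left hx⟩
    let y' : sumSpace X Y := ⟨y, Submodule.mem_sup_right hy⟩
    have hh : h = x' + y' := Subtype.ext hxy.symm
    rw [hh, map_add]
    refine add_mem (Submodule.mem_sup_left ?_) (Submodule.mem_sup_right ?_)
    · exact (hTX x' hx).trans_lt (ENNReal.mul_lt_top hC.lt_top hx)
    · exact (hTY y' hy).trans_lt (ENNReal.mul_lt_top hC.lt_top hy)
  refine ⟨T₀.codRestrict _ hmem, opNorm_le fun h => ?_, opNorm_le fun h => ?_, hT₀ g⟩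
  · rcases eq_or_ne (X.nrm (h : Ω →ₘ[μ] ℝ)) ∞ with hh | hh
    · rw [hh, ENNReal.mul_top hC0]
      exact le_top
    · exact hTX h hh.lt_top
  · rcases eq_or_ne (Y.nrm (h : Ω →ₘ[μ] ℝ)) ∞ with hh | hh
    · rw [hh, ENNReal.mul_top hC0]
      exact le_top
    · exact hTY h hh.lt_top

/-- An operator of rank one, from a seminorm that dominates its functional. -/
theorem reaches_of_seminorm (q : sumSpace X Y → ℝ) (hadd : ∀ x y, q (x + y) ≤ q x + q y)
    (hsmul : ∀ (c : ℝ) x, q (c • x) = |c| * q x) {u : Ω → ℝ} (hu : Measurable u)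
    {C : ℝ≥0∞} (hC : C ≠ ∞) {g : sumSpace X Y} (hg : 0 < q g)
    (hX : ∀ h : sumSpace X Y, X.nrm (h : Ω →ₘ[μ] ℝ) < ∞ →
      ENNReal.ofReal (q h) * X.N u ≤ C * ENNReal.ofReal (q g) * X.nrm (h : Ω →ₘ[μ] ℝ))
    (hY : ∀ h : sumSpace X Y, Y.nrm (h : Ω →ₘ[μ] ℝ) < ∞ →
      ENNReal.ofReal (q h) * Y.N u ≤ C * ENNReal.ofReal (q g) * Y.nrm (h : Ω →ₘ[μ] ℝ)) :
    Reaches X Y C g u := by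
  obtain ⟨φ, h1, h2⟩ := exists_functional q hadd hsmul g
  let c : sumSpace X Y →ₗ[ℝ] (Unit → ℝ) := LinearMap.pi fun _ => (q g)⁻¹ • φ
  have hc : ∀ h o, c h o = (q g)⁻¹ * φ h := fun h o => rfl
  have hq0 : ENNReal.ofReal (q g) ≠ 0 := by simpa using hg
  have key : ∀ (Z : KotheSpace μ) (h : sumSpace X Y),
      ENNReal.ofReal (q h) * Z.N u ≤ C * ENNReal.ofReal (q g) * Z.nrm (h : Ω →ₘ[μ] ℝ) →
      Z.N (fun s => c h () * u s) ≤ C * Z.nrm (h : Ω →ₘ[μ] ℝ) := fun Z h hZ => by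
    rw [N_const_mul hu.aestronglyMeasurable, hc, abs_mul, abs_of_pos (inv_pos.2 hg),
      ENNReal.ofReal_mul (inv_pos.2 hg).le, ENNReal.ofReal_inv_of_pos hg]
    calc _ ≤ (ENNReal.ofReal (q g))⁻¹ * ENNReal.ofReal (q h) * Z.N u := by
          gcongr
          exact h2 h
      _ ≤ (ENNReal.ofReal (q g))⁻¹ * (C * ENNReal.ofReal (q g) * Z.nrm (h : Ω →ₘ[μ] ℝ)) := by
          rw [mul_assoc]
          gcongr
      _ = ((ENNReal.ofReal (q g))⁻¹ * ENNReal.ofReal (q g)) * (C * Z.nrm (h : Ω →ₘ[μ] ℝ)) := by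
          ring
      _ = _ := by rw [ENNReal.inv_mul_cancel hq0 ENNReal.ofReal_ne_top, one_mul]
  have := reaches_of_coef (ι := Unit) (ℓ := fun _ => ()) measurable_const hu c hC
    (fun h hh => key X h (hX h hh)) (fun h hh => key Y h (hY h hh)) g
  refine this.congr (Eventually.of_forall fun s => ?_)
  simp only [hc, h1, inv_mul_cancel₀ hg.ne', one_mul]

end Operators

/-! ### The right-shift property for sequences indexed by the integers -/

section RightShift

/-- `HasRSP` asks for an interval of indices; this renumbers a finite set of indices by an interval
without changing their order. -/
theorem exists_enumeration (F : Finset ℤ) :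
    ∃ (N : ℕ) (σ : ℤ → ℤ), StrictMonoOn σ (Ico 0 (N : ℤ)) ∧ (Finset.Ico 0 (N : ℤ)).image σ = F := by
  classical
  induction F using Finset.induction_on_max with
  | empty => exact ⟨0, id, fun a ha => by simp at ha, by simp⟩
  | insert a F ha ih =>
    obtain ⟨N, σ, hσ, hF⟩ := ih
    have hmem : ∀ m ∈ Ico 0 (N : ℤ), σ m ∈ F := fun m hm => by
      rw [← hF]; exact Finset.mem_image_of_mem σ (by simpa using hm)
    refine ⟨N + 1, Function.update σ N a, fun m hm n hn hmn => ?_, ?_⟩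
    · simp only [mem_Ico, Nat.cast_add, Nat.cast_one] at hm hn
      rw [Function.update_of_ne (by omega)]
      by_cases hnN : n = N
      · subst hnN
        rw [Function.update_self]
        exact ha _ (hmem m ⟨hm.1, hmn⟩)
      · rw [Function.update_of_ne hnN]
        exact hσ ⟨hm.1, by omega⟩ ⟨hn.1, by omega⟩ hmn
    · ext x
      simp only [Finset.mem_image, Finset.mem_Ico, Finset.mem_insert, ← hF, Nat.cast_add,
        Nat.cast_one]
      constructor
      · rintro ⟨m, hm, rfl⟩
        by_cases hmN : m = N
        · left; rw [hmN, Function.update_self]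
        · right; exact ⟨m, by omega, (Function.update_of_ne hmN _ _).symm⟩
      · rintro (rfl | ⟨m, hm, rfl⟩)
        · exact ⟨N, by omega, Function.update_self _ _ _⟩
        · exact ⟨m, by omega, Function.update_of_ne (by omega) _ _⟩

open Classical in
/-- Extension of a sequence on `J` by zero. -/
def extendZero {J : Set ℤ} (ξ : J → ℝ) : ℤ → ℝ := fun k => if h : k ∈ J then ξ ⟨k, h⟩ else 0

theorem extendZero_of_mem {J : Set ℤ} (ξ : J → ℝ) {k : ℤ} (hk : k ∈ J) :
    extendZero ξ k = ξ ⟨k, hk⟩ := by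
  simp [extendZero, hk]

theorem support_extendZero {J : Set ℤ} (ξ : J → ℝ) :
    (extendZero ξ).support = Subtype.val '' ξ.support := by
  ext k
  by_cases hk : k ∈ J <;> simp [extendZero, hk]

variable {Ω : Type*} [MeasurableSpace Ω] {μ : Measure Ω} {κ : Ω → ℤ} {J : Set ℤ}

/-- The right-shift property, in a form without normalization. -/
def RightShift (X : KotheSpace μ) (κ : Ω → ℤ) (C : ℝ≥0∞) : Prop :=
  ∀ (F : Finset ℤ) (x y : ℤ → ℤ → ℝ), IsInterlaced (F : Set ℤ) x y →
    (∀ n ∈ F, X.NE κ (y n) ≤ X.NE κ (x n)) →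
    X.NE κ (fun k => ∑ n ∈ F, y n k) ≤ C * X.NE κ (fun k => ∑ n ∈ F, x n k)

variable {X : KotheSpace μ}

omit [MeasurableSpace Ω] in
theorem dyadicStep_eq {c : Ω → ℝ} (hκ : ∀ s, κ s = Int.log 2 (c s)) (ξ : J → ℝ)
    {s : Ω} (hs : 0 < c s) : dyadicStep c ξ s = extendZero ξ (κ s) := by
  have hmem : s ∈ dyadicBlock c (κ s) := by
    refine ⟨?_, ?_⟩
    · rw [hκ]
      simpa using Int.zpow_log_le_self (b := 2) one_lt_two hs
    · rw [hκ]
      simpa using Int.lt_zpow_succ_log_self (b := 2) one_lt_two (c s)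
  rw [dyadicStep]
  by_cases hk : κ s ∈ J
  · rw [extendZero_of_mem ξ hk, tsum_eq_single ⟨κ s, hk⟩]
    · simp [hmem]
    · intro l hl
      refine indicator_of_notMem (fun h => hl ?_) _
      exact Subtype.ext (dyadicBlock_unique c h hmem)
  · rw [extendZero, dif_neg hk]
    convert tsum_zero with l
    refine indicator_of_notMem (fun h => hk ?_) _
    rw [dyadicBlock_unique c hmem h]
    exact l.2

theorem dyadicNorm_eq {c : Ω → ℝ} (hc : Measurable c) (hκ : ∀ s, κ s = Int.log 2 (c s))
    (hpos : ∀ᵐ s ∂μ, 0 < c s) (ξ : J → ℝ) :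
    dyadicNorm X c hc J ξ = X.NE κ (extendZero ξ) := by
  rw [dyadicNorm, ← N_mk, KotheSpace.NE]
  refine N_congr ?_
  filter_upwards [hpos] with s hs using dyadicStep_eq hκ ξ hs

/-- The scalars are absorbed in the vectors: the unnormalized form applies to `α n • x n` and `α n •
y n`, over the support of `α`. -/
theorem DyadicModel.hasRSP_of_rightShift (M : DyadicModel μ κ J) {c : Ω → ℝ} (hc : Measurable c)
    (hκ : ∀ s, κ s = Int.log 2 (c s)) (hpos : ∀ᵐ s ∂μ, 0 < c s) {C : ℝ≥0}
    (h : RightShift X κ C) : HasRSP (dyadicNorm X c hc J) := by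
  refine ⟨C, fun I x y _ hint hnorm α hα => ?_⟩
  have hsupp : ∀ n (z : J → ℝ), (extendZero (α n • z)).support ⊆ Subtype.val '' z.support :=
    fun n z => by
      rw [support_extendZero]
      exact image_mono (Function.support_const_smul_subset _ _)
  have hsmul : ∀ (a : ℝ) (z : J → ℝ),
      X.NE κ (extendZero (a • z)) = ENNReal.ofReal |a| * X.NE κ (extendZero z) := fun a z => by
    rw [← M.NE_const_mul]
    refine M.NE_congr fun k hk => ?_
    simp [extendZero_of_mem _ hk]
  have hsum : ∀ z : ℤ → J → ℝ, dyadicNorm X c hc J (∑ n ∈ α.support, α n • z n) =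
      X.NE κ (fun k => ∑ n ∈ α.support, extendZero (α n • z n) k) := fun z => by
    rw [dyadicNorm_eq hc hκ hpos]
    refine M.NE_congr fun k hk => ?_
    simp [extendZero_of_mem _ hk, Finset.sum_apply]
  rw [hsum, hsum]
  have himg : ∀ {A B : Set J} {A' B' : Set ℤ}, SetLT A B → A' ⊆ Subtype.val '' A →
      B' ⊆ Subtype.val '' B → SetLT A' B' := fun hAB hA hB a ha b hb => by
    obtain ⟨a', ha', rfl⟩ := hA ha
    obtain ⟨b', hb', rfl⟩ := hB hb
    exact hAB a' ha' b' hb'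
  refine h α.support (fun n => extendZero (α n • x n)) (fun n => extendZero (α n • y n))
    ⟨fun n hn => ?_, fun n hn => ?_, fun n hn => ?_, fun m hm n hn hmn => ?_⟩ fun n hn => ?_
  · exact ((hint.1 n (hα hn)).image _).subset (hsupp n _)
  · exact ((hint.2 n (hα hn)).image _).subset (hsupp n _)
  · exact himg (hint.3 n (hα hn)) (hsupp n _) (hsupp n _)
  · refine himg (hint.4 m (hα hm) n (hα hn) hmn) ?_ ?_ <;>
    · rw [image_union]
      exact union_subset_union (hsupp _ _) (hsupp _ _)
  · have := hnorm n (hα hn)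
    rw [dyadicNorm_eq hc hκ hpos, dyadicNorm_eq hc hκ hpos] at this
    rw [hsmul, hsmul, this.1]
    gcongr
    exact this.2

/-- Pairs with `x n` null have `y n` null and are dropped. The others are divided by the norm of `x
n`, which returns as the scalar, and are renumbered by an interval. -/
theorem DyadicModel.rightShift_of_hasRSP (M : DyadicModel μ κ J) {c : Ω → ℝ} (hc : Measurable c)
    (hκ : ∀ s, κ s = Int.log 2 (c s)) (hpos : ∀ᵐ s ∂μ, 0 < c s)
    (h : HasRSP (dyadicNorm X c hc J)) : ∃ C : ℝ≥0, RightShift X κ C := by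
  classical
  obtain ⟨C, hC⟩ := h
  refine ⟨C, fun F x y hint hxy => ?_⟩
  set F' := F.filter fun n => X.NE κ (x n) ≠ 0 with hF'
  have hx0 : ∀ n ∈ F, n ∉ F' → X.NE κ (x n) = 0 := fun n hn hn' => by
    by_contra h0
    exact hn' (Finset.mem_filter.2 ⟨hn, h0⟩)
  have hred : ∀ z : ℤ → ℤ → ℝ, (∀ n ∈ F, n ∉ F' → X.NE κ (z n) = 0) →
      X.NE κ (fun k => ∑ n ∈ F, z n k) = X.NE κ (fun k => ∑ n ∈ F', z n k) := fun z hz => by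
    refine M.NE_congr fun k hk => ?_
    refine (Finset.sum_subset (Finset.filter_subset _ _) fun n hn hn' => ?_).symm
    exact M.NE_eq_zero (hz n hn hn') hk
  rw [hred x hx0, hred y fun n hn hn' => le_antisymm ((hxy n hn).trans (hx0 n hn hn').le) zero_le]
  obtain ⟨N, σ, hσ, hσF⟩ := exists_enumeration F'
  have hσmem : ∀ m ∈ Ico 0 (N : ℤ), σ m ∈ F' := fun m hm => by
    rw [← hσF]; exact Finset.mem_image_of_mem σ (by simpa using hm)
  have hσmem' : ∀ m ∈ Ico 0 (N : ℤ), σ m ∈ F := fun m hm =>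
    (Finset.mem_filter.1 (hσmem m hm)).1
  set a : ℤ → ℝ := fun n => (X.NE κ (x n)).toReal with ha
  have hfin : ∀ m ∈ Ico 0 (N : ℤ), X.NE κ (x (σ m)) < ∞ := fun m hm =>
    M.NE_lt_top (hint.1 _ (hσmem' m hm))
  have hapos : ∀ m ∈ Ico 0 (N : ℤ), 0 < a (σ m) := fun m hm =>
    ENNReal.toReal_pos (Finset.mem_filter.1 (hσmem m hm)).2 (hfin m hm).ne
  have haeq : ∀ m ∈ Ico 0 (N : ℤ), X.NE κ (x (σ m)) = ENNReal.ofReal (a (σ m)) := fun m hm =>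
    (ENNReal.ofReal_toReal (hfin m hm).ne).symm
  let r : (ℤ → ℤ → ℝ) → ℤ → J → ℝ := fun z m k => (a (σ m))⁻¹ * z (σ m) k
  have hrsupp : ∀ z m, Subtype.val '' (r z m).support ⊆ (z (σ m)).support := fun z m => by
    rintro _ ⟨k, hk, rfl⟩
    exact right_ne_zero_of_mul hk
  have hrsupp' : ∀ z m, ∀ k ∈ (r z m).support, (k : ℤ) ∈ (z (σ m)).support := fun z m k hk =>
    hrsupp z m ⟨k, hk, rfl⟩
  have hrE : ∀ z, ∀ m ∈ Ico 0 (N : ℤ), dyadicNorm X c hc J (r z m) =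
      ENNReal.ofReal (a (σ m))⁻¹ * X.NE κ (z (σ m)) := fun z m hm => by
    rw [dyadicNorm_eq hc hκ hpos, ← abs_of_pos (inv_pos.2 (hapos m hm)), ← M.NE_const_mul]
    refine M.NE_congr fun k hk => ?_
    rw [extendZero_of_mem _ hk]
  let α : ℤ →₀ ℝ := Finsupp.onFinset (Finset.Ico 0 (N : ℤ))
    (fun m => if m ∈ Finset.Ico 0 (N : ℤ) then a (σ m) else 0) (fun m hm => by
      by_contra h
      simp [h] at hm)
  have hαs : α.support ⊆ Finset.Ico 0 (N : ℤ) := Finsupp.support_onFinset_subset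
  have hαv : ∀ m ∈ Finset.Ico 0 (N : ℤ), α m = a (σ m) := fun m hm => by
    change (if m ∈ Finset.Ico 0 (N : ℤ) then a (σ m) else 0) = _
    rw [if_pos hm]
  have hinj : ∀ m ∈ Finset.Ico 0 (N : ℤ), ∀ n ∈ Finset.Ico 0 (N : ℤ), σ m = σ n → m = n :=
    fun m hm n hn h => hσ.injOn (by simpa using hm) (by simpa using hn) h
  have hsum : ∀ z, dyadicNorm X c hc J (∑ m ∈ α.support, α m • r z m) =
      X.NE κ (fun k => ∑ n ∈ F', z n k) := fun z => by
    rw [dyadicNorm_eq hc hκ hpos]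
    refine M.NE_congr fun k hk => ?_
    rw [extendZero_of_mem _ hk, Finset.sum_apply,
      Finset.sum_subset hαs fun m _ hm => by simp [Finsupp.notMem_support_iff.1 hm], ← hσF,
      Finset.sum_image hinj]
    refine Finset.sum_congr rfl fun m hm => ?_
    rw [Pi.smul_apply, hαv m hm, smul_eq_mul,
      mul_inv_cancel_left₀ (hapos m (by simpa using hm)).ne']
  rw [← hsum, ← hsum]
  refine hC (Ico 0 (N : ℤ)) (r x) (r y) ordConnected_Ico
    ⟨fun m hm => ?_, fun m hm => ?_, fun m hm k hk l hl => ?_, fun m hm n hn hmn k hk l hl => ?_⟩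
    (fun m hm => ⟨?_, ?_⟩) α (by
      have := Finset.coe_subset.2 hαs
      rwa [Finset.coe_Ico] at this)
  · exact Set.Finite.of_finite_image ((hint.1 _ (hσmem' m hm)).subset (hrsupp x m))
      Subtype.val_injective.injOn
  · exact Set.Finite.of_finite_image ((hint.2 _ (hσmem' m hm)).subset (hrsupp y m))
      Subtype.val_injective.injOn
  · exact hint.3 _ (hσmem' m hm) _ (hrsupp' x m k hk) _ (hrsupp' y m l hl)
  · refine hint.4 _ (hσmem' m hm) _ (hσmem' n hn) (hσ hm hn hmn) _ ?_ _ ?_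
    · exact hk.imp (hrsupp' x m k) (hrsupp' y m k)
    · exact hl.imp (hrsupp' x n l) (hrsupp' y n l)
  · rw [hrE x m hm, haeq m hm, ← ENNReal.ofReal_mul (inv_pos.2 (hapos m hm)).le,
      inv_mul_cancel₀ (hapos m hm).ne', ENNReal.ofReal_one]
  · rw [hrE y m hm]
    calc _ ≤ ENNReal.ofReal (a (σ m))⁻¹ * X.NE κ (x (σ m)) := by
          gcongr
          exact hxy _ (hσmem' m hm)
      _ = 1 := by
        rw [haeq m hm, ← ENNReal.ofReal_mul (inv_pos.2 (hapos m hm)).le,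
          inv_mul_cancel₀ (hapos m hm).ne', ENNReal.ofReal_one]

end RightShift

/-! ### Division of a sequence into blocks of comparable norm -/

section Blocks

variable {Ω : Type*} [MeasurableSpace Ω] {μ : Measure Ω} {X : KotheSpace μ} {κ : Ω → ℤ} {J : Set ℤ}

namespace DyadicModel

variable (M : DyadicModel μ κ J)

include M

theorem NE_indicator_mono {A B : Set ℤ} (h : ∀ k ∈ J, k ∈ A → k ∈ B) (a : ℤ → ℝ) :
    X.NE κ (A.indicator a) ≤ X.NE κ (B.indicator a) := by
  refine M.NE_mono fun k hk => ?_
  by_cases hA : k ∈ A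
  · rw [indicator_of_mem hA, indicator_of_mem (h k hk hA)]
  · rw [indicator_of_notMem hA, abs_zero]
    exact abs_nonneg _

theorem NE_indicator_le_add {A B D : Set ℤ} (h : ∀ k ∈ J, k ∈ A → k ∈ B ∨ k ∈ D) (a : ℤ → ℝ) :
    X.NE κ (A.indicator a) ≤ X.NE κ (B.indicator a) + X.NE κ (D.indicator a) := by
  classical
  calc X.NE κ (A.indicator a)
      ≤ X.NE κ (fun k => B.indicator a k + (D \ B).indicator a k) := by
        refine M.NE_mono fun k hk => ?_
        by_cases hA : k ∈ A
        · rw [indicator_of_mem hA]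
          by_cases hB : k ∈ B
          · simp [hB]
          · simp [hB, (h k hk hA).resolve_left hB]
        · rw [indicator_of_notMem hA, abs_zero]
          exact abs_nonneg _
    _ ≤ X.NE κ (B.indicator a) + X.NE κ ((D \ B).indicator a) := NE_add_le _ _
    _ ≤ _ := by
        gcongr
        exact M.NE_indicator_mono (fun k _ hk => hk.1) a

theorem mem_of_le (hmin : ∀ k ∈ J, ∃ l ∈ J, l < k) {m n : ℤ} (hn : n ∈ J) (hmn : m ≤ n) :
    m ∈ J := by
  classical
  by_contra hm
  obtain ⟨l, hl, hll⟩ := Int.exists_least_of_bdd (P := (· ∈ J)) ⟨m, fun z hz => by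
    by_contra! hzm
    exact hm (M.ordConnected.out hz hn ⟨hzm.le, hmn⟩)⟩ ⟨n, hn⟩
  obtain ⟨l', hl', hlt⟩ := hmin l hl
  exact absurd (hll l' hl') (by omega)

/-- A final part of the sequence on `Iic n` that has at least half of its norm. -/
theorem exists_lower_cut {a : ℤ → ℝ} (hA0 : ∀ n ∈ J, X.NE κ ((Iic n).indicator a) ≠ 0)
    (hA1 : ∀ n ∈ J, X.NE κ ((Iic n).indicator a) < ∞)
    (hA3 : ∀ n ∈ J, n + 1 ∈ J → X.NE κ ((Iic (n + 1)).indicator a) ≤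
      3 * X.NE κ ((Iic n).indicator a))
    (hmin : ∀ k ∈ J, ∃ l ∈ J, l < k) {n : ℤ} (hn : n ∈ J) :
    ∃ m ∈ J, m < n ∧ X.NE κ ((Iic n).indicator a) ≤ 2 * X.NE κ ((Ioc m n).indicator a) ∧
      X.NE κ ((Iic n).indicator a) ≤ 6 * X.NE κ ((Iic m).indicator a) := by
  classical
  set A : ℤ → ℝ≥0∞ := fun n => X.NE κ ((Iic n).indicator a) with hA
  have hex : ∃ m, m < n ∧ A n ≤ 2 * X.NE κ ((Ioc m n).indicator a) := by
    by_contra! hcon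
    -- If all final parts had less than half of the norm, so would the whole sequence, by the Fatou
    -- property.
    have h1 : A n ≤ A n / 2 := by
      refine M.NE_fatou fun i => ?_
      have h2 := hcon (min (n - 1) (-i - 1)) (by omega)
      have h3 : X.NE κ ((Icc (-i : ℤ) i).indicator ((Iic n).indicator a)) ≤
          X.NE κ ((Ioc (min (n - 1) (-i - 1)) n).indicator a) := by
        rw [indicator_indicator]
        refine M.NE_indicator_mono (fun k _ hk => ?_) a
        simp only [mem_inter_iff, mem_Icc, mem_Iic, mem_Ioc] at hk ⊢
        omega
      rw [ENNReal.le_div_iff_mul_le (by simp) (by simp), mul_comm]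
      exact (mul_le_mul_right h3 2).trans h2.le
    exact absurd h1 (not_le.2 (ENNReal.half_lt_self (hA0 n hn) (hA1 n hn).ne))
  -- The greatest admissible cut: starting one index later, the final part has too little norm, so
  -- `A n ≤ 2 A (m + 1) ≤ 6 A m`.
  obtain ⟨m, ⟨hmn, hm⟩, hmax⟩ := Int.exists_greatest_of_bdd
    (P := fun m => m < n ∧ A n ≤ 2 * X.NE κ ((Ioc m n).indicator a)) ⟨n, fun z hz => hz.1.le⟩ hex
  have hmJ : m ∈ J := M.mem_of_le hmin hn hmn.le
  refine ⟨m, hmJ, hmn, hm, ?_⟩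
  have hm1 : m + 1 ∈ J := M.mem_of_le hmin hn (by omega)
  have h3 := hA3 m hmJ hm1
  have h2 : A n ≤ 2 * A (m + 1) := by
    by_cases hmn' : m + 1 = n
    · rw [hmn', two_mul]
      exact le_self_add
    have hlt : 2 * X.NE κ ((Ioc (m + 1) n).indicator a) < A n := by
      by_contra! hc
      exact absurd (hmax (m + 1) ⟨by omega, hc⟩) (by omega)
    have hadd : A n ≤ A (m + 1) + X.NE κ ((Ioc (m + 1) n).indicator a) :=
      M.NE_indicator_le_add (fun k _ hk => by
        simp only [mem_Iic, mem_Ioc] at hk ⊢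
        omega) a
    by_contra! hc
    have h5 : 2 * A n < A n + A n := by
      calc 2 * A n ≤ 2 * (A (m + 1) + X.NE κ ((Ioc (m + 1) n).indicator a)) := by gcongr
        _ = 2 * A (m + 1) + 2 * X.NE κ ((Ioc (m + 1) n).indicator a) := mul_add _ _ _
        _ < A n + A n := ENNReal.add_lt_add hc hlt
    rw [two_mul] at h5
    exact lt_irrefl _ h5
  calc A n ≤ 2 * A (m + 1) := h2
    _ ≤ 2 * (3 * A m) := by gcongr
    _ = 6 * A m := by rw [← mul_assoc]; norm_num

/-- The upper part of the division: blocks on which the norm grows by a factor of about `4`. -/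
theorem le_of_log_label {a : ℤ → ℝ} (hA0 : ∀ n ∈ J, X.NE κ ((Iic n).indicator a) ≠ 0)
    (hA1 : ∀ n ∈ J, X.NE κ ((Iic n).indicator a) < ∞)
    (hA3 : ∀ n ∈ J, n + 1 ∈ J → X.NE κ ((Iic (n + 1)).indicator a) ≤
      3 * X.NE κ ((Iic n).indicator a)) {n₀ : ℤ} (hn₀ : n₀ ∈ J) {lab : ℤ → ℤ}
    (hle : ∀ k ≤ n₀, lab k ≤ 0) (hlab : ∀ k, n₀ < k → lab k =
      1 + Int.log 4 ((X.NE κ ((Iic k).indicator a)).toReal /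
        (X.NE κ ((Iic n₀).indicator a)).toReal)) {k : ℤ} (hk : k ∈ J) (hk2 : 2 ≤ lab k) :
    X.NE κ ((Iic k).indicator a) ≤
      48 * X.NE κ ({l | l ∈ J ∧ lab l = lab k - 1}.indicator a) := by
  classical
  set A : ℤ → ℝ≥0∞ := fun n => X.NE κ ((Iic n).indicator a) with hA
  set ρ : ℤ → ℝ := fun n => (A n).toReal with hρ
  have hAmono : ∀ {m n}, m ≤ n → A m ≤ A n := fun hmn =>
    M.NE_indicator_mono (fun k _ hk => le_trans hk hmn) a
  have hρpos : ∀ n ∈ J, 0 < ρ n := fun n hn => ENNReal.toReal_pos (hA0 n hn) (hA1 n hn).ne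
  have hρ0 := hρpos n₀ hn₀
  have hρ3 : ∀ n ∈ J, n + 1 ∈ J → ρ (n + 1) ≤ 3 * ρ n := fun n hn hn1 => by
    have := ENNReal.toReal_mono (ENNReal.mul_ne_top (by simp) (hA1 n hn).ne) (hA3 n hn hn1)
    rwa [ENNReal.toReal_mul, ENNReal.toReal_ofNat] at this
  have hlow : ∀ n ∈ J, n₀ < n → (4 : ℝ) ^ (lab n - 1) * ρ n₀ ≤ ρ n := fun n hn hn' => by
    rw [← le_div_iff₀ hρ0, hlab n hn', add_sub_cancel_left]
    simpa using Int.zpow_log_le_self (b := 4) (by norm_num) (div_pos (hρpos n hn) hρ0)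
  have hupp : ∀ n, n₀ < n → ρ n < (4 : ℝ) ^ (lab n) * ρ n₀ := fun n hn' => by
    rw [← div_lt_iff₀ hρ0, hlab n hn', add_comm]
    simpa using Int.lt_zpow_succ_log_self (b := 4) (by norm_num) (ρ n / ρ n₀)
  have hkn : n₀ < k := by
    by_contra! h
    have := hle k h
    omega
  have hJ : ∀ l, n₀ ≤ l → l ≤ k → l ∈ J := fun l h1 h2 => M.ordConnected.out hn₀ hk ⟨h1, h2⟩
  have hmono : ∀ l, l ∈ J → n₀ < l → l ≤ k → lab l ≤ lab k := fun l hl hl0 hlk => by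
    rw [hlab l hl0, hlab k hkn]
    gcongr 1 + ?_
    refine Int.log_mono_right (div_pos (hρpos l hl) hρ0) ?_
    gcongr
    exacts [(hA1 k hk).ne, hAmono hlk]
  have h4 : (1 : ℝ) < 4 := by norm_num
  -- the largest index with a smaller label
  obtain ⟨p, ⟨hpk, hpl⟩, hpmax⟩ := Int.exists_greatest_of_bdd
    (P := fun p => p ≤ k ∧ lab p < lab k) ⟨k, fun z hz => hz.1⟩
    ⟨n₀, hkn.le, by have := hle n₀ le_rfl; omega⟩
  have hpn : n₀ ≤ p := hpmax n₀ ⟨hkn.le, by have := hle n₀ le_rfl; omega⟩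
  have hpk' : p + 1 ≤ k := by
    rcases eq_or_lt_of_le hpk with h | h
    · rw [h] at hpl; omega
    · omega
  have hpl1 : lab k ≤ lab (p + 1) := by
    by_contra! h
    have := hpmax (p + 1) ⟨hpk', h⟩
    omega
  have hp1 := hlow (p + 1) (hJ _ (by omega) hpk') (by omega)
  have hp2 := hρ3 p (hJ _ hpn hpk) (hJ _ (by omega) hpk')
  have hz1 : (4 : ℝ) ^ (lab k - 1) ≤ 4 ^ (lab (p + 1) - 1) :=
    zpow_le_zpow_right₀ h4.le (by omega)
  have hz2 : (4 : ℝ) ^ (lab k - 1) = 4 * 4 ^ (lab k - 2) := by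
    rw [← zpow_one_add₀ (by norm_num)]
    congr 1
    ring
  have hz3 : (4 : ℝ) ^ (lab k) = 16 * 4 ^ (lab k - 2) := by
    rw [show (16 : ℝ) = 4 ^ (2 : ℤ) by norm_num, ← zpow_add₀ (by norm_num)]
    congr 1
    ring
  have hzpos : (0 : ℝ) < 4 ^ (lab k - 2) := zpow_pos (by norm_num) _
  have hp3 : 4 * 4 ^ (lab k - 2) * ρ n₀ ≤ 3 * ρ p := by
    rw [← hz2]
    exact (mul_le_mul_of_nonneg_right hz1 hρ0.le).trans (hp1.trans hp2)
  -- the largest index with a label smaller by at least two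
  obtain ⟨p', ⟨hpk2, hpl2⟩, hpmax2⟩ := Int.exists_greatest_of_bdd
    (P := fun p => p ≤ k ∧ lab p < lab k - 1) ⟨k, fun z hz => hz.1⟩
    ⟨n₀, hkn.le, by have := hle n₀ le_rfl; omega⟩
  have hpn2 : n₀ ≤ p' := hpmax2 n₀ ⟨hkn.le, by have := hle n₀ le_rfl; omega⟩
  have hp' : ρ p' ≤ 4 ^ (lab k - 2) * ρ n₀ := by
    rcases eq_or_lt_of_le hpn2 with h | h
    · rw [← h]
      have : (1 : ℝ) ≤ 4 ^ (lab k - 2) := one_le_zpow₀ h4.le (by omega)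
      nlinarith
    · refine (hupp p' h).le.trans (mul_le_mul_of_nonneg_right ?_ hρ0.le)
      exact zpow_le_zpow_right₀ h4.le (by omega)
  set Q := X.NE κ ({l | l ∈ J ∧ lab l = lab k - 1}.indicator a) with hQ
  have hQtop : Q < ∞ := by
    refine lt_of_le_of_lt (M.NE_indicator_mono (B := Iic k) (fun l hl hl' => ?_) a) (hA1 k hk)
    by_contra! h
    simp only [mem_Iic, not_le] at h
    have h5 : lab k ≤ lab l := by
      rw [hlab k hkn, hlab l (hkn.trans h)]
      gcongr 1 + ?_
      refine Int.log_mono_right (div_pos (hρpos k hk) hρ0) ?_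
      gcongr
      exacts [(hA1 l hl).ne, hAmono h.le]
    have := hl'.2
    omega
  have hadd : A p ≤ A p' + Q := M.NE_indicator_le_add (fun l hl hlp => by
    by_cases h : lab l < lab k - 1
    · exact Or.inl (hpmax2 l ⟨le_trans hlp hpk, h⟩)
    · refine Or.inr ⟨hl, ?_⟩
      have : lab l ≤ lab p := by
        simp only [mem_Iic] at hlp
        have hl0 : n₀ < l := by
          by_contra! hc
          have := hle l hc
          omega
        rw [hlab l hl0, hlab p (hl0.trans_le hlp)]
        gcongr 1 + ?_
        refine Int.log_mono_right (div_pos (hρpos l hl) hρ0) ?_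
        gcongr
        exacts [(hA1 p (hJ _ hpn hpk)).ne, hAmono hlp]
      omega) a
  have hadd' : ρ p ≤ ρ p' + Q.toReal := by
    have hp't := hA1 p' (hJ _ hpn2 hpk2)
    rw [hρ, ← ENNReal.toReal_add hp't.ne hQtop.ne]
    exact ENNReal.toReal_mono (ENNReal.add_lt_top.2 ⟨hp't, hQtop⟩).ne hadd
  -- In units of `4 ^ (lab k - 2) * ρ n₀`: `ρ p ≥ 4 / 3` and `ρ p' ≤ 1`, so the preceding block
  -- carries at least `1 / 3`, while `ρ k < 16`. Hence `48 = 3 * 16`.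
  have hfin : ρ k ≤ 48 * Q.toReal := by
    have := hupp k hkn
    rw [hz3] at this
    nlinarith
  calc A k = ENNReal.ofReal (ρ k) := (ENNReal.ofReal_toReal (hA1 k hk).ne).symm
    _ ≤ ENNReal.ofReal (48 * Q.toReal) := ENNReal.ofReal_le_ofReal hfin
    _ = 48 * Q := by
      rw [ENNReal.ofReal_mul (by norm_num), ENNReal.ofReal_toReal hQtop.ne, ENNReal.ofReal_ofNat]

/-- Labels up to `n₀` are kept; beyond it the label is 1 plus the logarithm to base 4 of the growth
of the norm since `n₀`. The block with label 0 must carry half of the norm up to `n₀`, because it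
controls label 1, where the norm has grown by less than 4. Fibres bounded below make the blocks
finite. -/
theorem exists_label {a : ℤ → ℝ} (hA0 : ∀ n ∈ J, X.NE κ ((Iic n).indicator a) ≠ 0)
    (hA1 : ∀ n ∈ J, X.NE κ ((Iic n).indicator a) < ∞)
    (hA3 : ∀ n ∈ J, n + 1 ∈ J → X.NE κ ((Iic (n + 1)).indicator a) ≤
      3 * X.NE κ ((Iic n).indicator a)) {n₀ : ℤ} (hn₀ : n₀ ∈ J) {lab₀ : ℤ → ℤ}
    (hle : ∀ k ≤ n₀, lab₀ k ≤ 0) (hmono : MonotoneOn lab₀ (J ∩ Iic n₀))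
    (hbdd : ∀ j, BddBelow {l | l ∈ J ∧ l ≤ n₀ ∧ lab₀ l = j})
    (h0 : X.NE κ ((Iic n₀).indicator a) ≤
      2 * X.NE κ ({l | l ∈ J ∧ l ≤ n₀ ∧ lab₀ l = 0}.indicator a)) :
    ∃ lab : ℤ → ℤ, (∀ k ≤ n₀, lab k = lab₀ k) ∧ MonotoneOn lab J ∧ (∀ k ∈ J, n₀ < k → 1 ≤ lab k) ∧
      (∀ j, BddBelow {l | l ∈ J ∧ lab l = j}) ∧
      ∀ k ∈ J, n₀ < k → X.NE κ ((Iic k).indicator a) ≤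
        48 * X.NE κ ({l | l ∈ J ∧ lab l = lab k - 1}.indicator a) := by
  classical
  set A : ℤ → ℝ≥0∞ := fun n => X.NE κ ((Iic n).indicator a) with hA
  have hAmono : ∀ {m n}, m ≤ n → A m ≤ A n := fun hmn =>
    M.NE_indicator_mono (fun k _ hk => le_trans hk hmn) a
  have hρpos : ∀ n ∈ J, 0 < (A n).toReal := fun n hn =>
    ENNReal.toReal_pos (hA0 n hn) (hA1 n hn).ne
  set lab : ℤ → ℤ := fun k => if k ≤ n₀ then lab₀ k else
    1 + Int.log 4 ((A k).toReal / (A n₀).toReal) with hlabdef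
  have hlow : ∀ k ≤ n₀, lab k = lab₀ k := fun k hk => if_pos hk
  have hup : ∀ k, n₀ < k → lab k = 1 + Int.log 4 ((A k).toReal / (A n₀).toReal) := fun k hk =>
    if_neg (not_le.2 hk)
  have h1 : ∀ k ∈ J, n₀ < k → 1 ≤ lab k := fun k hk hkn => by
    rw [hup k hkn]
    have : 0 ≤ Int.log 4 ((A k).toReal / (A n₀).toReal) := by
      rw [← Int.log_one_right (R := ℝ) 4]
      refine Int.log_mono_right one_pos ?_
      rw [one_le_div (hρpos n₀ hn₀)]
      exact ENNReal.toReal_mono (hA1 k hk).ne (hAmono hkn.le)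
    omega
  refine ⟨lab, hlow, ?_, h1, fun j => ?_, fun k hk hkn => ?_⟩
  · intro k hk l hl hkl
    by_cases hln : l ≤ n₀
    · rw [hlow k (hkl.trans hln), hlow l hln]
      exact hmono ⟨hk, hkl.trans hln⟩ ⟨hl, hln⟩ hkl
    · push Not at hln
      by_cases hkn : k ≤ n₀
      · have := h1 l hl hln
        have := hle k hkn
        rw [hlow k hkn]
        omega
      · push Not at hkn
        rw [hup k hkn, hup l hln]
        gcongr 1 + ?_
        refine Int.log_mono_right (div_pos (hρpos k hk) (hρpos _ hn₀)) ?_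
        gcongr
        exacts [(hA1 l hl).ne, hAmono hkl]
  · obtain ⟨b, hb⟩ := hbdd j
    refine ⟨min b n₀, fun l hl => ?_⟩
    by_cases hln : l ≤ n₀
    · exact (min_le_left _ _).trans (hb ⟨hl.1, hln, by rw [← hlow l hln]; exact hl.2⟩)
    · exact (min_le_right _ _).trans (not_le.1 hln).le
  · have h1k := h1 k hk hkn
    by_cases hk2 : 2 ≤ lab k
    · exact M.le_of_log_label hA0 hA1 hA3 hn₀ (fun k hk => by rw [hlow k hk]; exact hle k hk) hup
        hk hk2
    · have hk1 : lab k = 1 := by omega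
      have hlog : Int.log 4 ((A k).toReal / (A n₀).toReal) = 0 := by
        have := hup k hkn
        omega
      have h4 : (A k).toReal < 4 * (A n₀).toReal := by
        rw [← div_lt_iff₀ (hρpos _ hn₀)]
        have := Int.lt_zpow_succ_log_self (b := 4) (by norm_num) ((A k).toReal / (A n₀).toReal)
        rw [hlog] at this
        simpa using this
      calc A k = ENNReal.ofReal (A k).toReal := (ENNReal.ofReal_toReal (hA1 k hk).ne).symm
        _ ≤ ENNReal.ofReal (4 * (A n₀).toReal) := ENNReal.ofReal_le_ofReal h4.le
        _ = 4 * A n₀ := by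
          rw [ENNReal.ofReal_mul (by norm_num), ENNReal.ofReal_toReal (hA1 _ hn₀).ne,
            ENNReal.ofReal_ofNat]
        _ ≤ 4 * (2 * X.NE κ ({l | l ∈ J ∧ l ≤ n₀ ∧ lab₀ l = 0}.indicator a)) := by gcongr
        _ = 8 * X.NE κ ({l | l ∈ J ∧ l ≤ n₀ ∧ lab₀ l = 0}.indicator a) := by
          rw [← mul_assoc]; norm_num
        _ ≤ 48 * X.NE κ ({l | l ∈ J ∧ lab l = lab k - 1}.indicator a) := by
          gcongr
          · norm_num
          · refine M.NE_indicator_mono (fun l hl hl' => And.intro hl ?_) a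
            rw [hlow l hl'.2.1, hl'.2.2, hk1]
            norm_num

/-- Division of a sequence into blocks such that each block is controlled by the preceding one;
the first block, if there is one, is a single index. -/
theorem exists_division {a : ℤ → ℝ} (hA0 : ∀ n ∈ J, X.NE κ ((Iic n).indicator a) ≠ 0)
    (hA1 : ∀ n ∈ J, X.NE κ ((Iic n).indicator a) < ∞)
    (hA3 : ∀ n ∈ J, n + 1 ∈ J → X.NE κ ((Iic (n + 1)).indicator a) ≤
      3 * X.NE κ ((Iic n).indicator a)) :
    ∃ (lab : ℤ → ℤ) (P : ℤ → Set ℤ), MonotoneOn lab J ∧ ∀ k ∈ J, (P (lab k)).Finite ∧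
      P (lab k) ⊆ J ∩ Iic k ∧
      X.NE κ ((Iic k).indicator a) ≤ 48 * X.NE κ ((P (lab k)).indicator a) ∧
      ((∀ l ∈ P (lab k), lab l = lab k - 1) ∨ ∀ l ∈ J, k ≤ l) := by
  classical
  set A : ℤ → ℝ≥0∞ := fun n => X.NE κ ((Iic n).indicator a) with hA
  have hpre : ∀ lab : ℤ → ℤ, MonotoneOn lab J → (∀ j, BddBelow {l | l ∈ J ∧ lab l = j}) →
      ∀ k ∈ J, {l | l ∈ J ∧ lab l = lab k - 1}.Finite ∧
        {l | l ∈ J ∧ lab l = lab k - 1} ⊆ J ∩ Iic k := fun lab hm hb k hk => by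
    have hsub : {l | l ∈ J ∧ lab l = lab k - 1} ⊆ J ∩ Iic k := fun l hl => ⟨hl.1, by
      by_contra! h
      simp only [mem_Iic, not_le] at h
      have := hm hk hl.1 h.le
      have := hl.2
      omega⟩
    obtain ⟨b, hb⟩ := hb (lab k - 1)
    exact ⟨(finite_Icc b k).subset fun l hl => ⟨hb hl, (hsub hl).2⟩, hsub⟩
  by_cases hmin : ∃ k₀ ∈ J, ∀ l ∈ J, k₀ ≤ l
  · obtain ⟨k₀, hk₀, hleast⟩ := hmin
    have hIic : ∀ D : Set ℤ, k₀ ∈ D → A k₀ ≤ X.NE κ (D.indicator a) := fun D hD =>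
      M.NE_indicator_mono (fun l hl hl' => by
        have : l = k₀ := le_antisymm hl' (hleast l hl)
        rwa [this]) a
    obtain ⟨lab, h1, h2, h3, h4, h5⟩ := M.exists_label hA0 hA1 hA3 hk₀ (lab₀ := fun _ => 0)
      (fun _ _ => le_rfl) (fun _ _ _ _ _ => le_rfl) (fun j => ⟨k₀, fun l hl => hleast l hl.1⟩)
      ((hIic {l | l ∈ J ∧ l ≤ k₀ ∧ (0 : ℤ) = 0} ⟨hk₀, le_rfl, rfl⟩).trans
        (le_mul_of_one_le_left zero_le one_le_two))
    -- The least index of `J` has no predecessor, and its block controls itself.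
    refine ⟨lab, fun j => if j = 0 then {k₀} else {l | l ∈ J ∧ lab l = j - 1}, h2,
      fun k hk => ?_⟩
    rcases eq_or_lt_of_le (hleast k hk) with h | h
    · subst h
      rw [h1 _ le_rfl]
      simp only [if_true]
      refine ⟨finite_singleton _, by simpa using hk₀, (hIic {k₀} rfl).trans ?_, Or.inr hleast⟩
      calc _ = 1 * X.NE κ (({k₀} : Set ℤ).indicator a) := (one_mul _).symm
        _ ≤ _ := by gcongr; norm_num
    · have hk1 := h3 k hk h
      have hk0 : lab k ≠ 0 := by omega
      simp only [if_neg hk0]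
      exact ⟨(hpre lab h2 h4 k hk).1, (hpre lab h2 h4 k hk).2, h5 k hk h, Or.inl fun l hl => hl.2⟩
  · push Not at hmin
    obtain ⟨n₀, hn₀⟩ := M.nonempty
    choose! pred hpJ hplt hp2 hp6 using fun (n : ℤ) (hn : n ∈ J) =>
      M.exists_lower_cut hA0 hA1 hA3 hmin hn
    -- Cuts descending from `n₀` without end. For `k ≤ n₀`, `ix k` below is the number `i` of the
    -- piece `(D (i + 1), D i]` that contains `k`, and labels are its negative.
    let D : ℕ → ℤ := fun i => pred^[i] n₀
    have hD0 : D 0 = n₀ := rfl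
    have hDs : ∀ i, D (i + 1) = pred (D i) := fun i => Function.iterate_succ_apply' pred i n₀
    have hDJ : ∀ i, D i ∈ J := fun i => by
      induction i with
      | zero => exact hn₀
      | succ i ih => rw [hDs]; exact hpJ _ ih
    have hDlt : ∀ i, D (i + 1) < D i := fun i => by rw [hDs]; exact hplt _ (hDJ i)
    have hDanti : StrictAnti D := strictAnti_nat_of_succ_lt hDlt
    have hDle : ∀ i : ℕ, D i ≤ n₀ - i := fun i => by
      induction i with
      | zero => simp [hD0]
      | succ i ih => have := hDlt i; push_cast; omega
    have hex : ∀ k, ∃ i, D (i + 1) < k := fun k => by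
      refine ⟨(n₀ - k).toNat, ?_⟩
      have h1 := hDle ((n₀ - k).toNat + 1)
      push_cast at h1
      have := Int.self_le_toNat (n₀ - k)
      omega
    let ix : ℤ → ℕ := fun k => Nat.find (hex k)
    have hix1 : ∀ k, D (ix k + 1) < k := fun k => Nat.find_spec (hex k)
    have hix2 : ∀ k ≤ n₀, k ≤ D (ix k) := fun k hk => by
      rcases Nat.eq_zero_or_pos (ix k) with h | h
      · rwa [h]
      · have := Nat.find_min (hex k) (m := ix k - 1) (by change ix k - 1 < ix k; omega)
        rw [Nat.sub_add_cancel h] at this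
        exact not_lt.1 this
    have hix3 : ∀ k i, k ≤ n₀ → D (i + 1) < k → k ≤ D i → ix k = i := fun k i hk h1 h2 => by
      refine (Nat.find_eq_iff (hex k)).2 ⟨h1, fun m hm => not_lt.2 (h2.trans ?_)⟩
      exact hDanti.antitone (by omega)
    have hblock : ∀ i, A (D i) ≤ 2 * X.NE κ ({l | l ∈ J ∧ l ≤ n₀ ∧ -(ix l : ℤ) = -i}.indicator a) :=
      fun i => by
        refine (hp2 _ (hDJ i)).trans (mul_le_mul_right (M.NE_indicator_mono (fun l hl hl' => ?_) a) 2)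
        have hln : l ≤ n₀ := hl'.2.trans (hDanti.antitone (Nat.zero_le i))
        refine ⟨hl, hln, ?_⟩
        rw [hix3 l i hln (by rw [hDs]; exact hl'.1) hl'.2]
    obtain ⟨lab, h1, h2, h3, h4, h5⟩ := M.exists_label hA0 hA1 hA3 hn₀
      (lab₀ := fun k => -(ix k : ℤ)) (fun k _ => by simp)
      (fun k hk l hl hkl => by
        simp only [neg_le_neg_iff, Nat.cast_le]
        by_contra! h
        have e1 := hix1 l
        have e2 := hix2 k hk.2
        have e3 := hDanti.antitone (show ix k + 1 ≤ ix l by omega)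
        have e4 : D (ix l) ≤ D (ix k + 1) := e3
        have e5 := hix1 k
        have e6 := hix2 l hl.2
        omega)
      (fun j => ⟨D ((-j).toNat + 1), fun l hl => by
        have e1 := hix1 l
        have e2 := hl.2.2
        have : (-j).toNat = ix l := by omega
        rw [this]
        exact e1.le⟩)
      (by simpa [hD0, hA] using hblock 0)
    refine ⟨lab, fun j => {l | l ∈ J ∧ lab l = j - 1}, h2, fun k hk =>
      ⟨(hpre lab h2 h4 k hk).1, (hpre lab h2 h4 k hk).2, ?_, Or.inl fun l hl => hl.2⟩⟩
    by_cases hkn : k ≤ n₀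
    · have e1 : A k ≤ A (D (ix k)) :=
        M.NE_indicator_mono (fun l _ hl => le_trans hl (hix2 k hkn)) a
      have e2 : A (D (ix k)) ≤ 6 * A (D (ix k + 1)) := by rw [hDs]; exact hp6 _ (hDJ _)
      calc A k ≤ 6 * A (D (ix k + 1)) := e1.trans e2
        _ ≤ 6 * (2 * X.NE κ ({l | l ∈ J ∧ l ≤ n₀ ∧ -(ix l : ℤ) = -(ix k + 1 : ℕ)}.indicator a)) := by
          gcongr
          exact hblock _
        _ = 12 * X.NE κ ({l | l ∈ J ∧ l ≤ n₀ ∧ -(ix l : ℤ) = -(ix k + 1 : ℕ)}.indicator a) := by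
          rw [← mul_assoc]; norm_num
        _ ≤ _ := by
          gcongr
          · norm_num
          · refine M.NE_indicator_mono (fun l hl hl' => And.intro hl ?_) a
            rw [h1 l hl'.2.1, h1 k hkn, hl'.2.2]
            push_cast
            ring
    · exact h5 k hk (not_le.1 hkn)

end DyadicModel

end Blocks

/-! ### Averages over blocks -/

section Averages

variable {Ω : Type*} [MeasurableSpace Ω] {μ : Measure Ω} [SigmaFinite μ] {X : KotheSpace μ}
  {κ : Ω → ℤ} {J : Set ℤ}

variable (μ) in
/-- The averages of the absolute value of a function. -/
def blockAvg (G : ℤ → Set Ω) (w : Ω → ℝ) (k : ℤ) : ℝ := (∫ s in G k, |w s| ∂μ) / (μ (G k)).toReal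

omit [SigmaFinite μ] in
theorem blockAvg_nonneg (G : ℤ → Set Ω) (w : Ω → ℝ) (k : ℤ) : 0 ≤ blockAvg μ G w k :=
  div_nonneg (integral_nonneg fun _ => abs_nonneg _) ENNReal.toReal_nonneg

theorem integrableOn_of_linfty {G : Set Ω} (hfin : μ G < ∞) {w : Ω → ℝ} (hw : Measurable w)
    (h : (linfty μ).N w < ∞) : IntegrableOn w G μ := by
  refine Measure.integrableOn_of_bounded (M := ((linfty μ).N w).toReal) hfin.ne
    hw.aestronglyMeasurable (ae_restrict_of_ae ?_)
  filter_upwards [ae_le_N_linfty w] with s hs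
  rw [Real.norm_eq_abs]
  exact (ENNReal.ofReal_le_iff_le_toReal h.ne).1 hs

theorem DyadicModel.integrableOn_of_mem (M : DyadicModel μ κ J) (hX : X.IsRearrangementInvariant)
    {h : Ω →ₘ[μ] ℝ} (hh : h ∈ sumSpace X (linfty μ)) {G : Set Ω} (hG : MeasurableSet G)
    (hfin : μ G < ∞) : IntegrableOn h G μ := by
  obtain ⟨x, hx, y, hy, rfl⟩ := Submodule.mem_sup.1 hh
  have h1 : IntegrableOn x G μ :=
    M.integrableOn_of_N_lt_top hX hG hfin x.measurable (by rw [N_coe]; exact hx)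
  have h2 : IntegrableOn y G μ :=
    integrableOn_of_linfty hfin y.measurable (by rw [N_coe]; exact hy)
  exact (h1.add h2).congr (ae_restrict_of_ae (AEEqFun.coeFn_add x y).symm)

omit [SigmaFinite μ] in
theorem blockAvg_congr (G : ℤ → Set Ω) {v w : Ω → ℝ} (h : v =ᵐ[μ] w) (k : ℤ) :
    blockAvg μ G v k = blockAvg μ G w k := by
  have : ∫ s in G k, |v s| ∂μ = ∫ s in G k, |w s| ∂μ :=
    integral_congr_ae (ae_restrict_of_ae (by filter_upwards [h] with s hs; rw [hs]))
  rw [blockAvg, blockAvg, this]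

omit [SigmaFinite μ] in
theorem blockAvg_add_le {G : ℤ → Set Ω} {k : ℤ} {v w : Ω → ℝ} (hv : IntegrableOn v (G k) μ)
    (hw : IntegrableOn w (G k) μ) :
    blockAvg μ G (fun s => v s + w s) k ≤ blockAvg μ G v k + blockAvg μ G w k := by
  rw [blockAvg, blockAvg, blockAvg, ← add_div, ← integral_add hv.abs hw.abs]
  refine div_le_div_of_nonneg_right ?_ ENNReal.toReal_nonneg
  exact integral_mono (hv.add hw).abs (hv.abs.add hw.abs) fun s => abs_add_le _ _

omit [SigmaFinite μ] in
theorem blockAvg_const_mul (G : ℤ → Set Ω) (c : ℝ) (w : Ω → ℝ) (k : ℤ) :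
    blockAvg μ G (fun s => c * w s) k = |c| * blockAvg μ G w k := by
  simp only [blockAvg, abs_mul, integral_const_mul, mul_div_assoc]

omit [SigmaFinite μ] in
theorem le_blockAvg {G : ℤ → Set Ω} {k : ℤ} (hG : MeasurableSet (G k)) (h0 : μ (G k) ≠ 0)
    (hfin : μ (G k) < ∞) {w : Ω → ℝ} (hw : IntegrableOn w (G k) μ) {c : ℝ}
    (h : ∀ s ∈ G k, c ≤ |w s|) : c ≤ blockAvg μ G w k := by
  have hpos := ENNReal.toReal_pos h0 hfin.ne
  rw [blockAvg, le_div_iff₀ hpos]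
  have := setIntegral_mono_on (integrableOn_const (C := c) hfin.ne) hw.abs hG h
  rwa [setIntegral_const, smul_eq_mul, mul_comm] at this

theorem blockAvg_le_linfty {G : ℤ → Set Ω} {k : ℤ} (h0 : μ (G k) ≠ 0)
    (hfin : μ (G k) < ∞) {w : Ω → ℝ} (hw : Measurable w) :
    ENNReal.ofReal (blockAvg μ G w k) ≤ (linfty μ).N w := by
  by_cases htop : (linfty μ).N w = ∞
  · rw [htop]; exact le_top
  have hpos := ENNReal.toReal_pos h0 hfin.ne
  rw [ENNReal.ofReal_le_iff_le_toReal htop, blockAvg, div_le_iff₀ hpos]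
  have := setIntegral_mono_ae_restrict (integrableOn_of_linfty hfin hw (Ne.lt_top htop)).abs
    (integrableOn_const (C := ((linfty μ).N w).toReal) hfin.ne) (ae_restrict_of_ae (by
      filter_upwards [ae_le_N_linfty w] with s hs
      exact (ENNReal.ofReal_le_iff_le_toReal htop).1 hs))
  rwa [setIntegral_const, smul_eq_mul, mul_comm] at this

omit [SigmaFinite μ] in
-- A conditional expectation onto the sets `G k`, followed by transfer to the dyadic blocks; the
-- factor 2 pays for sets with only half the measure of the block.
theorem DyadicModel.NE_blockAvg_le (M : DyadicModel μ κ J) (hX : X.IsRearrangementInvariant)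
    {G : ℤ → Set Ω} (hG : ∀ k, MeasurableSet (G k)) (hd : J.PairwiseDisjoint G)
    (hlow : ∀ k ∈ J, 2 ^ k ≤ 2 * μ (G k)) (hfin : ∀ k ∈ J, μ (G k) < ∞) {w : Ω → ℝ}
    (hw : Measurable w) : X.NE κ (J.indicator (blockAvg μ G w)) ≤ 2 * X.N w := by
  classical
  have h0 : ∀ k ∈ J, μ (G k) ≠ 0 := fun k hk h => by
    have := hlow k hk
    rw [h, mul_zero] at this
    exact absurd this (not_le.2 (two_zpow_pos k))
  refine M.NE_fatou fun n => ?_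
  set F : Finset ℤ := (Finset.Icc (-n : ℤ) n).filter (· ∈ J) with hF
  have hFJ : ∀ k ∈ F, k ∈ J := fun k hk => (Finset.mem_filter.1 hk).2
  have hdF : (F : Set ℤ).PairwiseDisjoint G := hd.subset hFJ
  calc X.NE κ ((Icc (-n : ℤ) n).indicator (J.indicator (blockAvg μ G w)))
      ≤ 2 * X.N (step F (blockAvg μ G w) G) := by
        refine M.NE_le_two_N hX hG hd hlow hfin fun k hk s hs => ?_
        by_cases hkF : k ∈ F
        · rw [step_of_mem hdF hkF hs, indicator_of_mem (by simpa using (Finset.mem_filter.1 hkF).1),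
            indicator_of_mem hk]
        · rw [indicator_of_notMem fun h => hkF (Finset.mem_filter.2 ⟨by simpa using h, hk⟩),
            abs_zero]
          exact abs_nonneg _
    _ ≤ 2 * X.N w := by
        gcongr
        exact M.N_step_avg_le hX (fun k _ => hG k) hdF (fun k hk => hfin k (hFJ k hk))
          (fun k hk => h0 k (hFJ k hk)) hw

/-- A functional that is controlled by the averages over finitely many blocks. -/
theorem DyadicModel.exists_coef (M : DyadicModel μ κ J) (hX : X.IsRearrangementInvariant)
    {G : ℤ → Set Ω} (hG : ∀ k, MeasurableSet (G k))
    (hlow : ∀ k ∈ J, 2 ^ k ≤ 2 * μ (G k)) (hfin : ∀ k ∈ J, μ (G k) < ∞)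
    {P : Set ℤ} (hP : P.Finite) {g : sumSpace X (linfty μ)} {a : ℤ → ℝ}
    (ha : ∀ k, 0 ≤ a k) (hag : ∀ k ∈ J, ∀ s ∈ G k, a k / 2 ≤ |(g : Ω →ₘ[μ] ℝ) s|)
    (hpos : X.NE κ (P.indicator a) ≠ 0) :
    ∃ c : sumSpace X (linfty μ) →ₗ[ℝ] ℝ, c g = 1 ∧ ∀ h : sumSpace X (linfty μ),
      ENNReal.ofReal |c h| * X.NE κ (P.indicator a) ≤
        2 * X.NE κ (P.indicator (blockAvg μ G (h : Ω →ₘ[μ] ℝ))) := by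
  have h0 : ∀ k ∈ J, μ (G k) ≠ 0 := fun k hk h => by
    have := hlow k hk
    rw [h, mul_zero] at this
    exact absurd this (not_le.2 (two_zpow_pos k))
  have hint : ∀ (h : sumSpace X (linfty μ)) k, k ∈ J →
      IntegrableOn (h : Ω →ₘ[μ] ℝ) (G k) μ := fun h k hk =>
    M.integrableOn_of_mem hX h.2 (hG k) (hfin k hk)
  have htop : ∀ ξ : ℤ → ℝ, X.NE κ (P.indicator ξ) < ∞ := fun ξ =>
    M.NE_lt_top (hP.subset fun k hk => mem_of_indicator_ne_zero hk)
  -- A seminorm, finite because `P` is finite. The lower bound `a k / 2` for `|g|` on `G k` makes `Q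
  -- g` at least half of the norm of `a` on `P`, so a norming functional at `g` can be divided by `Q
  -- g`.
  set Q : sumSpace X (linfty μ) → ℝ≥0∞ := fun h =>
    X.NE κ (P.indicator (blockAvg μ G (h : Ω →ₘ[μ] ℝ))) with hQ
  have hQadd : ∀ x y, Q (x + y) ≤ Q x + Q y := fun x y => by
    refine (M.NE_mono fun k hk => ?_).trans (NE_add_le _ _)
    by_cases hkP : k ∈ P
    · simp only [indicator_of_mem hkP]
      rw [Submodule.coe_add, blockAvg_congr G (AEEqFun.coeFn_add _ _)]
      rw [abs_of_nonneg (blockAvg_nonneg _ _ _),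
        abs_of_nonneg (add_nonneg (blockAvg_nonneg _ _ _) (blockAvg_nonneg _ _ _))]
      exact blockAvg_add_le (hint x k hk) (hint y k hk)
    · simp [hkP]
  have hQsmul : ∀ (c : ℝ) x, Q (c • x) = ENNReal.ofReal |c| * Q x := fun c x => by
    rw [hQ, ← abs_abs c, ← M.NE_const_mul]
    refine M.NE_congr fun k hk => ?_
    by_cases hkP : k ∈ P
    · simp only [indicator_of_mem hkP]
      rw [Submodule.coe_smul, blockAvg_congr G (AEEqFun.coeFn_smul _ _)]
      exact blockAvg_const_mul G c _ k
    · simp [hkP]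
  obtain ⟨φ, hφ, hφle⟩ := exists_functional (fun h => (Q h).toReal)
    (fun x y => by
      rw [← ENNReal.toReal_add (htop _).ne (htop _).ne]
      exact ENNReal.toReal_mono (ENNReal.add_lt_top.2 ⟨htop _, htop _⟩).ne (hQadd x y))
    (fun c x => by rw [hQsmul, ENNReal.toReal_mul, ENNReal.toReal_ofReal (abs_nonneg c)]) g
  have hg : X.NE κ (P.indicator a) ≤ 2 * Q g := by
    have h2 : (2 : ℝ≥0∞) = ENNReal.ofReal |(2 : ℝ)| := by simp
    rw [h2, hQ, ← M.NE_const_mul]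
    refine M.NE_mono fun k hk => ?_
    by_cases hkP : k ∈ P
    · rw [indicator_of_mem hkP, indicator_of_mem hkP, abs_of_nonneg (ha k), abs_mul, abs_two,
        abs_of_nonneg (blockAvg_nonneg _ _ _)]
      have := le_blockAvg (hG k) (h0 k hk) (hfin k hk) (hint g k hk) (hag k hk)
      linarith
    · simp [hkP]
  have hQg0 : Q g ≠ 0 := fun h => by
    rw [h, mul_zero, nonpos_iff_eq_zero] at hg
    exact hpos hg
  have hqpos : 0 < (Q g).toReal := ENNReal.toReal_pos hQg0 (htop _).ne
  refine ⟨(Q g).toReal⁻¹ • φ, ?_, fun h => ?_⟩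
  · rw [LinearMap.smul_apply, hφ, smul_eq_mul, inv_mul_cancel₀ hqpos.ne']
  · rw [LinearMap.smul_apply, smul_eq_mul, abs_mul, abs_of_pos (inv_pos.2 hqpos)]
    calc _ ≤ ENNReal.ofReal ((Q g).toReal⁻¹ * (Q h).toReal) * (2 * Q g) := by
          gcongr
          exact hφle h
      _ = 2 * ((Q g)⁻¹ * Q g) * Q h := by
          rw [ENNReal.ofReal_mul (inv_pos.2 hqpos).le, ENNReal.ofReal_inv_of_pos hqpos,
            ENNReal.ofReal_toReal (htop _).ne, ENNReal.ofReal_toReal (htop _).ne]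
          ring
      _ = _ := by rw [ENNReal.inv_mul_cancel hQg0 (htop _).ne, mul_one]

end Averages

/-! ### Stretchable spaces give Calderón couples -/

section Sufficiency

variable {Ω : Type*} [MeasurableSpace Ω] {μ : Measure Ω} [SigmaFinite μ] {X : KotheSpace μ}
  {κ : Ω → ℤ} {J : Set ℤ}

open Classical in
/-- The index of the level set that contains a point. -/
def levelIndex (μ : Measure Ω) (J : Set ℤ) (w : Ω → ℝ) (s : Ω) : ℤ :=
  if h : ∃ k, s ∈ levelSet μ J w k then h.choose else 0

omit [SigmaFinite μ] in
theorem levelIndex_of_mem {w : Ω → ℝ} (hw : HasLevels μ J w) {s : Ω} {k : ℤ}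
    (hs : s ∈ levelSet μ J w k) : levelIndex μ J w s = k := by
  have h : ∃ k, s ∈ levelSet μ J w k := ⟨k, hs⟩
  rw [levelIndex, dif_pos h]
  exact hw.disjoint h.choose_spec hs

omit [SigmaFinite μ] in
theorem measurable_levelIndex {w : Ω → ℝ} (hwm : Measurable w) (hw : HasLevels μ J w) :
    Measurable (levelIndex μ J w) := by
  refine measurable_to_countable' fun k => ?_
  have hU : MeasurableSet (⋃ k, levelSet μ J w k)ᶜ :=
    (MeasurableSet.iUnion fun k => measurableSet_levelSet hwm k).compl
  have : levelIndex μ J w ⁻¹' {k} =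
      levelSet μ J w k ∪ (if k = 0 then (⋃ k, levelSet μ J w k)ᶜ else ∅) := by
    ext s
    by_cases h : ∃ l, s ∈ levelSet μ J w l
    · obtain ⟨l, hl⟩ := h
      have hsU : s ∉ (⋃ k, levelSet μ J w k)ᶜ := fun h => h (mem_iUnion.2 ⟨l, hl⟩)
      simp only [mem_preimage, mem_singleton_iff, levelIndex_of_mem hw hl, mem_union]
      constructor
      · rintro rfl; exact Or.inl hl
      · rintro (h | h)
        · exact hw.disjoint hl h
        · split_ifs at h
          · exact absurd h hsU
          · exact absurd h (notMem_empty s)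
    · have h0 : levelIndex μ J w s = 0 := by rw [levelIndex, dif_neg h]
      have hk : s ∉ levelSet μ J w k := fun hs => h ⟨k, hs⟩
      have hsU : s ∈ (⋃ k, levelSet μ J w k)ᶜ := fun hs => h (mem_iUnion.1 hs)
      simp only [mem_preimage, mem_singleton_iff, h0, mem_union, hk, false_or]
      by_cases hk0 : k = 0
      · simp only [hk0, if_true, true_iff]; exact hsU
      · simp only [if_neg hk0, notMem_empty, iff_false]; exact fun h => hk0 h.symm
  rw [this]
  refine (measurableSet_levelSet hwm k).union ?_
  split_ifs
  · exact hU
  · exact MeasurableSet.empty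

namespace DyadicModel

variable (M : DyadicModel μ κ J)

include M

omit [SigmaFinite μ] in
/-- The estimate in the sequence space for the operators below, on indices of one parity. -/
theorem NE_parity_le {C : ℝ≥0∞} (hC : RightShift X κ C) {lab : ℤ → ℤ}
    {P : ℤ → Set ℤ} (hlab : MonotoneOn lab J) {r : ℤ} {S : Set ℤ} (hS : S.Finite) (hSJ : S ⊆ J)
    (hr : ∀ k ∈ S, lab k % 2 = r) (hPfin : ∀ k ∈ S, (P (lab k)).Finite)
    (hPJ : ∀ k ∈ S, P (lab k) ⊆ J)
    (hP : ∀ k ∈ S, ∀ l ∈ P (lab k), lab l = lab k - 1) {ξ η : ℤ → ℝ}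
    (h : ∀ j, ∀ S' ⊆ S, (∀ k ∈ S', lab k = j) →
      X.NE κ (S'.indicator ξ) ≤ X.NE κ ((P j).indicator η)) :
    X.NE κ (S.indicator ξ) ≤ C * X.NE κ (J.indicator η) := by
  classical
  set F : Finset ℤ := hS.toFinset.image lab with hF
  have hFmem : ∀ j ∈ F, ∃ k ∈ S, lab k = j := fun j hj => by simpa [hF] using hj
  -- `x j` lives on label `j - 1` and `y j` on label `j`. For `i < j` of equal parity `i < j - 1`,
  -- so the pairs are interlaced.
  set x : ℤ → ℤ → ℝ := fun j => (P j).indicator η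
  set y : ℤ → ℤ → ℝ := fun j => {k | k ∈ S ∧ lab k = j}.indicator ξ
  have hxs : ∀ j ∈ F, ∀ l ∈ (x j).support, l ∈ J ∧ lab l = j - 1 := fun j hj l hl => by
    obtain ⟨k, hk, rfl⟩ := hFmem j hj
    have hl' : l ∈ P (lab k) := mem_of_indicator_ne_zero hl
    exact ⟨hPJ k hk hl', hP k hk l hl'⟩
  have hys : ∀ j, ∀ l ∈ (y j).support, l ∈ J ∧ lab l = j := fun j l hl => by
    have hl' : l ∈ {k | k ∈ S ∧ lab k = j} := mem_of_indicator_ne_zero hl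
    exact ⟨hSJ hl'.1, hl'.2⟩
  have hlt : ∀ k l, k ∈ J → l ∈ J → lab k < lab l → k < l := fun k l hk hl hkl => by
    by_contra! hc
    exact absurd (hlab hl hk hc) (not_le.2 hkl)
  have hint : IsInterlaced (F : Set ℤ) x y := by
    refine ⟨fun j hj => ?_, fun j hj => ?_, fun j hj a ha b hb => ?_,
      fun i hi j hj hij a ha b hb => ?_⟩
    · obtain ⟨k, hk, rfl⟩ := hFmem j hj
      exact (hPfin k hk).subset fun l hl => mem_of_indicator_ne_zero hl
    · exact hS.subset fun l hl => (mem_of_indicator_ne_zero hl : l ∈ {k | k ∈ S ∧ lab k = j}).1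
    · have h1 := hxs j hj a ha
      have h2 := hys j b hb
      exact hlt a b h1.1 h2.1 (by omega)
    · have ha' : a ∈ J ∧ lab a ≤ i := by
        rcases ha with ha | ha
        · have := hxs i hi a ha; exact ⟨this.1, by omega⟩
        · have := hys i a ha; exact ⟨this.1, by omega⟩
      have hb' : b ∈ J ∧ j - 1 ≤ lab b := by
        rcases hb with hb | hb
        · have := hxs j hj b hb; exact ⟨this.1, by omega⟩
        · have := hys j b hb; exact ⟨this.1, by omega⟩
      obtain ⟨k, hk, rfl⟩ := hFmem i hi
      obtain ⟨l, hl, rfl⟩ := hFmem j hj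
      have := hr k hk
      have := hr l hl
      exact hlt a b ha'.1 hb'.1 (by omega)
  have hmain := hC F x y hint fun j hj => h j _ (fun k hk => hk.1) fun k hk => hk.2
  calc X.NE κ (S.indicator ξ) = X.NE κ (fun k => ∑ j ∈ F, y j k) := by
        congr 1
        funext k
        by_cases hk : k ∈ S
        · rw [indicator_of_mem hk, Finset.sum_eq_single_of_mem (lab k) (by
            rw [hF]; exact Finset.mem_image_of_mem _ (by simpa using hk))]
          · exact (indicator_of_mem (show k ∈ {l | l ∈ S ∧ lab l = lab k} from ⟨hk, rfl⟩) ξ).symm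
          · intro j _ hj
            exact indicator_of_notMem (fun h => hj h.2.symm) _
        · rw [indicator_of_notMem hk]
          exact (Finset.sum_eq_zero fun j _ => indicator_of_notMem (fun h => hk h.1) _).symm
    _ ≤ C * X.NE κ (fun k => ∑ j ∈ F, x j k) := hmain
    _ ≤ C * X.NE κ (J.indicator η) := by
        gcongr
        refine M.NE_mono fun k hk => ?_
        have hother : ∀ j ∈ F, j ≠ lab k + 1 → x j k = 0 := fun j hj hne => by
          by_contra h0
          have := (hxs j hj k h0).2
          omega
        rw [indicator_of_mem hk]
        by_cases hj : lab k + 1 ∈ F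
        · rw [Finset.sum_eq_single_of_mem _ hj hother]
          by_cases hkP : k ∈ P (lab k + 1) <;> simp [x, hkP]
        · rw [Finset.sum_eq_zero fun j hjF => hother j hjF fun h => hj (h ▸ hjF), abs_zero]
          exact abs_nonneg _

/-- The operator multiplies `f` on its `k`-th level set by `c_j(h)`, where `j` is the label of `k`
and `c_j` is normalized at `g` and controlled by averages over the preceding block. The right-shift
property enters only in the bound on `X`; on `L_∞` the norm `T_k` cancels. -/
theorem reaches_levelSets (hX : X.IsRearrangementInvariant) {C : ℝ≥0} (hC : RightShift X κ C)
    {f g : sumSpace X (linfty μ)}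
    (hA0 : ∀ n ∈ J, X.NE κ ((Iic n).indicator (level μ (g : Ω →ₘ[μ] ℝ))) ≠ 0)
    (hBA : ∀ n ∈ J, X.NE κ ((Iic n).indicator (level μ (f : Ω →ₘ[μ] ℝ))) ≤
      16 * X.NE κ ((Iic n).indicator (level μ (g : Ω →ₘ[μ] ℝ)))) :
    Reaches X (linfty μ) ((12288 * C + 6144 : ℝ≥0) : ℝ≥0∞) g
      ((⋃ k, levelSet μ J (f : Ω →ₘ[μ] ℝ) k).indicator (f : Ω →ₘ[μ] ℝ)) := by
  classical
  set a := level μ (g : Ω →ₘ[μ] ℝ) with ha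
  set b := level μ (f : Ω →ₘ[μ] ℝ) with hb
  set f' : Ω → ℝ := ((f : Ω →ₘ[μ] ℝ) : Ω → ℝ) with hf'
  have hfm : Measurable f' := (f : Ω →ₘ[μ] ℝ).measurable
  have hlf := M.hasLevels hX f.2
  have hlg := M.hasLevels hX g.2
  obtain ⟨G, H, hG, -, hd, -, hGk⟩ := M.exists_blocks (g : Ω →ₘ[μ] ℝ).measurable hlg
  have hlow : ∀ k ∈ J, 2 ^ k ≤ 2 * μ (G k) := fun k hk => (hGk k hk).2.2.1
  have hfin : ∀ k ∈ J, μ (G k) < ∞ := fun k hk => (hGk k hk).2.1.trans_lt (two_zpow_lt_top k)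
  have hG0 : ∀ k ∈ J, μ (G k) ≠ 0 := fun k hk h => by
    have := hlow k hk
    rw [h, mul_zero] at this
    exact absurd this (not_le.2 (two_zpow_pos k))
  have hA1 : ∀ n ∈ J, X.NE κ ((Iic n).indicator a) < ∞ := fun n hn => by
    have hT := M.T_lt_top (X := X) hn
    have hTe : ((X.T κ n).toNNReal : ℝ≥0∞) = X.T κ n := ENNReal.coe_toNNReal hT.ne
    refine (M.NE_level_le hX g.2 hn (t := (X.T κ n).toNNReal)
      (ENNReal.toNNReal_pos (M.T_pos hn).ne' hT.ne)
      (by rw [hTe]; exact M.e_le_T n)).trans_lt ?_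
    exact ENNReal.mul_lt_top (by simp) (kFunctional_lt_top g.2)
  -- One more coordinate adds at most twice the norm, since levels decrease and `e_(n+1) ≤ 2 e_n`.
  have hA3 : ∀ n ∈ J, n + 1 ∈ J → X.NE κ ((Iic (n + 1)).indicator a) ≤
      3 * X.NE κ ((Iic n).indicator a) := fun n hn hn1 => by
    have h1 : X.NE κ (({n + 1} : Set ℤ).indicator a) ≤ 2 * X.NE κ ((Iic n).indicator a) := by
      calc _ ≤ ENNReal.ofReal (a (n + 1)) * X.e κ (n + 1) := by
            rw [KotheSpace.e, ← abs_of_nonneg (show 0 ≤ a (n + 1) from level_nonneg _ _),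
              ← N_const_mul (aestronglyMeasurable_const.indicator (M.ms_pre _))]
            refine N_mono (M.aesm_comp _) (Eventually.of_forall fun s => ?_)
            by_cases h : κ s = n + 1 <;> simp [indicator, h, ha]
        _ ≤ ENNReal.ofReal (a n) * (2 * X.e κ n) := by
            gcongr
            · exact hlg.antitone hn (by omega)
            · exact M.e_succ_le hX hn hn1
        _ = 2 * (ENNReal.ofReal |(Iic n).indicator a n| * X.e κ n) := by
            rw [indicator_of_mem (by simp), abs_of_nonneg (level_nonneg _ _)]
            ring
        _ ≤ _ := by
            gcongr
            exact M.NE_coord _ n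
    calc _ ≤ X.NE κ ((Iic n).indicator a) + X.NE κ (({n + 1} : Set ℤ).indicator a) :=
          M.NE_indicator_le_add (fun k _ hk => by
            simp only [mem_Iic, mem_singleton_iff] at hk ⊢
            omega) a
      _ ≤ X.NE κ ((Iic n).indicator a) + 2 * X.NE κ ((Iic n).indicator a) := by gcongr
      _ = _ := by ring
  obtain ⟨lab, P, hlab, hP⟩ := M.exists_division hA0 hA1 hA3
  have hPA : ∀ k ∈ J, X.NE κ ((P (lab k)).indicator a) ≠ 0 := fun k hk h => by
    have := (hP k hk).2.2.1
    rw [h, mul_zero, nonpos_iff_eq_zero] at this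
    exact hA0 k hk this
  have hex : ∀ j, ∃ c : sumSpace X (linfty μ) →ₗ[ℝ] ℝ, ∀ k ∈ J, lab k = j → c g = 1 ∧
      ∀ h : sumSpace X (linfty μ), ENNReal.ofReal |c h| * X.NE κ ((P j).indicator a) ≤
        2 * X.NE κ ((P j).indicator (blockAvg μ G (h : Ω →ₘ[μ] ℝ))) := fun j => by
    by_cases hj : ∃ k ∈ J, lab k = j
    · obtain ⟨k, hk, rfl⟩ := hj
      obtain ⟨c, h1, h2⟩ := M.exists_coef hX hG hlow hfin (hP k hk).1
        (fun k => level_nonneg _ k) (fun k hk => (hGk k hk).2.2.2) (hPA k hk)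
      exact ⟨c, fun _ _ _ => ⟨h1, h2⟩⟩
    · exact ⟨0, fun k hk hkj => absurd ⟨k, hk, hkj⟩ hj⟩
  choose c hc using hex
  set U : Set Ω := ⋃ k, levelSet μ J f' k with hU
  have hUm : MeasurableSet U := MeasurableSet.iUnion fun k => measurableSet_levelSet hfm k
  have hval : ∀ (h : sumSpace X (linfty μ)) k, ∀ s ∈ levelSet μ J f' k,
      LinearMap.pi c h (lab (levelIndex μ J f' s)) * U.indicator f' s = c (lab k) h * f' s :=
    fun h k s hs => by
      rw [levelIndex_of_mem hlf hs, indicator_of_mem (mem_iUnion.2 ⟨k, hs⟩)]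
      rfl
  have hval0 : ∀ (h : sumSpace X (linfty μ)) s, (∀ k, s ∉ levelSet μ J f' k) →
      LinearMap.pi c h (lab (levelIndex μ J f' s)) * U.indicator f' s = 0 := fun h s hs => by
    rw [indicator_of_notMem (by simpa [hU] using hs), mul_zero]
  have hmeas : ∀ h : sumSpace X (linfty μ), Measurable fun s =>
      LinearMap.pi c h (lab (levelIndex μ J f' s)) * U.indicator f' s := fun h =>
    ((measurable_of_countable fun k => LinearMap.pi c h (lab k)).comp
      (measurable_levelIndex hfm hlf)).mul (hfm.indicator hUm)
  have hreach := reaches_of_coef (X := X) (Y := linfty μ) (C := ((12288 * C + 6144 : ℝ≥0) : ℝ≥0∞))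
    (ℓ := fun s => lab (levelIndex μ J f' s))
    ((measurable_of_countable lab).comp (measurable_levelIndex hfm hlf)) (hfm.indicator hUm)
    (LinearMap.pi c) ENNReal.coe_ne_top (fun h hh => ?_) (fun h hh => ?_) g
  · refine hreach.congr (Eventually.of_forall fun s => ?_)
    by_cases hs : ∃ k, s ∈ levelSet μ J f' k
    · obtain ⟨k, hk⟩ := hs
      simp only
      rw [hval g k s hk, (hc (lab k) k hk.1 rfl).1, one_mul,
        indicator_of_mem (mem_iUnion.2 ⟨k, hk⟩)]
    · push Not at hs
      simp only
      rw [hval0 g s hs, indicator_of_notMem (by simpa [hU] using hs)]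
  · -- the bound on `X`
    set η : ℤ → ℝ := blockAvg μ G (h : Ω →ₘ[μ] ℝ) with hη
    set ξ : ℤ → ℝ := J.indicator fun k => c (lab k) h * b k with hξ
    have hηN : X.NE κ (J.indicator η) ≤ 2 * X.N (h : Ω →ₘ[μ] ℝ) :=
      M.NE_blockAvg_le hX hG hd hlow hfin (h : Ω →ₘ[μ] ℝ).measurable
    -- `1536 = 16 * 48 * 2`: the comparison of the levels of `f` and `g`, the control of the norm by
    -- the preceding block, and the bound on the functional.
    have hpiece : ∀ j, ∀ S : Set ℤ, S.Finite → S ⊆ J → (∀ k ∈ S, lab k = j) →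
        X.NE κ (S.indicator ξ) ≤ 1536 * X.NE κ ((P j).indicator η) := fun j S hS hSJ hSj => by
      rcases S.eq_empty_or_nonempty with rfl | hne
      · rw [indicator_empty]
        exact (NE_zero (X := X) (κ := κ)).le.trans zero_le
      obtain ⟨p, hpS, hp⟩ := hS.exists_maximal hne
      have hp' : ∀ k ∈ S, k ≤ p := fun k hk => by
        by_contra! hc
        exact absurd (hp hk hc.le) (not_le.2 hc)
      have hpj := hSj p hpS
      have hpJ := hSJ hpS
      calc X.NE κ (S.indicator ξ)
          ≤ ENNReal.ofReal |c j h| * X.NE κ ((Iic p).indicator b) := by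
            rw [← M.NE_const_mul]
            refine M.NE_mono fun k hk => ?_
            by_cases hkS : k ∈ S
            · rw [indicator_of_mem hkS, hξ, indicator_of_mem hk,
                indicator_of_mem (by simpa using hp' k hkS), hSj k hkS]
            · rw [indicator_of_notMem hkS, abs_zero]
              exact abs_nonneg _
        _ ≤ ENNReal.ofReal |c j h| * (16 * (48 * X.NE κ ((P j).indicator a))) := by
            gcongr
            refine (hBA p hpJ).trans ?_
            gcongr
            rw [← hpj]
            exact (hP p hpJ).2.2.1
        _ = 768 * (ENNReal.ofReal |c j h| * X.NE κ ((P j).indicator a)) := by ring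
        _ ≤ 768 * (2 * X.NE κ ((P j).indicator η)) := mul_le_mul_right ((hc j p hpJ hpj).2 h) _
        _ = _ := by rw [← mul_assoc]; norm_num
    have hscale : ∀ Q : Set ℤ, 1536 * X.NE κ (Q.indicator η) =
        X.NE κ (Q.indicator fun k => 1536 * η k) := fun Q => by
      have h2 : (1536 : ℝ≥0∞) = ENNReal.ofReal |(1536 : ℝ)| := by
        rw [abs_of_pos (by norm_num)]; norm_num
      rw [h2, ← M.NE_const_mul]
      congr 1
      funext k
      by_cases hk : k ∈ Q <;> simp [hk]
    have hpar : ∀ (n : ℕ) (r : ℤ), X.NE κ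
        ({k | k ∈ Icc (-n : ℤ) n ∧ k ∈ J ∧ lab k % 2 = r ∧ ¬ ∀ l ∈ J, k ≤ l}.indicator ξ) ≤
        C * (1536 * X.NE κ (J.indicator η)) := fun n r => by
      have hfinS : {k | k ∈ Icc (-n : ℤ) n ∧ k ∈ J ∧ lab k % 2 = r ∧ ¬ ∀ l ∈ J, k ≤ l}.Finite :=
        (finite_Icc (-n : ℤ) n).subset fun k hk => hk.1
      rw [hscale]
      refine M.NE_parity_le hC hlab hfinS (fun k hk => hk.2.1) (fun k hk => hk.2.2.1)
        (fun k hk => (hP k hk.2.1).1) (fun k hk l hl => ((hP k hk.2.1).2.1 hl).1)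
        (fun k hk => ((hP k hk.2.1).2.2.2).resolve_right hk.2.2.2) fun j S' hS' hj => ?_
      rw [← hscale]
      exact hpiece j S' (hfinS.subset hS') (fun k hk => (hS' hk).2.1) hj
    -- The least index of `J` cannot be paired with a block to its left; its block controls itself
    -- and no shift is needed.
    have hbot : ∀ n : ℕ, X.NE κ ({k | k ∈ Icc (-n : ℤ) n ∧ k ∈ J ∧ ∀ l ∈ J, k ≤ l}.indicator ξ) ≤
        1536 * X.NE κ (J.indicator η) := fun n => by
      by_cases hk : ∃ k ∈ J, ∀ l ∈ J, k ≤ l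
      · obtain ⟨k, hk, hkl⟩ := hk
        refine (hpiece (lab k) _ ((finite_Icc (-n : ℤ) n).subset fun k hk => hk.1)
          (fun l hl => hl.2.1) fun l hl => ?_).trans ?_
        · rw [le_antisymm (hl.2.2 k hk) (hkl l hl.2.1)]
        · gcongr
          exact M.NE_indicator_mono (fun l hl _ => hl) _
      · have : {k | k ∈ Icc (-n : ℤ) n ∧ k ∈ J ∧ ∀ l ∈ J, k ≤ l} = ∅ :=
          eq_empty_of_forall_notMem fun k hk' => hk ⟨k, hk'.2⟩
        rw [this, indicator_empty]
        exact (NE_zero (X := X) (κ := κ)).le.trans zero_le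
    -- The least index costs 1536, each parity `1536 * C`, and the passage from the averages to `h`
    -- a factor 2. A last factor 2, from level sets to blocks, gives the constant of the statement.
    have hNEξ : X.NE κ ξ ≤ (6144 * C + 3072 : ℝ≥0∞) * X.N (h : Ω →ₘ[μ] ℝ) := by
      refine M.NE_fatou fun n => ?_
      calc X.NE κ ((Icc (-n : ℤ) n).indicator ξ)
          ≤ X.NE κ ({k | k ∈ Icc (-n : ℤ) n ∧ k ∈ J ∧ ∀ l ∈ J, k ≤ l}.indicator ξ) +
            X.NE κ (({k | k ∈ Icc (-n : ℤ) n ∧ k ∈ J ∧ lab k % 2 = 0 ∧ ¬ ∀ l ∈ J, k ≤ l} ∪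
              {k | k ∈ Icc (-n : ℤ) n ∧ k ∈ J ∧ lab k % 2 = 1 ∧ ¬ ∀ l ∈ J, k ≤ l}).indicator ξ) := by
            refine M.NE_indicator_le_add (fun k hk hkn => ?_) ξ
            by_cases hl : ∀ l ∈ J, k ≤ l
            · exact Or.inl ⟨hkn, hk, hl⟩
            · rcases Int.emod_two_eq_zero_or_one (lab k) with h | h
              · exact Or.inr (Or.inl ⟨hkn, hk, h, hl⟩)
              · exact Or.inr (Or.inr ⟨hkn, hk, h, hl⟩)
        _ ≤ 1536 * X.NE κ (J.indicator η) +
            (C * (1536 * X.NE κ (J.indicator η)) + C * (1536 * X.NE κ (J.indicator η))) :=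
            add_le_add (hbot n) ((M.NE_indicator_le_add (fun k _ hk => hk) ξ).trans
              (add_le_add (hpar n 0) (hpar n 1)))
        _ = (3072 * C + 1536) * X.NE κ (J.indicator η) := by ring
        _ ≤ (3072 * C + 1536) * (2 * X.N (h : Ω →ₘ[μ] ℝ)) := by gcongr
        _ = _ := by ring
    rw [← N_coe]
    calc _ ≤ 2 * X.NE κ ξ := by
          refine M.N_le_two_NE hX hfm hlf (hmeas h) (fun k s hs => ?_)
            (Eventually.of_forall fun s hs => hval0 h s hs)
          rw [hval h k s hs, hξ, indicator_of_mem hs.1, abs_mul, abs_mul]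
          exact mul_le_mul_of_nonneg_left (hs.2.2.1.trans (le_abs_self _)) (abs_nonneg _)
      _ ≤ 2 * ((6144 * C + 3072 : ℝ≥0∞) * X.N (h : Ω →ₘ[μ] ℝ)) := by gcongr
      _ = _ := by push_cast; ring
  · -- the bound on `L_∞`
    rw [← N_coe] at hh ⊢
    refine N_linfty_le (hmeas h).aestronglyMeasurable (Eventually.of_forall fun s => ?_)
    by_cases hs : ∃ k, s ∈ levelSet μ J f' k
    · obtain ⟨k, hk⟩ := hs
      have hkJ := hk.1
      have hT0 := (M.T_pos (X := X) hkJ).ne'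
      have hT1 := (M.T_lt_top (X := X) hkJ).ne
      rw [hval h k s hk, abs_mul, ENNReal.ofReal_mul (abs_nonneg _)]
      -- The block lies in `Iic k`, so averages bounded by the sup norm of `h` cost at most `T_k`,
      -- the factor that `b k` carries in `hbT`.
      have hq : X.NE κ ((P (lab k)).indicator (blockAvg μ G (h : Ω →ₘ[μ] ℝ))) ≤
          (linfty μ).N (h : Ω →ₘ[μ] ℝ) * X.T κ k := by
        rw [← ENNReal.ofReal_toReal hh.ne]
        refine M.NE_le_mul_T k ENNReal.toReal_nonneg (fun l hl => ?_) fun l hl hkl => ?_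
        · by_cases hlP : l ∈ P (lab k)
          · rw [indicator_of_mem hlP, abs_of_nonneg (blockAvg_nonneg _ _ _),
              ← ENNReal.ofReal_le_iff_le_toReal hh.ne]
            exact blockAvg_le_linfty (hG0 l hl) (hfin l hl) (h : Ω →ₘ[μ] ℝ).measurable
          · rw [indicator_of_notMem hlP, abs_zero]
            exact ENNReal.toReal_nonneg
        · refine indicator_of_notMem (fun hlP => ?_) _
          exact absurd ((hP k hkJ).2.1 hlP).2 (not_le.2 hkl)
      have hbT : ENNReal.ofReal (b k) * X.T κ k ≤
          1536 * X.NE κ ((P (lab k)).indicator a) := by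
        calc _ ≤ 2 * X.NE κ ((Iic k).indicator b) := M.level_mul_T_le hX hkJ
          _ ≤ 2 * (16 * (48 * X.NE κ ((P (lab k)).indicator a))) := by
              gcongr
              refine (hBA k hkJ).trans ?_
              gcongr
              exact (hP k hkJ).2.2.1
          _ = _ := by ring
      have hmul : ENNReal.ofReal |c (lab k) h| * ENNReal.ofReal |f' s| * X.T κ k ≤
          3072 * (linfty μ).N (h : Ω →ₘ[μ] ℝ) * X.T κ k := by
        calc _ ≤ ENNReal.ofReal |c (lab k) h| * (ENNReal.ofReal (b k) * X.T κ k) := by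
              rw [mul_assoc]
              gcongr
              exact hk.2.2.1
          _ ≤ ENNReal.ofReal |c (lab k) h| * (1536 * X.NE κ ((P (lab k)).indicator a)) := by
              gcongr
          _ = 1536 * (ENNReal.ofReal |c (lab k) h| * X.NE κ ((P (lab k)).indicator a)) := by ring
          _ ≤ 1536 * (2 * ((linfty μ).N (h : Ω →ₘ[μ] ℝ) * X.T κ k)) :=
              mul_le_mul_right (((hc (lab k) k hkJ rfl).2 h).trans (mul_le_mul_right hq 2)) _
          _ = _ := by ring
      rw [ENNReal.mul_le_mul_iff_left hT0 hT1] at hmul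
      refine hmul.trans ?_
      gcongr
      push_cast
      calc (3072 : ℝ≥0∞) ≤ 6144 := by norm_num
        _ ≤ _ := le_add_self
    · push Not at hs
      rw [hval0 h s hs, abs_zero, ENNReal.ofReal_zero]
      exact zero_le

end DyadicModel

end Sufficiency

/-! ### The part of a function below all its levels, and the end of the sufficiency proof -/

section Sufficiency

variable {Ω : Type*} [MeasurableSpace Ω] {μ : Measure Ω} [SigmaFinite μ] {X : KotheSpace μ}
  {κ : Ω → ℤ} {J : Set ℤ}

namespace DyadicModel

variable (M : DyadicModel μ κ J)

include M

omit [SigmaFinite μ] in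
theorem exists_cofinal_seq : ∃ m : ℕ → ℤ, (∀ i, m i ∈ J) ∧ ∀ k ∈ J, ∀ᶠ i in atTop, k ≤ m i := by
  by_cases hb : BddAbove J
  · obtain ⟨b, hb⟩ := hb
    obtain ⟨p, hp, hpmax⟩ := Int.exists_greatest_of_bdd (P := (· ∈ J)) ⟨b, fun z hz => hb hz⟩
      M.nonempty
    exact ⟨fun _ => p, fun _ => hp, fun k hk => Eventually.of_forall fun _ => hpmax k hk⟩
  · rw [not_bddAbove_iff] at hb
    choose m hm hlt using fun i : ℕ => hb (i : ℤ)
    refine ⟨m, hm, fun k _ => ?_⟩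
    filter_upwards [eventually_ge_atTop k.toNat] with i hi
    have := hlt i
    have := Int.self_le_toNat k
    omega

omit M in
variable (X κ J) in
/-- The limit of `K(t, h) / t` for large `t`. -/
def tailK (h : Ω →ₘ[μ] ℝ) : ℝ≥0∞ :=
  ⨅ n : J, kFunctional X (linfty μ) (X.T κ n).toNNReal h / X.T κ n

omit [SigmaFinite μ] in
theorem coe_toNNReal_T {n : ℤ} (hn : n ∈ J) : ((X.T κ n).toNNReal : ℝ≥0∞) = X.T κ n :=
  ENNReal.coe_toNNReal (M.T_lt_top hn).ne

omit [SigmaFinite μ] in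
theorem toNNReal_T_pos {n : ℤ} (hn : n ∈ J) : 0 < (X.T κ n).toNNReal :=
  ENNReal.toNNReal_pos (M.T_pos hn).ne' (M.T_lt_top hn).ne

theorem div_T_antitone {m n : ℤ} (hm : m ∈ J) (hn : n ∈ J) (hmn : m ≤ n) (h : Ω →ₘ[μ] ℝ) :
    kFunctional X (linfty μ) (X.T κ n).toNNReal h / X.T κ n ≤
      kFunctional X (linfty μ) (X.T κ m).toNNReal h / X.T κ m := by
  have := kFunctional_le_div_mul (X := X) (M.toNNReal_T_pos hm)
    (ENNReal.toNNReal_mono (M.T_lt_top (X := X) hn).ne (M.T_mono (X := X) hmn)) h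
  rw [M.coe_toNNReal_T hm, M.coe_toNNReal_T hn] at this
  rw [ENNReal.div_le_iff (M.T_pos hn).ne' (M.T_lt_top hn).ne, mul_comm, ← mul_div_assoc,
    ENNReal.le_div_iff_mul_le (Or.inl (M.T_pos hm).ne') (Or.inl (M.T_lt_top hm).ne), mul_comm]
  exact this

theorem tailK_mul_le (h : Ω →ₘ[μ] ℝ) {n : ℤ} (hn : n ∈ J) :
    tailK X κ J h * X.T κ n ≤ kFunctional X (linfty μ) (X.T κ n).toNNReal h := by
  rw [← ENNReal.le_div_iff_mul_le (Or.inl (M.T_pos hn).ne') (Or.inl (M.T_lt_top hn).ne)]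
  exact iInf_le (fun n : J => kFunctional X (linfty μ) (X.T κ n).toNNReal h / X.T κ n) ⟨n, hn⟩

theorem tailK_ne_top {h : Ω →ₘ[μ] ℝ} (hh : h ∈ sumSpace X (linfty μ)) : tailK X κ J h ≠ ∞ := by
  obtain ⟨n, hn⟩ := M.nonempty
  intro htop
  have := M.tailK_mul_le (X := X) h hn
  rw [htop, ENNReal.top_mul (M.T_pos hn).ne', top_le_iff] at this
  exact (kFunctional_lt_top hh).ne this

/-- The quotients decrease in `n`, so the sum of the two infima is the infimum of the sums with a
common index. -/
theorem tailK_add_le (x y : Ω →ₘ[μ] ℝ) :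
    tailK X κ J (x + y) ≤ tailK X κ J x + tailK X κ J y := by
  rw [tailK, tailK, tailK, ENNReal.iInf_add_iInf (ι := J) fun (i j : J) =>
    ⟨max i j, add_le_add (M.div_T_antitone i.2 (max i j).2 (le_max_left i j) x)
      (M.div_T_antitone j.2 (max i j).2 (le_max_right i j) y)⟩]
  refine iInf_mono fun n => ?_
  rw [← ENNReal.add_div]
  exact ENNReal.div_le_div_right (kFunctional_add_le _ x y) _

omit M in
theorem tailK_smul_le {c : ℝ} (hc : c ≠ 0) (x : Ω →ₘ[μ] ℝ) :
    tailK X κ J (c • x) ≤ ENNReal.ofReal |c| * tailK X κ J x := by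
  rw [tailK, tailK, ENNReal.mul_iInf_of_ne (by simpa using hc) ENNReal.ofReal_ne_top]
  refine iInf_mono fun n => ?_
  rw [← mul_div_assoc]
  exact ENNReal.div_le_div_right (kFunctional_smul_le _ hc x) _

theorem tailK_le_nrm (h : Ω →ₘ[μ] ℝ) {n : ℤ} (hn : n ∈ J) :
    tailK X κ J h * X.T κ n ≤ X.nrm h :=
  (M.tailK_mul_le h hn).trans (kFunctional_le_nrm _ h)

theorem tailK_le_linfty (h : Ω →ₘ[μ] ℝ) : tailK X κ J h ≤ (linfty μ).nrm h := by
  obtain ⟨n, hn⟩ := M.nonempty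
  have := (M.tailK_mul_le (X := X) h hn).trans (kFunctional_le_linfty _ h)
  rwa [M.coe_toNNReal_T hn, mul_comm,
    ENNReal.mul_le_mul_iff_right (M.T_pos hn).ne' (M.T_lt_top hn).ne] at this

theorem tailK_smul (c : ℝ) (x : Ω →ₘ[μ] ℝ) :
    tailK X κ J (c • x) = ENNReal.ofReal |c| * tailK X κ J x := by
  by_cases hc : c = 0
  · subst hc
    rw [zero_smul, abs_zero, ENNReal.ofReal_zero, zero_mul]
    exact le_antisymm ((M.tailK_le_linfty 0).trans (((linfty μ).nrm_eq_zero_iff 0).2 rfl).le)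
      zero_le
  · refine le_antisymm (tailK_smul_le hc x) ?_
    have h1 := tailK_smul_le (X := X) (κ := κ) (J := J) (inv_ne_zero hc) (c • x)
    rw [smul_smul, inv_mul_cancel₀ hc, one_smul, abs_inv,
      ENNReal.ofReal_inv_of_pos (abs_pos.2 hc)] at h1
    calc _ ≤ ENNReal.ofReal |c| * ((ENNReal.ofReal |c|)⁻¹ * tailK X κ J (c • x)) := by gcongr
      _ = _ := by
        rw [← mul_assoc, ENNReal.mul_inv_cancel (by simpa using hc) ENNReal.ofReal_ne_top, one_mul]

/-- On the blocks up to `m` the norm of `u` is at most `Q T_m`, and `tailK h * T_m ≤ ‖h‖`; the Fatou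
property passes to the whole space. In particular, bounded functions belong to `X` as soon as some
`h` in `X` has nonzero tail. -/
theorem N_le_of_tailK {u : Ω → ℝ} (hum : Measurable u) {Q : ℝ≥0∞} (hQ : Q ≠ ∞)
    (hu : (linfty μ).N u ≤ Q) {h : Ω →ₘ[μ] ℝ} (hh : h ∈ sumSpace X (linfty μ)) :
    tailK X κ J h * X.N u ≤ Q * X.nrm h := by
  have hQfin := M.tailK_ne_top hh
  by_cases hQh : tailK X κ J h = 0
  · rw [hQh, zero_mul]
    exact zero_le
  rw [mul_comm, ← ENNReal.le_div_iff_mul_le (Or.inl hQh) (Or.inl hQfin)]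
  obtain ⟨m, hmJ, hm⟩ := M.exists_cofinal_seq
  refine N_fatou (u := fun i => (κ ⁻¹' Iic (m i)).indicator u)
    (fun i => hum.indicator (M.ms_pre _)) hum (fun i => ?_) ?_
  · rw [ENNReal.le_div_iff_mul_le (Or.inl hQh) (Or.inl hQfin)]
    calc _ ≤ (linfty μ).N u * X.T κ (m i) * tailK X κ J h := by
          gcongr
          exact N_indicator_le_linfty u (M.ms_pre _) hum.aestronglyMeasurable
            (ne_top_of_le_ne_top hQ hu)
      _ ≤ Q * (tailK X κ J h * X.T κ (m i)) := by
          rw [mul_assoc, mul_comm (X.T κ (m i))]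
          gcongr
      _ ≤ _ := by
          gcongr
          exact M.tailK_le_nrm _ (hmJ i)
  · filter_upwards [M.ae_mem] with s hs
    refine tendsto_const_nhds.congr' ?_
    filter_upwards [hm _ hs] with i hi
    exact (indicator_of_mem (show s ∈ κ ⁻¹' Iic (m i) from hi) u).symm

/-- The tail is a seminorm on the sum space. It is dominated by the norm of `L_∞` and, in the
presence of the factor `‖u‖_X`, by that of `X`, so a norming functional at `g` times `u` is bounded
on both spaces. -/
theorem reaches_of_tailK {u : Ω → ℝ} (hum : Measurable u) {g : sumSpace X (linfty μ)}
    (hQg : tailK X κ J (g : Ω →ₘ[μ] ℝ) ≠ 0)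
    (huL : (linfty μ).N u ≤ 8 * tailK X κ J (g : Ω →ₘ[μ] ℝ)) : Reaches X (linfty μ) 8 g u := by
  have hfin : ∀ h : sumSpace X (linfty μ), tailK X κ J (h : Ω →ₘ[μ] ℝ) ≠ ∞ := fun h =>
    M.tailK_ne_top h.2
  obtain ⟨q, hq⟩ : ∃ q : sumSpace X (linfty μ) → ℝ,
      ∀ h, q h = (tailK X κ J (h : Ω →ₘ[μ] ℝ)).toReal := ⟨_, fun _ => rfl⟩
  have hq' : ∀ h, ENNReal.ofReal (q h) = tailK X κ J (h : Ω →ₘ[μ] ℝ) := fun h => by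
    rw [hq, ENNReal.ofReal_toReal (hfin h)]
  have hadd : ∀ x y, q (x + y) ≤ q x + q y := fun x y => by
    rw [hq, hq, hq, ← ENNReal.toReal_add (hfin x) (hfin y)]
    exact ENNReal.toReal_mono (ENNReal.add_lt_top.2 ⟨(hfin x).lt_top, (hfin y).lt_top⟩).ne
      (M.tailK_add_le _ _)
  have hsmul : ∀ (c : ℝ) x, q (c • x) = |c| * q x := fun c x => by
    rw [hq, hq, Submodule.coe_smul, M.tailK_smul, ENNReal.toReal_mul,
      ENNReal.toReal_ofReal (abs_nonneg c)]
  have hpos : 0 < q g := by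
    rw [hq]
    exact ENNReal.toReal_pos hQg (hfin g)
  refine reaches_of_seminorm q hadd hsmul hum ENNReal.ofNat_ne_top hpos (fun h _ => ?_)
    fun h _ => ?_
  · rw [hq', hq']
    exact M.N_le_of_tailK hum (ENNReal.mul_ne_top ENNReal.ofNat_ne_top (hfin g)) huL h.2
  · rw [hq', hq', mul_comm]
    exact mul_le_mul' huL (M.tailK_le_linfty _)

/-- On this part `|f|` is below every level, and dividing the hypothesis by `T_n` bounds it by 8
times the tail of `g`. If that tail is 0, nothing remains to be reached. -/
theorem reaches_levelRest {f g : sumSpace X (linfty μ)}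
    (hBK : ∀ n ∈ J, ENNReal.ofReal (level μ (f : Ω →ₘ[μ] ℝ) n) * X.T κ n ≤
      8 * kFunctional X (linfty μ) (X.T κ n).toNNReal (g : Ω →ₘ[μ] ℝ)) :
    Reaches X (linfty μ) 8 g
      ((levelRest μ J (f : Ω →ₘ[μ] ℝ)).indicator (f : Ω →ₘ[μ] ℝ)) := by
  have hfm : Measurable (f : Ω →ₘ[μ] ℝ) := (f : Ω →ₘ[μ] ℝ).measurable
  have hum := hfm.indicator (measurableSet_levelRest (μ := μ) (J := J) hfm)
  have hu8 : ∀ s, ENNReal.ofReal |(levelRest μ J (f : Ω →ₘ[μ] ℝ)).indicator (f : Ω →ₘ[μ] ℝ) s| ≤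
      8 * tailK X κ J (g : Ω →ₘ[μ] ℝ) := fun s => by
    rw [tailK, ENNReal.mul_iInf_of_ne (by norm_num) (by norm_num)]
    refine le_iInf fun n => ?_
    rw [← mul_div_assoc,
      ENNReal.le_div_iff_mul_le (Or.inl (M.T_pos n.2).ne') (Or.inl (M.T_lt_top n.2).ne)]
    refine le_trans ?_ (hBK n n.2)
    gcongr
    by_cases hs : s ∈ levelRest μ J (f : Ω →ₘ[μ] ℝ)
    · rw [indicator_of_mem hs]
      exact hs n n.2
    · rw [indicator_of_notMem hs, abs_zero]
      exact level_nonneg _ _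
  have huL : (linfty μ).N ((levelRest μ J (f : Ω →ₘ[μ] ℝ)).indicator (f : Ω →ₘ[μ] ℝ)) ≤
      8 * tailK X κ J (g : Ω →ₘ[μ] ℝ) :=
    N_linfty_le hum.aestronglyMeasurable (Eventually.of_forall hu8)
  by_cases hQg : tailK X κ J (g : Ω →ₘ[μ] ℝ) = 0
  · refine Reaches.zero.congr ?_
    rw [hQg, mul_zero, nonpos_iff_eq_zero] at huL
    exact (N_eq_zero (X := linfty μ) huL).symm
  exact M.reaches_of_tailK hum hQg huL

/-- The sufficiency of the right-shift property. -/
theorem exists_operator (hX : X.IsRearrangementInvariant) {C : ℝ≥0} (hC : RightShift X κ C)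
    {f g : sumSpace X (linfty μ)} (hK : ∀ t : ℝ≥0, 0 < t →
      kFunctional X (linfty μ) t (f : Ω →ₘ[μ] ℝ) ≤ kFunctional X (linfty μ) t (g : Ω →ₘ[μ] ℝ)) :
    Reaches X (linfty μ) ((12288 * C + 6152 : ℝ≥0) : ℝ≥0∞) g (f : Ω →ₘ[μ] ℝ) := by
  have hT1 : ∀ n ∈ J, X.T κ n ≠ ∞ := fun n hn => (M.T_lt_top hn).ne
  have hT0 : ∀ n ∈ J, X.T κ n ≠ 0 := fun n hn => (M.T_pos hn).ne'
  have hTe : ∀ n ∈ J, ((X.T κ n).toNNReal : ℝ≥0∞) = X.T κ n := fun n hn =>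
    ENNReal.coe_toNNReal (hT1 n hn)
  have hTpos : ∀ n ∈ J, 0 < (X.T κ n).toNNReal := fun n hn =>
    ENNReal.toNNReal_pos (hT0 n hn) (hT1 n hn)
  have hBK : ∀ n ∈ J, X.NE κ ((Iic n).indicator (level μ (f : Ω →ₘ[μ] ℝ))) ≤
      4 * kFunctional X (linfty μ) (X.T κ n).toNNReal (g : Ω →ₘ[μ] ℝ) := fun n hn =>
    (M.NE_level_le hX f.2 hn (hTpos n hn) (by rw [hTe n hn]; exact M.e_le_T n)).trans
      (mul_le_mul_right (hK _ (hTpos n hn)) 4)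
  have hKA : ∀ n ∈ J, kFunctional X (linfty μ) (X.T κ n).toNNReal (g : Ω →ₘ[μ] ℝ) ≤
      4 * X.NE κ ((Iic n).indicator (level μ (g : Ω →ₘ[μ] ℝ))) := fun n hn =>
    M.kFunctional_le_NE hX g.2 hn (hTe n hn).le
  by_cases hA0 : ∀ n ∈ J, X.NE κ ((Iic n).indicator (level μ (g : Ω →ₘ[μ] ℝ))) ≠ 0
  · have h1 := M.reaches_levelSets hX hC hA0 fun n hn => by
      calc _ ≤ 4 * (4 * X.NE κ ((Iic n).indicator (level μ (g : Ω →ₘ[μ] ℝ)))) :=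
            (hBK n hn).trans (mul_le_mul_right (hKA n hn) 4)
        _ = _ := by ring
    have h2 := M.reaches_levelRest (f := f) (g := g) fun n hn => by
      calc _ ≤ 2 * (4 * kFunctional X (linfty μ) (X.T κ n).toNNReal (g : Ω →ₘ[μ] ℝ)) :=
            (M.level_mul_T_le hX hn).trans (mul_le_mul_right (hBK n hn) 2)
        _ = _ := by ring
    refine ((h1.add h2).mono (le_of_eq ?_)).congr ?_
    · push_cast
      ring
    · have hfm : Measurable (f : Ω →ₘ[μ] ℝ) := (f : Ω →ₘ[μ] ℝ).measurable
      filter_upwards [M.ae_mem_levelSet hfm (M.hasLevels hX f.2)] with s hs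
      by_cases hr : s ∈ levelRest μ J (f : Ω →ₘ[μ] ℝ)
      · have : s ∉ ⋃ k, levelSet μ J (f : Ω →ₘ[μ] ℝ) k := fun h => by
          obtain ⟨k, hk⟩ := mem_iUnion.1 h
          exact absurd (hr _ hk.2.1) (not_le.2 hk.2.2.2)
        rw [indicator_of_notMem this, indicator_of_mem hr, zero_add]
      · rw [indicator_of_notMem hr, indicator_of_mem (mem_iUnion.2 (hs.resolve_left hr)), add_zero]
  -- Degenerate case: `K(T_n, g) = 0`, hence `K(T_n, f) = 0`, and `f` vanishes on each block. The
  -- factor `s` below is only there to compare `T_n` with the block.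
  · push Not at hA0
    obtain ⟨n, hn, hA0⟩ := hA0
    have hKf : kFunctional X (linfty μ) (X.T κ n).toNNReal (f : Ω →ₘ[μ] ℝ) = 0 := by
      refine le_antisymm ((hK _ (hTpos n hn)).trans ((hKA n hn).trans ?_)) zero_le
      rw [hA0, mul_zero]
    refine Reaches.zero.congr ?_
    have hk : ∀ k, ∀ᵐ s ∂μ, κ s = k → (f : Ω →ₘ[μ] ℝ) s = 0 := fun k => by
      have h := N_indicator_le_kFunctional (M.ms_pre {k})
        (s := max 1 ((X.e κ k).toNNReal / (X.T κ n).toNNReal)) (le_max_left _ _) (hTpos n hn)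
        (by
          rw [← ENNReal.coe_mul]
          calc X.e κ k = ((X.e κ k).toNNReal : ℝ≥0∞) := (ENNReal.coe_toNNReal (M.e_lt_top k).ne).symm
            _ ≤ _ := by
              rw [ENNReal.coe_le_coe, ← div_le_iff₀ (hTpos n hn)]
              exact le_max_right _ _) (f : Ω →ₘ[μ] ℝ)
      rw [hKf, mul_zero, nonpos_iff_eq_zero] at h
      filter_upwards [N_eq_zero h] with s hs hsk
      rwa [indicator_of_mem (by simpa using hsk)] at hs
    filter_upwards [ae_all_iff.2 hk] with s hs
    exact (hs _ rfl).symm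

theorem isUniformCalderonCouple (hX : X.IsRearrangementInvariant) {C : ℝ≥0}
    (hC : RightShift X κ C) : IsUniformCalderonCouple X (linfty μ) := by
  refine ⟨12288 * C + 6152, fun f g hK => ?_⟩
  obtain ⟨T, h1, h2, h3⟩ := M.exists_operator hX hC hK
  exact ⟨T, h1, h2, Subtype.ext (AEEqFun.ext h3)⟩

end DyadicModel

end Sufficiency

/-! ### Reduction of the right-shift property to widely separated sequences -/

section Chains

variable {Ω : Type*} [MeasurableSpace Ω] {μ : Measure Ω} {X : KotheSpace μ} {κ : Ω → ℤ} {J : Set ℤ}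

theorem abs_sum_le_of_disjoint {ι : Type*} {F : Finset ι} {x z : ι → ℝ}
    (hd : ∀ m ∈ F, ∀ n ∈ F, m ≠ n → x m = 0 ∨ x n = 0) (hz : ∀ n ∈ F, |z n| ≤ |x n|) :
    |∑ n ∈ F, z n| ≤ |∑ n ∈ F, x n| := by
  by_cases h : ∃ n ∈ F, x n ≠ 0
  · obtain ⟨n, hn, hxn⟩ := h
    have hx : ∀ m ∈ F, m ≠ n → x m = 0 := fun m hm hmn => (hd m hm n hn hmn).resolve_right hxn
    rw [Finset.sum_eq_single_of_mem n hn hx, Finset.sum_eq_single_of_mem n hn fun m hm hmn => by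
      simpa [hx m hm hmn] using hz m hm]
    exact hz n hn
  · push Not at h
    rw [Finset.sum_eq_zero h, Finset.sum_eq_zero fun m hm => by simpa [h m hm] using hz m hm]

/-- Sequences `xᵢ`, `yᵢ`, supported in disjoint intervals that begin at `i`, with gaps between
the intervals that are measured by `Λ`. -/
structure IsChain (X : KotheSpace μ) (κ : Ω → ℤ) (J : Set ℤ) (Λ : ℤ → ℕ) (D : Set ℤ)
    (x y : ℤ → ℤ → ℝ) (r s h : ℤ → ℤ) : Prop where
  mem : ∀ i ∈ D, i ∈ J
  h_mem : ∀ i ∈ D, h i ∈ J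
  le_s : ∀ i ∈ D, i ≤ s i
  s_le : ∀ i ∈ D, s i ≤ h i
  le_r : ∀ i ∈ D, i ≤ r i
  r_le : ∀ i ∈ D, r i ≤ h i
  T_le : ∀ i ∈ D, X.T κ (r i) ≤ 2 * X.T κ (s i)
  supp_x : ∀ i ∈ D, Function.support (x i) ⊆ Icc i (r i)
  supp_y : ∀ i ∈ D, Function.support (y i) ⊆ Icc (s i) (h i)
  NE_le : ∀ i ∈ D, X.NE κ (y i) ≤ X.NE κ (x i)
  NE_ne : ∀ i ∈ D, X.NE κ (x i) ≠ 0
  lt : ∀ i ∈ D, ∀ j ∈ D, i < j → h i < j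
  sep : ∀ i ∈ D, ∀ j ∈ D, i < j → (Λ i : ℝ≥0∞) ^ 2 * (Λ j : ℝ≥0∞) ^ 2 * X.T κ (h i) ≤ X.T κ j

namespace DyadicModel

variable (M : DyadicModel μ κ J)

include M

/-- On a stretch where `T` at most doubles, `E` is `ℓ_∞` up to a constant: each coordinate is at
most `2 A / T_a`, and a sequence with this bound, supported up to `b`, has norm at most `(2 A / T_a)
T_b ≤ 4 A`. -/
theorem NE_sum_le_four (hX : X.IsRearrangementInvariant) {ι : Type*} {E : Finset ι}
    {z : ι → ℤ → ℝ} {a b : ℤ} (ha : a ∈ J) (hT : X.T κ b ≤ 2 * X.T κ a)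
    (hd : ∀ m ∈ E, ∀ n ∈ E, m ≠ n → ∀ k, z m k = 0 ∨ z n k = 0)
    (hs : ∀ n ∈ E, Function.support (z n) ⊆ Icc a b) {A : ℝ≥0∞} (hA : A ≠ ∞)
    (hz : ∀ n ∈ E, X.NE κ (z n) ≤ A) : X.NE κ (fun k => ∑ n ∈ E, z n k) ≤ 4 * A := by
  have hT0 := (M.T_pos (X := X) ha).ne'
  have hT1 := (M.T_lt_top (X := X) ha).ne
  have hc : (2 * A / X.T κ a) ≠ ∞ := ENNReal.div_ne_top (ENNReal.mul_ne_top (by simp) hA) hT0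
  have hpt : ∀ n ∈ E, ∀ k ∈ J, |z n k| ≤ (2 * A / X.T κ a).toReal := fun n hn k hk => by
    by_cases hk0 : z n k = 0
    · rw [hk0, abs_zero]
      exact ENNReal.toReal_nonneg
    have hak := (hs n hn hk0).1
    rw [← ENNReal.ofReal_le_iff_le_toReal hc, ENNReal.le_div_iff_mul_le (Or.inl hT0) (Or.inl hT1)]
    calc ENNReal.ofReal |z n k| * X.T κ a ≤ ENNReal.ofReal |z n k| * (2 * X.e κ k) := by
          gcongr
          exact (M.T_mono hak).trans (M.T_le_two_e hX hk)
      _ = 2 * (ENNReal.ofReal |z n k| * X.e κ k) := by ring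
      _ ≤ 2 * A := by
          gcongr
          exact (M.NE_coord _ k).trans (hz n hn)
  calc X.NE κ (fun k => ∑ n ∈ E, z n k)
      ≤ ENNReal.ofReal (2 * A / X.T κ a).toReal * X.T κ b := by
        refine M.NE_le_mul_T b ENNReal.toReal_nonneg (fun k hk => ?_) fun k hk hbk => ?_
        · by_cases h : ∃ n ∈ E, z n k ≠ 0
          · obtain ⟨n, hn, hzn⟩ := h
            rw [Finset.sum_eq_single_of_mem n hn fun m hm hmn =>
              (hd m hm n hn hmn k).resolve_right hzn]
            exact hpt n hn k hk
          · push Not at h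
            rw [Finset.sum_eq_zero h, abs_zero]
            exact ENNReal.toReal_nonneg
        · refine Finset.sum_eq_zero fun n hn => ?_
          by_contra h0
          exact absurd (hs n hn h0).2 (not_le.2 hbk)
    _ ≤ 2 * A / X.T κ a * (2 * X.T κ a) := by
        rw [ENNReal.ofReal_toReal hc]
        gcongr
    _ = 4 * A * ((X.T κ a)⁻¹ * X.T κ a) := by
        rw [div_eq_mul_inv]
        ring
    _ = 4 * A := by rw [ENNReal.inv_mul_cancel hT0 hT1, mul_one]

/-- Interlaced sequences may be taken nonzero and supported in `J`. -/
theorem rightShift_of_hulls {C : ℝ≥0∞} (h : ∀ (F : Finset ℤ) (x y : ℤ → ℤ → ℝ) (a r b : ℤ → ℤ),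
      (∀ n ∈ F, a n ∈ J ∧ b n ∈ J ∧ a n ≤ r n ∧ r n < b n) →
      (∀ n ∈ F, Function.support (x n) ⊆ Icc (a n) (r n)) →
      (∀ n ∈ F, Function.support (y n) ⊆ Ioc (r n) (b n)) →
      (∀ m ∈ F, ∀ n ∈ F, m < n → b m < a n) →
      (∀ n ∈ F, X.NE κ (x n) ≠ 0 ∧ X.NE κ (y n) ≤ X.NE κ (x n)) →
      X.NE κ (fun k => ∑ n ∈ F, y n k) ≤ C * X.NE κ (fun k => ∑ n ∈ F, x n k)) :
    RightShift X κ C := by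
  classical
  intro F x y hint hxy
  -- Null `y n` contribute nothing to the left side. For the other indices `x n` is not null either,
  -- so both supports have a first and a last element in `J`.
  set F' := F.filter fun n => X.NE κ (y n) ≠ 0 with hF'
  have hF : ∀ n ∈ F', n ∈ F := fun n hn => (Finset.mem_filter.1 hn).1
  have hJx : ∀ z : ℤ → ℝ, X.NE κ (J.indicator z) = X.NE κ z := fun z =>
    M.NE_congr fun k hk => indicator_of_mem hk z
  have hx0 : ∀ n ∈ F', X.NE κ (x n) ≠ 0 := fun n hn h0 => (Finset.mem_filter.1 hn).2
    (le_antisymm ((hxy n (hF n hn)).trans h0.le) zero_le)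
  have hull : ∀ z : ℤ → ℝ, z.support.Finite → X.NE κ z ≠ 0 → ∃ a b,
      a ∈ (J.indicator z).support ∧ b ∈ (J.indicator z).support ∧
      (J.indicator z).support ⊆ Icc a b := fun z hz h0 => by
    have hfin : (J.indicator z).support.Finite := hz.subset fun k hk => by
      rw [Function.mem_support, indicator_apply_ne_zero] at hk
      exact hk.2
    have hne : (J.indicator z).support.Nonempty := by
      by_contra hcon
      rw [Set.not_nonempty_iff_eq_empty, Function.support_eq_empty_iff] at hcon
      apply h0
      rw [← hJx, hcon]
      exact NE_zero
    obtain ⟨a, ha⟩ := hfin.exists_minimal hne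
    obtain ⟨b, hb⟩ := hfin.exists_maximal hne
    refine ⟨a, b, ha.1, hb.1, fun k hk => ⟨?_, ?_⟩⟩
    · by_contra! hc
      exact absurd (ha.2 hk hc.le) (not_le.2 hc)
    · by_contra! hc
      exact absurd (hb.2 hk hc.le) (not_le.2 hc)
  choose! a r ha hr hxs using fun n (hn : n ∈ F') => hull (x n) (hint.1 n (hF n hn)) (hx0 n hn)
  choose! a' b ha' hb hys using fun n (hn : n ∈ F') =>
    hull (y n) (hint.2 n (hF n hn)) (Finset.mem_filter.1 hn).2
  have hsub : ∀ {z : ℤ → ℝ} {k : ℤ}, k ∈ (J.indicator z).support → k ∈ J ∧ k ∈ z.support :=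
    fun {z k} hk => by
      rw [Function.mem_support, indicator_apply_ne_zero] at hk
      exact hk
  have hmain := h F' (fun n => J.indicator (x n)) (fun n => J.indicator (y n)) a r b
    (fun n hn => ⟨(hsub (ha n hn)).1, (hsub (hb n hn)).1, (hxs n hn (hr n hn)).1,
      hint.3 n (hF n hn) _ (hsub (hr n hn)).2 _ (hsub (hb n hn)).2⟩) hxs
    (fun n hn k hk => ⟨hint.3 n (hF n hn) _ (hsub (hr n hn)).2 _ (hsub hk).2, (hys n hn hk).2⟩)
    (fun m hm n hn hmn => hint.4 m (hF m hm) n (hF n hn) hmn _ (Or.inr (hsub (hb m hm)).2) _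
      (Or.inl (hsub (ha n hn)).2))
    (fun n hn => ⟨by rw [hJx]; exact hx0 n hn, by rw [hJx, hJx]; exact hxy n (hF n hn)⟩)
  calc X.NE κ (fun k => ∑ n ∈ F, y n k) =
        X.NE κ (fun k => ∑ n ∈ F', J.indicator (y n) k) := by
        refine M.NE_congr fun k hk => ?_
        rw [← Finset.sum_subset (show F' ⊆ F from fun n hn => hF n hn) fun n hn hn' => ?_]
        · exact Finset.sum_congr rfl fun n _ => (indicator_of_mem hk _).symm
        · exact M.NE_eq_zero (by
            by_contra h0
            exact hn' (Finset.mem_filter.2 ⟨hn, h0⟩)) hk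
    _ ≤ C * X.NE κ (fun k => ∑ n ∈ F', J.indicator (x n) k) := hmain
    _ ≤ C * X.NE κ (fun k => ∑ n ∈ F, x n k) := by
        gcongr
        refine M.NE_mono fun k hk => ?_
        have : ∑ n ∈ F', J.indicator (x n) k = ∑ n ∈ F, if n ∈ F' then x n k else 0 := by
          rw [Finset.sum_ite_mem, Finset.inter_eq_right.2 (Finset.filter_subset _ F)]
          exact Finset.sum_congr rfl fun n _ => indicator_of_mem hk _
        rw [this]
        refine abs_sum_le_of_disjoint (fun m hm n hn hmn => ?_) fun n _ => ?_
        · by_contra! hcon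
          rcases lt_or_gt_of_ne hmn with hlt | hlt
          · exact absurd (hint.4 m hm n hn hlt k (Or.inl hcon.1) k (Or.inl hcon.2)) (lt_irrefl k)
          · exact absurd (hint.4 n hn m hm hlt k (Or.inl hcon.2) k (Or.inl hcon.1)) (lt_irrefl k)
        · split_ifs
          · exact le_rfl
          · rw [abs_zero]; exact abs_nonneg _

/-- The right-shift property holds if it holds for widely separated sequences. -/
theorem rightShift_of_chain (hX : X.IsRearrangementInvariant) {Λ B : ℕ}
    (hB : ∀ (D : Finset ℤ) (x y : ℤ → ℤ → ℝ) (r s h : ℤ → ℤ),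
      IsChain X κ J (fun _ => Λ) (D : Set ℤ) x y r s h →
      X.NE κ (fun k => ∑ i ∈ D, y i k) ≤ B * X.NE κ (fun k => ∑ i ∈ D, x i k)) :
    ∃ C : ℝ≥0, RightShift X κ C := by
  classical
  -- Two groups in the same class modulo `p` leave at least `p - 2 = 4 Λ + 1` doublings of `T`
  -- between their neighbours `q + 1` and `q' - 1`; one is lost in rounding, and `Λ ^ 4 ≤ 2 ^ (4
  -- Λ)`.
  set p : ℕ := 4 * Λ + 3 with hp
  refine ⟨p * (5 * B), M.rightShift_of_hulls fun F x y a r b hJ hxs hys hord hn => ?_⟩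
  have hrJ : ∀ n ∈ F, r n ∈ J := fun n hn' =>
    M.ordConnected.out (hJ n hn').1 (hJ n hn').2.1 ⟨(hJ n hn').2.2.1, (hJ n hn').2.2.2.le⟩
  set τ : ℤ → ℝ := fun k => (X.T κ k).toReal with hτ
  have hτpos : ∀ k ∈ J, 0 < τ k := fun k hk =>
    ENNReal.toReal_pos (M.T_pos hk).ne' (M.T_lt_top hk).ne
  have hτT : ∀ k ∈ J, ENNReal.ofReal (τ k) = X.T κ k := fun k hk =>
    ENNReal.ofReal_toReal (M.T_lt_top hk).ne
  -- Indices are grouped by the dyadic size of `T` at the end of `x n`. Within a group `T (r n)`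
  -- varies by a factor at most 2, and there `E` behaves like `ℓ_∞`.
  set γ : ℤ → ℤ := fun n => Int.log 2 (τ (r n)) with hγ
  have hγlow : ∀ n ∈ F, (2 : ℝ) ^ γ n ≤ τ (r n) := fun n hn' => by
    simpa using Int.zpow_log_le_self (b := 2) one_lt_two (hτpos _ (hrJ n hn'))
  have hγupp : ∀ n, τ (r n) < (2 : ℝ) ^ (γ n + 1) := fun n => by
    simpa using Int.lt_zpow_succ_log_self (b := 2) one_lt_two (τ (r n))
  have hrlt : ∀ m ∈ F, ∀ n ∈ F, m < n → r m < a n := fun m hm n hn' hmn =>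
    (hJ m hm).2.2.2.trans (hord m hm n hn' hmn)
  have hγmono : ∀ m ∈ F, ∀ n ∈ F, γ m < γ n → m < n := fun m hm n hn' hmn => by
    by_contra! hc
    rcases eq_or_lt_of_le hc with h | h
    · rw [h] at hmn; exact lt_irrefl _ hmn
    · refine absurd (Int.log_mono_right (hτpos _ (hrJ n hn')) ?_) (not_le.2 hmn)
      exact ENNReal.toReal_mono (M.T_lt_top (hrJ m hm)).ne
        (M.T_mono ((hrlt n hn' m hm h).le.trans (hJ m hm).2.2.1))
  obtain ⟨N, σ, hσ, hσF⟩ := exists_enumeration (F.image γ)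
  have hσinj : ∀ q ∈ Finset.Ico 0 (N : ℤ), ∀ q' ∈ Finset.Ico 0 (N : ℤ), σ q = σ q' → q = q' :=
    fun q hq q' hq' h => hσ.injOn (by simpa using hq) (by simpa using hq') h
  have hσlt : ∀ q ∈ Finset.Ico 0 (N : ℤ), ∀ q' ∈ Finset.Ico 0 (N : ℤ), q < q' → σ q < σ q' :=
    fun q hq q' hq' h => hσ (by simpa using hq) (by simpa using hq') h
  have hσgap : ∀ q ∈ Finset.Ico 0 (N : ℤ), ∀ q' ∈ Finset.Ico 0 (N : ℤ), q ≤ q' →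
      q' - q ≤ σ q' - σ q := fun q hq q' hq' hqq => by
    induction q', hqq using Int.leInduction with
    | base => omega
    | succ m hm ih =>
      simp only [Finset.mem_Ico] at hq hq' ih
      have h1 := ih (by omega)
      have h2 := hσlt m (by simp; omega) (m + 1) (by simp; omega) (by omega)
      omega
  set Gr : ℤ → Finset ℤ := fun q => F.filter fun n => γ n = σ q with hGr
  have hGrF : ∀ q n, n ∈ Gr q → n ∈ F ∧ γ n = σ q := fun q n h => Finset.mem_filter.1 h
  have hGrne : ∀ q ∈ Finset.Ico 0 (N : ℤ), (Gr q).Nonempty := fun q hq => by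
    have : σ q ∈ F.image γ := by rw [← hσF]; exact Finset.mem_image_of_mem σ hq
    obtain ⟨n, hn', hnq⟩ := Finset.mem_image.1 this
    exact ⟨n, Finset.mem_filter.2 ⟨hn', hnq⟩⟩
  choose! nm hnm hnmle using fun q (hq : q ∈ Finset.Ico 0 (N : ℤ)) =>
    Finset.exists_min_image (Gr q) id (hGrne q hq)
  choose! np hnp hnple using fun q (hq : q ∈ Finset.Ico 0 (N : ℤ)) =>
    Finset.exists_max_image (Gr q) id (hGrne q hq)
  choose! ns hns hnsle using fun q (hq : q ∈ Finset.Ico 0 (N : ℤ)) =>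
    Finset.exists_max_image (Gr q) (fun n => X.NE κ (x n)) (hGrne q hq)
  simp only [id] at hnmle hnple
  have hrmono : ∀ m ∈ F, ∀ n ∈ F, m ≤ n → r m ≤ r n := fun m hm n hn' hmn => by
    rcases eq_or_lt_of_le hmn with h | h
    · rw [h]
    · exact (hrlt m hm n hn' h).le.trans (hJ n hn').2.2.1
  have hbmono : ∀ m ∈ F, ∀ n ∈ F, m ≤ n → b m ≤ b n := fun m hm n hn' hmn => by
    rcases eq_or_lt_of_le hmn with h | h
    · rw [h]
    · exact (hord m hm n hn' h).le.trans ((hJ n hn').2.2.1.trans (hJ n hn').2.2.2.le)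
  have hamono : ∀ m ∈ F, ∀ n ∈ F, m ≤ n → a m ≤ a n := fun m hm n hn' hmn => by
    rcases eq_or_lt_of_le hmn with h | h
    · rw [h]
    · exact ((hJ m hm).2.2.1.trans (hrlt m hm n hn' h).le)
  have hgroup : ∀ q ∈ Finset.Ico 0 (N : ℤ), ∀ m ∈ Gr q, ∀ n ∈ Gr q,
      X.T κ (r m) ≤ 2 * X.T κ (r n) := fun q hq m hm n hn' => by
    rw [← hτT _ (hrJ m (hGrF q m hm).1), ← hτT _ (hrJ n (hGrF q n hn').1), ← ENNReal.ofReal_ofNat,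
      ← ENNReal.ofReal_mul (by norm_num)]
    refine ENNReal.ofReal_le_ofReal ?_
    have h1 := hγupp m
    have h2 := hγlow n (hGrF q n hn').1
    rw [(hGrF q m hm).2, zpow_add_one₀ (by norm_num)] at h1
    rw [(hGrF q n hn').2] at h2
    linarith
  have hydis : ∀ m ∈ F, ∀ n ∈ F, m ≠ n → ∀ k, y m k = 0 ∨ y n k = 0 := fun m hm n hn' hmn k => by
    by_contra! hcon
    have h1 := hys m hm hcon.1
    have h2 := hys n hn' hcon.2
    rcases lt_or_gt_of_ne hmn with h | h
    · have := hord m hm n hn' h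
      have := (hJ n hn').2.2.1
      have := h1.2; have := h2.1
      omega
    · have := hord n hn' m hm h
      have := (hJ m hm).2.2.1
      have := h2.2; have := h1.1
      omega
  have hxdis : ∀ m ∈ F, ∀ n ∈ F, m ≠ n → ∀ k, x m k = 0 ∨ x n k = 0 := fun m hm n hn' hmn k => by
    by_contra! hcon
    have h1 := hxs m hm hcon.1
    have h2 := hxs n hn' hcon.2
    rcases lt_or_gt_of_ne hmn with h | h
    · have := hrlt m hm n hn' h
      have := h1.2; have := h2.1
      omega
    · have := hrlt n hn' m hm h
      have := h2.2; have := h1.1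
      omega
  -- the sum over a group
  have hyq : ∀ q ∈ Finset.Ico 0 (N : ℤ),
      X.NE κ (fun k => ∑ n ∈ Gr q, y n k) ≤ 5 * X.NE κ (x (ns q)) := fun q hq => by
    have hA : X.NE κ (x (ns q)) ≠ ∞ := by
      refine (M.NE_lt_top ((finite_Icc (a (ns q)) (r (ns q))).subset ?_)).ne
      exact hxs _ (hGrF q _ (hns q hq)).1
    have hyA : ∀ n ∈ Gr q, X.NE κ (y n) ≤ X.NE κ (x (ns q)) := fun n hn' =>
      (hn n (hGrF q n hn').1).2.trans (hnsle q hq n hn')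
    -- All `y n` but the last end before `r (np q)` and cost 4 together; the last may reach far
    -- beyond, and costs 1.
    calc X.NE κ (fun k => ∑ n ∈ Gr q, y n k)
        = X.NE κ (fun k => ∑ n ∈ (Gr q).erase (np q), y n k + y (np q) k) := by
          congr 1
          funext k
          exact (Finset.sum_erase_add _ _ (hnp q hq)).symm
      _ ≤ X.NE κ (fun k => ∑ n ∈ (Gr q).erase (np q), y n k) + X.NE κ (y (np q)) :=
          NE_add_le _ _
      _ ≤ 4 * X.NE κ (x (ns q)) + X.NE κ (x (ns q)) := by
          gcongr
          · refine M.NE_sum_le_four hX (a := r (nm q)) (b := r (np q))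
              (hrJ _ (hGrF q _ (hnm q hq)).1) (hgroup q hq _ (hnp q hq) _ (hnm q hq))
              (fun m hm n hn' hmn => ?_) (fun n hn' k hk => ?_) hA
              (fun n hn' => hyA n (Finset.mem_of_mem_erase hn'))
            · exact hydis m (hGrF q m (Finset.mem_of_mem_erase hm)).1 n
                (hGrF q n (Finset.mem_of_mem_erase hn')).1 hmn
            · have hnG := Finset.mem_of_mem_erase hn'
              have hnF := (hGrF q n hnG).1
              have hpF := (hGrF q _ (hnp q hq)).1
              have h1 := hys n hnF hk
              have h2 := hrmono _ (hGrF q _ (hnm q hq)).1 n hnF (hnmle q hq n hnG)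
              have h3 : n < np q :=
                lt_of_le_of_ne (hnple q hq n hnG) (Finset.ne_of_mem_erase hn')
              have h4 := hord n hnF _ hpF h3
              have h5 := (hJ _ hpF).2.2.1
              exact ⟨h2.trans h1.1.le, h1.2.trans (h4.le.trans h5)⟩
          · exact hyA _ (hnp q hq)
      _ = 5 * X.NE κ (x (ns q)) := by ring
  -- the classes
  have hlt : ∀ q ∈ Finset.Ico 0 (N : ℤ), ∀ q' ∈ Finset.Ico 0 (N : ℤ), q < q' →
      b (np q) < a (nm q') := fun q hq q' hq' hqq =>
    hord _ (hGrF q _ (hnp q hq)).1 _ (hGrF q' _ (hnm q' hq')).1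
      (hγmono _ (hGrF q _ (hnp q hq)).1 _ (hGrF q' _ (hnm q' hq')).1 (by
        rw [(hGrF q _ (hnp q hq)).2, (hGrF q' _ (hnm q' hq')).2]
        exact hσlt q hq q' hq' hqq))
  have hab : ∀ q ∈ Finset.Ico 0 (N : ℤ), a (nm q) ≤ r (nm q) ∧ r (nm q) ≤ r (ns q) ∧
      r (ns q) ≤ b (np q) ∧ a (nm q) ≤ a (ns q) := fun q hq => by
    have h1 := (hGrF q _ (hnm q hq)).1
    have h2 := (hGrF q _ (hns q hq)).1
    have h3 := (hGrF q _ (hnp q hq)).1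
    exact ⟨(hJ _ h1).2.2.1, hrmono _ h1 _ h2 (hnmle q hq _ (hns q hq)),
      (hJ _ h2).2.2.2.le.trans (hbmono _ h2 _ h3 (hnple q hq _ (hns q hq))),
      hamono _ h1 _ h2 (hnmle q hq _ (hns q hq))⟩
  have hclass : ∀ c : ℤ, X.NE κ (fun k => ∑ q ∈ (Finset.Ico 0 (N : ℤ)).filter (fun q => q % p = c),
      ∑ n ∈ Gr q, y n k) ≤ 5 * B * X.NE κ (fun k => ∑ n ∈ F, x n k) := fun c => by
    set Q := (Finset.Ico 0 (N : ℤ)).filter (fun q => q % p = c) with hQ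
    have hQI : ∀ q ∈ Q, q ∈ Finset.Ico 0 (N : ℤ) := fun q hq => (Finset.mem_filter.1 hq).1
    have hinj : Set.InjOn (fun q => a (nm q)) (Q : Set ℤ) := fun q hq q' hq' hqq => by
      have aux : ∀ q ∈ Q, ∀ q' ∈ Q, q < q' → a (nm q) < a (nm q') := fun q hq q' hq' h =>
        ((hab q (hQI q hq)).1.trans ((hab q (hQI q hq)).2.1.trans
          (hab q (hQI q hq)).2.2.1)).trans_lt (hlt q (hQI q hq) q' (hQI q' hq') h)
      rcases lt_trichotomy q q' with h | h | h
      · exact absurd hqq (aux q hq q' hq' h).ne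
      · exact h
      · exact absurd hqq.symm (aux q' hq' q hq h).ne
    -- Chains are indexed by the left ends of their intervals; `iv` recovers the group.
    set iv : ℤ → ℤ := Function.invFunOn (fun q => a (nm q)) (Q : Set ℤ) with hiv
    have hivq : ∀ q ∈ Q, iv (a (nm q)) = q := fun q hq => hinj.leftInvOn_invFunOn hq
    have h5 : ENNReal.ofReal |(5 : ℝ)⁻¹| = 5⁻¹ := by
      rw [abs_of_pos (by norm_num), ENNReal.ofReal_inv_of_pos (by norm_num), ENNReal.ofReal_ofNat]
    -- A group becomes one pair: its `x n` of largest norm against a fifth of the sum of its `y n`.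
    -- The two supports may overlap, which is why `IsChain` asks only that `T (r i) ≤ 2 T (s i)`.
    have hch := hB (Q.image fun q => a (nm q)) (fun i => x (ns (iv i)))
      (fun i k => 5⁻¹ * ∑ n ∈ Gr (iv i), y n k) (fun i => r (ns (iv i))) (fun i => r (nm (iv i)))
      (fun i => b (np (iv i))) ?_
    · have e1 : (fun k => ∑ i ∈ Q.image (fun q => a (nm q)), 5⁻¹ * ∑ n ∈ Gr (iv i), y n k) =
          fun k => 5⁻¹ * ∑ q ∈ Q, ∑ n ∈ Gr q, y n k := by
        funext k
        rw [Finset.sum_image hinj, Finset.mul_sum]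
        exact Finset.sum_congr rfl fun q hq => by rw [hivq q hq]
      have e2 : (fun k => ∑ i ∈ Q.image (fun q => a (nm q)), x (ns (iv i)) k) =
          fun k => ∑ q ∈ Q, x (ns q) k := by
        funext k
        rw [Finset.sum_image hinj]
        exact Finset.sum_congr rfl fun q hq => by rw [hivq q hq]
      rw [e1, e2, M.NE_const_mul, h5] at hch
      have hle : X.NE κ (fun k => ∑ q ∈ Q, x (ns q) k) ≤ X.NE κ (fun k => ∑ n ∈ F, x n k) := by
        refine M.NE_mono fun k _ => ?_
        have hnsinj : Set.InjOn ns (Q : Set ℤ) := fun q hq q' hq' h => by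
          refine hσinj q (hQI q hq) q' (hQI q' hq') ?_
          rw [← (hGrF q _ (hns q (hQI q hq))).2, ← (hGrF q' _ (hns q' (hQI q' hq'))).2, h]
        have e3 : ∑ q ∈ Q, x (ns q) k = ∑ n ∈ F, if n ∈ Q.image ns then x n k else 0 := by
          rw [Finset.sum_ite_mem, Finset.inter_eq_right.2 fun n hn' => ?_,
            Finset.sum_image hnsinj]
          obtain ⟨q, hq, rfl⟩ := Finset.mem_image.1 hn'
          exact (hGrF q _ (hns q (hQI q hq))).1
        rw [e3]
        refine abs_sum_le_of_disjoint (fun m hm n hn' hmn => hxdis m hm n hn' hmn k) fun n _ => ?_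
        split_ifs
        · exact le_rfl
        · rw [abs_zero]; exact abs_nonneg _
      calc _ = 5 * (5⁻¹ * X.NE κ (fun k => ∑ q ∈ Q, ∑ n ∈ Gr q, y n k)) := by
            rw [← mul_assoc, ENNReal.mul_inv_cancel (by norm_num) (by norm_num), one_mul]
        _ ≤ 5 * (B * X.NE κ (fun k => ∑ n ∈ F, x n k)) :=
            mul_le_mul_right (hch.trans (mul_le_mul_right hle _)) _
        _ = _ := by ring
    · have hall : ∀ {φ : ℤ → Prop}, (∀ q ∈ Q, φ (a (nm q))) →
          ∀ i ∈ ((Q.image fun q => a (nm q) : Finset ℤ) : Set ℤ), φ i := fun hφ i hi => by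
        obtain ⟨q, hq, rfl⟩ := Finset.mem_image.1 (Finset.mem_coe.1 hi)
        exact hφ q hq
      refine ⟨hall fun q hq => ?_, hall fun q hq => ?_, hall fun q hq => ?_, hall fun q hq => ?_,
        hall fun q hq => ?_, hall fun q hq => ?_, hall fun q hq => ?_, hall fun q hq => ?_,
        hall fun q hq => ?_, hall fun q hq => ?_, hall fun q hq => ?_,
        hall fun q hq => hall fun q' hq' => ?_, hall fun q hq => hall fun q' hq' => ?_⟩
      · exact (hJ _ (hGrF q _ (hnm q (hQI q hq))).1).1
      · simp only [hivq q hq]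
        exact (hJ _ (hGrF q _ (hnp q (hQI q hq))).1).2.1
      · simp only [hivq q hq]
        exact (hab q (hQI q hq)).1
      · simp only [hivq q hq]
        exact (hab q (hQI q hq)).2.1.trans (hab q (hQI q hq)).2.2.1
      · simp only [hivq q hq]
        exact (hab q (hQI q hq)).1.trans (hab q (hQI q hq)).2.1
      · simp only [hivq q hq]
        exact (hab q (hQI q hq)).2.2.1
      · simp only [hivq q hq]
        exact hgroup q (hQI q hq) _ (hns q (hQI q hq)) _ (hnm q (hQI q hq))
      · simp only [hivq q hq]
        intro k hk
        have := hxs _ (hGrF q _ (hns q (hQI q hq))).1 hk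
        exact ⟨(hab q (hQI q hq)).2.2.2.trans this.1, this.2⟩
      · simp only [hivq q hq]
        intro k hk
        have hk' : ∑ n ∈ Gr q, y n k ≠ 0 := right_ne_zero_of_mul hk
        obtain ⟨n, hnG, hnk⟩ := Finset.exists_ne_zero_of_sum_ne_zero hk'
        have hnF := (hGrF q n hnG).1
        have h1 := hys n hnF hnk
        exact ⟨(hrmono _ (hGrF q _ (hnm q (hQI q hq))).1 n hnF
          (hnmle q (hQI q hq) n hnG)).trans h1.1.le, h1.2.trans (hbmono n hnF _
          (hGrF q _ (hnp q (hQI q hq))).1 (hnple q (hQI q hq) n hnG))⟩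
      · simp only [hivq q hq]
        rw [M.NE_const_mul, h5]
        calc _ ≤ 5⁻¹ * (5 * X.NE κ (x (ns q))) := by
              gcongr
              exact hyq q (hQI q hq)
          _ = _ := by rw [← mul_assoc, ENNReal.inv_mul_cancel (by norm_num) (by norm_num), one_mul]
      · simp only [hivq q hq]
        exact (hn _ (hGrF q _ (hns q (hQI q hq))).1).1
      · intro hqq
        simp only [hivq q hq]
        refine hlt q (hQI q hq) q' (hQI q' hq') ?_
        by_contra! hc
        rcases eq_or_lt_of_le hc with h | h
        · rw [h] at hqq; exact lt_irrefl _ hqq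
        · have h1 := hlt q' (hQI q' hq') q (hQI q hq) h
          have h2 := hab q' (hQI q' hq')
          omega
      · intro hqq
        simp only [hivq q hq]
        have hqq' : q < q' := by
          by_contra! hc
          rcases eq_or_lt_of_le hc with h | h
          · rw [h] at hqq; exact lt_irrefl _ hqq
          · have h1 := hlt q' (hQI q' hq') q (hQI q hq) h
            have h2 := hab q' (hQI q' hq')
            omega
        have hmod : q % p = q' % p := by
          rw [(Finset.mem_filter.1 hq).2, (Finset.mem_filter.1 hq').2]
        have hpp : q + p ≤ q' := by
          have h1 : (p : ℤ) ∣ q' - q := Int.ModEq.dvd hmod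
          have := Int.le_of_dvd (by omega) h1
          omega
        have hq0 := Finset.mem_Ico.1 (hQI q hq)
        have hq0' := Finset.mem_Ico.1 (hQI q' hq')
        have hq1 : q + 1 ∈ Finset.Ico 0 (N : ℤ) := by simp only [Finset.mem_Ico]; omega
        have hq2 : q' - 1 ∈ Finset.Ico 0 (N : ℤ) := by simp only [Finset.mem_Ico]; omega
        have g1 : X.T κ (b (np q)) ≤ ENNReal.ofReal (2 ^ (σ (q + 1) + 1)) := by
          have hF1 := (hGrF _ _ (hnm _ hq1))
          calc X.T κ (b (np q)) ≤ X.T κ (r (nm (q + 1))) :=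
                M.T_mono ((hlt q (hQI q hq) _ hq1 (by omega)).le.trans (hab _ hq1).1)
            _ = ENNReal.ofReal (τ (r (nm (q + 1)))) := (hτT _ (hrJ _ hF1.1)).symm
            _ ≤ _ := by
              refine ENNReal.ofReal_le_ofReal ?_
              rw [← hF1.2]
              exact (hγupp _).le
        have g2 : ENNReal.ofReal (2 ^ (σ (q' - 1))) ≤ X.T κ (a (nm q')) := by
          have hF1 := (hGrF _ _ (hnp _ hq2))
          calc _ ≤ ENNReal.ofReal (τ (r (np (q' - 1)))) := by
                refine ENNReal.ofReal_le_ofReal ?_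
                rw [← hF1.2]
                exact hγlow _ hF1.1
            _ = X.T κ (r (np (q' - 1))) := hτT _ (hrJ _ hF1.1)
            _ ≤ _ := M.T_mono ((hJ _ hF1.1).2.2.2.le.trans
                (hlt _ hq2 q' (hQI q' hq') (by omega)).le)
        have g3 := hσgap _ hq1 _ hq2 (by omega)
        have g4 : (Λ : ℝ) ^ 4 * 2 ^ (σ (q + 1) + 1) ≤ 2 ^ (σ (q' - 1)) := by
          have e1 : (Λ : ℝ) ≤ 2 ^ Λ := by exact_mod_cast Nat.lt_two_pow_self.le
          calc (Λ : ℝ) ^ 4 * 2 ^ (σ (q + 1) + 1) ≤ (2 ^ Λ) ^ 4 * 2 ^ (σ (q + 1) + 1) := by gcongr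
            _ = 2 ^ (((4 * Λ : ℕ) : ℤ) + (σ (q + 1) + 1)) := by
              rw [zpow_add₀ (by norm_num) ((4 * Λ : ℕ) : ℤ), zpow_natCast, ← pow_mul, mul_comm Λ 4]
            _ ≤ 2 ^ (σ (q' - 1)) := zpow_le_zpow_right₀ one_le_two (by push_cast; omega)
        calc (Λ : ℝ≥0∞) ^ 2 * (Λ : ℝ≥0∞) ^ 2 * X.T κ (b (np q))
            ≤ (Λ : ℝ≥0∞) ^ 2 * (Λ : ℝ≥0∞) ^ 2 * ENNReal.ofReal (2 ^ (σ (q + 1) + 1)) := by gcongr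
          _ = ENNReal.ofReal ((Λ : ℝ) ^ 4 * 2 ^ (σ (q + 1) + 1)) := by
            rw [ENNReal.ofReal_mul (by positivity), ENNReal.ofReal_pow (by positivity),
              ENNReal.ofReal_natCast]
            ring
          _ ≤ ENNReal.ofReal (2 ^ (σ (q' - 1))) := ENNReal.ofReal_le_ofReal g4
          _ ≤ _ := g2
  have hp0 : (0 : ℤ) < p := by positivity
  calc X.NE κ (fun k => ∑ n ∈ F, y n k)
      = X.NE κ (fun k => ∑ c ∈ Finset.Ico 0 (p : ℤ),
          ∑ q ∈ (Finset.Ico 0 (N : ℤ)).filter (fun q => q % p = c), ∑ n ∈ Gr q, y n k) := by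
        congr 1
        funext k
        rw [Finset.sum_fiberwise_of_maps_to fun q _ => by
          simp only [Finset.mem_Ico]
          exact ⟨Int.emod_nonneg _ hp0.ne', Int.emod_lt_of_pos _ hp0⟩]
        rw [← Finset.sum_fiberwise_of_maps_to (t := F.image γ) (g := γ)
          fun n hn' => Finset.mem_image_of_mem γ hn', ← hσF, Finset.sum_image hσinj]
    _ ≤ ∑ c ∈ Finset.Ico 0 (p : ℤ), X.NE κ (fun k =>
          ∑ q ∈ (Finset.Ico 0 (N : ℤ)).filter (fun q => q % p = c), ∑ n ∈ Gr q, y n k) :=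
        NE_sum_le _ _
    _ ≤ ∑ c ∈ Finset.Ico 0 (p : ℤ), 5 * B * X.NE κ (fun k => ∑ n ∈ F, x n k) :=
        Finset.sum_le_sum fun c _ => hclass c
    _ = _ := by
        rw [Finset.sum_const, Int.card_Ico, sub_zero, Int.toNat_natCast, nsmul_eq_mul]
        push_cast
        ring

end DyadicModel

end Chains

/-! ### Sums over a chain with rapidly changing coefficients -/

section Weights

theorem exists_weight (u : ℤ → ℝ) (hu : ∀ l, 0 < u l) :
    ∃ P : ℤ → ℝ, (∀ l, 0 < P l) ∧ ∀ l, P l = u l * P (l - 1) := by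
  let f : ℕ → ℝ := fun n => ∏ i ∈ Finset.range n, u (i + 1)
  let g : ℕ → ℝ := fun n => ∏ i ∈ Finset.range n, u (-i)
  have hf : ∀ n, 0 < f n := fun n => Finset.prod_pos fun i _ => hu _
  have hg : ∀ n, 0 < g n := fun n => Finset.prod_pos fun i _ => hu _
  refine ⟨fun l => f l.toNat / g (-l).toNat, fun l => div_pos (hf _) (hg _), fun l => ?_⟩
  rcases le_or_gt l 0 with hl | hl
  · have e1 : l.toNat = 0 := by omega
    have e2 : (l - 1).toNat = 0 := by omega
    have e3 : (-(l - 1)).toNat = (-l).toNat + 1 := by omega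
    have e4 : -(((-l).toNat : ℕ) : ℤ) = l := by omega
    have e5 : g ((-l).toNat + 1) = g (-l).toNat * u l := by
      simp only [g, Finset.prod_range_succ, e4]
    simp only [e1, e2, e3, e5]
    have := (hg (-l).toNat).ne'
    have := (hu l).ne'
    field_simp
  · have e1 : l.toNat = (l - 1).toNat + 1 := by omega
    have e2 : (-l).toNat = 0 := by omega
    have e3 : (-(l - 1)).toNat = 0 := by omega
    have e4 : (((l - 1).toNat : ℕ) : ℤ) + 1 = l := by omega
    have e5 : f ((l - 1).toNat + 1) = f (l - 1).toNat * u l := by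
      simp only [f, Finset.prod_range_succ, e4]
    simp only [e1, e2, e3, e5]
    ring

variable {Ω : Type*} [MeasurableSpace Ω] {μ : Measure Ω} {X : KotheSpace μ} {κ : Ω → ℤ} {J : Set ℤ}
  {Λ : ℤ → ℕ} {D : Set ℤ} {x y : ℤ → ℤ → ℝ} {r s h : ℤ → ℤ}

theorem IsChain.le_h (hch : IsChain X κ J Λ D x y r s h) {i : ℤ} (hi : i ∈ D) : i ≤ h i :=
  (hch.le_s i hi).trans (hch.s_le i hi)

/-- Take `c i = P i / Λ i`, where `P` is multiplied by `Λ i ^ 2` at each `i ∈ D` and is constant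
elsewhere. Since `Λ + 1 ≤ Λ ^ 2`, the sum of the `c n` before `i` telescopes to at most `P (i - 1) =
c i / Λ i`. The separation of the chain makes `T` grow faster than `P`, so the quotients `c m / T m`
decrease as claimed. -/
theorem IsChain.exists_coefs (hch : IsChain X κ J Λ D x y r s h) (M : DyadicModel μ κ J)
    (hΛ : ∀ i ∈ D, 2 ≤ Λ i) :
    ∃ c : ℤ → ℝ, (∀ i ∈ D, 0 < c i) ∧
      (∀ i ∈ D, ∀ F : Finset ℤ, (∀ n ∈ F, n ∈ D ∧ n < i) → ∑ n ∈ F, c n ≤ c i / Λ i) ∧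
      ∀ i ∈ D, ∀ m ∈ D, i < m →
        c m / (X.T κ m).toReal ≤ c i / (Λ i * (X.T κ (h i)).toReal) := by
  classical
  obtain ⟨P, hP, hPu⟩ := exists_weight (fun l => if l ∈ D then (Λ l : ℝ) ^ 2 else 1) fun l => by
    split_ifs with hl
    · have := hΛ l hl
      positivity
    · exact one_pos
  have hΛ2 : ∀ i ∈ D, (2 : ℝ) ≤ Λ i := fun i hi => by exact_mod_cast hΛ i hi
  have hPD : ∀ l ∈ D, P l = (Λ l : ℝ) ^ 2 * P (l - 1) := fun l hl => by
    rw [hPu l, if_pos hl]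
  have hPn : ∀ l ∉ D, P l = P (l - 1) := fun l hl => by rw [hPu l, if_neg hl, one_mul]
  have hstep : ∀ l, P l ≤ P (l + 1) := fun l => by
    by_cases hl : l + 1 ∈ D
    · rw [hPD _ hl, add_sub_cancel_right]
      have := hΛ2 _ hl
      exact le_mul_of_one_le_left (hP l).le (by nlinarith)
    · rw [hPn _ hl, add_sub_cancel_right]
  have hmono : Monotone P := monotone_int_of_le_succ hstep
  have hsum : ∀ F : Finset ℤ, (∀ n ∈ F, n ∈ D) → ∀ m, (∀ n ∈ F, n ≤ m) →
      ∑ n ∈ F, P n / Λ n ≤ P m := fun F => by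
    induction F using Finset.induction_on_max with
    | empty => intro _ m _; simpa using (hP m).le
    | insert a F ha ih =>
      intro hF m hm
      have haD := hF a (Finset.mem_insert_self a F)
      rw [Finset.sum_insert fun h => lt_irrefl a (ha a h)]
      have h1 := ih (fun n hn => hF n (Finset.mem_insert_of_mem hn)) (a - 1)
        fun n hn => by have := ha n hn; omega
      have h2 := hΛ2 a haD
      have h3 := hP (a - 1)
      have h4 : P a / Λ a = Λ a * P (a - 1) := by
        rw [hPD a haD]
        field_simp
      have h5 : P a ≤ P m := hmono (hm a (Finset.mem_insert_self a F))
      rw [h4]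
      rw [hPD a haD] at h5
      have h6 := mul_le_mul_of_nonneg_right
        (show (Λ a : ℝ) + 1 ≤ (Λ a : ℝ) ^ 2 by nlinarith) h3.le
      linarith
  have hτ : ∀ k ∈ J, 0 < (X.T κ k).toReal := fun k hk =>
    ENNReal.toReal_pos (M.T_pos hk).ne' (M.T_lt_top hk).ne
  have hsep : ∀ i ∈ D, ∀ m ∈ D, i < m →
      (Λ i : ℝ) ^ 2 * (Λ m : ℝ) ^ 2 * (X.T κ (h i)).toReal ≤ (X.T κ m).toReal :=
    fun i hi m hm him => by
      have := ENNReal.toReal_mono (M.T_lt_top (hch.mem m hm)).ne (hch.sep i hi m hm him)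
      simpa [ENNReal.toReal_mul, ENNReal.toReal_pow] using this
  have hkey : ∀ i ∈ D, ∀ d : ℕ, ∀ m ∈ D, i < m → (m - i).toNat ≤ d →
      P m / (X.T κ m).toReal ≤ P i / ((Λ i : ℝ) ^ 2 * (X.T κ (h i)).toReal) := fun i hi d => by
    induction d with
    | zero => intro m _ him hd; omega
    | succ d ih =>
      intro m hm him hd
      obtain ⟨n, ⟨hn, hnm⟩, hnmax⟩ := Int.exists_greatest_of_bdd (P := fun n => n ∈ D ∧ n < m)
        ⟨m, fun z hz => hz.2.le⟩ ⟨i, hi, him⟩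
      have hin : i ≤ n := hnmax i ⟨hi, him⟩
      have hPn' : ∀ l, n ≤ l → l < m → P l = P n := fun l hl => by
        induction l, hl using Int.leInduction with
        | base => intro _; rfl
        | succ l hl ih' =>
          intro hlm
          rw [hPn (l + 1) fun hD => by have := hnmax (l + 1) ⟨hD, hlm⟩; omega, add_sub_cancel_right]
          exact ih' (by omega)
      have hPm : P m = (Λ m : ℝ) ^ 2 * P n := by rw [hPD m hm, hPn' (m - 1) (by omega) (by omega)]
      have hτm := hτ m (hch.mem m hm)
      have hτh := hτ (h n) (hch.h_mem n hn)
      have hτn := hτ n (hch.mem n hn)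
      have hΛn := hΛ2 n hn
      have hΛm := hΛ2 m hm
      have h1 : P m / (X.T κ m).toReal ≤ P n / ((Λ n : ℝ) ^ 2 * (X.T κ (h n)).toReal) := by
        rw [hPm, div_le_div_iff₀ hτm (by positivity)]
        calc (Λ m : ℝ) ^ 2 * P n * ((Λ n : ℝ) ^ 2 * (X.T κ (h n)).toReal)
            = P n * ((Λ n : ℝ) ^ 2 * (Λ m : ℝ) ^ 2 * (X.T κ (h n)).toReal) := by ring
          _ ≤ _ := mul_le_mul_of_nonneg_left (hsep n hn m hm hnm) (hP n).le
      rcases eq_or_lt_of_le hin with h' | h'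
      · rw [h']; exact h1
      · refine h1.trans (le_trans ?_ (ih n hn h' (by omega)))
        have hle : (X.T κ n).toReal ≤ (X.T κ (h n)).toReal :=
          ENNReal.toReal_mono (M.T_lt_top (hch.h_mem n hn)).ne (M.T_mono (hch.le_h hn))
        gcongr
        · exact (hP n).le
        · exact hle.trans (le_mul_of_one_le_left hτh.le (by nlinarith))
  refine ⟨fun i => P i / Λ i, fun i hi => div_pos (hP i) (by have := hΛ2 i hi; positivity),
    fun i hi F hF => ?_, fun i hi m hm him => ?_⟩
  · refine (hsum F (fun n hn => (hF n hn).1) (i - 1) fun n hn => by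
      have := (hF n hn).2; omega).trans (le_of_eq ?_)
    have := hΛ2 i hi
    change P (i - 1) = P i / Λ i / Λ i
    rw [hPD i hi]
    field_simp
  · have h1 := hkey i hi _ m hm him le_rfl
    have h2 := hΛ2 m hm
    have h3 := hΛ2 i hi
    have hτm := hτ m (hch.mem m hm)
    have hτh := hτ (h i) (hch.h_mem i hi)
    calc P m / Λ m / (X.T κ m).toReal ≤ P m / (X.T κ m).toReal := by
          gcongr
          exact div_le_self (hP m).le (by linarith)
      _ ≤ _ := h1
      _ = _ := by
        field_simp

end Weights

/-! ### Gluing vectors along a chain -/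

section Glue

open Classical in
/-- The sequence that is equal to `u i` on `[i, h i]`, for `i ∈ D`. -/
def glue (D : Set ℤ) (h : ℤ → ℤ) (u : ℤ → ℤ → ℝ) (k : ℤ) : ℝ :=
  if H : ∃ i ∈ D, i ≤ k ∧ k ≤ h i then u H.choose k else 0

variable {Ω : Type*} [MeasurableSpace Ω] {μ : Measure Ω} {X : KotheSpace μ} {κ : Ω → ℤ} {J : Set ℤ}
  {Λ : ℤ → ℕ} {D : Set ℤ} {x y : ℤ → ℤ → ℝ} {r s h : ℤ → ℤ} {u : ℤ → ℤ → ℝ}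

theorem glue_of_mem (hD : ∀ i ∈ D, ∀ j ∈ D, i < j → h i < j) {i k : ℤ} (hi : i ∈ D) (h1 : i ≤ k)
    (h2 : k ≤ h i) : glue D h u k = u i k := by
  have H : ∃ i ∈ D, i ≤ k ∧ k ≤ h i := ⟨i, hi, h1, h2⟩
  rw [glue, dif_pos H]
  congr 1
  obtain ⟨g1, g2, g3⟩ := H.choose_spec
  rcases lt_trichotomy H.choose i with h' | h' | h'
  · have := hD _ g1 i hi h'; omega
  · exact h'
  · have := hD i hi _ g1 h'; omega

theorem glue_of_notMem {k : ℤ} (hk : ∀ i ∈ D, i ≤ k → h i < k) : glue D h u k = 0 := by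
  rw [glue, dif_neg]
  rintro ⟨i, hi, h1, h2⟩
  have := hk i hi h1
  omega

/-- Past, present and future as seen from the interval of `i`: later the past is small in `X` and
the future is small in `L_∞`. -/
theorem glue_decomp (hD : ∀ i ∈ D, ∀ j ∈ D, i < j → h i < j) {i : ℤ} (hi : i ∈ D) (hih : i ≤ h i)
    (hu : Function.support (u i) ⊆ Icc i (h i)) (k : ℤ) :
    glue D h u k = (Iio i).indicator (glue D h u) k + u i k +
      (Ioi (h i)).indicator (glue D h u) k := by
  rcases lt_or_ge k i with hk | hk
  · have : u i k = 0 := by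
      by_contra h0
      have := (hu h0).1
      omega
    rw [indicator_of_mem (by simpa using hk), indicator_of_notMem (by simp; omega), this]
    ring
  · rcases le_or_gt k (h i) with hk' | hk'
    · rw [indicator_of_notMem (by simpa using hk), indicator_of_notMem (by simpa using hk'),
        glue_of_mem hD hi hk hk']
      ring
    · have : u i k = 0 := by
        by_contra h0
        have := (hu h0).2
        omega
      rw [indicator_of_notMem (by simp; omega), indicator_of_mem (by simpa using hk'), this]
      ring

namespace DyadicModel

variable (M : DyadicModel μ κ J)

include M

/-- The norm of a part of a glued sequence. -/
theorem NE_glue_le (hD : ∀ i ∈ D, ∀ j ∈ D, i < j → h i < j) {S : Set ℤ} {B : ℝ≥0∞}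
    (hB : ∀ F : Finset ℤ, (∀ n ∈ F, n ∈ D ∧ ∃ k ∈ S, n ≤ k ∧ k ≤ h n) →
      ∑ n ∈ F, X.NE κ (u n) ≤ B) : X.NE κ (S.indicator (glue D h u)) ≤ B := by
  classical
  refine M.NE_fatou fun w => ?_
  have hown : ∀ k, ∃ n, (∃ i ∈ D, i ≤ k ∧ k ≤ h i) → n ∈ D ∧ n ≤ k ∧ k ≤ h n := fun k => by
    by_cases H : ∃ i ∈ D, i ≤ k ∧ k ≤ h i
    · obtain ⟨i, hi⟩ := H; exact ⟨i, fun _ => hi⟩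
    · exact ⟨0, fun H' => absurd H' H⟩
  choose own hown using hown
  set K : Finset ℤ := (Finset.Icc (-w : ℤ) w).filter
    fun k => k ∈ S ∧ ∃ i ∈ D, i ≤ k ∧ k ≤ h i with hK
  have hKmem : ∀ k ∈ K, k ∈ S ∧ own k ∈ D ∧ own k ≤ k ∧ k ≤ h (own k) := fun k hk =>
    ⟨(Finset.mem_filter.1 hk).2.1, hown k (Finset.mem_filter.1 hk).2.2⟩
  refine le_trans ?_ (hB (K.image own) fun n hn => ?_)
  · calc X.NE κ ((Icc (-w : ℤ) w).indicator (S.indicator (glue D h u)))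
        ≤ X.NE κ (fun k => ∑ n ∈ K.image own, |u n k|) := by
          refine M.NE_mono fun k hk => ?_
          have hnn : 0 ≤ ∑ n ∈ K.image own, |u n k| := Finset.sum_nonneg fun _ _ => abs_nonneg _
          rw [abs_of_nonneg hnn]
          by_cases hkK : k ∈ K
          · obtain ⟨hkS, h1, h2, h3⟩ := hKmem k hkK
            have hkw : k ∈ Icc (-w : ℤ) w := by simpa using (Finset.mem_filter.1 hkK).1
            rw [indicator_of_mem hkw, indicator_of_mem hkS, glue_of_mem hD h1 h2 h3]
            exact Finset.single_le_sum (f := fun n => |u n k|) (fun _ _ => abs_nonneg _)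
              (Finset.mem_image_of_mem own hkK)
          · have : (Icc (-w : ℤ) w).indicator (S.indicator (glue D h u)) k = 0 := by
              rw [indicator_indicator]
              by_cases hkS : k ∈ Icc (-w : ℤ) w ∩ S
              · rw [indicator_of_mem hkS]
                refine glue_of_notMem fun i hi hik => ?_
                by_contra! hc
                refine hkK (Finset.mem_filter.2 ⟨by simpa using hkS.1, hkS.2, i, hi, hik, hc⟩)
              · exact indicator_of_notMem hkS _
            rw [this, abs_zero]
            exact hnn
      _ ≤ ∑ n ∈ K.image own, X.NE κ (fun k => |u n k|) := NE_sum_le _ _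
      _ = ∑ n ∈ K.image own, X.NE κ (u n) :=
          Finset.sum_congr rfl fun n _ => N_abs (M.aesm_comp (u n))
  · obtain ⟨k, hk, rfl⟩ := Finset.mem_image.1 hn
    obtain ⟨hkS, h1, h2, h3⟩ := hKmem k hk
    exact ⟨h1, k, hkS, h2, h3⟩

end DyadicModel

end Glue

/-! ### Classes of sequences, and averages over the blocks -/

section Classes

variable {Ω : Type*} [MeasurableSpace Ω] {μ : Measure Ω} {X : KotheSpace μ} {κ : Ω → ℤ} {J : Set ℤ}

namespace DyadicModel

variable (M : DyadicModel μ κ J)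

/-- The class of the function `ξ ∘ κ`. -/
def cls (ξ : ℤ → ℝ) : Ω →ₘ[μ] ℝ := AEEqFun.mk (fun s => ξ (κ s)) (M.aesm_comp ξ)

theorem coeFn_cls (ξ : ℤ → ℝ) : M.cls ξ =ᵐ[μ] fun s => ξ (κ s) := AEEqFun.coeFn_mk _ _

theorem nrm_cls (ξ : ℤ → ℝ) : X.nrm (M.cls ξ) = X.NE κ ξ := (N_mk (M.aesm_comp ξ)).symm

theorem cls_add (ξ η : ℤ → ℝ) : M.cls (fun k => ξ k + η k) = M.cls ξ + M.cls η := rfl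

theorem cls_smul (c : ℝ) (ξ : ℤ → ℝ) : M.cls (fun k => c * ξ k) = c • M.cls ξ := rfl

theorem cls_congr {ξ η : ℤ → ℝ} (h : ∀ k ∈ J, ξ k = η k) : M.cls ξ = M.cls η := by
  refine AEEqFun.ext ?_
  filter_upwards [M.coeFn_cls ξ, M.coeFn_cls η, M.ae_mem] with s h1 h2 h3
  rw [h1, h2, h _ h3]

theorem nrm_linfty_cls_le [SigmaFinite μ] {ξ : ℤ → ℝ} {C : ℝ} (h : ∀ k ∈ J, |ξ k| ≤ C) :
    (linfty μ).nrm (M.cls ξ) ≤ ENNReal.ofReal C := by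
  rw [nrm_cls]
  refine N_linfty_le (M.aesm_comp ξ) ?_
  filter_upwards [M.ae_mem] with s hs
  exact ENNReal.ofReal_le_ofReal (h _ hs)

end DyadicModel

/-- The averages of a function over the blocks. -/
def blockMean (μ : Measure Ω) (κ : Ω → ℤ) (w : Ω →ₘ[μ] ℝ) (k : ℤ) : ℝ :=
  (∫ s in κ ⁻¹' {k}, w s ∂μ) / (μ (κ ⁻¹' {k})).toReal

namespace DyadicModel

variable (M : DyadicModel μ κ J)

include M

theorem blockMean_cls (ξ : ℤ → ℝ) {k : ℤ} (hk : k ∈ J) : blockMean μ κ (M.cls ξ) k = ξ k := by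
  have h0 : (μ (κ ⁻¹' {k})).toReal ≠ 0 := by
    rw [M.block k hk]
    exact (ENNReal.toReal_pos (two_zpow_pos k).ne' (two_zpow_lt_top k).ne).ne'
  have h1 : ∫ s in κ ⁻¹' {k}, M.cls ξ s ∂μ = ∫ s in κ ⁻¹' {k}, ξ k ∂μ := by
    refine setIntegral_congr_ae (M.ms_pre _) ?_
    filter_upwards [M.coeFn_cls ξ] with s hs hsk
    rw [hs, show κ s = k from hsk]
  rw [blockMean, h1, setIntegral_const, smul_eq_mul, Measure.real, mul_div_cancel_left₀ _ h0]

omit M in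
theorem abs_blockMean_le (w : Ω →ₘ[μ] ℝ) (k : ℤ) :
    |blockMean μ κ w k| ≤ blockAvg μ (fun k => κ ⁻¹' {k}) w k := by
  rw [blockMean, blockAvg, abs_div, abs_of_nonneg (ENNReal.toReal_nonneg)]
  gcongr
  exact abs_integral_le_integral_abs

/-- Conditional expectation onto the dyadic blocks, used to turn an operator on functions into one
on sequences. -/
theorem NE_blockMean_le [SigmaFinite μ] (hX : X.IsRearrangementInvariant) (w : Ω →ₘ[μ] ℝ) :
    X.NE κ (blockMean μ κ w) ≤ 2 * X.nrm w := by
  have hd : J.PairwiseDisjoint fun k => κ ⁻¹' {k} := fun i _ j _ hij =>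
    (disjoint_singleton.2 hij).preimage κ
  rw [← N_coe]
  refine (M.NE_mono fun k hk => ?_).trans (M.NE_blockAvg_le hX (fun k => M.ms_pre _) hd
    (fun k hk => ?_) (fun k _ => M.block_lt_top k) w.measurable)
  · rw [indicator_of_mem hk, abs_of_nonneg (blockAvg_nonneg _ _ _)]
    exact abs_blockMean_le w k
  · rw [M.block k hk]
    exact le_mul_of_one_le_left' one_le_two

variable [SigmaFinite μ]

theorem abs_blockMean_le_linfty {w : Ω →ₘ[μ] ℝ} (hw : (linfty μ).nrm w ≠ ∞) {k : ℤ} (hk : k ∈ J) :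
    |blockMean μ κ w k| ≤ ((linfty μ).nrm w).toReal := by
  refine (abs_blockMean_le w k).trans ?_
  rw [← ENNReal.ofReal_le_iff_le_toReal hw, ← N_coe]
  refine blockAvg_le_linfty ?_ (M.block_lt_top k) w.measurable
  rw [M.block k hk]
  exact (two_zpow_pos k).ne'

theorem integrableOn_block (hX : X.IsRearrangementInvariant) {w : Ω →ₘ[μ] ℝ}
    (hw : w ∈ sumSpace X (linfty μ)) (k : ℤ) : IntegrableOn w (κ ⁻¹' {k}) μ :=
  M.integrableOn_of_mem hX hw (M.ms_pre _) (M.block_lt_top k)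

theorem blockMean_add (hX : X.IsRearrangementInvariant) {v w : Ω →ₘ[μ] ℝ}
    (hv : v ∈ sumSpace X (linfty μ)) (hw : w ∈ sumSpace X (linfty μ)) (k : ℤ) :
    blockMean μ κ (v + w) k = blockMean μ κ v k + blockMean μ κ w k := by
  rw [blockMean, blockMean, blockMean, ← add_div,
    ← integral_add (M.integrableOn_block hX hv k) (M.integrableOn_block hX hw k)]
  congr 1
  refine integral_congr_ae (ae_restrict_of_ae ?_)
  filter_upwards [AEEqFun.coeFn_add v w] with s hs
  rw [hs, Pi.add_apply]

omit M [SigmaFinite μ] in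
theorem blockMean_smul (c : ℝ) (w : Ω →ₘ[μ] ℝ) (k : ℤ) :
    blockMean μ κ (c • w) k = c * blockMean μ κ w k := by
  rw [blockMean, blockMean, ← mul_div_assoc, ← integral_const_mul]
  congr 1
  refine integral_congr_ae (ae_restrict_of_ae ?_)
  filter_upwards [AEEqFun.coeFn_smul c w] with s hs
  rw [hs, Pi.smul_apply, smul_eq_mul]

omit [SigmaFinite μ] in
/-- Averaging over signs leaves the diagonal of a matrix of sequences. -/
theorem NE_diag_le {ι : Type*} (F : Finset ι) (a : ι → ι → ℤ → ℝ) (b : ℤ → ℝ) {B : ℝ≥0∞}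
    (h : ∀ ε : ι → ℝ, (∀ i, |ε i| = 1) →
      X.NE κ (fun k => b k + ∑ i ∈ F, ∑ j ∈ F, ε i * ε j * a i j k) ≤ B) :
    X.NE κ (fun k => b k + ∑ i ∈ F, a i i k) ≤ B := by
  classical
  induction F using Finset.induction_on generalizing b with
  | empty => simpa using h (fun _ => 1) (by simp)
  | insert m F hm ih =>
    have key : ∀ ε : ι → ℝ, (∀ i, |ε i| = 1) →
        X.NE κ (fun k => (b k + a m m k) + ∑ i ∈ F, ∑ j ∈ F, ε i * ε j * a i j k) ≤ B := by
      intro ε hε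
      let S : ℤ → ℝ := fun k => ∑ i ∈ F, ∑ j ∈ F, ε i * ε j * a i j k
      let L : ℤ → ℝ := fun k => ∑ j ∈ F, ε j * (a m j k + a j m k)
      -- A change of the sign at `m` flips exactly the off-diagonal terms that involve `m`,
      -- collected in `L`; the diagonal term is kept because `c * c = 1`. The mean over both signs
      -- removes `L`.
      have hup : ∀ c : ℝ, |c| = 1 → X.NE κ (fun k => b k + a m m k + S k + c * L k) ≤ B := by
        intro c hc
        have h1 := h (Function.update ε m c) fun i => by
          by_cases hi : i = m
          · rw [hi, Function.update_self, hc]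
          · rw [Function.update_of_ne hi, hε]
        refine le_of_eq_of_le ?_ h1
        congr 1
        funext k
        have hne : ∀ i ∈ F, Function.update ε m c i = ε i := fun i hi =>
          Function.update_of_ne (fun h' : i = m => hm (h' ▸ hi)) _ _
        have hcc : c * c = 1 := by rw [← abs_mul_abs_self, hc, one_mul]
        simp only [Finset.sum_insert hm, Function.update_self]
        rw [Finset.sum_add_distrib]
        have e1 : ∑ j ∈ F, c * Function.update ε m c j * a m j k =
            c * ∑ j ∈ F, ε j * a m j k := by
          rw [Finset.mul_sum]
          exact Finset.sum_congr rfl fun j hj => by rw [hne j hj]; ring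
        have e2 : ∑ i ∈ F, Function.update ε m c i * c * a i m k =
            c * ∑ j ∈ F, ε j * a j m k := by
          rw [Finset.mul_sum]
          exact Finset.sum_congr rfl fun j hj => by rw [hne j hj]; ring
        have e3 : ∑ i ∈ F, ∑ j ∈ F, Function.update ε m c i * Function.update ε m c j * a i j k =
            S k := Finset.sum_congr rfl fun i hi => Finset.sum_congr rfl fun j hj => by
          rw [hne i hi, hne j hj]
        have e4 : L k = ∑ j ∈ F, ε j * a m j k + ∑ j ∈ F, ε j * a j m k := by
          rw [← Finset.sum_add_distrib]
          exact Finset.sum_congr rfl fun j _ => by ring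
        rw [e1, e2, e3, e4, hcc]
        ring
      have h1 := hup 1 (by simp)
      have h2 := hup (-1) (by simp)
      calc _ = X.NE κ (fun k => (1 / 2) * (b k + a m m k + S k + 1 * L k) +
              (1 / 2) * (b k + a m m k + S k + (-1) * L k)) := by
            congr 1; funext k; simp only [S]; ring
        _ ≤ ENNReal.ofReal |1 / 2| * B + ENNReal.ofReal |1 / 2| * B := by
            refine (NE_add_le _ _).trans ?_
            rw [M.NE_const_mul, M.NE_const_mul]
            gcongr
        _ = B := by
            rw [← add_mul, ← ENNReal.ofReal_add (by positivity) (by positivity)]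
            norm_num
    have := ih (fun k => b k + a m m k) key
    refine le_of_eq_of_le ?_ this
    congr 1
    funext k
    rw [Finset.sum_insert hm, add_assoc]

end DyadicModel

end Classes

/-! ### The right-shift property on a chain, up to a small error -/

section ChainBound

variable {Ω : Type*} [MeasurableSpace Ω] {μ : Measure Ω} {X : KotheSpace μ} {κ : Ω → ℤ}
  {J : Set ℤ} {Λ : ℤ → ℕ} {D : Set ℤ} {x y u : ℤ → ℤ → ℝ} {r s h : ℤ → ℤ} {c : ℤ → ℝ}

/-- The `k`-th coordinate satisfies `|ξ k| e_k ≤ ‖ξ‖`, and `T_m ≤ T_k ≤ 2 e_k`. -/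
theorem DyadicModel.abs_mul_T_le (M : DyadicModel μ κ J) (hX : X.IsRearrangementInvariant)
    {ξ : ℤ → ℝ} {C : ℝ} (hξ : X.NE κ ξ ≤ ENNReal.ofReal C) (hC : 0 ≤ C) {m k : ℤ} (hk : k ∈ J)
    (hmk : m ≤ k) : |ξ k| * (X.T κ m).toReal ≤ 2 * C := by
  have hT := ((M.T_mono (X := X) hmk).trans_lt (M.T_lt_top hk)).ne
  rw [← ENNReal.ofReal_le_ofReal_iff (by positivity), ENNReal.ofReal_mul (abs_nonneg _),
    ENNReal.ofReal_toReal hT, ENNReal.ofReal_mul (by positivity)]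
  calc ENNReal.ofReal |ξ k| * X.T κ m ≤ ENNReal.ofReal |ξ k| * (2 * X.e κ k) := by
        gcongr
        exact (M.T_mono hmk).trans (M.T_le_two_e hX hk)
    _ = 2 * (ENNReal.ofReal |ξ k| * X.e κ k) := by ring
    _ ≤ 2 * ENNReal.ofReal C := by
        gcongr
        exact (M.NE_coord ξ k).trans hξ
    _ = _ := by simp

theorem NE_glue_Iio_le (M : DyadicModel μ κ J) (hD : ∀ i ∈ D, ∀ j ∈ D, i < j → h i < j)
    (hc : ∀ i ∈ D, 0 < c i) {B : ℝ} {i : ℤ}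
    (hsum : ∀ F : Finset ℤ, (∀ n ∈ F, n ∈ D ∧ n < i) → ∑ n ∈ F, c n ≤ B)
    (hu : ∀ i ∈ D, X.NE κ (u i) ≤ ENNReal.ofReal (c i)) :
    X.NE κ ((Iio i).indicator (glue D h u)) ≤ ENNReal.ofReal B := by
  refine M.NE_glue_le hD fun F hF => ?_
  have hF' : ∀ n ∈ F, n ∈ D ∧ n < i := fun n hn => by
    obtain ⟨h1, k, hk, h2, -⟩ := hF n hn
    exact ⟨h1, h2.trans_lt hk⟩
  calc ∑ n ∈ F, X.NE κ (u n) ≤ ∑ n ∈ F, ENNReal.ofReal (c n) :=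
        Finset.sum_le_sum fun n hn => hu n (hF' n hn).1
    _ = ENNReal.ofReal (∑ n ∈ F, c n) :=
        (ENNReal.ofReal_sum_of_nonneg fun n hn => (hc n (hF' n hn).1).le).symm
    _ ≤ _ := ENNReal.ofReal_le_ofReal (hsum F hF')

/-- A vector of norm at most `c m` supported from `m` on has coordinates at most `2 c m / T m`, and
`B` bounds these quotients for `m > i`. -/
theorem abs_glue_Ioi_le (M : DyadicModel μ κ J) (hX : X.IsRearrangementInvariant)
    (hch : IsChain X κ J Λ D x y r s h) (hc : ∀ i ∈ D, 0 < c i) {i : ℤ} (hi : i ∈ D) {B : ℝ}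
    (hB : 0 ≤ B) (hup : ∀ m ∈ D, i < m → c m / (X.T κ m).toReal ≤ B)
    (hu : ∀ i ∈ D, X.NE κ (u i) ≤ ENNReal.ofReal (c i)) {k : ℤ} (hk : k ∈ J) :
    |(Ioi (h i)).indicator (glue D h u) k| ≤ 2 * B := by
  by_cases hki : k ∈ Ioi (h i)
  · rw [indicator_of_mem hki]
    by_cases H : ∃ m ∈ D, m ≤ k ∧ k ≤ h m
    · obtain ⟨m, hm, h1, h2⟩ := H
      have him : i < m := by
        rcases lt_trichotomy i m with h' | h' | h'
        · exact h'
        · rw [h'] at hki; exact absurd hki (not_lt.2 h2)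
        · have h3 := hch.lt m hm i hi h'
          have h4 := hch.le_h hi
          have h5 : h i < k := hki
          omega
      rw [glue_of_mem hch.lt hm h1 h2]
      have hT : 0 < (X.T κ m).toReal :=
        ENNReal.toReal_pos (M.T_pos (hch.mem m hm)).ne' (M.T_lt_top (hch.mem m hm)).ne
      have h3 := M.abs_mul_T_le hX (hu m hm) (hc m hm).le hk h1
      rw [← le_div_iff₀ hT, mul_div_assoc] at h3
      exact h3.trans (mul_le_mul_of_nonneg_left (hup m hm him) zero_le_two)
    · rw [glue_of_notMem, abs_zero]
      · positivity
      · intro m hm hmk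
        by_contra! hc'
        exact H ⟨m, hm, hmk, hc'⟩
  · rw [indicator_of_notMem hki, abs_zero]
    positivity

variable [SigmaFinite μ]

/-- Cut after the interval of any `i ∈ D`: the part up to there is in `X`, since the norms are
summable, and the rest is bounded. -/
theorem cls_glue_mem (M : DyadicModel μ κ J) (hX : X.IsRearrangementInvariant)
    (hch : IsChain X κ J Λ D x y r s h) (hc : ∀ i ∈ D, 0 < c i)
    (hsum : ∀ i ∈ D, ∀ F : Finset ℤ, (∀ n ∈ F, n ∈ D ∧ n < i) → ∑ n ∈ F, c n ≤ c i / Λ i)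
    (hup : ∀ i ∈ D, ∀ m ∈ D, i < m →
      c m / (X.T κ m).toReal ≤ c i / (Λ i * (X.T κ (h i)).toReal))
    (hs : ∀ i ∈ D, Function.support (u i) ⊆ Icc i (h i))
    (hu : ∀ i ∈ D, X.NE κ (u i) ≤ ENNReal.ofReal (c i)) :
    M.cls (glue D h u) ∈ sumSpace X (linfty μ) := by
  rcases D.eq_empty_or_nonempty with rfl | ⟨i, hi⟩
  · have : M.cls (glue ∅ h u) = 0 := by
      have h0 : glue ∅ h u = fun _ => 0 := funext fun k => glue_of_notMem (by simp)
      rw [h0]; rfl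
    rw [this]
    exact Submodule.zero_mem _
  · refine Submodule.mem_sup.2 ⟨M.cls (fun k => (Iio i).indicator (glue D h u) k + u i k), ?_,
      M.cls ((Ioi (h i)).indicator (glue D h u)), ?_, ?_⟩
    · change X.nrm _ < ∞
      rw [M.nrm_cls]
      exact (DyadicModel.NE_add_le _ _).trans_lt (ENNReal.add_lt_top.2
        ⟨(NE_glue_Iio_le M hch.lt hc (hsum i hi) hu).trans_lt ENNReal.ofReal_lt_top,
          (hu i hi).trans_lt ENNReal.ofReal_lt_top⟩)
    · change (linfty μ).nrm _ < ∞
      exact (M.nrm_linfty_cls_le fun k hk => abs_glue_Ioi_le M hX hch hc hi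
        (by have := hc i hi; positivity) (hup i hi) hu hk).trans_lt ENNReal.ofReal_lt_top
    · rw [← M.cls_add]
      exact M.cls_congr fun k _ => (glue_decomp hch.lt hi (hch.le_h hi) (hs i hi) k).symm

theorem le_kFunctional_cls_glue (M : DyadicModel μ κ J) (hch : IsChain X κ J Λ D x y r s h)
    {i : ℤ} (hi : i ∈ D) (hs : Function.support (u i) ⊆ Icc i (r i)) {σ t : ℝ≥0} (hσ : 1 ≤ σ)
    (ht : 0 < t) (hT : X.T κ (r i) ≤ σ * t) :
    X.NE κ (u i) ≤ σ * kFunctional X (linfty μ) t (M.cls (glue D h u)) := by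
  have hA : MeasurableSet (κ ⁻¹' Icc i (r i)) := M.ms_pre _
  refine le_of_eq_of_le ?_ (N_indicator_le_kFunctional hA hσ ht ?_ _)
  · refine N_congr ?_
    filter_upwards [M.coeFn_cls (glue D h u)] with p hp
    by_cases hpA : p ∈ κ ⁻¹' Icc i (r i)
    · rw [indicator_of_mem hpA, hp, glue_of_mem hch.lt hi hpA.1 (hpA.2.trans (hch.r_le i hi))]
    · rw [indicator_of_notMem hpA]
      by_contra h0
      exact hpA (hs h0)
  · refine (N_mono (aestronglyMeasurable_const.indicator hA)
      (Eventually.of_forall fun p => ?_)).trans hT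
    by_cases hpA : p ∈ κ ⁻¹' Icc i (r i)
    · have : p ∈ κ ⁻¹' Iic (r i) := hpA.2
      rw [indicator_of_mem hpA, indicator_of_mem this]
    · rw [indicator_of_notMem hpA, abs_zero]
      exact abs_nonneg _

/-- Split the glued `v` at the intervals with `T (r n) ≤ t`. Over these the coefficients sum to at
most twice the last one, which is at most `K`, so the norm in `X` is at most `K / 3`. Over the
others the coordinates are at most `2 (c m / 6) / T (s m)`, and `T (r m) ≤ 2 T (s m)` with `c m * t
≤ T (r m) * K` gives the sup norm `2 K / (3 t)`. The factor 6 makes `1 / 3 + 2 / 3 = 1`. -/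
theorem kFunctional_glue_le (M : DyadicModel μ κ J) (hX : X.IsRearrangementInvariant)
    (hch : IsChain X κ J Λ D x y r s h) (hc : ∀ i ∈ D, 0 < c i)
    (hsum : ∀ i ∈ D, ∀ F : Finset ℤ, (∀ n ∈ F, n ∈ D ∧ n < i) → ∑ n ∈ F, c n ≤ c i)
    {v : ℤ → ℤ → ℝ} (hus : ∀ i ∈ D, Function.support (u i) ⊆ Icc i (r i))
    (hvs : ∀ i ∈ D, Function.support (v i) ⊆ Icc (s i) (h i))
    (hu : ∀ i ∈ D, X.NE κ (u i) = ENNReal.ofReal (c i))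
    (hv : ∀ i ∈ D, X.NE κ (v i) ≤ ENNReal.ofReal (c i / 6)) {t : ℝ≥0} (ht : 0 < t) :
    kFunctional X (linfty μ) t (M.cls (glue D h v)) ≤
      kFunctional X (linfty μ) t (M.cls (glue D h u)) := by
  set K := kFunctional X (linfty μ) t (M.cls (glue D h u)) with hK
  rcases eq_or_ne K ∞ with hKtop | hKtop
  · rw [hKtop]; exact le_top
  set S : Set ℤ := {k | ∃ n ∈ D, X.T κ (r n) ≤ t ∧ n ≤ k ∧ k ≤ h n} with hS
  have hlow : X.NE κ (S.indicator (glue D h v)) ≤ ENNReal.ofReal (K.toReal / 3) := by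
    refine M.NE_glue_le hch.lt fun F hF => ?_
    have hF' : ∀ n ∈ F, n ∈ D ∧ X.T κ (r n) ≤ t := fun n hn => by
      obtain ⟨h1, k, ⟨m, hm, hmt, h3, h4⟩, h5, h6⟩ := hF n hn
      have : m = n := by
        rcases lt_trichotomy m n with h' | h' | h'
        · have := hch.lt m hm n h1 h'; omega
        · exact h'
        · have := hch.lt n h1 m hm h'; omega
      exact ⟨h1, this ▸ hmt⟩
    rcases F.eq_empty_or_nonempty with rfl | hne
    · simp
    have hp := F.max'_mem hne
    set p := F.max' hne with hpdef
    have hcK : c p ≤ K.toReal := by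
      rw [← ENNReal.ofReal_le_iff_le_toReal hKtop, ← hu p (hF' p hp).1]
      have := le_kFunctional_cls_glue M hch (hF' p hp).1 (hus p (hF' p hp).1) le_rfl ht
        (by simpa using (hF' p hp).2)
      simpa using this
    have hsp : ∑ n ∈ F, c n ≤ 2 * c p := by
      rw [← Finset.add_sum_erase F c hp]
      have := hsum p (hF' p hp).1 (F.erase p) fun n hn =>
        ⟨(hF' n (Finset.mem_of_mem_erase hn)).1,
          lt_of_le_of_ne (F.le_max' n (Finset.mem_of_mem_erase hn)) (Finset.ne_of_mem_erase hn)⟩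
      linarith
    calc ∑ n ∈ F, X.NE κ (v n) ≤ ∑ n ∈ F, ENNReal.ofReal (c n / 6) :=
          Finset.sum_le_sum fun n hn => hv n (hF' n hn).1
      _ = ENNReal.ofReal (∑ n ∈ F, c n / 6) :=
          (ENNReal.ofReal_sum_of_nonneg fun n hn => by
            have := hc n (hF' n hn).1; positivity).symm
      _ ≤ _ := by
          refine ENNReal.ofReal_le_ofReal ?_
          rw [← Finset.sum_div]
          linarith
  have hhigh : (linfty μ).N (fun p => Sᶜ.indicator (glue D h v) (κ p)) ≤
      ENNReal.ofReal (2 * K.toReal / (3 * t)) := by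
    refine N_linfty_le (M.aesm_comp _) ?_
    filter_upwards [M.ae_mem] with p hp
    refine ENNReal.ofReal_le_ofReal ?_
    generalize κ p = k at hp
    have ht' : (0 : ℝ) < t := ht
    by_cases hkS : k ∈ S
    · rw [indicator_of_notMem (by simpa using hkS), abs_zero]
      positivity
    rw [indicator_of_mem (by exact hkS)]
    by_cases H : ∃ m ∈ D, m ≤ k ∧ k ≤ h m
    · obtain ⟨m, hm, h1, h2⟩ := H
      rw [glue_of_mem hch.lt hm h1 h2]
      have hmt : (t : ℝ≥0∞) < X.T κ (r m) := by
        by_contra! hc'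
        exact hkS ⟨m, hm, hc', h1, h2⟩
      by_cases hv0 : v m k = 0
      · rw [hv0, abs_zero]; positivity
      have hcm := hc m hm
      have hrJ : r m ∈ J := M.ordConnected.out (hch.mem m hm) (hch.h_mem m hm)
        ⟨hch.le_r m hm, hch.r_le m hm⟩
      have hTtop := (M.T_lt_top (X := X) hrJ).ne
      have hsJ : s m ∈ J := M.ordConnected.out (hch.mem m hm) (hch.h_mem m hm)
        ⟨hch.le_s m hm, hch.s_le m hm⟩
      have h3 := M.abs_mul_T_le hX (hv m hm) (by positivity) hp (hvs m hm hv0).1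
      have h4 : (X.T κ (r m)).toReal ≤ 2 * (X.T κ (s m)).toReal := by
        have := ENNReal.toReal_mono (ENNReal.mul_ne_top (by simp) (M.T_lt_top hsJ).ne)
          (hch.T_le m hm)
        simpa [ENNReal.toReal_mul] using this
      have htr : (t : ℝ) ≤ (X.T κ (r m)).toReal := by
        have := ENNReal.toReal_mono hTtop hmt.le
        simpa using this
      have h5 : c m * t ≤ (X.T κ (r m)).toReal * K.toReal := by
        have h6 := le_kFunctional_cls_glue M hch hm (hus m hm) (σ := (X.T κ (r m)).toNNReal / t)
          (by rw [one_le_div ht]; exact_mod_cast htr) ht (by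
            rw [← ENNReal.coe_mul, div_mul_cancel₀ _ ht.ne', ENNReal.coe_toNNReal hTtop])
        rw [hu m hm, ← hK, ENNReal.ofReal_le_iff_le_toReal (ENNReal.mul_ne_top (by simp) hKtop),
          ENNReal.toReal_mul, ENNReal.coe_toReal, NNReal.coe_div, div_mul_eq_mul_div,
          le_div_iff₀ ht'] at h6
        exact h6
      have hTr : 0 < (X.T κ (r m)).toReal := ht'.trans_le htr
      rw [le_div_iff₀ (by positivity)]
      have h7 : |v m k| * (X.T κ (r m)).toReal ≤ 2 * c m / 3 := by
        have := mul_le_mul_of_nonneg_left h4 (abs_nonneg (v m k))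
        linarith
      have h8 : |v m k| * (3 * t) * (X.T κ (r m)).toReal ≤
          2 * K.toReal * (X.T κ (r m)).toReal := by
        have := mul_le_mul_of_nonneg_right h7 ht'.le
        nlinarith
      exact le_of_mul_le_mul_right h8 hTr
    · rw [glue_of_notMem, abs_zero]
      · positivity
      · intro m hm hmk
        by_contra! hc'
        exact H ⟨m, hm, hmk, hc'⟩
  refine (kFunctional_le (M.aesm_comp (S.indicator (glue D h v)))
    (M.aesm_comp (Sᶜ.indicator (glue D h v))) ?_).trans ?_
  · filter_upwards [M.coeFn_cls (glue D h v)] with p hp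
    rw [hp]
    exact (congrFun (indicator_self_add_compl S (glue D h v)) (κ p)).symm
  · calc _ ≤ ENNReal.ofReal (K.toReal / 3) + t * ENNReal.ofReal (2 * K.toReal / (3 * t)) := by
          gcongr
          exact hlow
      _ = ENNReal.ofReal K.toReal := by
          have ht' : (0 : ℝ) < t := ht
          rw [← ENNReal.ofReal_coe_nnreal, ← ENNReal.ofReal_mul ht'.le,
            ← ENNReal.ofReal_add (by positivity) (by positivity)]
          congr 1
          field_simp
          ring
      _ = K := ENNReal.ofReal_toReal hKtop

end ChainBound

/-! ### Sequence operators from a Calderón couple, and the right-shift property on one chain -/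

section ChainBound

variable {Ω : Type*} [MeasurableSpace Ω] {μ : Measure Ω} {X : KotheSpace μ} {κ : Ω → ℤ}
  {J : Set ℤ} {Λ : ℤ → ℕ} {D : Set ℤ} {x y u : ℤ → ℤ → ℝ} {r s h : ℤ → ℤ} {c : ℤ → ℝ}

/-- In a Calderón couple `(X, L_∞)`, an operator on sequences that maps `ξ` to `η`. -/
theorem DyadicModel.exists_sequence_operator [SigmaFinite μ] (M : DyadicModel μ κ J)
    (hX : X.IsRearrangementInvariant) (hCal : IsCalderonCouple X (linfty μ)) {ξ η : ℤ → ℝ}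
    (hξ : M.cls ξ ∈ sumSpace X (linfty μ)) (hη : M.cls η ∈ sumSpace X (linfty μ))
    (hK : ∀ t : ℝ≥0, 0 < t → kFunctional X (linfty μ) t (M.cls η) ≤
      kFunctional X (linfty μ) t (M.cls ξ)) :
    ∃ (C : ℝ≥0) (S : (ℤ → ℝ) →ₗ[ℝ] ℤ → ℝ), (∀ a, X.NE κ a < ∞ → X.NE κ (S a) ≤ C * X.NE κ a) ∧
      (∀ (a : ℤ → ℝ) (B : ℝ), 0 ≤ B → (∀ k ∈ J, |a k| ≤ B) → ∀ k ∈ J, |S a k| ≤ C * B) ∧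
      ∀ k ∈ J, S ξ k = η k := by
  obtain ⟨T, hT1, hT2, hT⟩ := hCal ⟨M.cls η, hη⟩ ⟨M.cls ξ, hξ⟩ hK
  let bm : sumSpace X (linfty μ) →ₗ[ℝ] ℤ → ℝ :=
    { toFun := fun w => blockMean μ κ (w : Ω →ₘ[μ] ℝ)
      map_add' := fun v w => funext fun k => M.blockMean_add hX v.2 w.2 k
      map_smul' := fun c w => funext fun k => blockMean_smul c _ k }
  let cl : (ℤ → ℝ) →ₗ[ℝ] Ω →ₘ[μ] ℝ :=
    { toFun := M.cls
      map_add' := fun a b => M.cls_add a b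
      map_smul' := fun c a => M.cls_smul c a }
  -- An arbitrary linear extension to all functions, so that `S` is defined on all sequences; only
  -- its values on the sum space are used.
  obtain ⟨E, hE⟩ := LinearMap.exists_extend (bm ∘ₗ T)
  have hS : ∀ a (ha : M.cls a ∈ sumSpace X (linfty μ)),
      (E ∘ₗ cl) a = blockMean μ κ (T ⟨M.cls a, ha⟩ : Ω →ₘ[μ] ℝ) := fun a ha =>
    DFunLike.congr_fun hE (⟨M.cls a, ha⟩ : sumSpace X (linfty μ))
  set C₁ := (opNorm X T).toNNReal
  set C₂ := (opNorm (linfty μ) T).toNNReal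
  have h1 : opNorm X T ≤ C₁ := (ENNReal.coe_toNNReal hT1.ne).ge
  have h2 : opNorm (linfty μ) T ≤ C₂ := (ENNReal.coe_toNNReal hT2.ne).ge
  refine ⟨2 * C₁ + C₂, E ∘ₗ cl, fun a ha => ?_, fun a B hB haB k hk => ?_, fun k hk => ?_⟩
  · have hm : X.nrm (M.cls a) < ∞ := by rwa [M.nrm_cls]
    have hmV : M.cls a ∈ sumSpace X (linfty μ) := Submodule.mem_sup_left hm
    rw [hS a hmV]
    calc _ ≤ 2 * X.nrm (T ⟨M.cls a, hmV⟩ : Ω →ₘ[μ] ℝ) := M.NE_blockMean_le hX _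
      _ ≤ 2 * (C₁ * X.nrm (M.cls a)) := by
          gcongr
          exact nrm_map_le h1 (f := ⟨M.cls a, hmV⟩) hm
      _ ≤ _ := by
          rw [M.nrm_cls, ← mul_assoc]
          gcongr
          push_cast
          exact le_self_add
  · have hle := M.nrm_linfty_cls_le haB
    have hm : (linfty μ).nrm (M.cls a) < ∞ := hle.trans_lt ENNReal.ofReal_lt_top
    have hmV : M.cls a ∈ sumSpace X (linfty μ) := Submodule.mem_sup_right hm
    rw [hS a hmV]
    have h3 : (linfty μ).nrm (T ⟨M.cls a, hmV⟩ : Ω →ₘ[μ] ℝ) ≤ C₂ * ENNReal.ofReal B :=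
      (nrm_map_le h2 (f := ⟨M.cls a, hmV⟩) hm).trans (by gcongr)
    have h4 : (C₂ : ℝ≥0∞) * ENNReal.ofReal B ≠ ∞ := ENNReal.mul_ne_top (by simp) (by simp)
    refine (M.abs_blockMean_le_linfty (h3.trans_lt h4.lt_top).ne hk).trans
      ((ENNReal.toReal_mono h4 h3).trans ?_)
    rw [ENNReal.toReal_mul, ENNReal.coe_toReal, ENNReal.toReal_ofReal hB]
    gcongr
    exact le_add_of_nonneg_left (by positivity)
  · rw [hS ξ hξ, hT]
    exact M.blockMean_cls η hk

/-- The diagonal of the matrix of a bounded operator on a sequence of disjoint vectors. -/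
theorem IsChain.NE_diag_le (hch : IsChain X κ J Λ D x y r s h) (M : DyadicModel μ κ J)
    {C : ℝ≥0} {S : (ℤ → ℝ) →ₗ[ℝ] ℤ → ℝ}
    (hS : ∀ a, X.NE κ a < ∞ → X.NE κ (S a) ≤ C * X.NE κ a) {F : Finset ℤ} (hF : (F : Set ℤ) ⊆ D) :
    X.NE κ (fun k => ∑ i ∈ F, (Icc (s i) (h i)).indicator (S (x i)) k) ≤
      C * X.NE κ (fun k => ∑ i ∈ F, x i k) := by
  have hdis : ∀ m ∈ F, ∀ n ∈ F, m ≠ n → ∀ k, k ∈ Icc m (h m) → k ∉ Icc n (h n) := by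
    intro m hm n hn hmn k hk hk'
    rcases lt_or_gt_of_ne hmn with h' | h'
    · have := hch.lt m (hF hm) n (hF hn) h'
      have := hk.2; have := hk'.1; omega
    · have := hch.lt n (hF hn) m (hF hm) h'
      have := hk'.2; have := hk.1; omega
  have hxm : ∀ i ∈ F, ∀ k, x i k ≠ 0 → k ∈ Icc i (h i) := fun i hi k hk =>
    ⟨(hch.supp_x i (hF hi) hk).1, (hch.supp_x i (hF hi) hk).2.trans (hch.r_le i (hF hi))⟩
  have := M.NE_diag_le (X := X) F (fun i j => (Icc (s i) (h i)).indicator (S (x j)))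
    (fun _ => 0) (B := C * X.NE κ (fun k => ∑ i ∈ F, x i k)) fun ε hε => ?_
  · simpa using this
  -- Signs do not change the norm of a sum of disjoint vectors.
  have hz : X.NE κ (∑ j ∈ F, ε j • x j) ≤ X.NE κ (fun k => ∑ i ∈ F, x i k) := by
    refine M.NE_mono fun k _ => ?_
    rw [Finset.sum_apply]
    refine abs_sum_le_of_disjoint (fun m hm n hn hmn => ?_) fun n _ => ?_
    · by_contra! hc
      exact hdis m hm n hn hmn k (hxm m hm k hc.1) (hxm n hn k hc.2)
    · rw [Pi.smul_apply, smul_eq_mul, abs_mul, hε, one_mul]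
  have hfin : X.NE κ (∑ j ∈ F, ε j • x j) < ∞ := by
    refine M.NE_lt_top (Set.Finite.subset
      (F.finite_toSet.biUnion fun i _ => Set.finite_Icc i (h i)) fun k hk => ?_)
    rw [Function.mem_support, Finset.sum_apply] at hk
    obtain ⟨i, hi, hne⟩ := Finset.exists_ne_zero_of_sum_ne_zero hk
    exact mem_biUnion hi (hxm i hi k fun h0 => hne (by simp [h0]))
  refine le_trans ?_ ((hS _ hfin).trans (by gcongr))
  refine M.NE_mono fun k _ => ?_
  have e : ∀ i ∈ F, ∑ j ∈ F, ε i * ε j * (Icc (s i) (h i)).indicator (S (x j)) k =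
      ε i * (Icc (s i) (h i)).indicator (S (∑ j ∈ F, ε j • x j)) k := fun i _ => by
    by_cases hk : k ∈ Icc (s i) (h i)
    · simp only [indicator_of_mem hk, map_sum, map_smul, Finset.sum_apply, Pi.smul_apply,
        smul_eq_mul, Finset.mul_sum, mul_assoc]
    · simp only [indicator_of_notMem hk, mul_zero, Finset.sum_const_zero]
  rw [zero_add, Finset.sum_congr rfl e]
  by_cases H : ∃ i ∈ F, k ∈ Icc (s i) (h i)
  · obtain ⟨i, hi, hk⟩ := H
    rw [Finset.sum_eq_single_of_mem i hi fun j hj hji => ?_, indicator_of_mem hk, abs_mul, hε,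
      one_mul]
    rw [indicator_of_notMem, mul_zero]
    intro hkj
    exact hdis j hj i hi hji k ⟨(hch.le_s j (hF hj)).trans hkj.1, hkj.2⟩
      ⟨(hch.le_s i (hF hi)).trans hk.1, hk.2⟩
  · rw [Finset.sum_eq_zero, abs_zero]
    · exact abs_nonneg _
    · intro i hi
      rw [indicator_of_notMem fun hk => H ⟨i, hi, hk⟩, mul_zero]

/-- The part of `yᵢ` that is not explained by the action of the operator on `xᵢ` is small. -/
theorem IsChain.NE_remainder_le (hch : IsChain X κ J Λ D x y r s h) (M : DyadicModel μ κ J)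
    (hX : X.IsRearrangementInvariant) (hΛ : ∀ i ∈ D, 2 ≤ Λ i) (hc : ∀ i ∈ D, 0 < c i)
    (hsum : ∀ i ∈ D, ∀ F : Finset ℤ, (∀ n ∈ F, n ∈ D ∧ n < i) → ∑ n ∈ F, c n ≤ c i / Λ i)
    (hup : ∀ i ∈ D, ∀ m ∈ D, i < m →
      c m / (X.T κ m).toReal ≤ c i / (Λ i * (X.T κ (h i)).toReal))
    {α : ℤ → ℝ} (hα : ∀ i ∈ D, 0 < α i) (hxα : ∀ i ∈ D, X.NE κ (x i) = ENNReal.ofReal (α i))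
    {C : ℝ≥0} {S : (ℤ → ℝ) →ₗ[ℝ] ℤ → ℝ}
    (hS : ∀ a, X.NE κ a < ∞ → X.NE κ (S a) ≤ C * X.NE κ a)
    (hS' : ∀ (a : ℤ → ℝ) (B : ℝ), 0 ≤ B → (∀ k ∈ J, |a k| ≤ B) → ∀ k ∈ J, |S a k| ≤ C * B)
    (hST : ∀ k ∈ J, S (glue D h fun i => (c i / α i) • x i) k =
      glue D h (fun i => (c i / (6 * α i)) • y i) k) {i : ℤ} (hi : i ∈ D) :
    Λ i * X.NE κ ((Icc (s i) (h i)).indicator fun k => y i k - 6 * S (x i) k) ≤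
      (18 * C : ℝ≥0) * X.NE κ (x i) := by
  set u : ℤ → ℤ → ℝ := fun i => (c i / α i) • x i with hu_def
  have hci := hc i hi
  have hαi := hα i hi
  have hΛi : (0 : ℝ) < Λ i := by have := hΛ i hi; positivity
  have hu : ∀ i ∈ D, X.NE κ (u i) ≤ ENNReal.ofReal (c i) := fun i hi => by
    have e : u i = fun k => c i / α i * x i k := rfl
    rw [e, M.NE_const_mul, hxα i hi, ← ENNReal.ofReal_mul (abs_nonneg _),
      abs_of_pos (div_pos (hc i hi) (hα i hi)), div_mul_cancel₀ _ (hα i hi).ne']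
  have hus : Function.support (u i) ⊆ Icc i (h i) := fun k hk => by
    have : x i k ≠ 0 := fun h0 => hk (by simp [u, h0])
    exact ⟨(hch.supp_x i hi this).1, (hch.supp_x i hi this).2.trans (hch.r_le i hi)⟩
  set lo := (Iio i).indicator (glue D h u)
  set up := (Ioi (h i)).indicator (glue D h u)
  have hdec : glue D h u = lo + u i + up :=
    funext (glue_decomp hch.lt hi (hch.le_h hi) hus)
  have hlo : X.NE κ lo ≤ ENNReal.ofReal (c i / Λ i) := NE_glue_Iio_le M hch.lt hc (hsum i hi) hu
  have hT : 0 < (X.T κ (h i)).toReal :=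
    ENNReal.toReal_pos (M.T_pos (hch.h_mem i hi)).ne' (M.T_lt_top (hch.h_mem i hi)).ne
  set B := c i / (Λ i * (X.T κ (h i)).toReal) with hB
  have hB0 : 0 ≤ B := by positivity
  have hup' : ∀ k ∈ J, |S up k| ≤ C * (2 * B) := hS' up (2 * B) (by positivity) fun k hk =>
    abs_glue_Ioi_le M hX hch hc hi hB0 (hup i hi) hu hk
  -- On the interval of `i` the image of the glued `x` is a multiple of `y i`; solving for `y i - 6
  -- S (x i)` leaves the images of past and future.
  have key : ∀ k ∈ J, (Icc (s i) (h i)).indicator (fun k => y i k - 6 * S (x i) k) k =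
      (6 * α i / c i) * ((Icc (s i) (h i)).indicator (S lo) k +
        (Icc (s i) (h i)).indicator (S up) k) := fun k hk => by
    by_cases hki : k ∈ Icc (s i) (h i)
    · simp only [indicator_of_mem hki]
      have h1 := hST k hk
      rw [hdec, map_add, map_add,
        glue_of_mem hch.lt hi ((hch.le_s i hi).trans hki.1) hki.2] at h1
      simp only [u, map_smul, Pi.add_apply, Pi.smul_apply, smul_eq_mul] at h1
      have h2 : S lo k + S up k = c i / (6 * α i) * y i k - c i / α i * S (x i) k := by linarith
      rw [h2]
      field_simp
    · simp only [indicator_of_notMem hki, add_zero, mul_zero]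
  have h1 : X.NE κ ((Icc (s i) (h i)).indicator (S lo)) ≤ C * ENNReal.ofReal (c i / Λ i) := by
    refine (M.NE_mono (η := S lo) fun k _ => ?_).trans
      ((hS lo (hlo.trans_lt ENNReal.ofReal_lt_top)).trans (by gcongr))
    by_cases hki : k ∈ Icc (s i) (h i) <;> simp [hki]
  -- The future is small only in the sup norm; up to `h i` this costs the factor `T (h i)`, which
  -- cancels the denominator of `B`.
  have h2 : X.NE κ ((Icc (s i) (h i)).indicator (S up)) ≤
      C * ENNReal.ofReal (2 * c i / Λ i) := by
    refine (M.NE_le_mul_T (h i) (c := C * (2 * B)) (by positivity) (fun k hk => ?_)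
      fun k hk hik => ?_).trans (le_of_eq ?_)
    · by_cases hki : k ∈ Icc (s i) (h i)
      · rw [indicator_of_mem hki]; exact hup' k hk
      · rw [indicator_of_notMem hki, abs_zero]; positivity
    · exact indicator_of_notMem (fun hki => not_lt.2 hki.2 hik) _
    · rw [ENNReal.ofReal_mul C.coe_nonneg, ENNReal.ofReal_coe_nnreal, mul_assoc,
        ← ENNReal.ofReal_toReal (M.T_lt_top (X := X) (hch.h_mem i hi)).ne,
        ← ENNReal.ofReal_mul (by positivity), hB]
      congr 2
      field_simp
  rw [M.NE_congr key, M.NE_const_mul]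
  -- `18 = 6 * (1 + 2)`: the past contributes 1 and the future 2.
  calc (Λ i : ℝ≥0∞) * (ENNReal.ofReal |6 * α i / c i| * X.NE κ (fun k =>
        (Icc (s i) (h i)).indicator (S lo) k + (Icc (s i) (h i)).indicator (S up) k))
      ≤ Λ i * (ENNReal.ofReal |6 * α i / c i| *
          (C * ENNReal.ofReal (c i / Λ i) + C * ENNReal.ofReal (2 * c i / Λ i))) := by
        gcongr
        exact (DyadicModel.NE_add_le _ _).trans (add_le_add h1 h2)
    _ = (18 * C : ℝ≥0) * X.NE κ (x i) := by
        rw [hxα i hi, abs_of_pos (by positivity), ← mul_add,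
          ← ENNReal.ofReal_add (by positivity) (by positivity), ← ENNReal.ofReal_natCast,
          ← ENNReal.ofReal_coe_nnreal, ← ENNReal.ofReal_coe_nnreal (p := 18 * C),
          ← ENNReal.ofReal_mul C.coe_nonneg, ← ENNReal.ofReal_mul (by positivity),
          ← ENNReal.ofReal_mul (by positivity), ← ENNReal.ofReal_mul (by positivity)]
        congr 1
        push_cast
        field_simp
        ring

/-- In a Calderón couple, the right-shift property holds on a chain up to an error that is small
where the gaps of the chain are large. -/
theorem IsChain.exists_remainder [SigmaFinite μ] (hch : IsChain X κ J Λ D x y r s h)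
    (M : DyadicModel μ κ J) (hX : X.IsRearrangementInvariant)
    (hCal : IsCalderonCouple X (linfty μ)) (hΛ : ∀ i ∈ D, 2 ≤ Λ i) :
    ∃ (C : ℝ≥0) (ρ : ℤ → ℤ → ℝ), (∀ i ∈ D, Function.support (ρ i) ⊆ Icc (s i) (h i)) ∧
      (∀ i ∈ D, Λ i * X.NE κ (ρ i) ≤ C * X.NE κ (x i)) ∧
      ∀ F : Finset ℤ, (F : Set ℤ) ⊆ D → X.NE κ (fun k => ∑ i ∈ F, y i k) ≤
        C * X.NE κ (fun k => ∑ i ∈ F, x i k) + X.NE κ (fun k => ∑ i ∈ F, ρ i k) := by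
  obtain ⟨c, hc, hsum, hup⟩ := hch.exists_coefs M hΛ
  set α : ℤ → ℝ := fun i => (X.NE κ (x i)).toReal with hα_def
  have hfin : ∀ i ∈ D, X.NE κ (x i) ≠ ∞ := fun i hi =>
    (M.NE_lt_top ((Set.finite_Icc _ _).subset (hch.supp_x i hi))).ne
  have hα : ∀ i ∈ D, 0 < α i := fun i hi => ENNReal.toReal_pos (hch.NE_ne i hi) (hfin i hi)
  have hxα : ∀ i ∈ D, X.NE κ (x i) = ENNReal.ofReal (α i) := fun i hi =>
    (ENNReal.ofReal_toReal (hfin i hi)).symm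
  set u : ℤ → ℤ → ℝ := fun i => (c i / α i) • x i
  set v : ℤ → ℤ → ℝ := fun i => (c i / (6 * α i)) • y i
  have hu : ∀ i ∈ D, X.NE κ (u i) = ENNReal.ofReal (c i) := fun i hi => by
    have e : u i = fun k => c i / α i * x i k := rfl
    rw [e, M.NE_const_mul, hxα i hi, ← ENNReal.ofReal_mul (abs_nonneg _),
      abs_of_pos (div_pos (hc i hi) (hα i hi)), div_mul_cancel₀ _ (hα i hi).ne']
  have hv : ∀ i ∈ D, X.NE κ (v i) ≤ ENNReal.ofReal (c i / 6) := fun i hi => by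
    have e : v i = fun k => c i / (6 * α i) * y i k := rfl
    have h1 := hα i hi
    have h2 := hc i hi
    rw [e, M.NE_const_mul, abs_of_pos (by positivity)]
    refine (mul_le_mul_right (hch.NE_le i hi) _).trans (le_of_eq ?_)
    rw [hxα i hi, ← ENNReal.ofReal_mul (by positivity)]
    congr 1
    field_simp
  have hus : ∀ i ∈ D, Function.support (u i) ⊆ Icc i (r i) := fun i hi k hk =>
    hch.supp_x i hi fun h0 => hk (by simp [u, h0])
  have hvs : ∀ i ∈ D, Function.support (v i) ⊆ Icc (s i) (h i) := fun i hi k hk =>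
    hch.supp_y i hi fun h0 => hk (by simp [v, h0])
  have hv' : ∀ i ∈ D, X.NE κ (v i) ≤ ENNReal.ofReal (c i) := fun i hi =>
    (hv i hi).trans (ENNReal.ofReal_le_ofReal (by have := hc i hi; linarith))
  obtain ⟨C, S, hS, hS', hST⟩ := M.exists_sequence_operator hX hCal
    (cls_glue_mem M hX hch hc hsum hup
      (fun i hi => (hus i hi).trans (Icc_subset_Icc_right (hch.r_le i hi))) fun i hi => (hu i hi).le)
    (cls_glue_mem M hX hch hc hsum hup
      (fun i hi => (hvs i hi).trans (Icc_subset_Icc_left (hch.le_s i hi))) hv')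
    fun t ht => kFunctional_glue_le M hX hch hc (fun i hi F hF => (hsum i hi F hF).trans
      (div_le_self (hc i hi).le (by have := hΛ i hi; exact_mod_cast (by omega : 1 ≤ Λ i))))
      hus hvs hu hv ht
  refine ⟨18 * C, fun i => (Icc (s i) (h i)).indicator fun k => y i k - 6 * S (x i) k,
    fun i _ => support_indicator_subset, fun i hi =>
      hch.NE_remainder_le M hX hΛ hc hsum hup hα hxα hS hS' hST hi, fun F hF => ?_⟩
  have e : (fun k => ∑ i ∈ F, y i k) = fun k =>
      6 * ∑ i ∈ F, (Icc (s i) (h i)).indicator (S (x i)) k +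
        ∑ i ∈ F, (Icc (s i) (h i)).indicator (fun k => y i k - 6 * S (x i) k) k := by
    funext k
    rw [Finset.mul_sum, ← Finset.sum_add_distrib]
    refine Finset.sum_congr rfl fun i hi => ?_
    by_cases hk : k ∈ Icc (s i) (h i)
    · simp only [indicator_of_mem hk]; ring
    · simp only [indicator_of_notMem hk]
      by_contra h0
      exact hk (hch.supp_y i (hF hi) fun h1 => h0 (by rw [h1]; ring))
  rw [e]
  refine (DyadicModel.NE_add_le _ _).trans (add_le_add_left ?_ _)
  rw [M.NE_const_mul]
  calc _ ≤ ENNReal.ofReal |6| * (C * X.NE κ (fun k => ∑ i ∈ F, x i k)) := by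
        gcongr
        exact hch.NE_diag_le M hS hF
    _ ≤ _ := by
        rw [← mul_assoc]
        gcongr
        rw [abs_of_pos (by norm_num), ENNReal.ofReal_ofNat]
        push_cast
        gcongr
        norm_num

end ChainBound

/-! ### Gluing chains -/

section Gliding

variable {Ω : Type*} [MeasurableSpace Ω] {μ : Measure Ω} {X : KotheSpace μ} {κ : Ω → ℤ}
  {J : Set ℤ}

theorem IsChain.replace {Λ : ℤ → ℕ} {D E : Set ℤ} {x y z : ℤ → ℤ → ℝ} {r s h : ℤ → ℤ}
    (hch : IsChain X κ J Λ D x y r s h) (hE : E ⊆ D)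
    (hz : ∀ i ∈ E, Function.support (z i) ⊆ Icc (s i) (h i) ∧ X.NE κ (z i) ≤ X.NE κ (x i)) :
    IsChain X κ J Λ E x z r s h where
  mem i hi := hch.mem i (hE hi)
  h_mem i hi := hch.h_mem i (hE hi)
  le_s i hi := hch.le_s i (hE hi)
  s_le i hi := hch.s_le i (hE hi)
  le_r i hi := hch.le_r i (hE hi)
  r_le i hi := hch.r_le i (hE hi)
  T_le i hi := hch.T_le i (hE hi)
  supp_x i hi := hch.supp_x i (hE hi)
  supp_y i hi := (hz i hi).1
  NE_le i hi := (hz i hi).2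
  NE_ne i hi := hch.NE_ne i (hE hi)
  lt i hi j hj := hch.lt i (hE hi) j (hE hj)
  sep i hi j hj := hch.sep i (hE hi) j (hE hj)

theorem IsChain.NE_sum_mono {Λ : ℤ → ℕ} {D : Set ℤ} {x y : ℤ → ℤ → ℝ} {r s h : ℤ → ℤ}
    (hch : IsChain X κ J Λ D x y r s h) (M : DyadicModel μ κ J) {E F : Finset ℤ} (hEF : E ⊆ F)
    (hF : (F : Set ℤ) ⊆ D) :
    X.NE κ (fun k => ∑ i ∈ E, x i k) ≤ X.NE κ (fun k => ∑ i ∈ F, x i k) := by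
  classical
  refine M.NE_mono fun k _ => ?_
  have e : ∑ i ∈ E, x i k = ∑ i ∈ F, if i ∈ E then x i k else 0 := by
    rw [← Finset.sum_filter, Finset.filter_mem_eq_inter, Finset.inter_eq_right.2 hEF]
  rw [e]
  refine abs_sum_le_of_disjoint (fun m hm n hn hmn => ?_) fun n _ => ?_
  · by_contra! hc
    have h1 := hch.supp_x m (hF hm) hc.1
    have h2 := hch.supp_x n (hF hn) hc.2
    have h3 := hch.r_le m (hF hm)
    have h4 := hch.r_le n (hF hn)
    have := h1.1; have := h1.2; have := h2.1; have := h2.2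
    rcases lt_or_gt_of_ne hmn with h' | h'
    · have := hch.lt m (hF hm) n (hF hn) h'; omega
    · have := hch.lt n (hF hn) m (hF hm) h'; omega
  · split_ifs
    · exact le_rfl
    · simp

/-- A finite chain outside of the window `[-m, m]`, on which the right-shift property fails for the
constant `k`, and for which `y` is close to optimal. -/
structure IsBadChain (X : KotheSpace μ) (κ : Ω → ℤ) (J : Set ℤ) (k m : ℕ) (D : Finset ℤ)
    (x y : ℤ → ℤ → ℝ) (r s h : ℤ → ℤ) : Prop where
  chain : IsChain X κ J (fun _ => k + 2) (D : Set ℤ) x y r s h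
  far : ∀ i ∈ D, ((m : ℤ) < i ∧ ((k + 2 : ℕ) : ℝ≥0∞) ^ 4 * X.T κ m ≤ X.T κ i) ∨
    (h i < -(m : ℤ) ∧ ((k + 2 : ℕ) : ℝ≥0∞) ^ 4 * X.T κ (h i) ≤ X.T κ (-m))
  lt : k * X.NE κ (fun l => ∑ i ∈ D, x i l) < X.NE κ (fun l => ∑ i ∈ D, y i l)
  extremal : ∀ z : ℤ → ℤ → ℝ, (∀ i ∈ D, Function.support (z i) ⊆ Icc (s i) (h i) ∧
    X.NE κ (z i) ≤ X.NE κ (x i)) →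
    X.NE κ (fun l => ∑ i ∈ D, z i l) ≤ 2 * X.NE κ (fun l => ∑ i ∈ D, y i l)

/-- An index is kept if another interval of the chain lies between it and the window, for then the
separation of the chain yields the required gap. At most one index on each side is lost, besides
those whose interval meets the window, so at most `2 m + 3` are discarded, and each of these `y i`
costs at most the norm of the sum of all `x i`. -/
theorem IsChain.exists_far {Λ : ℕ} {D : Finset ℤ} {x y : ℤ → ℤ → ℝ} {r s h : ℤ → ℤ}
    (hch : IsChain X κ J (fun _ => Λ) (D : Set ℤ) x y r s h) (M : DyadicModel μ κ J) (m : ℕ) :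
    ∃ E ⊆ D, (∀ i ∈ E, ((m : ℤ) < i ∧ (Λ : ℝ≥0∞) ^ 4 * X.T κ m ≤ X.T κ i) ∨
      (h i < -(m : ℤ) ∧ (Λ : ℝ≥0∞) ^ 4 * X.T κ (h i) ≤ X.T κ (-m))) ∧
      X.NE κ (fun l => ∑ i ∈ D, y i l) ≤ X.NE κ (fun l => ∑ i ∈ E, y i l) +
        (2 * m + 3 : ℕ) * X.NE κ (fun l => ∑ i ∈ D, x i l) := by
  classical
  set E := D.filter fun i => (∃ j ∈ D, j < i ∧ (m : ℤ) < j) ∨ ∃ j ∈ D, i < j ∧ h j < -(m : ℤ)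
    with hE
  have hΛ4 : (Λ : ℝ≥0∞) ^ 4 = (Λ : ℝ≥0∞) ^ 2 * (Λ : ℝ≥0∞) ^ 2 := by ring
  refine ⟨E, Finset.filter_subset _ _, fun i hi => ?_, ?_⟩
  · obtain ⟨hiD, ⟨j, hj, hji, hmj⟩ | ⟨j, hj, hij, hjm⟩⟩ := Finset.mem_filter.1 hi
    · refine Or.inl ⟨hmj.trans hji, le_trans ?_ (hch.sep j hj i hiD hji)⟩
      rw [hΛ4]
      gcongr
      exact M.T_mono (hmj.le.trans (hch.le_h (Finset.mem_coe.2 hj)))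
    · have h1 := hch.le_h (Finset.mem_coe.2 hj)
      refine Or.inr ⟨by have := hch.lt i hiD j hj hij; omega, ?_⟩
      rw [hΛ4]
      exact (hch.sep i hiD j hj hij).trans (M.T_mono (by omega))
  · have hcard : (D \ E).card ≤ 2 * m + 3 := by
      let φ : ℤ → ℤ := fun i => if h i < -m then -m - 1 else if (m : ℤ) < i then m + 1 else max i (-m)
      have hinj : ∀ i ∈ D \ E, ∀ j ∈ D \ E, i < j → φ i ≠ φ j := by
        intro i hi j hj hij
        obtain ⟨hiD, hiE⟩ := Finset.mem_sdiff.1 hi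
        obtain ⟨hjD, hjE⟩ := Finset.mem_sdiff.1 hj
        have h1 : ¬ (m : ℤ) < i := fun h => hjE (Finset.mem_filter.2 ⟨hjD, Or.inl ⟨i, hiD, hij, h⟩⟩)
        have h2 : ¬ h j < -(m : ℤ) := fun h =>
          hiE (Finset.mem_filter.2 ⟨hiD, Or.inr ⟨j, hjD, hij, h⟩⟩)
        have h3 := hch.lt i hiD j hjD hij
        have h4 := hch.le_h (Finset.mem_coe.2 hiD)
        simp only [φ, if_neg h1, if_neg h2]
        split_ifs <;> omega
      calc (D \ E).card ≤ (Finset.Icc (-m - 1 : ℤ) (m + 1)).card := by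
            refine Finset.card_le_card_of_injOn φ (fun i _ => ?_) fun i hi j hj hij => ?_
            · simp only [φ, Finset.coe_Icc, mem_Icc]
              split_ifs <;> omega
            · by_contra hne
              rcases lt_or_gt_of_ne hne with h' | h'
              · exact hinj i hi j hj h' hij
              · exact hinj j hj i hi h' hij.symm
        _ = 2 * m + 3 := by rw [Int.card_Icc]; omega
    have e : (fun l => ∑ i ∈ D, y i l) = fun l => ∑ i ∈ E, y i l + ∑ i ∈ D \ E, y i l := by
      funext l
      rw [add_comm, Finset.sum_sdiff (Finset.filter_subset _ _)]
    rw [e]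
    refine (DyadicModel.NE_add_le _ _).trans (add_le_add_right ?_ _)
    calc X.NE κ (fun l => ∑ i ∈ D \ E, y i l) ≤ ∑ i ∈ D \ E, X.NE κ (y i) :=
          DyadicModel.NE_sum_le _ _
      _ ≤ ∑ i ∈ D \ E, X.NE κ (fun l => ∑ i ∈ D, x i l) := by
          refine Finset.sum_le_sum fun i hi => ?_
          have hiD := (Finset.mem_sdiff.1 hi).1
          refine (hch.NE_le i hiD).trans ?_
          have := hch.NE_sum_mono M (Finset.singleton_subset_iff.2 hiD) subset_rfl
          simpa using this
      _ ≤ _ := by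
          rw [Finset.sum_const, nsmul_eq_mul]
          gcongr

/-- Take a chain on which the constant `2 k + (2 m + 3)` fails. The summand `2 m + 3` pays for the
indices near the window, and the factor 2 in `2 k` for replacing `y` by a choice that is optimal up
to a factor 2. The supremum is finite because the chain is. -/
theorem DyadicModel.exists_isBadChain (M : DyadicModel μ κ J) (hX : X.IsRearrangementInvariant)
    (hno : ¬ ∃ C : ℝ≥0, RightShift X κ C) (k m : ℕ) :
    ∃ D x y r s h, IsBadChain X κ J k m D x y r s h := by
  obtain ⟨D, x, y, r, s, h, hch, hlt⟩ : ∃ (D : Finset ℤ) (x y : ℤ → ℤ → ℝ) (r s h : ℤ → ℤ),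
      IsChain X κ J (fun _ => k + 2) (D : Set ℤ) x y r s h ∧
      ((2 * k + (2 * m + 3) : ℕ) : ℝ≥0∞) * X.NE κ (fun l => ∑ i ∈ D, x i l) <
        X.NE κ (fun l => ∑ i ∈ D, y i l) := by
    by_contra! hcon
    exact hno (M.rightShift_of_chain hX hcon)
  obtain ⟨E, hED, hfar, hle⟩ := hch.exists_far M m
  have hsupp : ∀ (z : ℤ → ℤ → ℝ) (F : Finset ℤ), (∀ i ∈ F, X.NE κ (z i) < ∞) →
      X.NE κ (fun l => ∑ i ∈ F, z i l) < ∞ := fun z F hz =>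
    (DyadicModel.NE_sum_le _ _).trans_lt (ENNReal.sum_lt_top.2 hz)
  have hxfin : ∀ i ∈ D, X.NE κ (x i) < ∞ := fun i hi =>
    M.NE_lt_top ((Set.finite_Icc _ _).subset (hch.supp_x i hi))
  have hxD := hsupp x D hxfin
  have hltE : ((2 * k : ℕ) : ℝ≥0∞) * X.NE κ (fun l => ∑ i ∈ E, x i l) <
      X.NE κ (fun l => ∑ i ∈ E, y i l) := by
    have h1 := hlt.trans_le hle
    rw [Nat.cast_add, add_mul] at h1
    refine lt_of_le_of_lt ?_ (lt_of_add_lt_add_right h1)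
    gcongr
    exact hch.NE_sum_mono M hED subset_rfl
  let A : Set (ℤ → ℤ → ℝ) := {z | ∀ i ∈ E, Function.support (z i) ⊆ Icc (s i) (h i) ∧
    X.NE κ (z i) ≤ X.NE κ (x i)}
  set S : ℝ≥0∞ := ⨆ z ∈ A, X.NE κ (fun l => ∑ i ∈ E, z i l) with hS
  have hSA : ∀ z ∈ A, X.NE κ (fun l => ∑ i ∈ E, z i l) ≤ S := fun z hz =>
    le_iSup₂ (f := fun z (_ : z ∈ A) => X.NE κ (fun l => ∑ i ∈ E, z i l)) z hz
  have hy : y ∈ A := fun i hi => ⟨hch.supp_y i (hED hi), hch.NE_le i (hED hi)⟩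
  have hSfin : S ≠ ∞ := by
    refine ne_top_of_le_ne_top (ENNReal.sum_lt_top.2 fun i hi => hxfin i (hED hi)).ne
      (iSup₂_le fun z hz => (DyadicModel.NE_sum_le _ _).trans
        (Finset.sum_le_sum fun i hi => (hz i hi).2))
  have hSpos : S ≠ 0 := ((zero_le.trans_lt hltE).trans_le (hSA y hy)).ne'
  obtain ⟨z, hz, hSz⟩ : ∃ z ∈ A, S / 2 < X.NE κ (fun l => ∑ i ∈ E, z i l) :=
    lt_biSup_iff.1 (ENNReal.half_lt_self hSpos hSfin)
  have hSz' : S < 2 * X.NE κ (fun l => ∑ i ∈ E, z i l) := by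
    rw [ENNReal.div_lt_iff (by simp) (by simp)] at hSz
    rwa [mul_comm]
  refine ⟨E, x, z, r, s, h, hch.replace (Finset.coe_subset.2 hED) hz, hfar, ?_,
    fun z' hz' => (hSA z' hz').trans hSz'.le⟩
  have h1 := (hltE.trans_le (hSA y hy)).trans hSz'
  rw [Nat.cast_mul, mul_assoc] at h1
  exact lt_of_mul_lt_mul_left' (by exact_mod_cast h1)

/-- The right-shift property is necessary for `(X, L_∞)` to be a Calderón couple. -/
theorem DyadicModel.rightShift_of_isCalderonCouple [SigmaFinite μ] (M : DyadicModel μ κ J)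
    (hX : X.IsRearrangementInvariant) (hCal : IsCalderonCouple X (linfty μ)) :
    ∃ C : ℝ≥0, RightShift X κ C := by
  classical
  by_contra hno
  choose D x y r s h hbad using M.exists_isBadChain hX hno
  have hbd : ∀ k m, ∃ b : ℕ, ∀ i ∈ D k m, -(b : ℤ) ≤ i ∧ h k m i ≤ b := fun k m => by
    refine ⟨∑ i ∈ D k m, (i.natAbs + (h k m i).natAbs), fun i hi => ?_⟩
    have : i.natAbs + (h k m i).natAbs ≤ ∑ i ∈ D k m, (i.natAbs + (h k m i).natAbs) :=
      Finset.single_le_sum (f := fun i => i.natAbs + (h k m i).natAbs)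
        (fun _ _ => Nat.zero_le _) hi
    omega
  choose b hb using hbd
  -- The window `[-w k, w k]` contains the intervals of the chains chosen before step `k`, so the
  -- `k`-th chain lies outside all of them.
  obtain ⟨w, hw⟩ : ∃ w : ℕ → ℕ, ∀ k, w (k + 1) = max (w k) (b k (w k)) :=
    ⟨fun n => Nat.rec 0 (fun k m => max m (b k m)) n, fun _ => rfl⟩
  have hwmono : Monotone w := monotone_nat_of_le_succ fun k => by rw [hw]; exact le_max_left _ _
  have hin : ∀ k l, k < l → ∀ i ∈ D k (w k), -(w l : ℤ) ≤ i ∧ h k (w k) i ≤ (w l : ℤ) := by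
    intro k l hkl i hi
    have h1 := hb k (w k) i hi
    have h2 : b k (w k) ≤ w l := (le_max_right _ _).trans ((hw k).ge.trans (hwmono hkl))
    have h3 : (b k (w k) : ℤ) ≤ w l := by exact_mod_cast h2
    omega
  have hle : ∀ k, ∀ i ∈ D k (w k), i ≤ h k (w k) i := fun k i hi =>
    (hbad k (w k)).chain.le_h (Finset.mem_coe.2 hi)
  have huniq : ∀ k l i, k < l → i ∈ D k (w k) → i ∉ D l (w l) := by
    intro k l i hkl hik hil
    have h1 := hin k l hkl i hik
    have h2 := hle k i hik
    have h3 := hle l i hil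
    rcases (hbad l (w l)).far i hil with h4 | h4
    · have := h4.1; omega
    · have := h4.1; omega
  have hidx : ∀ i, ∃ k, (∃ l, i ∈ D l (w l)) → i ∈ D k (w k) := fun i => by
    by_cases H : ∃ l, i ∈ D l (w l)
    · exact ⟨H.choose, fun _ => H.choose_spec⟩
    · exact ⟨0, fun h => absurd h H⟩
  choose q hq using hidx
  have hqeq : ∀ k, ∀ i ∈ D k (w k), q i = k := fun k i hi => by
    have h1 := hq i ⟨k, hi⟩
    rcases lt_trichotomy (q i) k with h' | h' | h'
    · exact absurd hi (huniq _ _ i h' h1)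
    · exact h'
    · exact absurd h1 (huniq _ _ i h' hi)
  set U : Set ℤ := {i | ∃ l, i ∈ D l (w l)}
  have hU : ∀ i ∈ U, i ∈ D (q i) (w (q i)) := fun i hi => hq i hi
  have hchain : ∀ i, IsChain X κ J (fun _ => q i + 2) (D (q i) (w (q i)) : Set ℤ)
    (x (q i) (w (q i))) (y (q i) (w (q i))) (r (q i) (w (q i))) (s (q i) (w (q i)))
    (h (q i) (w (q i))) := fun i => (hbad _ _).chain
  have hpair : ∀ i ∈ U, ∀ j ∈ U, i < j → h (q i) (w (q i)) i < j ∧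
      ((q i + 2 : ℕ) : ℝ≥0∞) ^ 2 * ((q j + 2 : ℕ) : ℝ≥0∞) ^ 2 * X.T κ (h (q i) (w (q i)) i) ≤
        X.T κ j := by
    intro i hi j hj hij
    have hiD := hU i hi
    have hjD := hU j hj
    rcases lt_trichotomy (q i) (q j) with h' | h' | h'
    · have h1 := hin _ _ h' i hiD
      have h2 := hle _ i hiD
      have h3 := hle _ j hjD
      rcases (hbad _ _).far j hjD with h4 | h4
      · refine ⟨by have := h4.1; omega, le_trans ?_ h4.2⟩
        have e : ((q j + 2 : ℕ) : ℝ≥0∞) ^ 4 =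
          ((q j + 2 : ℕ) : ℝ≥0∞) ^ 2 * ((q j + 2 : ℕ) : ℝ≥0∞) ^ 2 := by ring
        rw [e]
        gcongr
        exact M.T_mono h1.2
      · have := h4.1; omega
    · have hiD' : i ∈ D (q j) (w (q j)) := h' ▸ hiD
      have h1 := (hchain j).lt i hiD' j hjD hij
      have h2 := (hchain j).sep i hiD' j hjD hij
      rw [h']
      exact ⟨h1, h2⟩
    · have h1 := hin _ _ h' j hjD
      have h2 := hle _ i hiD
      have h3 := hle _ j hjD
      rcases (hbad _ _).far i hiD with h4 | h4
      · have := h4.1; omega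
      · refine ⟨by have := h4.1; omega, le_trans ?_ (h4.2.trans (M.T_mono h1.1))⟩
        have e : ((q i + 2 : ℕ) : ℝ≥0∞) ^ 4 =
          ((q i + 2 : ℕ) : ℝ≥0∞) ^ 2 * ((q i + 2 : ℕ) : ℝ≥0∞) ^ 2 := by ring
        rw [e]
        gcongr
  -- The union is one chain with variable gaps, `q i` being the number of the finite chain that
  -- contains `i`. This is why the gap function of `IsChain` depends on the index.
  have hall : IsChain X κ J (fun i => q i + 2) U (fun i => x (q i) (w (q i)) i)
      (fun i => y (q i) (w (q i)) i) (fun i => r (q i) (w (q i)) i)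
      (fun i => s (q i) (w (q i)) i) (fun i => h (q i) (w (q i)) i) :=
    { mem := fun i hi => (hchain i).mem i (hU i hi)
      h_mem := fun i hi => (hchain i).h_mem i (hU i hi)
      le_s := fun i hi => (hchain i).le_s i (hU i hi)
      s_le := fun i hi => (hchain i).s_le i (hU i hi)
      le_r := fun i hi => (hchain i).le_r i (hU i hi)
      r_le := fun i hi => (hchain i).r_le i (hU i hi)
      T_le := fun i hi => (hchain i).T_le i (hU i hi)
      supp_x := fun i hi => (hchain i).supp_x i (hU i hi)
      supp_y := fun i hi => (hchain i).supp_y i (hU i hi)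
      NE_le := fun i hi => (hchain i).NE_le i (hU i hi)
      NE_ne := fun i hi => (hchain i).NE_ne i (hU i hi)
      lt := fun i hi j hj hij => (hpair i hi j hj hij).1
      sep := fun i hi j hj hij => (hpair i hi j hj hij).2 }
  obtain ⟨C, ρ, hρ1, hρ2, hρ3⟩ := hall.exists_remainder M hX hCal fun i _ => by omega
  obtain ⟨k, hk⟩ := exists_nat_ge (4 * C)
  have hkC : (4 : ℝ≥0∞) * C ≤ k := by exact_mod_cast hk
  have hDU : ((D k (w k) : Finset ℤ) : Set ℤ) ⊆ U := fun i hi => ⟨k, hi⟩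
  have hB := hbad k (w k)
  have hsum := hρ3 _ hDU
  have ex : ∀ l, ∑ i ∈ D k (w k), x (q i) (w (q i)) i l = ∑ i ∈ D k (w k), x k (w k) i l :=
    fun l => Finset.sum_congr rfl fun i hi => by rw [hqeq k i hi]
  have ey : ∀ l, ∑ i ∈ D k (w k), y (q i) (w (q i)) i l = ∑ i ∈ D k (w k), y k (w k) i l :=
    fun l => Finset.sum_congr rfl fun i hi => by rw [hqeq k i hi]
  simp only [ex, ey] at hsum
  set NX := X.NE κ (fun l => ∑ i ∈ D k (w k), x k (w k) i l) with hNX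
  set NY := X.NE κ (fun l => ∑ i ∈ D k (w k), y k (w k) i l) with hNY
  have hxfin : ∀ i ∈ D k (w k), X.NE κ (x k (w k) i) < ∞ := fun i hi =>
    M.NE_lt_top ((Set.finite_Icc _ _).subset (hB.chain.supp_x i hi))
  have hNYfin : NY ≠ ∞ := ((DyadicModel.NE_sum_le _ _).trans_lt (ENNReal.sum_lt_top.2 fun i hi =>
    (hB.chain.NE_le i hi).trans_lt (hxfin i hi))).ne
  -- Since `k ≥ 4 C`, the vectors `4 ρ i` have norm at most that of `x i` and compete with the `y
  -- i`.
  have hext := hB.extremal (fun i l => 4 * ρ i l) fun i hi => by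
    have hqi := hqeq k i hi
    have h1 := hρ1 i (hDU hi)
    have h2 := hρ2 i (hDU hi)
    simp only [hqi] at h1 h2
    refine ⟨fun l hl => h1 fun h0 => hl (by simp [h0]), ?_⟩
    rw [M.NE_const_mul, abs_of_pos (by norm_num), ENNReal.ofReal_ofNat]
    have hk0 : ((k + 2 : ℕ) : ℝ≥0∞) ≠ 0 := by simp
    have hk1 : ((k + 2 : ℕ) : ℝ≥0∞) ≠ ∞ := by simp
    rw [← ENNReal.mul_le_mul_iff_right hk0 hk1]
    calc ((k + 2 : ℕ) : ℝ≥0∞) * (4 * X.NE κ (ρ i)) = 4 * (((k + 2 : ℕ) : ℝ≥0∞) * X.NE κ (ρ i)) := by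
          ring
      _ ≤ 4 * (C * X.NE κ (x k (w k) i)) := by gcongr
      _ = 4 * C * X.NE κ (x k (w k) i) := by ring
      _ ≤ _ := by
          gcongr
          exact hkC.trans (by push_cast; exact le_self_add)
  have hρsum : 4 * X.NE κ (fun l => ∑ i ∈ D k (w k), ρ i l) ≤ 2 * NY := by
    have e : (fun l => ∑ i ∈ D k (w k), 4 * ρ i l) = fun l => 4 * ∑ i ∈ D k (w k), ρ i l :=
      funext fun l => (Finset.mul_sum _ _ _).symm
    rw [e, M.NE_const_mul, abs_of_pos (by norm_num), ENNReal.ofReal_ofNat] at hext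
    exact hext
  -- The remainder is at most half of `NY`, which is finite and can be subtracted.
  have hfinal : 2 * NY ≤ 4 * C * NX := by
    have h1 : 4 * NY ≤ 4 * C * NX + 2 * NY := by
      calc 4 * NY ≤ 4 * (C * NX + X.NE κ (fun l => ∑ i ∈ D k (w k), ρ i l)) := by gcongr
        _ = 4 * C * NX + 4 * X.NE κ (fun l => ∑ i ∈ D k (w k), ρ i l) := by ring
        _ ≤ _ := by gcongr
    have h2 : (2 * NY : ℝ≥0∞) ≠ ∞ := ENNReal.mul_ne_top (by simp) hNYfin
    refine (ENNReal.add_le_add_iff_right h2).1 ?_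
    calc 2 * NY + 2 * NY = 4 * NY := by ring
      _ ≤ _ := h1
  have := hB.lt
  refine absurd hfinal (not_le.2 ?_)
  calc 4 * C * NX ≤ k * NX := by gcongr
    _ < NY := hB.lt
    _ ≤ 2 * NY := le_mul_of_one_le_left' one_le_two

end Gliding

/-! ### Lebesgue measure -/

section Lebesgue

theorem ofReal_two_zpow (k : ℤ) : ENNReal.ofReal ((2 : ℝ) ^ k) = 2 ^ k := by
  cases k with
  | ofNat n => simp [ENNReal.ofReal_pow]
  | negSucc n =>
    rw [zpow_negSucc, zpow_negSucc, ENNReal.ofReal_inv_of_pos (by positivity),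
      ENNReal.ofReal_pow (by norm_num), ENNReal.ofReal_ofNat]

theorem log_two_eq_iff {x : ℝ} (hx : 0 < x) {k : ℤ} :
    Int.log 2 x = k ↔ x ∈ Ico ((2 : ℝ) ^ k) (2 ^ (k + 1)) := by
  have h1 := Int.zpow_le_iff_le_log one_lt_two (x := k) hx
  have h2 := Int.lt_zpow_iff_log_lt one_lt_two (x := k + 1) hx
  push_cast at h1 h2
  rw [mem_Ico, h1, h2]
  omega

theorem measurable_log_two : Measurable fun x : ℝ => Int.log 2 x := by
  refine measurable_to_countable' fun k => ?_
  have e : (fun x : ℝ => Int.log 2 x) ⁻¹' {k} =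
      Ico ((2 : ℝ) ^ k) (2 ^ (k + 1)) ∪ (Iic 0 ∩ {_x | k = 0}) := by
    ext x
    rcases lt_or_ge 0 x with hx | hx
    · simp only [mem_preimage, mem_singleton_iff, log_two_eq_iff hx, mem_union, mem_inter_iff,
        mem_Iic, not_le.2 hx, false_and, or_false]
    · have : ¬ x ∈ Ico ((2 : ℝ) ^ k) (2 ^ (k + 1)) := fun h =>
        not_lt.2 hx ((by positivity : (0 : ℝ) < 2 ^ k).trans_le h.1)
      simp only [mem_preimage, mem_singleton_iff, Int.log_of_right_le_zero 2 hx, mem_union, this,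
        false_or, mem_inter_iff, mem_Iic, hx, true_and, mem_ofPred_eq]
      exact eq_comm
  rw [e]
  exact measurableSet_Ico.union (measurableSet_Iic.inter (MeasurableSet.const _))

variable {S : Set ℝ}

/-- The measure of `A ∪ (B ∩ Iic t)` is a Lipschitz function of `t` that starts at `μ A`, because
`S` has no negative points; the intermediate value theorem applies. -/
theorem exists_measure_restrict_eq (h0 : S ⊆ Ici 0) {A B : Set ℝ}
    (hA : MeasurableSet A) (hB : MeasurableSet B) (hAB : A ⊆ B) {v : ℝ≥0∞}
    (hv : volume.restrict S A ≤ v) (hvB : v ≤ volume.restrict S B) (hfin : v < ∞) :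
    ∃ C, MeasurableSet C ∧ A ⊆ C ∧ C ⊆ B ∧ volume.restrict S C = v := by
  set μ : Measure ℝ := volume.restrict S with hμ
  rcases hvB.eq_or_lt with h | h
  · exact ⟨B, hB, hAB, Subset.rfl, h.symm⟩
  set C : ℝ → Set ℝ := fun t => A ∪ (B ∩ Iic t) with hC
  have hCm : ∀ t, MeasurableSet (C t) := fun t => hA.union (hB.inter measurableSet_Iic)
  have hmono : Monotone C := fun s t hst =>
    union_subset_union_right _ (inter_subset_inter_right _ (Iic_subset_Iic.2 hst))
  have hstep : ∀ s t, s ≤ t → μ (C t) ≤ μ (C s) + ENNReal.ofReal (t - s) := fun s t hst => by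
    calc μ (C t) ≤ μ (C s ∪ Ioc s t) := by
          refine measure_mono ?_
          rintro x (hx | ⟨hx, hxt⟩)
          · exact Or.inl (Or.inl hx)
          · rcases le_or_gt x s with h' | h'
            · exact Or.inl (Or.inr ⟨hx, h'⟩)
            · exact Or.inr ⟨h', hxt⟩
      _ ≤ μ (C s) + μ (Ioc s t) := measure_union_le _ _
      _ ≤ _ := by
          gcongr
          exact (Measure.restrict_apply_le _ _).trans (by rw [Real.volume_Ioc])
  have hneg : μ (C (-1)) = μ A := by
    refine le_antisymm ?_ (measure_mono subset_union_left)
    refine (measure_union_le _ _).trans ?_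
    have : μ (B ∩ Iic (-1)) = 0 := by
      rw [hμ, Measure.restrict_apply (hB.inter measurableSet_Iic)]
      convert measure_empty (μ := (volume : Measure ℝ)) using 2
      refine eq_empty_of_forall_notMem fun x hx => ?_
      have h1 : (0 : ℝ) ≤ x := h0 hx.2
      have h2 : x ≤ -1 := hx.1.2
      linarith
    rw [this, add_zero]
  have hAfin : μ A < ∞ := hv.trans_lt hfin
  have hCfin : ∀ t, μ (C t) ≠ ∞ := fun t => by
    rcases le_total (-1) t with ht | ht
    · refine ((hstep _ _ ht).trans_lt ?_).ne
      rw [hneg]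
      exact ENNReal.add_lt_top.2 ⟨hAfin, ENNReal.ofReal_lt_top⟩
    · exact ((measure_mono (hmono ht)).trans_lt (hneg.trans_lt hAfin)).ne
  have hlip : LipschitzWith 1 fun t => (μ (C t)).toReal := by
    refine LipschitzWith.of_le_add fun t s => ?_
    rcases le_total s t with hst | hst
    · have := ENNReal.toReal_mono (ENNReal.add_ne_top.2 ⟨hCfin s, ENNReal.ofReal_ne_top⟩)
        (hstep s t hst)
      rw [ENNReal.toReal_add (hCfin s) ENNReal.ofReal_ne_top,
        ENNReal.toReal_ofReal (sub_nonneg.2 hst)] at this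
      rwa [Real.dist_eq, abs_of_nonneg (sub_nonneg.2 hst)]
    · exact (ENNReal.toReal_mono (hCfin s) (measure_mono (hmono hst))).trans
        (le_add_of_nonneg_right dist_nonneg)
  obtain ⟨t, ht, ht'⟩ : ∃ t, -1 ≤ t ∧ v < μ (C t) := by
    have hU : ⋃ t, C t = B := by
      refine subset_antisymm (iUnion_subset fun t => union_subset hAB inter_subset_left) ?_
      exact fun x hx => mem_iUnion.2 ⟨x, Or.inr ⟨hx, le_refl x⟩⟩
    have h1 := tendsto_measure_iUnion_atTop (μ := μ) hmono
    rw [hU] at h1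
    exact ((eventually_ge_atTop (-1)).and (h1.eventually (lt_mem_nhds h))).exists
  obtain ⟨p, -, hp⟩ := intermediate_value_Icc ht hlip.continuous.continuousOn
    (show v.toReal ∈ Icc _ _ from ⟨by
      rw [hneg]; exact ENNReal.toReal_mono hfin.ne hv, ENNReal.toReal_mono (hCfin t) ht'.le⟩)
  refine ⟨C p, hCm p, subset_union_left, union_subset hAB inter_subset_left, ?_⟩
  exact (ENNReal.toReal_eq_toReal_iff' (hCfin p) hfin.ne).1 hp

/-- A set of given measure where a function is largest. -/
theorem exists_top_slice (h0 : S ⊆ Ici 0) {G : Set ℝ}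
    (hG : MeasurableSet G) (hGfin : volume.restrict S G < ∞) {w : ℝ → ℝ} (hw : Measurable w)
    (hw0 : ∀ s, 0 ≤ w s) {L : ℝ} (hL : ∀ s ∈ G, w s ≤ L) {η : ℝ≥0∞}
    (hη : η ≤ volume.restrict S G) :
    ∃ (P : Set ℝ) (a : ℝ), MeasurableSet P ∧ P ⊆ G ∧ volume.restrict S P = η ∧ 0 ≤ a ∧
      (∀ s ∈ P, a ≤ w s) ∧ ∀ s ∈ G \ P, w s ≤ a := by
  set μ : Measure ℝ := volume.restrict S with hμ
  set R : Set ℝ := {t | 0 ≤ t ∧ μ (G ∩ {s | t < w s}) ≤ η} with hR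
  have hRne : R.Nonempty := by
    refine ⟨max L 0, le_max_right _ _, ?_⟩
    have : G ∩ {s | max L 0 < w s} = ∅ := eq_empty_of_forall_notMem fun s hs =>
      absurd hs.2 (not_lt.2 ((hL s hs.1).trans (le_max_left _ _)))
    rw [this]
    simp
  have hRbdd : BddBelow R := ⟨0, fun t ht => ht.1⟩
  -- The least height that is exceeded on a set of measure at most `η`; a set of measure exactly `η`
  -- then fits between `{w > a}` and `{w ≥ a}`.
  set a := sInf R with ha
  have ha0 : 0 ≤ a := le_csInf hRne fun t ht => ht.1
  have hm1 : ∀ t : ℝ, MeasurableSet (G ∩ {s | t < w s}) := fun t =>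
    hG.inter (measurableSet_lt measurable_const hw)
  have hpos : ∀ n : ℕ, (0 : ℝ) < 1 / ((n : ℝ) + 1) := fun n => by positivity
  have hlow : μ (G ∩ {s | a < w s}) ≤ η := by
    have hU : G ∩ {s | a < w s} = ⋃ n : ℕ, G ∩ {s | a + 1 / ((n : ℝ) + 1) < w s} := by
      ext s
      simp only [mem_inter_iff, mem_ofPred_eq, mem_iUnion, exists_and_left]
      refine and_congr_right fun _ => ⟨fun h => ?_, fun ⟨n, hn⟩ => ?_⟩
      · obtain ⟨n, hn⟩ := exists_nat_one_div_lt (sub_pos.2 h)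
        exact ⟨n, by linarith⟩
      · have := hpos n; linarith
    have hmono : Monotone fun n : ℕ => G ∩ {s | a + 1 / ((n : ℝ) + 1) < w s} := by
      intro m n hmn s hs
      have := Nat.one_div_le_one_div (α := ℝ) hmn
      have h2 : a + 1 / ((m : ℝ) + 1) < w s := hs.2
      exact ⟨hs.1, show a + 1 / ((n : ℝ) + 1) < w s by linarith⟩
    rw [hU, hmono.measure_iUnion]
    refine iSup_le fun n => ?_
    obtain ⟨t, ht, hta⟩ := exists_lt_of_csInf_lt hRne (lt_add_of_pos_right a (hpos n))
    refine (measure_mono ?_).trans ht.2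
    exact fun s hs => ⟨hs.1, hta.trans hs.2⟩
  have hup : η ≤ μ (G ∩ {s | a ≤ w s}) := by
    have hU : G ∩ {s | a ≤ w s} = ⋂ n : ℕ, G ∩ {s | a - 1 / ((n : ℝ) + 1) < w s} := by
      ext s
      simp only [mem_inter_iff, mem_ofPred_eq, mem_iInter]
      refine ⟨fun h n => ⟨h.1, by have := hpos n; linarith [h.2]⟩, fun h => ⟨(h 0).1, ?_⟩⟩
      by_contra! hc
      obtain ⟨n, hn⟩ := exists_nat_one_div_lt (sub_pos.2 hc)
      have := (h n).2
      linarith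
    have hanti : Antitone fun n : ℕ => G ∩ {s | a - 1 / ((n : ℝ) + 1) < w s} := by
      intro m n hmn s hs
      have := Nat.one_div_le_one_div (α := ℝ) hmn
      have h2 : a - 1 / ((n : ℝ) + 1) < w s := hs.2
      exact ⟨hs.1, show a - 1 / ((m : ℝ) + 1) < w s by linarith⟩
    rw [hU, hanti.measure_iInter (fun n => (hm1 _).nullMeasurableSet)
      ⟨0, ((measure_mono inter_subset_left).trans_lt hGfin).ne⟩]
    refine le_iInf fun n => ?_
    rcases lt_or_ge (a - 1 / ((n : ℝ) + 1)) 0 with hn | hn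
    · refine hη.trans (measure_mono fun s hs => ⟨hs, hn.trans_le (hw0 s)⟩)
    · by_contra! hc
      have := csInf_le hRbdd (show a - 1 / ((n : ℝ) + 1) ∈ R from ⟨hn, hc.le⟩)
      have := hpos n
      linarith
  obtain ⟨P, hP, h1, h2, h3⟩ := exists_measure_restrict_eq h0 (hm1 a)
    (hG.inter (measurableSet_le measurable_const hw))
    (fun s hs => ⟨hs.1, show a ≤ w s from le_of_lt hs.2⟩) hlow hup (hη.trans_lt hGfin)
  refine ⟨P, a, hP, fun s hs => (h2 hs).1, h3, ha0, fun s hs => (h2 hs).2, fun s hs => ?_⟩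
  by_contra! hc
  exact hs.2 (h1 ⟨hs.1, hc⟩)

/-- Slices are removed in decreasing order of `w`. The lower bound `c l` of one slice is an upper
bound on all that remains, so the differences of upper and lower sums telescope to `L η`; the last
slice gets the lower bound 0. -/
theorem exists_slices (h0 : S ⊆ Ici 0) {w : ℝ → ℝ} (hw : Measurable w)
    (hw0 : ∀ s, 0 ≤ w s) {η : ℝ≥0∞} (hηfin : η ≠ ∞) (n : ℕ) : ∀ (G : Set ℝ) (L : ℝ),
    MeasurableSet G → volume.restrict S G = (n + 1 : ℕ) * η → (∀ s ∈ G, w s ≤ L) →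
    ∃ (P : Fin (n + 1) → Set ℝ) (c : Fin (n + 1) → ℝ), (∀ l, MeasurableSet (P l)) ∧
      Pairwise (fun l l' => Disjoint (P l) (P l')) ∧ ⋃ l, P l = G ∧
      (∀ l, volume.restrict S (P l) = η) ∧ (∀ l, 0 ≤ c l) ∧ (∀ l, ∀ s ∈ P l, c l ≤ w s) ∧
      ∫ s in G, w s ∂(volume.restrict S) ≤ ∑ l, c l * η.toReal + L * η.toReal := by
  set μ : Measure ℝ := volume.restrict S with hμ
  have hint : ∀ {G : Set ℝ} {L : ℝ}, MeasurableSet G → μ G < ∞ → (∀ s ∈ G, w s ≤ L) →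
      IntegrableOn w G μ ∧ ∫ s in G, w s ∂μ ≤ L * (μ G).toReal := fun {G L} hG hfin hL => by
    have h1 : IntegrableOn w G μ := by
      refine Measure.integrableOn_of_bounded (M := L) hfin.ne hw.aestronglyMeasurable ?_
      filter_upwards [ae_restrict_mem hG] with s hs
      rw [Real.norm_of_nonneg (hw0 s)]
      exact hL s hs
    refine ⟨h1, (setIntegral_mono_on h1 (integrableOn_const hfin.ne) hG hL).trans (le_of_eq ?_)⟩
    rw [setIntegral_const, smul_eq_mul, mul_comm, Measure.real]
  induction n with
  | zero =>
    intro G L hG hμG hL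
    have hμG' : μ G = η := by simpa using hμG
    refine ⟨fun _ => G, fun _ => 0, fun _ => hG, fun l l' hl => absurd (Fin.ext (by omega)) hl,
      iUnion_const G, fun _ => hμG', fun _ => le_rfl, fun _ s _ => hw0 s, ?_⟩
    have := (hint hG (by rw [hμG']; exact hηfin.lt_top) hL).2
    rw [hμG'] at this
    simpa using this
  | succ n ih =>
    intro G L hG hμG hL
    have hGfin : μ G < ∞ := by
      rw [hμG]; exact ENNReal.mul_lt_top (ENNReal.natCast_lt_top _) hηfin.lt_top
    have hμG' : μ G = (n + 1 : ℕ) * η + η := by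
      rw [hμG]; push_cast; ring
    obtain ⟨P₀, a, hP, hPG, hμP, ha, haP, haG⟩ := exists_top_slice h0 hG hGfin hw hw0 hL
      (hμG'.ge.trans' le_add_self)
    have hμd : μ (G \ P₀) = (n + 1 : ℕ) * η := by
      rw [measure_sdiff hPG hP.nullMeasurableSet (by rw [hμP]; exact hηfin), hμP, hμG']
      exact ENNReal.add_sub_cancel_right hηfin
    obtain ⟨P, c, h1, h2, h3, h4, h5, h6, h7⟩ := ih (G \ P₀) a (hG.diff hP) hμd haG
    have hdis : ∀ l, Disjoint P₀ (P l) := fun l =>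
      disjoint_sdiff_right.mono_right (h3 ▸ subset_iUnion P l)
    refine ⟨Fin.cons P₀ P, Fin.cons a c, ?_, ?_, ?_, ?_, ?_, ?_, ?_⟩
    · exact Fin.cases (by simpa using hP) (by simpa using h1)
    · intro l l' hl
      induction l using Fin.cases with
      | zero =>
        induction l' using Fin.cases with
        | zero => exact absurd rfl hl
        | succ l' => simpa using hdis l'
      | succ l =>
        induction l' using Fin.cases with
        | zero => simpa using (hdis l).symm
        | succ l' => simpa using h2 (fun h => hl (by rw [h]))
    · ext s
      rw [mem_iUnion, Fin.exists_fin_succ]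
      simp only [Fin.cons_zero, Fin.cons_succ]
      rw [← mem_iUnion, h3]
      by_cases hs : s ∈ P₀
      · simp [hs, hPG hs]
      · simp [hs]
    · exact Fin.cases (by simpa using hμP) (by simpa using h4)
    · exact Fin.cases (by simpa using ha) (by simpa using h5)
    · exact Fin.cases (by simpa using haP) (by simpa using h6)
    · have i1 := hint hP (by rw [hμP]; exact hηfin.lt_top) fun s hs => hL s (hPG hs)
      have i2 := hint (hG.diff hP) ((measure_mono sdiff_subset).trans_lt hGfin) haG
      have e : ∫ s in G, w s ∂μ = ∫ s in P₀, w s ∂μ + ∫ s in G \ P₀, w s ∂μ := by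
        rw [← setIntegral_union disjoint_sdiff_right (hG.diff hP) i1.1 i2.1,
          union_sdiff_cancel hPG]
      rw [e, Fin.sum_univ_succ]
      simp only [Fin.cons_zero, Fin.cons_succ]
      have := i1.2
      rw [hμP] at this
      linarith

theorem ae_restrict_pos {S : Set ℝ} (hS : MeasurableSet S) (h0 : S ⊆ Ici 0) :
    ∀ᵐ x ∂(volume.restrict S : Measure ℝ), 0 < x := by
  filter_upwards [ae_restrict_mem hS, ae_restrict_of_ae (Measure.ae_ne volume 0)] with x hx hx0
  exact lt_of_le_of_ne (h0 hx) hx0.symm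

theorem dyadicModel_restrict (hS : MeasurableSet S) (h0 : S ⊆ Ici 0) {J : Set ℤ}
    (hJ : J.OrdConnected) (hneg : Iio 0 ⊆ J)
    (hblock : ∀ k ∈ J, Ico ((2 : ℝ) ^ k) (2 ^ (k + 1)) ⊆ S)
    (hnull : ∀ k ∉ J, volume (Ico ((2 : ℝ) ^ k) (2 ^ (k + 1)) ∩ S) = 0)
    (htwo : ∀ k ∈ J, (2 : ℝ≥0∞) ^ k ≤ volume S) :
    DyadicModel (volume.restrict S) (fun x : ℝ => Int.log 2 x) J := by
  have hpos := ae_restrict_pos hS h0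
  have hpre : ∀ k : ℤ, volume.restrict S ((fun x : ℝ => Int.log 2 x) ⁻¹' {k}) =
      volume (Ico ((2 : ℝ) ^ k) (2 ^ (k + 1)) ∩ S) := fun k => by
    rw [← Measure.restrict_apply measurableSet_Ico]
    refine measure_congr ?_
    filter_upwards [hpos] with x hx
    exact propext (log_two_eq_iff hx)
  refine ⟨measurable_log_two, hJ, ⟨-1, hneg (by simp)⟩, fun k hk => ?_, fun k hk => ?_,
    fun k hk => ?_, fun k hk => ?_, fun A hA h => ?_,
    fun A B F hA hB hF hAB h1 h2 h3 => exists_measure_restrict_eq h0 hA hB hAB h1 h2 h3,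
    fun G w L ε hG hGfin hw hw0 hL hε => ?_⟩
  · rw [hpre, inter_eq_left.2 (hblock k hk), Real.volume_Ico, ← ofReal_two_zpow]
    congr 1
    rw [zpow_add_one₀ two_ne_zero]
    ring
  · rw [hpre, hnull k hk]
  · calc volume.restrict S {s : ℝ | Int.log 2 s < k} ≤ volume.restrict S (Ioc 0 (2 ^ k)) := by
          refine measure_mono_ae ?_
          filter_upwards [hpos] with x hx hxk
          have := (Int.lt_zpow_iff_log_lt one_lt_two hx).2 hxk
          exact ⟨hx, by exact_mod_cast this.le⟩
      _ ≤ volume (Ioc (0 : ℝ) (2 ^ k)) := Measure.restrict_apply_le _ _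
      _ = _ := by rw [Real.volume_Ioc, sub_zero, ofReal_two_zpow]
  · rw [Measure.restrict_apply_univ]
    exact htwo k hk
  · by_contra hne
    obtain ⟨n, hn⟩ := ENNReal.exists_inv_two_pow_lt hne
    have h1 := h (-((n : ℤ) + 1)) (hneg (by simp; omega))
    have h2 : (2 : ℝ≥0∞) ^ (-((n : ℤ) + 1)) ≤ 2⁻¹ ^ n := by
      rw [← ofReal_two_zpow, zpow_neg, ENNReal.ofReal_inv_of_pos (by positivity), ← ENNReal.inv_pow,
        ENNReal.inv_le_inv, ofReal_two_zpow]
      have e : ((n : ℤ) + 1) = ((n + 1 : ℕ) : ℤ) := by push_cast; rfl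
      rw [e, zpow_natCast]
      exact pow_le_pow_right₀ one_le_two (Nat.le_succ n)
    exact absurd (h1.trans_le h2) (not_lt.2 hn.le)
  · set m := (volume.restrict S G).toReal with hm
    -- The error of the slices is `L m / (n + 1)`.
    obtain ⟨n, hn⟩ := exists_nat_ge (L * m / ε)
    set η : ℝ≥0∞ := volume.restrict S G / (n + 1 : ℕ) with hη
    have hn0 : ((n + 1 : ℕ) : ℝ≥0∞) ≠ 0 := by exact_mod_cast Nat.succ_ne_zero n
    have hηfin : η ≠ ∞ := ENNReal.div_ne_top hGfin.ne hn0
    obtain ⟨P, c, h1, h2, h3, h4, h5, h6, h7⟩ := exists_slices h0 hw hw0 hηfin n G L hG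
      (by rw [hη, ENNReal.mul_div_cancel hn0 (ENNReal.natCast_ne_top _)]) fun s _ => hL s
    refine ⟨n, P, c, h1, h2, h3, fun l l' => by rw [h4, h4], h5, h6, ?_⟩
    simp only [h4]
    refine h7.trans (add_le_add_right ?_ _)
    rw [hη, ENNReal.toReal_div, ENNReal.toReal_natCast, ← mul_div_assoc,
      div_le_iff₀ (by positivity)]
    rw [div_le_iff₀ hε] at hn
    push_cast
    nlinarith

theorem dyadicModel_unit :
    DyadicModel unitMeasure (fun x : ℝ => Int.log 2 x) (Iio 0) := by
  refine dyadicModel_restrict measurableSet_Icc (fun x hx => hx.1) ordConnected_Iio Subset.rfl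
    (fun k hk x hx => ⟨?_, ?_⟩) (fun k hk => ?_) fun k hk => ?_
  · exact (by positivity : (0 : ℝ) ≤ 2 ^ k).trans hx.1
  · refine hx.2.le.trans (zpow_le_one_of_nonpos₀ one_le_two ?_)
    have : k < 0 := hk
    omega
  -- Blocks with `k ≥ 0` meet `[0, 1]` at most in the point 1.
  · refine measure_mono_null (t := {1}) (fun x hx => ?_) Real.volume_singleton
    have h1 : (1 : ℝ) ≤ 2 ^ k := one_le_zpow₀ one_le_two (by simpa using hk)
    exact le_antisymm hx.2.2 (h1.trans hx.1.1)
  · rw [Real.volume_Icc, ← ofReal_two_zpow]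
    refine ENNReal.ofReal_le_ofReal ?_
    rw [sub_zero]
    exact zpow_le_one_of_nonpos₀ one_le_two (le_of_lt hk)

theorem dyadicModel_halfLine :
    DyadicModel halfLineMeasure (fun x : ℝ => Int.log 2 x) univ := by
  refine dyadicModel_restrict measurableSet_Ici Subset.rfl ordConnected_univ (subset_univ _)
    (fun k hk x hx => ?_) (fun k hk => absurd (mem_univ k) hk) fun k hk => ?_
  · exact (by positivity : (0 : ℝ) ≤ 2 ^ k).trans hx.1
  · rw [Real.volume_Ici]
    exact le_top

end Lebesgue

/-! ### Counting measure -/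

section Counting

theorem log_two_add_one (i : ℕ) : Int.log 2 ((i : ℝ) + 1) = (Nat.log 2 (i + 1) : ℤ) := by
  have := Int.log_natCast (R := ℝ) 2 (i + 1)
  push_cast at this
  exact this

theorem dyadicModel_seq :
    DyadicModel seqMeasure (fun i : ℕ => Int.log 2 ((i : ℝ) + 1)) (Ici 0) := by
  have hcount : ∀ A : Set ℕ, seqMeasure A = A.encard := fun A =>
    Measure.count_apply (MeasurableSet.of_discrete)
  have huniv : seqMeasure univ = ∞ := by
    rw [hcount, encard_univ]
    simp
  have hpow : ∀ n : ℕ, (2 : ℝ≥0∞) ^ (n : ℤ) = ((2 ^ n : ℕ) : ℝ≥0∞) := fun n => by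
    rw [zpow_natCast]; push_cast; rfl
  have hfinset : ∀ F : Finset ℕ, seqMeasure F = (F.card : ℝ≥0∞) := fun F => by
    rw [hcount, encard_coe_eq_coe_finsetCard]; simp
  refine ⟨measurable_of_countable _, ordConnected_Ici, ⟨0, le_refl (0 : ℤ)⟩, fun k hk => ?_,
    fun k hk => ?_, fun k hk => ?_, fun k hk => by rw [huniv]; exact le_top, fun A hA h => ?_,
    fun A B F hA hB hF hAB h1 h2 h3 => ?_, fun G w L ε hG hGfin hw hw0 hL hε => ?_⟩
  · lift k to ℕ using hk
    -- Positions are `i + 1`, so block `k` consists of the indices from `2 ^ k - 1` to `2 ^ (k + 1)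
    -- - 2`.
    have e : (fun i : ℕ => Int.log 2 ((i : ℝ) + 1)) ⁻¹' {(k : ℤ)} =
        (Finset.Ico (2 ^ k - 1) (2 ^ (k + 1) - 1) : Finset ℕ) := by
      ext i
      rw [mem_preimage, mem_singleton_iff, log_two_add_one, Finset.mem_coe, Finset.mem_Ico,
        Nat.cast_inj, Nat.log_eq_iff (Or.inr ⟨one_lt_two, Nat.succ_ne_zero i⟩)]
      omega
    rw [e, hfinset, hpow, Nat.card_Ico]
    congr 1
    have : 2 ^ (k + 1) = 2 * 2 ^ k := by ring
    have := Nat.one_le_two_pow (n := k)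
    omega
  · convert measure_empty (μ := seqMeasure) using 2
    refine eq_empty_of_forall_notMem fun i hi => hk ?_
    rw [mem_preimage, mem_singleton_iff, log_two_add_one] at hi
    rw [← hi]
    exact Int.natCast_nonneg _
  · lift k to ℕ using hk
    have e : {i : ℕ | Int.log 2 ((i : ℝ) + 1) < k} ⊆ (Finset.range (2 ^ k) : Finset ℕ) := by
      intro i hi
      rw [mem_ofPred_eq, log_two_add_one, Nat.cast_lt] at hi
      have := Nat.lt_pow_of_log_lt one_lt_two hi
      simp only [Finset.coe_range, mem_Iio]
      omega
    refine (measure_mono e).trans ?_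
    rw [hfinset, hpow, Finset.card_range]
  · by_contra hne
    have h0 := h 0 (le_refl (0 : ℤ))
    obtain ⟨i, hi⟩ : A.Nonempty := nonempty_of_measure_ne_zero hne
    have h1 := measure_mono (μ := seqMeasure) (singleton_subset_iff.2 hi)
    rw [Measure.count_singleton] at h1
    rw [zpow_zero] at h0
    exact absurd h0 (not_lt.2 h1)
  · rw [hcount, hcount] at h1 h2
    obtain ⟨C, hAC, hCB, hC⟩ := exists_superset_subset_encard_eq hAB
      (by exact_mod_cast h1) (by exact_mod_cast h2 : F.encard ≤ B.encard)
    exact ⟨C, MeasurableSet.of_discrete, hAC, hCB, by rw [hcount, hcount, hC]⟩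
  · have hfin : G.Finite := by
      rw [Measure.count_apply_lt_top] at hGfin
      exact hGfin
    lift G to Finset ℕ using hfin
    have hint : ∫ s in (G : Set ℕ), w s ∂seqMeasure = ∑ i ∈ G, w i := by
      rw [setIntegral_finset G (Measure.integrableOn_of_bounded (M := L) hGfin.ne
          hw.aestronglyMeasurable (Eventually.of_forall fun s => by
            rw [Real.norm_of_nonneg (hw0 s)]; exact hL s))]
      simp [Measure.real]
    rw [hint]
    rcases G.eq_empty_or_nonempty with rfl | hne
    · refine ⟨0, fun _ => ∅, fun _ => 0, by simp, fun l l' _ => disjoint_bot_left, by simp,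
        by simp, by simp, by simp, by simpa using hε.le⟩
    · obtain ⟨n, hn⟩ : ∃ n, G.card = n + 1 := Nat.exists_eq_succ_of_ne_zero hne.card_pos.ne'
      let o := G.orderIsoOfFin hn
      refine ⟨n, fun l => {(o l : ℕ)}, fun l => w (o l), fun _ => MeasurableSet.of_discrete,
        fun l l' hl => ?_, ?_, fun l l' => by simp, fun l => hw0 _, fun l s hs => ?_, ?_⟩
      · exact disjoint_singleton.2 fun h => hl (o.injective (Subtype.ext h))
      · ext i
        simp only [mem_iUnion, mem_singleton_iff, Finset.mem_coe]
        refine ⟨fun ⟨l, hl⟩ => hl ▸ (o l).2, fun hi => ⟨o.symm ⟨i, hi⟩, by simp⟩⟩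
      · rw [mem_singleton_iff.1 hs]
      · have : ∑ l, w (o l) = ∑ i ∈ G, w i := by
          rw [← Finset.sum_coe_sort G]
          exact Fintype.sum_equiv o.toEquiv _ _ fun _ => rfl
        simp only [Measure.count_singleton, ENNReal.toReal_one, mul_one, this]
        linarith

end Counting

/-! ### Calderón couples and the right-shift property -/

section Main

variable {Ω : Type*} [MeasurableSpace Ω] {μ : Measure Ω} {X Y : KotheSpace μ}

theorem IsUniformCalderonCouple.isCalderonCouple (h : IsUniformCalderonCouple X Y) :
    IsCalderonCouple X Y := by
  obtain ⟨C, hC⟩ := h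
  intro f g hfg
  obtain ⟨T, h1, h2, h3⟩ := hC f g hfg
  exact ⟨T, h1.trans_lt ENNReal.coe_lt_top, h2.trans_lt ENNReal.coe_lt_top, h3⟩

/-- Interchanging the two spaces amounts to replacing `t` by `1 / t`. Domination for all `t` is
therefore symmetric in the couple, and the order of the spaces in the case of sequences is
immaterial. -/
theorem mul_kFunctional_inv {t : ℝ≥0} (ht : 0 < t) (f : Ω →ₘ[μ] ℝ) :
    t * kFunctional X Y t⁻¹ f = kFunctional Y X t f := by
  have h0 : (t : ℝ≥0∞) ≠ 0 := by exact_mod_cast ht.ne'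
  have h1 : (t : ℝ≥0∞) * ((t⁻¹ : ℝ≥0) : ℝ≥0∞) = 1 := by
    rw [← ENNReal.coe_mul, mul_inv_cancel₀ ht.ne', ENNReal.coe_one]
  simp only [kFunctional, ENNReal.mul_iInf_of_ne h0 ENNReal.coe_ne_top, mul_add, ← mul_assoc, h1,
    one_mul]
  rw [iInf_comm]
  refine iInf_congr fun y => iInf_congr fun x => ?_
  rw [add_comm x y, add_comm (_ * _)]

theorem kFunctional_le_of_swap {f g : Ω →ₘ[μ] ℝ}
    (h : ∀ t : ℝ≥0, 0 < t → kFunctional Y X t f ≤ kFunctional Y X t g) (t : ℝ≥0) (ht : 0 < t) :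
    kFunctional X Y t f ≤ kFunctional X Y t g := by
  rw [← mul_kFunctional_inv ht, ← mul_kFunctional_inv ht]
  gcongr
  exact h _ (inv_pos.2 ht)

theorem IsCalderonCouple.swap (h : IsCalderonCouple X Y) : IsCalderonCouple Y X := by
  unfold IsCalderonCouple at h ⊢
  rw [sumSpace, sup_comm, ← sumSpace]
  intro f g hfg
  obtain ⟨T, h1, h2, h3⟩ := h f g (kFunctional_le_of_swap hfg)
  exact ⟨T, h2, h1, h3⟩

theorem IsUniformCalderonCouple.swap (h : IsUniformCalderonCouple X Y) :
    IsUniformCalderonCouple Y X := by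
  unfold IsUniformCalderonCouple at h ⊢
  obtain ⟨C, hC⟩ := h
  refine ⟨C, ?_⟩
  rw [sumSpace, sup_comm, ← sumSpace]
  intro f g hfg
  obtain ⟨T, h1, h2, h3⟩ := hC f g (kFunctional_le_of_swap hfg)
  exact ⟨T, h2, h1, h3⟩

/-- The right-shift property gives uniform operators, uniform couples are Calderón couples, and
these already force the right-shift property; the cycle yields both equivalences. -/
theorem DyadicModel.isCalderonCouple_iff [SigmaFinite μ] {κ : Ω → ℤ} {J : Set ℤ}
    (M : DyadicModel μ κ J) (hX : X.IsRearrangementInvariant) {c : Ω → ℝ} (hc : Measurable c)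
    (hκ : ∀ s, κ s = Int.log 2 (c s)) (hpos : ∀ᵐ s ∂μ, 0 < c s) :
    (IsCalderonCouple X (linfty μ) ↔ HasRSP (dyadicNorm X c hc J)) ∧
      (IsUniformCalderonCouple X (linfty μ) ↔ HasRSP (dyadicNorm X c hc J)) := by
  have h1 : HasRSP (dyadicNorm X c hc J) → IsUniformCalderonCouple X (linfty μ) := fun h => by
    obtain ⟨C, hC⟩ := M.rightShift_of_hasRSP hc hκ hpos h
    exact M.isUniformCalderonCouple hX hC
  have h2 : IsCalderonCouple X (linfty μ) → HasRSP (dyadicNorm X c hc J) := fun h => by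
    obtain ⟨C, hC⟩ := M.rightShift_of_isCalderonCouple hX h
    exact M.hasRSP_of_rightShift hc hκ hpos hC
  exact ⟨⟨h2, fun h => (h1 h).isCalderonCouple⟩, fun h => h2 h.isCalderonCouple, h1⟩

end Main

end CalderonCouples

end


theorem theorem5p4 :
    (∀ X : KotheSpace unitMeasure, X.IsRearrangementInvariant →
      (IsCalderonCouple X (linfty unitMeasure) ↔ StretchableUnit X) ∧
      (IsUniformCalderonCouple X (linfty unitMeasure) ↔ StretchableUnit X)) ∧
    (∀ X : KotheSpace halfLineMeasure, X.IsRearrangementInvariant →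
      (IsCalderonCouple X (linfty halfLineMeasure) ↔ StretchableHalfLine X) ∧
      (IsUniformCalderonCouple X (linfty halfLineMeasure) ↔ StretchableHalfLine X)) ∧
    (∀ X : KotheSpace seqMeasure, X.IsRearrangementInvariant →
      (IsCalderonCouple (linfty seqMeasure) X ↔ StretchableSeq X) ∧
      (IsUniformCalderonCouple (linfty seqMeasure) X ↔ StretchableSeq X)) := by
  refine ⟨fun X hX => ?_, fun X hX => ?_, fun X hX => ?_⟩
  · exact dyadicModel_unit.isCalderonCouple_iff hX measurable_id (fun _ => rfl)
      (ae_restrict_pos measurableSet_Icc fun x hx => hx.1)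
  · exact dyadicModel_halfLine.isCalderonCouple_iff hX measurable_id (fun _ => rfl)
      (ae_restrict_pos measurableSet_Ici Set.Subset.rfl)
  · obtain ⟨h1, h2⟩ := dyadicModel_seq.isCalderonCouple_iff hX (measurable_of_countable _)
      (fun _ => rfl) (Filter.Eventually.of_forall fun i => by positivity)
    exact ⟨⟨fun h => h1.1 h.swap, fun h => (h1.2 h).swap⟩,
      ⟨fun h => h2.1 h.swap, fun h => (h2.2 h).swap⟩⟩
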